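/- Let $\alpha>0$ be a real number that is not an integer, and let $k$ be the lowest integer with $k>\frac{1+\alpha}{2}$. There are real numbers $c_0,\dots,c_{k-1}$, depending only on $\alpha$, such that the following holds for every $n\ge 1$, every smooth cutoff $\chi:\mathbb R\to\mathbb R$ with $\chi=1$ on $y<1$ and $\chi=0$ on $y>2$, and every real-valued $f\in C_c^\infty(\mathbb R^n)$. Notation. Write points of $\mathbb R^n$ as $(t,x)\in\mathbb R\times\mathbb R^{n-1}$, points of the half-space $\mathbb R^n_+$ as $(x,y)\in\mathbb R^{n-1}\times(0,\infty)$, and $\Box=\partial_{tt}-\Delta_x$. Let $L^2_\alpha=L^2(\mathbb R^n_+,y^{1-2\alpha}dx\,dy)$, and let $\dot H^1_\alpha$ be the closure of the functions in $C_c^\infty(\overline{\mathbb R^n_+})$ of finite norm with respect to $\|v\|_{\dot H^1_\alpha}^2=\int_{\mathbb R^n_+}(|\nabla_xv|^2+(\partial_yv)^2)\,y^{1-2\alpha}dx\,dy$, its elements being realised as locally integrable functions on $\mathbb R^n_+$. Let $\mathcal E=L^2_{\rm loc}(\mathbb R,\dot H^1_\alpha)\cap H^1_{\rm loc}(\mathbb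 R,L^2_\alpha)$, and let $\mathcal X$ be the set of all functions $\sum_{j=0}^{k-1}y^{2j}\chi(y)b_j(t,x)+w(t,x,y)$ with $b_j\in C_c^\infty(\mathbb R^n)$ and $w\in\mathcal E$. A solution of the problem $$u_{tt}-\Delta_xu-u_{yy}-\frac{1-2\alpha}{y}u_y=0\ \text{ in } y>0,\qquad u(t,x,0)=f(t,x),\qquad u(-\infty,x,y)=u_t(-\infty,x,y)=0 \qquad (\ast)$$ is a function $u\in\mathcal X$ that satisfies the equation in the sense of distributions in $\{y>0\}$, the boundary condition in the trace sense $$\lim_{\varepsilon\to0^+}\frac1\varepsilon\int_0^\varepsilon\!\int_K|u(t,x,y)-f(t,x)|\,dt\,dx\,dy=0\quad\text{for all compact }K\subset\mathbb R^n,$$ and the initial condition in the sense that $\|u(t,\cdot)\|_{\dot H^1_\alpha}\to0$ and $\|u_t(t,\cdot)\|_{L^2_\alpha}\to0$ as $t\to-\infty$ (up to a null set of times). Claim. There is a function $v\in L^\infty(\mathbb R,\dot H^1_\alpha)$ such that $$u(t,x,y)=\sum_{j=0}^{k-1}c_j\,y^{2j}\chi(y)\,\Box^jf(t,x)+v(t,x,y)$$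 is a solution of $(\ast)$. It is the unique solution of $(\ast)$ (up to almost everywhere equality), and it vanishes almost everywhere in $\{t<t_0\}$ for every $t_0$ such that $f=0$ for $t<t_0$. -/

import Mathlib

open MeasureTheory Set Filter Topology
open scoped ContDiff ENNReal NNReal

noncomputable section

namespace AdSWave

/-- Points `x` of `ℝ^d`, where `d = n - 1`. The boundary is `ℝ^n = ℝ_t × ℝ^d_x`. -/
abbrev Space (d : ℕ) : Type := EuclideanSpace ℝ (Fin d)

/-- The open half-space `ℝ^n_+` of points `(x, y)` with `y > 0`. -/
def halfSpace (d : ℕ) : Set (Space d × ℝ) := {z | 0 < z.2}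

/-- The open space-time domain of points `(t, x, y)` with `y > 0`. -/
def bulk (d : ℕ) : Set (ℝ × Space d × ℝ) := {p | 0 < p.2.2}

/-- The measure `y^{1-2α} dx dy` on the half-space, so that `L²_α` is `L²` of this measure. -/
def wMeasure (d : ℕ) (α : ℝ) : Measure (Space d × ℝ) :=
  (volume.restrict (halfSpace d)).withDensity (fun z => ENNReal.ofReal (z.2 ^ (1 - 2 * α)))

/-- The measure `y^{1-2α} dt dx dy` on the space-time domain. -/
def bulkMeasure (d : ℕ) (α : ℝ) : Measure (ℝ × Space d × ℝ) :=
  (volume : Measure ℝ).prod (wMeasure d α)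

/-- The measure `y^{1-2α} dt dx dy` on the time slab `a ≤ t ≤ b`. -/
def slabMeasure (d : ℕ) (α a b : ℝ) : Measure (ℝ × Space d × ℝ) :=
  ((volume : Measure ℝ).restrict (Icc a b)).prod (wMeasure d α)

/-- The flat wave operator `□ f = f_tt - Δ_x f` on `ℝ^n = ℝ_t × ℝ^d_x`. -/
def box {d : ℕ} (f : ℝ × Space d → ℝ) : ℝ × Space d → ℝ := fun q =>
  iteratedDeriv 2 (fun s => f (s, q.2)) q.1 -
    Laplacian.laplacian (fun x : Space d => f (q.1, x)) q.2

/-- The operator `P u = u_tt - Δ_x u - u_yy - ((1 - 2α) / y) u_y`. -/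
def waveOp {d : ℕ} (α : ℝ) (u : ℝ × Space d × ℝ → ℝ) : ℝ × Space d × ℝ → ℝ := fun p =>
  iteratedDeriv 2 (fun s => u (s, p.2.1, p.2.2)) p.1 -
    Laplacian.laplacian (fun x : Space d => u (p.1, x, p.2.2)) p.2.1 -
    iteratedDeriv 2 (fun y => u (p.1, p.2.1, y)) p.2.2 -
    (1 - 2 * α) / p.2.2 * deriv (fun y => u (p.1, p.2.1, y)) p.2.2

/-- Test functions: smooth functions with compact support contained in `{y > 0}`. -/
def IsTest {d : ℕ} (φ : ℝ × Space d × ℝ → ℝ) : Prop :=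
  ContDiff ℝ ∞ φ ∧ HasCompactSupport φ ∧ tsupport φ ⊆ bulk d

/-- `u` is a distributional solution of `P u = 0` in `{y > 0}`. The operator `P` is formally
symmetric with respect to `y^{1-2α} dt dx dy`, because
`u_yy + ((1 - 2α) / y) u_y = y^{2α-1} ∂_y (y^{1-2α} u_y)`, and multiplication by `y^{1-2α}` is a
bijection of the space of test functions; hence this is the usual notion. -/
def IsWeakSol {d : ℕ} (α : ℝ) (u : ℝ × Space d × ℝ → ℝ) : Prop :=
  LocallyIntegrableOn u (bulk d) volume ∧
    ∀ φ : ℝ × Space d × ℝ → ℝ, IsTest φ → ∫ p, u p * waveOp α φ p ∂(bulkMeasure d α) = 0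

/-- `g` is the weak derivative of `u` with respect to `t` in `{y > 0}`. -/
def IsWeakTimeDeriv {d : ℕ} (α : ℝ) (u g : ℝ × Space d × ℝ → ℝ) : Prop :=
  LocallyIntegrableOn u (bulk d) volume ∧ LocallyIntegrableOn g (bulk d) volume ∧
    ∀ φ : ℝ × Space d × ℝ → ℝ, IsTest φ →
      ∫ p, u p * deriv (fun s => φ (s, p.2)) p.1 ∂(bulkMeasure d α) =
        -∫ p, g p * φ p ∂(bulkMeasure d α)

/-- Values of gradients `(∇_x v, ∂_y v)`, with the Euclidean norm. -/
abbrev Grad (d : ℕ) : Type := WithLp 2 (Space d × ℝ)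

/-- The gradient `(∇_x φ, ∂_y φ)` of a differentiable function of `(x, y)`. -/
def grad {d : ℕ} (φ : Space d × ℝ → ℝ) : Space d × ℝ → Grad d := fun z =>
  WithLp.toLp 2 (gradient (fun x => φ (x, z.2)) z.1, deriv (fun y => φ (z.1, y)) z.2)

/-- `v` belongs to `Ḣ¹_α`, and its gradient is `G`. The space `Ḣ¹_α` is the closure, with respect
to the norm `‖v‖² = ∫ |∇ v|² y^{1-2α} dx dy`, of the smooth functions with compact support in the
closed half-space (restrictions to it of smooth compactly supported functions on `ℝ^d × ℝ`)
for which the norm is finite. As usual the limits are realised as locally integrable functions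
on the open half-space. The norm of `v` is then the `L²_α` norm of `G`. -/
def HasHomGrad {d : ℕ} (α : ℝ) (v : Space d × ℝ → ℝ) (G : Space d × ℝ → Grad d) : Prop :=
  LocallyIntegrableOn v (halfSpace d) volume ∧ MemLp G 2 (wMeasure d α) ∧
    ∃ φ : ℕ → Space d × ℝ → ℝ,
      (∀ m, ContDiff ℝ ∞ (φ m) ∧ HasCompactSupport (φ m)) ∧
      Tendsto (fun m => eLpNorm (fun z => grad (φ m) z - G z) 2 (wMeasure d α)) atTop (𝓝 0) ∧
      ∀ K : Set (Space d × ℝ), IsCompact K → K ⊆ halfSpace d →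
        Tendsto (fun m => ∫⁻ z in K, ‖φ m z - v z‖ₑ) atTop (𝓝 0)

/-- `v ∈ L^∞(ℝ, Ḣ¹_α)`. -/
def MemLInftyHom {d : ℕ} (α : ℝ) (v : ℝ × Space d × ℝ → ℝ) : Prop :=
  AEStronglyMeasurable v (bulkMeasure d α) ∧
    ∃ G : ℝ × Space d × ℝ → Grad d, AEStronglyMeasurable G (bulkMeasure d α) ∧
      ∃ C : ℝ≥0, ∀ᵐ t : ℝ, HasHomGrad α (fun z => v (t, z)) (fun z => G (t, z)) ∧
        eLpNorm (fun z => G (t, z)) 2 (wMeasure d α) ≤ C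

/-- `v ∈ L²_loc(ℝ, Ḣ¹_α)`. -/
def MemL2LocHom {d : ℕ} (α : ℝ) (v : ℝ × Space d × ℝ → ℝ) : Prop :=
  AEStronglyMeasurable v (bulkMeasure d α) ∧
    ∃ G : ℝ × Space d × ℝ → Grad d,
      (∀ᵐ t : ℝ, HasHomGrad α (fun z => v (t, z)) (fun z => G (t, z))) ∧
      ∀ a b : ℝ, MemLp G 2 (slabMeasure d α a b)

/-- `v ∈ H¹_loc(ℝ, L²_α)`. -/
def MemH1LocL2 {d : ℕ} (α : ℝ) (v : ℝ × Space d × ℝ → ℝ) : Prop :=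
  ∃ g : ℝ × Space d × ℝ → ℝ, IsWeakTimeDeriv α v g ∧
    ∀ a b : ℝ, MemLp v 2 (slabMeasure d α a b) ∧ MemLp g 2 (slabMeasure d α a b)

/-- The finite sum `∑_{j<k} y^{2j} χ(y) b_j(t,x)`. -/
def expansion {d : ℕ} (k : ℕ) (χ : ℝ → ℝ) (b : ℕ → ℝ × Space d → ℝ) :
    ℝ × Space d × ℝ → ℝ := fun p =>
  ∑ j ∈ Finset.range k, p.2.2 ^ (2 * j) * χ p.2.2 * b j (p.1, p.2.1)

/-- The class of functions in which the problem is posed: `u` is the sum of a finite expansion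
`∑_{j<k} y^{2j} χ(y) b_j(t,x)`, with some `b_j ∈ C_c^∞(ℝ^n)`, and of a function in
`L²_loc(ℝ, Ḣ¹_α) ∩ H¹_loc(ℝ, L²_α)`. The first term is only needed for `α > 1`, where nonzero
boundary values are incompatible with finite energy. -/
def IsAdmissible {d : ℕ} (α : ℝ) (k : ℕ) (χ : ℝ → ℝ) (u : ℝ × Space d × ℝ → ℝ) : Prop :=
  ∃ b : ℕ → ℝ × Space d → ℝ, (∀ j, ContDiff ℝ ∞ (b j) ∧ HasCompactSupport (b j)) ∧
    MemL2LocHom α (fun p => u p - expansion k χ b p) ∧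
    MemH1LocL2 α (fun p => u p - expansion k χ b p)

/-- The boundary condition `u(t,x,0) = f(t,x)` in the sense of traces: the averages of `|u - f|`
over `K × (0, ε)` tend to zero with `ε`, for every compact set `K` of points `(t,x)`. -/
def HasBoundaryValue {d : ℕ} (u : ℝ × Space d × ℝ → ℝ) (f : ℝ × Space d → ℝ) : Prop :=
  ∀ K : Set (ℝ × Space d), IsCompact K →
    Tendsto (fun ε : ℝ => (ENNReal.ofReal ε)⁻¹ *
        ∫⁻ p in {p : ℝ × Space d × ℝ | (p.1, p.2.1) ∈ K ∧ p.2.2 ∈ Ioo 0 ε},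
          ‖u p - f (p.1, p.2.1)‖ₑ)
      (𝓝[>] 0) (𝓝 0)

/-- Trivial initial data `u(-∞) = u_t(-∞) = 0`: as `t → -∞`, `u(t)` tends to zero in `Ḣ¹_α` and
`u_t(t)` tends to zero in `L²_α`. -/
def HasTrivialData {d : ℕ} (α : ℝ) (u : ℝ × Space d × ℝ → ℝ) : Prop :=
  ∃ g : ℝ × Space d × ℝ → ℝ, IsWeakTimeDeriv α u g ∧
    ∀ ε : ℝ≥0, 0 < ε → ∃ T : ℝ, ∀ᵐ t : ℝ, t < T →
      (∃ G : Space d × ℝ → Grad d, HasHomGrad α (fun z => u (t, z)) G ∧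
        eLpNorm G 2 (wMeasure d α) ≤ ε) ∧
      eLpNorm (fun z => g (t, z)) 2 (wMeasure d α) ≤ ε

/-- `u` solves `P u = 0` in `{y > 0}` with `u(t,x,0) = f(t,x)` and `u(-∞) = u_t(-∞) = 0`. -/
structure IsSolution {d : ℕ} (α : ℝ) (k : ℕ) (χ : ℝ → ℝ) (f : ℝ × Space d → ℝ)
    (u : ℝ × Space d × ℝ → ℝ) : Prop where
  admissible : IsAdmissible α k χ u
  equation : IsWeakSol α u
  boundary : HasBoundaryValue u f
  initial : HasTrivialData α u

end AdSWave

end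

/-!
The solution is the sum of an explicit expansion at the boundary and a remainder of finite energy,
and a solution with zero boundary value has finite energy, which is conserved and hence zero.

*Existence.* The coefficients `coeff α j` are determined recursively by the requirement that
`∑ j, c_j y^(2j) □^j f` solve the equation up to a multiple of `y^(2k-2) □^k f`; the recursion
divides by `4 j (j - α)`, which is nonzero since `α` is not an integer. The error belongs to
`L²_α` because `k > (1 + α) / 2`, and the cutoff only adds terms supported in `1 ≤ y ≤ 2`. The
remainder is then the solution of an inhomogeneous wave equation in the closure of the test
functions of the open half-space (`energySpace`), with a source that is a smooth compactly
supported curve in `L²_α`. It exists by the abstract result `exists_wave_solution`: for a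
contraction `J : V → K` of Hilbert spaces, the equation is written with `J J†`, which is
regularised to an invertible operator, and the energy estimates are uniform in the regularisation.
Hardy's inequality, `hardy_of_mem_energySpace`, makes the remainder divided by `y`
square-integrable, so that its trace vanishes (`exists_solution`).

*Uniqueness.* The difference `z` of two solutions is again an expansion, with coefficients `b_j`,
plus a function `w` of finite energy, and all `b_j` with `2j < α` vanish if `α > 1`. For `b_0` this
is a statement about traces: `w / y` is in `L²_{α-1}` and therefore integrable near the boundary, so
`w` has trace zero (`coeff_zero_eq_zero`). For the next ones, the equation is tested with functions
concentrated at the distance `ε` from the boundary, where the first nonzero term of the expansion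
dominates the contribution `O(ε^(-α))` of `w` (`coeff_succ_eq_zero`). The remaining terms have
finite energy, so `z` has finite energy as well.

Averages of `z` in time have a weak gradient and trace zero, so they are the primitives of their
normal derivative, and cutting off near the boundary and mollifying shows that they belong to
`energySpace` (`mem_energySpace_of_hasZeroTrace`). They may therefore be used as test functions,
which gives conservation of their energy (`energy_avgLp_eq`). As the energy tends to zero in the
past, the averages have zero gradient, and Hardy's inequality yields `z = 0`
(`ae_eq_zero_of_isWeakSol`, `IsSolution.unique`).
-/

namespace AdSWave

/-! ### An abstract wave equation in Hilbert space -/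

section AbstractWave

open ContinuousLinearMap
open scoped RealInnerProductSpace

theorem contDiff_of_hasDerivAt_seq {X : Type*} [NormedAddCommGroup X] [NormedSpace ℝ X]
    {g : ℕ → ℝ → X} (hg : ∀ j t, HasDerivAt (g j) (g (j + 1) t) t) (j : ℕ) :
    ContDiff ℝ ∞ (g j) := by
  have hd : ∀ j, deriv (g j) = g (j + 1) := fun j => funext fun t => (hg j t).deriv
  rw [contDiff_infty]
  intro n
  induction n generalizing j with
  | zero =>
    exact contDiff_zero.2 (continuous_iff_continuousAt.2 fun t => (hg j t).continuousAt)
  | succ n ih =>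
    rw [Nat.cast_add_one]
    refine contDiff_succ_iff_deriv.2 ⟨fun t => (hg j t).differentiableAt, by simp, ?_⟩
    rw [hd]
    exact ih (j + 1)

theorem iterate_deriv_eq_zero {X : Type*} [NormedAddCommGroup X] [NormedSpace ℝ X]
    {f : ℝ → X} {t₀ : ℝ} (hf : ∀ t < t₀, f t = 0) (j : ℕ) : ∀ t < t₀, deriv^[j] f t = 0 := by
  induction j with
  | zero => simpa using hf
  | succ j ih =>
    intro t ht
    rw [Function.iterate_succ_apply']
    have : deriv^[j] f =ᶠ[𝓝 t] fun _ => 0 := by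
      filter_upwards [Iio_mem_nhds ht] with s hs using ih s hs
    rw [this.deriv_eq]
    simp

theorem hasCompactSupport_iterate_deriv {X : Type*} [NormedAddCommGroup X] [NormedSpace ℝ X]
    {f : ℝ → X} (hf : HasCompactSupport f) (j : ℕ) : HasCompactSupport (deriv^[j] f) := by
  induction j with
  | zero => exact hf
  | succ j ih =>
    rw [Function.iterate_succ_apply']
    exact ih.deriv

theorem hasDerivAt_iterate_deriv {X : Type*} [NormedAddCommGroup X] [NormedSpace ℝ X]
    {f : ℝ → X} (hf : ContDiff ℝ ∞ f) (j : ℕ) (t : ℝ) :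
    HasDerivAt (deriv^[j] f) (deriv^[j + 1] f t) t := by
  rw [Function.iterate_succ_apply']
  exact ((hf.iterate_deriv j).differentiable (by simp) t).hasDerivAt

/-- Inhomogeneous linear ordinary differential equations with a bounded operator, by the
variation of constants formula. -/
theorem exists_linear_ode {X : Type*} [NormedAddCommGroup X] [NormedSpace ℝ X] [CompleteSpace X]
    (M : X →L[ℝ] X) {H : ℝ → X} (hH : ContDiff ℝ ∞ H) {a : ℝ} (ha : ∀ t ≤ a, H t = 0) :
    ∃ U : ℝ → X, ContDiff ℝ ∞ U ∧ (∀ t, HasDerivAt U (M (U t) + H t) t) ∧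
      ∀ t₀, (∀ t < t₀, H t = 0) → ∀ t < t₀, U t = 0 := by
  have hexp : ∀ t : ℝ, HasDerivAt (fun u : ℝ => NormedSpace.exp (u • M))
      (M * NormedSpace.exp (t • M)) t := fun t => hasDerivAt_exp_smul_const' M t
  have hexpn : ∀ t : ℝ, NormedSpace.exp (t • M) * NormedSpace.exp (-t • M) = 1 := by
    intro t
    let _ : NormedAlgebra ℚ (X →L[ℝ] X) := NormedAlgebra.restrictScalars ℚ ℝ _
    rw [← NormedSpace.exp_add_of_commute]
    · simp
    · exact ((Commute.refl M).smul_left t).smul_right (-t)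
  have hcexp : Continuous fun u : ℝ => NormedSpace.exp (u • M) :=
    continuous_iff_continuousAt.2 fun t => (hexp t).continuousAt
  have hcI : Continuous fun s : ℝ => (NormedSpace.exp (-s • M)) (H s) :=
    (hcexp.comp continuous_neg).clm_apply hH.continuous
  let I : ℝ → X := fun t => ∫ s in a..t, (NormedSpace.exp (-s • M)) (H s)
  have hI : ∀ t, HasDerivAt I ((NormedSpace.exp (-t • M)) (H t)) t := fun t =>
    intervalIntegral.integral_hasDerivAt_right (hcI.intervalIntegrable _ _)
      hcI.aestronglyMeasurable.stronglyMeasurableAtFilter hcI.continuousAt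
  let U : ℝ → X := fun t => (NormedSpace.exp (t • M)) (I t)
  have hU : ∀ t, HasDerivAt U (M (U t) + H t) t := by
    intro t
    have h := (hexp t).clm_apply (hI t)
    have e : (NormedSpace.exp (t • M)) ((NormedSpace.exp (-t • M)) (H t)) = H t := by
      have := congrArg (fun T : X →L[ℝ] X => T (H t)) (hexpn t)
      simpa using this
    rw [e] at h
    exact h
  refine ⟨U, ?_, hU, ?_⟩
  -- smoothness: the equation gains one derivative at each step
  · have hd : deriv U = fun t => M (U t) + H t := funext fun t => (hU t).deriv
    rw [contDiff_infty]
    intro n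
    induction n with
    | zero => exact contDiff_zero.2 (continuous_iff_continuousAt.2 fun t => (hU t).continuousAt)
    | succ n ih =>
      rw [Nat.cast_add_one]
      refine contDiff_succ_iff_deriv.2 ⟨fun t => (hU t).differentiableAt, by simp, ?_⟩
      rw [hd]
      exact (M.contDiff.comp ih).add (hH.of_le (by exact_mod_cast le_top))
  · intro t₀ h0 t ht
    have : I t = 0 := by
      refine (intervalIntegral.integral_congr fun s hs => ?_).trans
        (intervalIntegral.integral_zero (a := a) (b := t) (μ := volume))
      have : H s = 0 := by
        rcases le_total a t with hat | hat
        · rw [uIcc_of_le hat] at hs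
          exact h0 s (hs.2.trans_lt ht)
        · rw [uIcc_of_ge hat] at hs
          exact ha s hs.2
      simp [this]
    simp [U, this]

variable {V K : Type*} [NormedAddCommGroup V] [InnerProductSpace ℝ V] [CompleteSpace V]
  [NormedAddCommGroup K] [InnerProductSpace ℝ K] [CompleteSpace K]

theorem norm_adjoint_apply_le {J : V →L[ℝ] K} (hJ : ∀ x, ‖J x‖ ≤ ‖x‖) (x : K) :
    ‖adjoint J x‖ ≤ ‖x‖ := by
  have h1 : ‖adjoint J‖ ≤ 1 := by
    rw [LinearIsometryEquiv.norm_map]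
    exact J.opNorm_le_bound zero_le_one (by simpa using hJ)
  simpa using (adjoint J).le_of_opNorm_le h1 x

/-- The wave equation `J J† v_tt + v = J J† (F + v)`, in which the operator `J J†` in front of the
second derivative is made invertible by adding `ε`. -/
theorem exists_regularized_wave (J : V →L[ℝ] K) {ε : ℝ} (hε : 0 < ε) {F : ℝ → K}
    (hF : ContDiff ℝ ∞ F) {a : ℝ} (ha : ∀ t ≤ a, F t = 0) :
    ∃ v : ℝ → K, ContDiff ℝ ∞ v ∧
      (∀ t, J (adjoint J (deriv (deriv v) t)) + ε • deriv (deriv v) t + v t =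
        J (adjoint J (v t)) + J (adjoint J (F t))) ∧
      ∀ t₀, (∀ t < t₀, F t = 0) → ∀ t < t₀, v t = 0 := by
  let R : K →L[ℝ] K := J ∘L adjoint J
  let Re : K →L[ℝ] K := R + ε • ContinuousLinearMap.id ℝ K
  -- `J J† + ε` is coercive, hence invertible by the Lax–Milgram theorem
  have hco : IsCoercive ((innerSL ℝ).comp Re : K →L[ℝ] K →L[ℝ] ℝ) := by
    refine ⟨ε, hε, fun x => ?_⟩
    have h : ⟪J (adjoint J x), x⟫ = ‖adjoint J x‖ * ‖adjoint J x‖ := by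
      rw [← adjoint_inner_right, real_inner_self_eq_norm_mul_norm]
    simp only [ContinuousLinearMap.comp_apply, Re, R, add_apply, smul_apply,
      ContinuousLinearMap.id_apply, innerSL_apply_apply, inner_add_left, real_inner_smul_left,
      real_inner_self_eq_norm_mul_norm, h]
    nlinarith [mul_self_nonneg ‖adjoint J x‖]
  let T := hco.continuousLinearEquivOfBilin
  have hT : ∀ x, T x = Re x := by
    intro x
    refine ext_inner_right ℝ fun y => ?_
    rw [IsCoercive.continuousLinearEquivOfBilin_apply]
    simp
  let S : K →L[ℝ] K := T.symm
  have hS : ∀ x, J (adjoint J (S x)) + ε • S x = x := by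
    intro x
    have : Re (T.symm x) = x := by rw [← hT]; simp
    exact this
  -- the equation as a first-order system for `(v, v_t)`
  let M : K × K →L[ℝ] K × K :=
    (ContinuousLinearMap.snd ℝ K K).prod ((S ∘L (R - ContinuousLinearMap.id ℝ K)) ∘L
      ContinuousLinearMap.fst ℝ K K)
  let H : ℝ → K × K := fun t => (0, S (R (F t)))
  have hH : ContDiff ℝ ∞ H := contDiff_const.prodMk (S.contDiff.comp (R.contDiff.comp hF))
  obtain ⟨U, hU, hUd, hU0⟩ := exists_linear_ode M hH (a := a)
    (fun t ht => by simp [H, ha t ht])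
  have h1 : ∀ t, HasDerivAt (fun t => (U t).1) (U t).2 t := fun t => by
    exact ((ContinuousLinearMap.fst ℝ K K).hasFDerivAt.comp_hasDerivAt t (hUd t)).congr_deriv
      (by simp [M, H])
  have h2 : ∀ t, HasDerivAt (fun t => (U t).2) (S (R (U t).1 - (U t).1) + S (R (F t))) t :=
    fun t => by
      exact ((ContinuousLinearMap.snd ℝ K K).hasFDerivAt.comp_hasDerivAt t (hUd t)).congr_deriv
        (by simp [M, H])
  refine ⟨fun t => (U t).1, hU.fst, fun t => ?_, fun t₀ h t ht => ?_⟩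
  · have e1 : deriv (fun t => (U t).1) = fun t => (U t).2 := funext fun t => (h1 t).deriv
    rw [e1, (h2 t).deriv, ← map_add S, hS]
    simp only [R, coe_comp, Function.comp_apply]
    abel
  · simp [hU0 t₀ (fun s hs => by simp [H, h s hs]) t ht]

/-- Gronwall bound for the energy `‖J† w'‖² + ε ‖w'‖² + ‖w‖²`. -/
theorem regularized_energy_le {J : V →L[ℝ] K} (hJ : ∀ x, ‖J x‖ ≤ ‖x‖) {ε : ℝ} (hε : 0 ≤ ε)
    {w w₁ w₂ F g : ℝ → K} (h1 : ∀ t, HasDerivAt w (w₁ t) t) (h2 : ∀ t, HasDerivAt w₁ (w₂ t) t)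
    (heq : ∀ t, J (adjoint J (w₂ t)) + ε • w₂ t + w t =
        J (adjoint J (w t)) + J (adjoint J (F t)) + g t)
    {a T B : ℝ} (hw : w a = 0) (hw₁ : w₁ a = 0)
    (hB : ∀ t ∈ Icc a T, ‖F t‖ ^ 2 + 2 * ‖g t‖ * ‖w₁ t‖ ≤ B) :
    ∀ t ∈ Icc a T, ‖w t‖ ^ 2 ≤ gronwallBound 0 2 B (t - a) := by
  set N : ℝ → ℝ := fun t =>
    ⟪adjoint J (w₁ t), adjoint J (w₁ t)⟫ + ε * ⟪w₁ t, w₁ t⟫ + ⟪w t, w t⟫ with hN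
  have hd : ∀ t, HasDerivAt N
      (2 * ⟪adjoint J (w₂ t), adjoint J (w₁ t)⟫ + 2 * ε * ⟪w₂ t, w₁ t⟫ + 2 * ⟪w₁ t, w t⟫) t := by
    intro t
    have hj : HasDerivAt (fun t => adjoint J (w₁ t)) (adjoint J (w₂ t)) t :=
      (adjoint J).hasFDerivAt.comp_hasDerivAt t (h2 t)
    have := ((hj.inner ℝ hj).add (((h2 t).inner ℝ (h2 t)).const_mul ε)).add
      ((h1 t).inner ℝ (h1 t))
    refine this.congr_deriv ?_
    rw [real_inner_comm (adjoint J (w₁ t)), real_inner_comm (w₁ t) (w₂ t),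
      real_inner_comm (w t) (w₁ t)]
    ring
  have key : ∀ t ∈ Icc a T, N t ≤ gronwallBound 0 2 B (t - a) := by
    refine le_gronwallBound_of_liminf_deriv_right_le
      (f' := fun t => 2 * ⟪adjoint J (w₂ t), adjoint J (w₁ t)⟫ + 2 * ε * ⟪w₂ t, w₁ t⟫ +
        2 * ⟪w₁ t, w t⟫)
      (fun t _ => (hd t).continuousAt.continuousWithinAt) ?_ ?_ ?_
    · intro x _ r hr
      exact (hd x).hasDerivWithinAt.liminf_right_slope_le hr
    · simp [hN, hw, hw₁]
    · intro t ht
      -- pair the equation with `w₁`, then bound the products on the right by sums of squares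
      have h := congrArg (fun x => ⟪x, w₁ t⟫) (heq t)
      simp only [inner_add_left, real_inner_smul_left] at h
      have hadj : ∀ x y : K, ⟪J (adjoint J x), y⟫ = ⟪adjoint J x, adjoint J y⟫ := fun x y =>
        (adjoint_inner_right J _ _).symm
      rw [hadj, hadj, hadj] at h
      have hB' := hB t ⟨ht.1, ht.2.le⟩
      have i1 := real_inner_le_norm (adjoint J (w t)) (adjoint J (w₁ t))
      have i2 := real_inner_le_norm (adjoint J (F t)) (adjoint J (w₁ t))
      have i3 := real_inner_le_norm (g t) (w₁ t)
      have j1 := norm_adjoint_apply_le hJ (w t)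
      have j2 := norm_adjoint_apply_le hJ (F t)
      have n0 := norm_nonneg (adjoint J (w t))
      have n1 := norm_nonneg (adjoint J (F t))
      have n2 : 0 ≤ ε * ‖w₁ t‖ ^ 2 := by positivity
      have s1 : ‖adjoint J (w t)‖ ^ 2 ≤ ‖w t‖ ^ 2 := by gcongr
      have s2 : ‖adjoint J (F t)‖ ^ 2 ≤ ‖F t‖ ^ 2 := by gcongr
      simp only [hN, real_inner_self_eq_norm_sq]
      rw [real_inner_comm (w t) (w₁ t)]
      nlinarith [sq_nonneg (‖adjoint J (w t)‖ - ‖adjoint J (w₁ t)‖),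
        sq_nonneg (‖adjoint J (F t)‖ - ‖adjoint J (w₁ t)‖), sq_nonneg ‖w t‖]
  intro t ht
  refine le_trans ?_ (key t ht)
  simp only [hN, real_inner_self_eq_norm_sq]
  nlinarith [sq_nonneg ‖adjoint J (w₁ t)‖, mul_nonneg hε (sq_nonneg ‖w₁ t‖)]

theorem gronwallBound_zero_two (B x : ℝ) :
    gronwallBound 0 2 B x = B / 2 * (Real.exp (2 * x) - 1) := by
  rw [gronwallBound_of_K_ne_0 two_ne_zero]
  ring

/-- The abstract wave equation `(J u)_tt + A u = F` in weak form, where `A` is the operator of the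
form `⟪u, ψ⟫ - ⟪J u, J ψ⟫`. The potential energy `⟪A u, u⟫` is bounded uniformly in time. -/
theorem exists_wave_solution {J : V →L[ℝ] K} (hJ : ∀ x, ‖J x‖ ≤ ‖x‖) {F : ℝ → K}
    (hF : ContDiff ℝ ∞ F) (hFc : HasCompactSupport F) :
    ∃ u : ℝ → V, ContDiff ℝ ∞ u ∧
      (∀ t ψ, ⟪J (deriv (deriv u) t), J ψ⟫ + (⟪u t, ψ⟫ - ⟪J (u t), J ψ⟫) = ⟪F t, J ψ⟫) ∧
      (∃ C, ∀ t, ‖u t‖ ^ 2 - ‖J (u t)‖ ^ 2 ≤ C) ∧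
      ∀ t₀, (∀ t < t₀, F t = 0) → ∀ t < t₀, u t = 0 := by
  obtain ⟨r, hr⟩ := hFc.isCompact.isBounded.subset_closedBall 0
  have hFr : ∀ t, r < |t| → F t = 0 := by
    intro t ht
    by_contra h
    have := hr (subset_tsupport F h)
    rw [mem_closedBall_zero_iff, Real.norm_eq_abs] at this
    linarith
  set a : ℝ := -|r| - 1 with ha
  have hFa : ∀ t < a + 1, F t = 0 := by
    intro t ht
    refine hFr t ?_
    have := le_abs_self r
    have := neg_abs_le t
    rw [lt_abs]
    right
    linarith
  set ε : ℕ → ℝ := fun n => 1 / ((n : ℝ) + 1) with hε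
  have hε0 : ∀ n, 0 < ε n := fun n => Nat.one_div_pos_of_nat
  have hεlim : Tendsto ε atTop (𝓝 0) := tendsto_one_div_add_atTop_nhds_zero_nat
  choose v hv heq hv0 using fun n => exists_regularized_wave J (hε0 n) hF (a := a)
    (fun t ht => hFa t (by linarith))
  have hva : ∀ n j, ∀ t < a + 1, deriv^[j] (v n) t = 0 := fun n j =>
    iterate_deriv_eq_zero (hv0 n _ hFa) j
  have hdv : ∀ n j t, HasDerivAt (deriv^[j] (v n)) (deriv^[j + 1] (v n) t) t := fun n j t =>
    hasDerivAt_iterate_deriv (hv n) j t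
  have hdF : ∀ j t, HasDerivAt (deriv^[j] F) (deriv^[j + 1] F t) t := fun j t =>
    hasDerivAt_iterate_deriv hF j t
  set R : K →L[ℝ] K := J ∘L adjoint J with hR
  have heqj : ∀ n j t, R (deriv^[j + 2] (v n) t) + ε n • deriv^[j + 2] (v n) t +
      deriv^[j] (v n) t = R (deriv^[j] (v n) t) + R (deriv^[j] F t) := by
    intro n j
    induction j with
    | zero => exact heq n
    | succ j ih =>
      intro t
      have h1 := ((R.hasFDerivAt.comp_hasDerivAt t (hdv n (j + 2) t)).add
        ((hdv n (j + 2) t).const_smul (ε n))).add (hdv n j t)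
      have h2 := (R.hasFDerivAt.comp_hasDerivAt t (hdv n j t)).add
        (R.hasFDerivAt.comp_hasDerivAt t (hdF j t))
      refine h1.unique (h2.congr_of_eventuallyEq (Eventually.of_forall fun s => ?_))
      exact ih s
  -- all time derivatives of the regularised solutions solve equations of the same form, so the
  -- Gronwall estimate bounds them uniformly in `n`
  have hgb : ∀ j T, ∃ C, 0 ≤ C ∧ ∀ n, ∀ t < T, ‖deriv^[j] (v n) t‖ ≤ C := by
    intro j T
    obtain ⟨M, hM⟩ := (hasCompactSupport_iterate_deriv hFc j).exists_bound_of_continuous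
      (hF.iterate_deriv j).continuous
    have hM0 : 0 ≤ M := (norm_nonneg _).trans (hM 0)
    set B : ℝ := M ^ 2 / 2 * Real.exp (2 * (T - a)) with hB
    refine ⟨√B, Real.sqrt_nonneg _, fun n t ht => ?_⟩
    rcases lt_or_ge t a with hta | hta
    · rw [hva n j t (by linarith), norm_zero]
      exact Real.sqrt_nonneg _
    · refine Real.le_sqrt_of_sq_le ?_
      have := regularized_energy_le hJ (hε0 n).le (hdv n j) (hdv n (j + 1)) (F := deriv^[j] F)
        (g := fun _ => 0) (fun t => (heqj n j t).trans (add_zero _).symm) (a := a) (T := T) (B := M ^ 2)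
        (hva n j a (by linarith)) (hva n (j + 1) a (by linarith))
        (fun t _ => by simpa using pow_le_pow_left₀ (norm_nonneg _) (hM t) 2) t ⟨hta, ht.le⟩
      rw [gronwallBound_zero_two] at this
      refine this.trans (mul_le_mul_of_nonneg_left ?_ (by positivity))
      have : Real.exp (2 * (t - a)) ≤ Real.exp (2 * (T - a)) := by
        rw [Real.exp_le_exp]; linarith
      linarith
  -- the difference of the regularised solutions with indices `n` and `m` solves the equation of
  -- index `n` with the error `(ε m - ε n) • v_tt`, which is small by the uniform bounds
  have hCauchy : ∀ j T, UniformCauchySeqOn (fun n => deriv^[j] (v n)) atTop (Iio T) := by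
    intro j T
    obtain ⟨C₁, hC₁, hb₁⟩ := hgb (j + 1) (T + 1)
    obtain ⟨C₂, hC₂, hb₂⟩ := hgb (j + 2) (T + 1)
    have hdiff : ∀ n m, ∀ t < T, ‖deriv^[j] (v n) t - deriv^[j] (v m) t‖ ^ 2 ≤
        |ε n - ε m| * (2 * C₁ * C₂ * Real.exp (2 * (T - a))) := by
      intro n m t ht
      rcases lt_or_ge t a with hta | hta
      · rw [hva n j t (by linarith), hva m j t (by linarith)]
        rw [sub_self, norm_zero, zero_pow two_ne_zero]
        positivity
      · have := regularized_energy_le hJ (hε0 n).le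
          (w := fun t => deriv^[j] (v n) t - deriv^[j] (v m) t)
          (fun t => (hdv n j t).sub (hdv m j t))
          (fun t => (hdv n (j + 1) t).sub (hdv m (j + 1) t)) (F := fun _ => 0)
          (g := fun t => (ε m - ε n) • deriv^[j + 2] (v m) t)
          (fun t => by
            have e1 := heqj n j t
            have e2 := heqj m j t
            have e3 := congrArg₂ (· - ·) e1 e2
            simp only [map_zero, add_zero]
            change R _ + _ + _ = R _ + _
            simp only [map_sub, smul_sub, sub_smul]
            have : R (deriv^[j + 2] (v n) t) = R (deriv^[j] (v n) t) + R (deriv^[j] F t) -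
                ε n • deriv^[j + 2] (v n) t - deriv^[j] (v n) t := by rw [← e1]; abel
            have h' : R (deriv^[j + 2] (v m) t) = R (deriv^[j] (v m) t) + R (deriv^[j] F t) -
                ε m • deriv^[j + 2] (v m) t - deriv^[j] (v m) t := by rw [← e2]; abel
            rw [show j + 1 + 1 = j + 2 from rfl, this, h']
            abel)
          (a := a) (T := T) (B := 4 * |ε n - ε m| * C₁ * C₂)
          (by simp [hva n j a (by linarith), hva m j a (by linarith)])
          (by simp [hva n (j + 1) a (by linarith), hva m (j + 1) a (by linarith)])
          (fun t ht => by
            have a1 := hb₂ m t (by linarith [ht.2])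
            have a2 := hb₁ n t (by linarith [ht.2])
            have a3 := hb₁ m t (by linarith [ht.2])
            have a4 := (norm_sub_le (deriv^[j + 1] (v n) t) (deriv^[j + 1] (v m) t)).trans
              (add_le_add a2 a3)
            rw [norm_smul, Real.norm_eq_abs, abs_sub_comm]
            simp only [norm_zero, ne_eq, OfNat.ofNat_ne_zero, not_false_eq_true, zero_pow,
              zero_add]
            calc _ ≤ 2 * (|ε n - ε m| * C₂) * (C₁ + C₁) := by gcongr
              _ = _ := by ring)
          t ⟨hta, ht.le⟩
        rw [gronwallBound_zero_two] at this
        refine this.trans ?_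
        have h' : Real.exp (2 * (t - a)) ≤ Real.exp (2 * (T - a)) := by
          rw [Real.exp_le_exp]; linarith
        calc 4 * |ε n - ε m| * C₁ * C₂ / 2 * (Real.exp (2 * (t - a)) - 1)
            ≤ 4 * |ε n - ε m| * C₁ * C₂ / 2 * Real.exp (2 * (T - a)) := by
              gcongr; linarith
          _ = _ := by ring
    rw [Metric.uniformCauchySeqOn_iff]
    intro δ hδ
    set D := 2 * C₁ * C₂ * Real.exp (2 * (T - a)) with hD
    have hD0 : 0 ≤ D := by positivity
    obtain ⟨N, hN⟩ := Metric.cauchySeq_iff.1 hεlim.cauchySeq (δ ^ 2 / (D + 1)) (by positivity)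
    refine ⟨N, fun m hm n hn t ht => ?_⟩
    have h1 := hN m hm n hn
    rw [Real.dist_eq, lt_div_iff₀ (by positivity)] at h1
    have h2 := hdiff m n t ht
    rw [dist_eq_norm]
    refine lt_of_pow_lt_pow_left₀ 2 hδ.le (h2.trans_lt ?_)
    nlinarith [abs_nonneg (ε m - ε n)]
  have hlim : ∀ j t, ∃ x, Tendsto (fun n => deriv^[j] (v n) t) atTop (𝓝 x) := fun j t =>
    cauchySeq_tendsto_of_complete ((hCauchy j (t + 1)).cauchySeq (by simp))
  choose g hg using hlim
  have hdg : ∀ j t, HasDerivAt (g j) (g (j + 1) t) t := fun j t =>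
    hasDerivAt_of_tendstoUniformlyOn (isOpen_Iio (a := t + 1))
      ((hCauchy (j + 1) (t + 1)).tendstoUniformlyOn_of_tendsto fun x _ => hg (j + 1) x)
      (Eventually.of_forall fun n x _ => hdv n j x) (fun x _ => hg j x) (by simp)
  have hgs : ∀ j, ContDiff ℝ ∞ (g j) := contDiff_of_hasDerivAt_seq hdg
  have hgeq : ∀ t, R (g 2 t) + g 0 t = R (g 0 t) + R (F t) := by
    intro t
    have h1 := (((R.continuous.tendsto _).comp (hg 2 t)).add (hεlim.smul (hg 2 t))).add (hg 0 t)
    have h2 := ((R.continuous.tendsto _).comp (hg 0 t)).add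
      (tendsto_const_nhds (x := R (F t)))
    rw [zero_smul, add_zero] at h1
    exact tendsto_nhds_unique h1 (h2.congr fun n => (heqj n 0 t).symm)
  have hg0 : ∀ t₀, (∀ t < t₀, F t = 0) → ∀ j, ∀ t < t₀, g j t = 0 := by
    intro t₀ h j t ht
    refine tendsto_nhds_unique (hg j t) ?_
    simp only [iterate_deriv_eq_zero (hv0 _ t₀ h) j t ht]
    exact tendsto_const_nhds
  -- The limit `g 0` satisfies `J J† (F - g 2 + g 0) = g 0`, so it is `J u` for the following `u`.
  let u : ℝ → V := fun t => adjoint J (F t - g 2 t + g 0 t)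
  have hu : ContDiff ℝ ∞ u := (adjoint J).contDiff.comp ((hF.sub (hgs 2)).add (hgs 0))
  have hJu : ∀ t, J (u t) = g 0 t := by
    intro t
    change R (F t - g 2 t + g 0 t) = g 0 t
    rw [map_add, map_sub, ← sub_eq_zero, ← sub_eq_zero.2 (hgeq t).symm]
    abel
  have hdu : ∀ t, HasDerivAt u (deriv u t) t := fun t =>
    (hu.differentiable (by simp) t).hasDerivAt
  have hddu : ∀ t, HasDerivAt (deriv u) (deriv (deriv u) t) t := fun t =>
    hasDerivAt_iterate_deriv hu 1 t
  have hJu' : ∀ t, J (deriv u t) = g 1 t := fun t =>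
    (J.hasFDerivAt.comp_hasDerivAt t (hdu t)).unique
      ((hdg 0 t).congr_of_eventuallyEq (Eventually.of_forall hJu))
  have hJu'' : ∀ t, J (deriv (deriv u) t) = g 2 t := fun t =>
    (J.hasFDerivAt.comp_hasDerivAt t (hddu t)).unique
      ((hdg 1 t).congr_of_eventuallyEq (Eventually.of_forall hJu'))
  have hweak : ∀ t ψ, ⟪u t, ψ⟫ = ⟪F t - g 2 t + g 0 t, J ψ⟫ := fun t ψ =>
    adjoint_inner_left J _ _
  refine ⟨u, hu, fun t ψ => ?_, ?_, fun t₀ h t ht => ?_⟩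
  · rw [hJu'', hweak, hJu, inner_add_left, inner_sub_left]
    ring
  -- the energy has derivative `2 ⟪F, J u_t⟫`, so it is constant outside the support of `F`
  · set E : ℝ → ℝ := fun t => ⟪g 1 t, g 1 t⟫ + ⟪u t, u t⟫ - ⟪g 0 t, g 0 t⟫ with hE
    have hdE : ∀ t, HasDerivAt E (2 * ⟪F t, g 1 t⟫) t := by
      intro t
      refine ((((hdg 1 t).inner ℝ (hdg 1 t)).add ((hdu t).inner ℝ (hdu t))).sub
        ((hdg 0 t).inner ℝ (hdg 0 t))).congr_deriv ?_
      rw [real_inner_comm (u t) (deriv u t), hweak, hJu', inner_add_left, inner_sub_left,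
        real_inner_comm (g 2 t) (g 1 t), real_inner_comm (g 0 t) (g 1 t)]
      simp only [zero_add, Nat.reduceAdd]
      ring
    have hEc : Continuous E := continuous_iff_continuousAt.2 fun t => (hdE t).continuousAt
    obtain ⟨C, hC⟩ := (isCompact_Icc (a := a) (b := |r| + 1)).bddAbove_image hEc.continuousOn
    have hC' : ∀ t ∈ Icc a (|r| + 1), E t ≤ C := fun t ht => hC (mem_image_of_mem _ ht)
    have hab : a ≤ |r| + 1 := by have := abs_nonneg r; linarith
    have hEb : ∀ t, E t ≤ C := by
      intro t
      rcases le_total t a with hta | hta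
      · have hEa : ∀ s ≤ a, E s = 0 := by
          intro s hs
          have h := hg0 _ hFa
          have hus : u s = 0 := by
            simp [u, h 2 s (by linarith), h 0 s (by linarith), hFa s (by linarith)]
          simp [hE, h 1 s (by linarith), h 0 s (by linarith), hus]
        rw [hEa t hta, ← hEa a le_rfl]
        exact hC' a ⟨le_rfl, hab⟩
      · rcases le_total t (|r| + 1) with htb | htb
        · exact hC' t ⟨hta, htb⟩
        · have hconst := constant_of_has_deriv_right_zero (f := E) (a := |r| + 1) (b := t)
            hEc.continuousOn (fun s hs => by
              have hFs : F s = 0 := hFr s (by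
                have := le_abs_self r
                have := le_abs_self s
                linarith [hs.1])
              have := hdE s
              rw [hFs, inner_zero_left, mul_zero] at this
              exact this.hasDerivWithinAt)
          rw [hconst t ⟨htb, le_rfl⟩]
          exact hC' _ ⟨hab, le_rfl⟩
    refine ⟨C, fun t => le_trans ?_ (hEb t)⟩
    simp only [hE, real_inner_self_eq_norm_sq, hJu]
    nlinarith [sq_nonneg ‖g 1 t‖]
  · simp [u, hg0 t₀ h 2 t ht, hg0 t₀ h 0 t ht, h t ht]

end AbstractWave

/-! ### Weighted measures -/

section Density

variable {X : Type*} [MeasurableSpace X] {m : Measure X} {U K : Set X} {w : X → ℝ}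

theorem ae_withDensity_ofReal_iff (hU : MeasurableSet U) (hw : Measurable w)
    (hpos : ∀ x ∈ U, 0 < w x) {P : X → Prop} :
    (∀ᵐ x ∂(m.restrict U).withDensity (fun x => ENNReal.ofReal (w x)), P x) ↔
      ∀ᵐ x ∂m.restrict U, P x := by
  rw [ae_withDensity_iff hw.ennreal_ofReal]
  refine eventually_congr ?_
  filter_upwards [ae_restrict_mem hU] with x hx
  simp [hpos x hx]

theorem integral_withDensity_ofReal {F : Type*} [NormedAddCommGroup F] [NormedSpace ℝ F]
    (hU : MeasurableSet U) (hw : Measurable w) (hpos : ∀ x ∈ U, 0 < w x) (f : X → F) :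
    ∫ x, f x ∂(m.restrict U).withDensity (fun x => ENNReal.ofReal (w x)) =
      ∫ x in U, w x • f x ∂m := by
  rw [integral_withDensity_eq_integral_toReal_smul hw.ennreal_ofReal (by simp)]
  refine setIntegral_congr_fun hU fun x hx => ?_
  rw [ENNReal.toReal_ofReal (hpos x hx).le]

variable [TopologicalSpace X] [T2Space X] [BorelSpace X]

theorem withDensity_apply_lt_top [IsFiniteMeasureOnCompacts m] (hK : IsCompact K) (hKU : K ⊆ U)
    (hc : ContinuousOn w U) :
    (m.restrict U).withDensity (fun x => ENNReal.ofReal (w x)) K < ⊤ := by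
  rw [withDensity_apply _ hK.measurableSet]
  obtain ⟨C, hC⟩ := hK.bddAbove_image (hc.mono hKU)
  calc ∫⁻ x in K, ENNReal.ofReal (w x) ∂m.restrict U
      ≤ ∫⁻ _ in K, ENNReal.ofReal C ∂m.restrict U := by
        refine setLIntegral_mono' hK.measurableSet fun x hx => ?_
        exact ENNReal.ofReal_le_ofReal (hC (mem_image_of_mem _ hx))
    _ < ⊤ := by
        rw [setLIntegral_const]
        exact ENNReal.mul_lt_top ENNReal.ofReal_lt_top
          ((Measure.restrict_apply_le _ _).trans_lt hK.measure_lt_top)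

theorem exists_restrict_le_withDensity (hK : IsCompact K) (hKU : K ⊆ U)
    (hc : ContinuousOn w U) (hpos : ∀ x ∈ U, 0 < w x) :
    ∃ c : ℝ≥0∞, c ≠ ⊤ ∧
      m.restrict K ≤ c • (m.restrict U).withDensity (fun x => ENNReal.ofReal (w x)) := by
  rcases K.eq_empty_or_nonempty with rfl | hne
  · exact ⟨0, by simp, by simp⟩
  obtain ⟨x₀, hx₀, hmin⟩ := hK.exists_isMinOn hne (hc.mono hKU)
  have h0 := hpos x₀ (hKU hx₀)
  refine ⟨(ENNReal.ofReal (w x₀))⁻¹, by simp [h0], ?_⟩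
  refine Measure.le_iff.2 fun s hs => ?_
  have hfin : ENNReal.ofReal (w x₀) ≠ ⊤ := ENNReal.ofReal_ne_top
  have hne0 : ENNReal.ofReal (w x₀) ≠ 0 := by simp [h0]
  rw [Measure.smul_apply, smul_eq_mul, mul_comm, ← div_eq_mul_inv,
    ENNReal.le_div_iff_mul_le (Or.inl hne0) (Or.inl hfin), mul_comm,
    withDensity_apply _ hs, Measure.restrict_apply hs]
  calc ENNReal.ofReal (w x₀) * m (s ∩ K)
      = ∫⁻ _ in s ∩ K, ENNReal.ofReal (w x₀) ∂m := by rw [setLIntegral_const]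
    _ ≤ ∫⁻ x in s ∩ K, ENNReal.ofReal (w x) ∂m := by
        refine lintegral_mono_ae ?_
        filter_upwards [ae_restrict_of_ae_restrict_of_subset inter_subset_right
          (ae_restrict_mem hK.measurableSet)] with x hx
        exact ENNReal.ofReal_le_ofReal (hmin hx)
    _ ≤ ∫⁻ x in s, ENNReal.ofReal (w x) ∂m.restrict U := by
        rw [Measure.restrict_restrict hs]
        exact lintegral_mono_set (inter_subset_inter_right s hKU)

/-- On compact subsets of `U`, the `L¹` seminorm is controlled by the weighted `L²` seminorm. -/
theorem exists_lintegral_le_eLpNorm_withDensity [IsFiniteMeasureOnCompacts m]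
    {F : Type*} [NormedAddCommGroup F]
    (hK : IsCompact K) (hKU : K ⊆ U) (hc : ContinuousOn w U) (hpos : ∀ x ∈ U, 0 < w x) :
    ∃ c : ℝ≥0∞, c ≠ ⊤ ∧ ∀ f : X → F, AEStronglyMeasurable f (m.restrict U) →
      ∫⁻ x in K, ‖f x‖ₑ ∂m ≤
        c * eLpNorm f 2 ((m.restrict U).withDensity (fun x => ENNReal.ofReal (w x))) := by
  obtain ⟨c, hc', hle⟩ := exists_restrict_le_withDensity (m := m) hK hKU hc hpos
  refine ⟨c ^ (1 / (2 : ℝ)) * m K ^ (1 / (2 : ℝ)),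
    ENNReal.mul_ne_top (by simp [hc']) (by simp [hK.measure_lt_top.ne]), fun f hf => ?_⟩
  have hfK : AEStronglyMeasurable f (m.restrict K) := hf.mono_measure (Measure.restrict_mono hKU le_rfl)
  have h1 := eLpNorm_le_eLpNorm_mul_rpow_measure_univ (p := 1) (q := 2) (by norm_num) hfK
  rw [eLpNorm_one_eq_lintegral_enorm] at h1
  refine h1.trans ?_
  have h2 : eLpNorm f 2 (m.restrict K) ≤ c ^ (1 / (2 : ℝ)) *
      eLpNorm f 2 ((m.restrict U).withDensity (fun x => ENNReal.ofReal (w x))) := by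
    refine (eLpNorm_mono_measure f hle).trans ?_
    rw [eLpNorm_smul_measure_of_ne_top (by norm_num)]
    simp
  have h3 : (m.restrict K) univ ^ (1 / (1 : ℝ≥0∞).toReal - 1 / (2 : ℝ≥0∞).toReal) =
      m K ^ (1 / (2 : ℝ)) := by
    rw [Measure.restrict_apply_univ]
    congr 1
    norm_num
  rw [h3]
  calc _ ≤ c ^ (1 / (2 : ℝ)) *
      eLpNorm f 2 ((m.restrict U).withDensity (fun x => ENNReal.ofReal (w x))) *
        m K ^ (1 / (2 : ℝ)) := by gcongr
    _ = _ := by ring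

theorem memLp_withDensity_of_hasCompactSupport [IsFiniteMeasureOnCompacts m]
    {F : Type*} [NormedAddCommGroup F] [SecondCountableTopologyEither X F] {f : X → F}
    (hf : Continuous f) (hfc : HasCompactSupport f) (hfU : tsupport f ⊆ U)
    (hc : ContinuousOn w U) (p : ℝ≥0∞) :
    MemLp f p ((m.restrict U).withDensity (fun x => ENNReal.ofReal (w x))) := by
  set ν := (m.restrict U).withDensity (fun x => ENNReal.ofReal (w x))
  obtain ⟨C, hC⟩ := hfc.exists_bound_of_continuous hf
  have hfin : ν (tsupport f) < ⊤ := withDensity_apply_lt_top hfc hfU hc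
  have : IsFiniteMeasure (ν.restrict (tsupport f)) := ⟨by simpa using hfin⟩
  have h : MemLp f p (ν.restrict (tsupport f)) :=
    MemLp.of_bound hf.aestronglyMeasurable C (Eventually.of_forall hC)
  rw [← memLp_indicator_iff_restrict (isClosed_tsupport f).measurableSet] at h
  rwa [indicator_eq_self.2 (subset_tsupport f)] at h

end Density

section Measures

variable {d : ℕ} {α : ℝ}

theorem isOpen_halfSpace : IsOpen (halfSpace d) := isOpen_lt continuous_const continuous_snd

theorem isOpen_bulk : IsOpen (bulk d) := isOpen_lt continuous_const (by fun_prop)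

theorem bulkMeasure_eq : bulkMeasure d α = (volume.restrict (bulk d)).withDensity
    (fun p => ENNReal.ofReal (p.2.2 ^ (1 - 2 * α))) := by
  have hb : bulk d = univ ×ˢ halfSpace d := by ext; simp [bulk, halfSpace]
  rw [bulkMeasure, wMeasure, prod_withDensity_right (by fun_prop), hb,
    Measure.volume_eq_prod ℝ (Space d × ℝ), ← Measure.prod_restrict, Measure.restrict_univ]

instance : SFinite (wMeasure d α) := by
  unfold wMeasure; infer_instance

theorem slabMeasure_eq (a b : ℝ) :
    slabMeasure d α a b = (bulkMeasure d α).restrict (Icc a b ×ˢ univ) := by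
  rw [slabMeasure, bulkMeasure, ← Measure.prod_restrict, Measure.restrict_univ]

theorem measurable_weight : Measurable fun z : Space d × ℝ => z.2 ^ (1 - 2 * α) := by fun_prop

theorem measurable_bulk_weight :
    Measurable fun p : ℝ × Space d × ℝ => p.2.2 ^ (1 - 2 * α) := by fun_prop

theorem weight_pos : ∀ z ∈ halfSpace d, 0 < z.2 ^ (1 - 2 * α) :=
  fun _ hz => Real.rpow_pos_of_pos hz _

theorem bulk_weight_pos : ∀ p ∈ bulk d, 0 < p.2.2 ^ (1 - 2 * α) :=
  fun _ hz => Real.rpow_pos_of_pos hz _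

theorem continuousOn_weight :
    ContinuousOn (fun z : Space d × ℝ => z.2 ^ (1 - 2 * α)) (halfSpace d) :=
  continuousOn_snd.rpow_const fun _ hz => Or.inl (ne_of_gt hz)

theorem continuousOn_bulk_weight :
    ContinuousOn (fun p : ℝ × Space d × ℝ => p.2.2 ^ (1 - 2 * α)) (bulk d) :=
  ContinuousOn.rpow_const (by fun_prop) fun _ hz => Or.inl (ne_of_gt hz)

theorem ae_wMeasure_iff {P : Space d × ℝ → Prop} :
    (∀ᵐ z ∂wMeasure d α, P z) ↔ ∀ᵐ z ∂volume.restrict (halfSpace d), P z :=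
  ae_withDensity_ofReal_iff isOpen_halfSpace.measurableSet measurable_weight weight_pos

theorem ae_bulkMeasure_iff {P : ℝ × Space d × ℝ → Prop} :
    (∀ᵐ p ∂bulkMeasure d α, P p) ↔ ∀ᵐ p ∂volume.restrict (bulk d), P p := by
  rw [bulkMeasure_eq]
  exact ae_withDensity_ofReal_iff isOpen_bulk.measurableSet measurable_bulk_weight bulk_weight_pos

theorem integral_wMeasure {F : Type*} [NormedAddCommGroup F] [NormedSpace ℝ F]
    (f : Space d × ℝ → F) :
    ∫ z, f z ∂wMeasure d α = ∫ z in halfSpace d, z.2 ^ (1 - 2 * α) • f z :=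
  integral_withDensity_ofReal isOpen_halfSpace.measurableSet measurable_weight weight_pos f

theorem aestronglyMeasurable_wMeasure_iff {F : Type*} [TopologicalSpace F]
    {f : Space d × ℝ → F} : AEStronglyMeasurable f (wMeasure d α) ↔
      AEStronglyMeasurable f (volume.restrict (halfSpace d)) := by
  have h1 : wMeasure d α ≪ volume.restrict (halfSpace d) :=
    withDensity_absolutelyContinuous _ _
  have h2 : volume.restrict (halfSpace d) ≪ wMeasure d α :=
    Measure.AbsolutelyContinuous.mk fun s _ hs => by
      rw [measure_eq_zero_iff_ae_notMem, ae_wMeasure_iff] at hs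
      exact measure_eq_zero_iff_ae_notMem.2 hs
  exact ⟨fun h => h.mono_ac h2, fun h => h.mono_ac h1⟩

theorem memLp_wMeasure_of_hasCompactSupport {F : Type*} [NormedAddCommGroup F]
    {f : Space d × ℝ → F} (hf : Continuous f) (hfc : HasCompactSupport f)
    (hfU : tsupport f ⊆ halfSpace d) (p : ℝ≥0∞) : MemLp f p (wMeasure d α) :=
  memLp_withDensity_of_hasCompactSupport hf hfc hfU continuousOn_weight p

theorem memLp_bulkMeasure_of_hasCompactSupport {F : Type*} [NormedAddCommGroup F]
    {f : ℝ × Space d × ℝ → F} (hf : Continuous f) (hfc : HasCompactSupport f)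
    (hfU : tsupport f ⊆ bulk d) (p : ℝ≥0∞) : MemLp f p (bulkMeasure d α) := by
  rw [bulkMeasure_eq]
  exact memLp_withDensity_of_hasCompactSupport hf hfc hfU continuousOn_bulk_weight p

/-- On compact subsets of the open half-space, `L²_α` convergence implies `L¹` convergence. -/
theorem exists_lintegral_le_eLpNorm {F : Type*} [NormedAddCommGroup F] {K : Set (Space d × ℝ)}
    (hK : IsCompact K) (hKU : K ⊆ halfSpace d) :
    ∃ c : ℝ≥0∞, c ≠ ⊤ ∧ ∀ f : Space d × ℝ → F, AEStronglyMeasurable f (wMeasure d α) →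
      ∫⁻ z in K, ‖f z‖ₑ ≤ c * eLpNorm f 2 (wMeasure d α) := by
  obtain ⟨c, hc, h⟩ := exists_lintegral_le_eLpNorm_withDensity (m := volume) (F := F)
    hK hKU (continuousOn_weight (α := α)) weight_pos
  exact ⟨c, hc, fun f hf => h f (aestronglyMeasurable_wMeasure_iff.1 hf)⟩

theorem locallyIntegrableOn_halfSpace {F : Type*} [NormedAddCommGroup F]
    {f : Space d × ℝ → F} (hf : MemLp f 2 (wMeasure d α)) :
    LocallyIntegrableOn f (halfSpace d) volume := by
  rw [locallyIntegrableOn_iff isOpen_halfSpace.isLocallyClosed]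
  intro K hKU hK
  obtain ⟨c, hc, h⟩ := exists_lintegral_le_eLpNorm (F := F) (α := α) hK hKU
  refine ⟨(aestronglyMeasurable_wMeasure_iff.1 hf.1).mono_measure
    (Measure.restrict_mono hKU le_rfl), (h f hf.1).trans_lt ?_⟩
  exact ENNReal.mul_lt_top hc.lt_top hf.2

theorem locallyIntegrableOn_bulk {F : Type*} [NormedAddCommGroup F]
    {f : ℝ × Space d × ℝ → F} (hf : ∀ a b : ℝ, MemLp f 2 (slabMeasure d α a b)) :
    LocallyIntegrableOn f (bulk d) volume := by
  rw [locallyIntegrableOn_iff isOpen_bulk.isLocallyClosed]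
  intro K hKU hK
  obtain ⟨c, hc, hle⟩ := exists_restrict_le_withDensity (m := volume) hK hKU
    (continuousOn_bulk_weight (α := α)) bulk_weight_pos
  rw [← bulkMeasure_eq] at hle
  obtain ⟨r, hr⟩ := hK.isBounded.subset_closedBall 0
  have hKs : K ⊆ Icc (-r) r ×ˢ univ := by
    intro p hp
    have h1 := hr hp
    rw [mem_closedBall_zero_iff] at h1
    have h2 := (norm_fst_le p).trans h1
    exact ⟨abs_le.1 h2, mem_univ _⟩
  have hle' : volume.restrict K ≤ c • slabMeasure d α (-r) r := by
    have := Measure.restrict_mono_measure hle (Icc (-r) r ×ˢ (univ : Set (Space d × ℝ)))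
    rwa [Measure.restrict_restrict (measurableSet_Icc.prod MeasurableSet.univ),
      inter_eq_self_of_subset_right hKs, Measure.restrict_smul, ← slabMeasure_eq] at this
  have : IsFiniteMeasure (volume.restrict K) := ⟨by simpa using hK.measure_lt_top⟩
  have hm : MemLp f 2 (volume.restrict K) := (hf (-r) r).of_measure_le_smul hc hle'
  exact hm.integrable (by norm_num)

theorem integrable_mul_of_locallyIntegrableOn {E : Type*} [TopologicalSpace E] [T2Space E]
    [MeasurableSpace E] [BorelSpace E] [SecondCountableTopology E] {m : Measure E} {U : Set E}
    {f g : E → ℝ} (hf : LocallyIntegrableOn f U m)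
    (hg : Continuous g) (hgc : HasCompactSupport g) (hgU : tsupport g ⊆ U) :
    Integrable (fun x => f x * g x) (m.restrict U) := by
  have h1 : IntegrableOn f (tsupport g) m := hf.integrableOn_compact_subset hgU hgc
  obtain ⟨C, hC⟩ := hgc.exists_bound_of_continuous hg
  have h2 : IntegrableOn (fun x => f x * g x) (tsupport g) m :=
    h1.mul_bdd hg.aestronglyMeasurable (Eventually.of_forall hC)
  rw [← integrable_indicator_iff (isClosed_tsupport g).measurableSet,
    indicator_eq_self.2] at h2
  · exact h2.restrict
  · intro x hx
    exact subset_tsupport g (right_ne_zero_of_mul hx)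

end Measures

/-! ### Test functions and derivatives -/

section TestFunctions

variable {E : Type*} [NormedAddCommGroup E] [NormedSpace ℝ E] {U : Set E} {φ ψ : E → ℝ}

/-- Smooth functions with compact support contained in `U`. -/
def IsTestOn (U : Set E) (φ : E → ℝ) : Prop :=
  ContDiff ℝ ∞ φ ∧ HasCompactSupport φ ∧ tsupport φ ⊆ U

theorem IsTestOn.mono {W : Set E} (h : IsTestOn U φ) (hUW : U ⊆ W) : IsTestOn W φ :=
  ⟨h.1, h.2.1, h.2.2.trans hUW⟩

theorem IsTestOn.eq_zero (h : IsTestOn U φ) {x : E} (hx : x ∉ U) : φ x = 0 :=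
  image_eq_zero_of_notMem_tsupport fun hx' => hx (h.2.2 hx')

theorem IsTestOn.fderiv_apply (h : IsTestOn U φ) (e : E) : IsTestOn U fun x => fderiv ℝ φ x e :=
  ⟨(h.1.fderiv_right (m := ∞) (by simp)).clm_apply contDiff_const,
    h.2.1.fderiv_apply ℝ e, (tsupport_fderiv_apply_subset ℝ e).trans h.2.2⟩

theorem IsTestOn.add (h : IsTestOn U φ) (h' : IsTestOn U ψ) : IsTestOn U (φ + ψ) :=
  ⟨h.1.add h'.1, h.2.1.add h'.2.1, (tsupport_add φ ψ).trans (union_subset h.2.2 h'.2.2)⟩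

theorem IsTestOn.contDiffOn_mul {w : E → ℝ} (hU : IsOpen U) (hw : ContDiffOn ℝ ∞ w U)
    (h : IsTestOn U φ) : IsTestOn U fun x => w x * φ x := by
  have hsub : tsupport (fun x => w x * φ x) ⊆ tsupport φ := tsupport_mul_subset_right
  refine ⟨contDiff_iff_contDiffAt.2 fun x => ?_, h.2.1.mul_left, hsub.trans h.2.2⟩
  by_cases hx : x ∈ tsupport φ
  · exact (hw.contDiffAt (hU.mem_nhds (h.2.2 hx))).mul h.1.contDiffAt
  · refine (contDiffAt_const (c := (0 : ℝ))).congr_of_eventuallyEq ?_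
    filter_upwards [(isClosed_tsupport φ).isOpen_compl.mem_nhds hx] with y hy
    rw [image_eq_zero_of_notMem_tsupport hy, mul_zero]

theorem IsTestOn.const_mul (h : IsTestOn U φ) (c : ℝ) : IsTestOn U fun x => c * φ x :=
  ⟨contDiff_const.mul h.1, h.2.1.mul_left, tsupport_mul_subset_right.trans h.2.2⟩

theorem IsTestOn.contDiff_mul {w : E → ℝ} (hw : ContDiff ℝ ∞ w)
    (h : IsTestOn U φ) : IsTestOn U fun x => w x * φ x :=
  ⟨hw.mul h.1, h.2.1.mul_left, tsupport_mul_subset_right.trans h.2.2⟩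

theorem IsTestOn.comp_equiv {E' : Type*} [NormedAddCommGroup E'] [NormedSpace ℝ E']
    (h : IsTestOn U φ) (e : E' ≃L[ℝ] E) : IsTestOn (e ⁻¹' U) (φ ∘ e) :=
  ⟨h.1.comp e.contDiff, h.2.1.comp_homeomorph e.toHomeomorph,
    (tsupport_comp_subset_preimage φ e.continuous).trans (preimage_mono h.2.2)⟩

theorem IsTestOn.prod_mul {E' : Type*} [NormedAddCommGroup E'] [NormedSpace ℝ E'] {W : Set E'}
    {η : E' → ℝ} (h : IsTestOn U φ) (h' : IsTestOn W η) :
    IsTestOn (U ×ˢ W) fun p : E × E' => φ p.1 * η p.2 := by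
  have hsub : tsupport (fun p : E × E' => φ p.1 * η p.2) ⊆ tsupport φ ×ˢ tsupport η := by
    refine closure_minimal ?_ ((isClosed_tsupport φ).prod (isClosed_tsupport η))
    intro p hp
    exact ⟨subset_tsupport φ (left_ne_zero_of_mul hp), subset_tsupport η (right_ne_zero_of_mul hp)⟩
  exact ⟨(h.1.comp contDiff_fst).mul (h'.1.comp contDiff_snd),
    (h.2.1.prod h'.2.1).of_isClosed_subset (isClosed_tsupport _) hsub,
    hsub.trans (prod_mono h.2.2 h'.2.2)⟩

theorem IsTestOn.slice {d : ℕ} {φ : ℝ × Space d × ℝ → ℝ} (h : IsTestOn (bulk d) φ) (t : ℝ) :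
    IsTestOn (halfSpace d) fun z => φ (t, z) := by
  have hc : Continuous fun z : Space d × ℝ => (t, z) := by fun_prop
  exact ⟨h.1.comp (contDiff_const.prodMk contDiff_id),
    .of_support_subset_isCompact (h.2.1.isCompact.image continuous_snd)
      fun z hz => ⟨(t, z), subset_tsupport φ hz, rfl⟩,
    (tsupport_comp_subset_preimage φ hc).trans fun z hz => h.2.2 hz⟩

theorem IsTestOn.time_mul {d : ℕ} {θ : ℝ → ℝ} {ψ : Space d × ℝ → ℝ} (h : IsTestOn univ θ)
    (h' : IsTestOn (halfSpace d) ψ) : IsTestOn (bulk d) fun p => θ p.1 * ψ p.2 :=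
  (h.prod_mul h').mono fun _ hp => hp.2

theorem IsTestOn.mul_normal {d : ℕ} {a : ℝ × Space d → ℝ} {η : ℝ → ℝ} (h : IsTestOn univ a)
    (h' : IsTestOn (Ioi 0) η) : IsTestOn (bulk d) fun p => a (p.1, p.2.1) * η p.2.2 :=
  ((h.prod_mul h').comp_equiv (ContinuousLinearEquiv.prodAssoc ℝ ℝ (Space d) ℝ).symm).mono
    fun _ hp => hp.2

/-- Integration by parts against a test function. -/
theorem integral_mul_fderiv_of_isTestOn [FiniteDimensional ℝ E] [MeasurableSpace E] [BorelSpace E]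
    {m : Measure E} [m.IsAddHaarMeasure] {f : E → ℝ} (hf : ContDiff ℝ 1 f) (h : IsTestOn U φ)
    (e : E) : ∫ x, f x * fderiv ℝ φ x e ∂m = -∫ x, fderiv ℝ f x e * φ x ∂m := by
  have hc : Continuous fun x => fderiv ℝ f x e :=
    (hf.continuous_fderiv one_ne_zero).clm_apply continuous_const
  have h' := h.fderiv_apply e
  exact integral_mul_fderiv_eq_neg_fderiv_mul_of_integrable
    ((hc.mul h.1.continuous).integrable_of_hasCompactSupport h.2.1.mul_left)
    ((hf.continuous.mul h'.1.continuous).integrable_of_hasCompactSupport h'.2.1.mul_left)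
    ((hf.continuous.mul h.1.continuous).integrable_of_hasCompactSupport h.2.1.mul_left)
    (fun x _ => hf.differentiable one_ne_zero x)
    (fun x _ => h.1.differentiable (by simp) x)

theorem setIntegral_mul_eq_of_isTestOn [MeasurableSpace E] {m : Measure E} (f : E → ℝ)
    (h : IsTestOn U φ) : ∫ x in U, f x * φ x ∂m = ∫ x, f x * φ x ∂m :=
  setIntegral_eq_integral_of_forall_compl_eq_zero fun x hx => by rw [h.eq_zero hx, mul_zero]

theorem tendsto_setIntegral_mul_of_isTestOn [MeasurableSpace E] [BorelSpace E]
    [SecondCountableTopology E] {m : Measure E} {f : ℕ → E → ℝ} {g : E → ℝ}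
    (hf : ∀ n, LocallyIntegrableOn (f n) U m) (hg : LocallyIntegrableOn g U m)
    (h : IsTestOn U φ)
    (hlim : Tendsto (fun n => ∫⁻ x in tsupport φ, ‖f n x - g x‖ₑ ∂m) atTop (𝓝 0)) :
    Tendsto (fun n => ∫ x in U, f n x * φ x ∂m) atTop (𝓝 (∫ x in U, g x * φ x ∂m)) := by
  obtain ⟨C, hC⟩ := h.2.1.exists_bound_of_continuous h.1.continuous
  refine tendsto_integral_of_L1 _
    (integrable_mul_of_locallyIntegrableOn hg h.1.continuous h.2.1 h.2.2).1
    (Eventually.of_forall fun n =>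
      integrable_mul_of_locallyIntegrableOn (hf n) h.1.continuous h.2.1 h.2.2) ?_
  have h0 := ENNReal.Tendsto.const_mul hlim (a := ENNReal.ofReal C) (Or.inr ENNReal.ofReal_ne_top)
  rw [mul_zero] at h0
  refine tendsto_of_tendsto_of_tendsto_of_le_of_le tendsto_const_nhds h0 (fun _ => zero_le)
    fun n => ?_
  rw [← lintegral_const_mul' _ _ ENNReal.ofReal_ne_top,
    ← lintegral_indicator (isClosed_tsupport φ).measurableSet]
  refine (lintegral_mono fun x => ?_).trans (lintegral_mono' Measure.restrict_le_self le_rfl)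
  by_cases hx : x ∈ tsupport φ
  · rw [indicator_of_mem hx, ← sub_mul, enorm_mul, mul_comm]
    gcongr
    rw [← ofReal_norm]
    exact ENNReal.ofReal_le_ofReal (hC x)
  · simp [image_eq_zero_of_notMem_tsupport hx]

end TestFunctions

section Calculus

open scoped RealInnerProductSpace
open InnerProductSpace

variable {d : ℕ} {α : ℝ}

theorem laplacian_comp_affine {E : Type*} [NormedAddCommGroup E] [NormedSpace ℝ E] {ψ : E → ℝ}
    (hψ : ContDiff ℝ ∞ ψ) {A : Space d → E} {L : Space d →L[ℝ] E} (hA : ∀ x, HasFDerivAt A L x)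
    (x : Space d) : Laplacian.laplacian (fun x => ψ (A x)) x =
      ∑ i, fderiv ℝ (fun z => fderiv ℝ ψ z (L (EuclideanSpace.single i 1))) (A x)
        (L (EuclideanSpace.single i 1)) := by
  have h1 : ∀ x, fderiv ℝ (fun x => ψ (A x)) x = (fderiv ℝ ψ (A x)).comp L := fun x =>
    ((hψ.differentiable (by simp) (A x)).hasFDerivAt.comp x (hA x)).fderiv
  have hdd : Differentiable ℝ (fderiv ℝ ψ) :=
    (hψ.fderiv_right (m := ∞) (by simp)).differentiable (by simp)
  rw [laplacian_eq_iteratedFDeriv_orthonormalBasis _ (EuclideanSpace.basisFun (Fin d) ℝ)]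
  refine Finset.sum_congr rfl fun i _ => ?_
  rw [iteratedFDeriv_two_apply]
  simp only [Matrix.cons_val_zero, Matrix.cons_val_one, EuclideanSpace.basisFun_apply]
  have h2 : fderiv ℝ (fun x => ψ (A x)) = fun x => (fderiv ℝ ψ (A x)).comp L := funext h1
  have h3 : HasFDerivAt (fun x => (fderiv ℝ ψ (A x)).comp L)
      (((ContinuousLinearMap.compL ℝ (Space d) E ℝ).flip L).comp
        ((fderiv ℝ (fderiv ℝ ψ) (A x)).comp L)) x :=
    ((ContinuousLinearMap.compL ℝ (Space d) E ℝ).flip L).hasFDerivAt.comp x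
      ((hdd (A x)).hasFDerivAt.comp x (hA x))
  rw [h2, h3.fderiv, fderiv_clm_apply (hdd (A x)) (differentiableAt_const _)]
  simp

theorem deriv_comp_affine {E : Type*} [NormedAddCommGroup E] [NormedSpace ℝ E]
    {ψ : E → ℝ} (hψ : ContDiff ℝ ∞ ψ) {A : ℝ → E} {v : E} (hA : ∀ s, HasDerivAt A v s) (s : ℝ) :
    deriv (fun s => ψ (A s)) s = fderiv ℝ ψ (A s) v :=
  ((hψ.differentiable (by simp) (A s)).hasFDerivAt.comp_hasDerivAt s (hA s)).deriv

theorem iteratedDeriv_two_comp_affine {E : Type*} [NormedAddCommGroup E] [NormedSpace ℝ E]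
    {ψ : E → ℝ} (hψ : ContDiff ℝ ∞ ψ) {A : ℝ → E} {v : E} (hA : ∀ s, HasDerivAt A v s) (s : ℝ) :
    iteratedDeriv 2 (fun s => ψ (A s)) s =
      fderiv ℝ (fun z => fderiv ℝ ψ z v) (A s) v := by
  have h1 : deriv (fun s => ψ (A s)) = fun s => fderiv ℝ ψ (A s) v :=
    funext fun s => deriv_comp_affine hψ hA s
  rw [iteratedDeriv_succ, iteratedDeriv_one, h1]
  exact deriv_comp_affine (ψ := fun z => fderiv ℝ ψ z v)
    ((hψ.fderiv_right (m := ∞) (by simp)).clm_apply contDiff_const) hA s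

/-- The operator `Δ_x ψ + ψ_yy + ((1 - 2α) / y) ψ_y`. -/
noncomputable def spatialOp (α : ℝ) (ψ : Space d × ℝ → ℝ) : Space d × ℝ → ℝ := fun z =>
  Laplacian.laplacian (fun x : Space d => ψ (x, z.2)) z.1 +
    iteratedDeriv 2 (fun y => ψ (z.1, y)) z.2 +
    (1 - 2 * α) / z.2 * deriv (fun y => ψ (z.1, y)) z.2

theorem waveOp_eq (φ : ℝ × Space d × ℝ → ℝ) (t : ℝ) (z : Space d × ℝ) :
    waveOp α φ (t, z) =
      iteratedDeriv 2 (fun s => φ (s, z)) t - spatialOp α (fun z => φ (t, z)) z := by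
  simp only [waveOp, spatialOp]
  ring

/-- The standard basis of `ℝ^d × ℝ`; the index `none` stands for the direction of `y`. -/
noncomputable def frame : Option (Fin d) → Space d × ℝ
  | none => (0, 1)
  | some i => (EuclideanSpace.single i 1, 0)

theorem sum_inner_frame (G : Grad d) :
    ∑ i, ⟪G, WithLp.toLp 2 (frame i)⟫ • frame i = WithLp.ofLp G := by
  rw [Fintype.sum_option]
  refine Prod.ext ?_ ?_
  · simp only [frame, WithLp.prod_inner_apply]
    ext j
    simp [Prod.fst_sum, EuclideanSpace.inner_single_right, Pi.single_apply]
  · simp [frame, WithLp.prod_inner_apply, Prod.snd_sum]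

theorem inner_grad {φ : Space d × ℝ → ℝ} {z : Space d × ℝ} (h : DifferentiableAt ℝ φ z)
    (G : Grad d) : ⟪G, grad φ z⟫ = fderiv ℝ φ z (WithLp.ofLp G) := by
  have h1 : HasFDerivAt (fun x => φ (x, z.2))
      ((fderiv ℝ φ z).comp (ContinuousLinearMap.inl ℝ (Space d) ℝ)) z.1 :=
    HasFDerivAt.comp (g := φ) z.1 (f := fun x => (x, z.2)) h.hasFDerivAt
      (hasFDerivAt_prodMk_left z.1 z.2)
  have h2 : HasDerivAt (fun y => φ (z.1, y)) (fderiv ℝ φ z (0, 1)) z.2 := by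
    have := HasFDerivAt.comp_hasDerivAt (l := φ) z.2 (f := fun y => (z.1, y)) h.hasFDerivAt
      ((hasDerivAt_const z.2 z.1).prodMk (hasDerivAt_id z.2))
    exact this
  have h3 : WithLp.ofLp G = ((WithLp.ofLp G).1, 0) + (WithLp.ofLp G).2 • ((0 : Space d), (1 : ℝ)) := by
    ext <;> simp
  rw [WithLp.prod_inner_apply, h3, map_add, map_smul]
  simp only [grad, h2.deriv]
  congr 1
  · rw [real_inner_comm, gradient, h1.fderiv, toDual_symm_apply]
    simp
  · simp [mul_comm]

theorem inner_grad_eq_sum {φ : Space d × ℝ → ℝ} {z : Space d × ℝ} (h : DifferentiableAt ℝ φ z)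
    (G : Grad d) :
    ⟪G, grad φ z⟫ = ∑ i, ⟪G, WithLp.toLp 2 (frame i)⟫ * fderiv ℝ φ z (frame i) := by
  rw [inner_grad h]
  conv_lhs => rw [← sum_inner_frame G]
  simp

theorem grad_inner {φ : Space d × ℝ → ℝ} {z : Space d × ℝ} (h : DifferentiableAt ℝ φ z)
    (e : Space d × ℝ) : ⟪grad φ z, WithLp.toLp 2 e⟫ = fderiv ℝ φ z e := by
  rw [real_inner_comm, inner_grad h]

theorem grad_eq_sum {φ : Space d × ℝ → ℝ} {z : Space d × ℝ} (h : DifferentiableAt ℝ φ z) :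
    grad φ z = ∑ i, fderiv ℝ φ z (frame i) • WithLp.toLp 2 (frame i) := by
  refine ext_inner_left ℝ fun G => ?_
  rw [inner_grad_eq_sum h, inner_sum]
  refine Finset.sum_congr rfl fun i _ => ?_
  rw [real_inner_smul_right, mul_comm]

theorem continuous_grad {φ : Space d × ℝ → ℝ} (h : ContDiff ℝ 1 φ) : Continuous (grad φ) := by
  have : grad φ = fun z => ∑ i, fderiv ℝ φ z (frame i) • WithLp.toLp 2 (frame i) :=
    funext fun z => grad_eq_sum (h.differentiable one_ne_zero z)
  rw [this]
  exact continuous_finsetSum _ fun i _ =>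
    ((h.continuous_fderiv one_ne_zero).clm_apply continuous_const).smul continuous_const

theorem grad_eq_zero_of_notMem {φ : Space d × ℝ → ℝ} (h : ContDiff ℝ 1 φ) {z : Space d × ℝ}
    (hz : z ∉ tsupport φ) : grad φ z = 0 := by
  rw [grad_eq_sum (h.differentiable one_ne_zero z)]
  have : fderiv ℝ φ z = 0 := image_eq_zero_of_notMem_tsupport fun hz' =>
    hz (tsupport_fderiv_subset ℝ hz')
  simp [this]

theorem tsupport_grad_subset {φ : Space d × ℝ → ℝ} (h : ContDiff ℝ 1 φ) :
    tsupport (grad φ) ⊆ tsupport φ :=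
  closure_minimal (fun _ hz => by_contra fun hz' => hz (grad_eq_zero_of_notMem h hz'))
    (isClosed_tsupport φ)

theorem hasFDerivAt_weight (s : ℝ) {z : Space d × ℝ} (hz : z ∈ halfSpace d) :
    HasFDerivAt (fun z : Space d × ℝ => z.2 ^ s)
      ((s * z.2 ^ (s - 1)) • ContinuousLinearMap.snd ℝ (Space d) ℝ) z :=
  (Real.hasDerivAt_rpow_const (Or.inl (ne_of_gt hz))).comp_hasFDerivAt z hasFDerivAt_snd

theorem contDiffOn_weight (s : ℝ) :
    ContDiffOn ℝ ∞ (fun z : Space d × ℝ => z.2 ^ s) (halfSpace d) := fun _ hz =>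
  ContDiffAt.contDiffWithinAt ((Real.contDiffAt_rpow_const_of_ne (ne_of_gt hz)).comp _ contDiffAt_snd)

theorem IsTestOn.weight_mul {φ : Space d × ℝ → ℝ} (h : IsTestOn (halfSpace d) φ) (s : ℝ) :
    IsTestOn (halfSpace d) fun z => z.2 ^ s * φ z :=
  h.contDiffOn_mul isOpen_halfSpace (contDiffOn_weight s)

theorem spatialOp_eq_sum {ψ : Space d × ℝ → ℝ} (hψ : ContDiff ℝ ∞ ψ) (z : Space d × ℝ) :
    spatialOp α ψ z = ∑ i, fderiv ℝ (fun z => fderiv ℝ ψ z (frame i)) z (frame i) +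
      (1 - 2 * α) / z.2 * fderiv ℝ ψ z (frame none) := by
  have hy : ∀ y, HasDerivAt (fun y : ℝ => (z.1, y)) (frame none) y := fun y =>
    (hasDerivAt_const y z.1).prodMk (hasDerivAt_id y)
  rw [spatialOp, laplacian_comp_affine hψ (A := fun x => (x, z.2))
    (fun x => hasFDerivAt_prodMk_left x z.2), iteratedDeriv_two_comp_affine hψ hy,
    deriv_comp_affine hψ hy, Fintype.sum_option]
  simp only [ContinuousLinearMap.inl_apply, frame, Prod.mk.eta]
  ring

/-- The divergence form `y^{1-2α} (Δ_x ψ + ψ_yy + ((1-2α)/y) ψ_y) = div (y^{1-2α} ∇ψ)`. -/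
theorem weight_mul_spatialOp {ψ : Space d × ℝ → ℝ} (hψ : ContDiff ℝ ∞ ψ) {z : Space d × ℝ}
    (hz : z ∈ halfSpace d) : z.2 ^ (1 - 2 * α) * spatialOp α ψ z =
      ∑ i, fderiv ℝ (fun z => z.2 ^ (1 - 2 * α) * fderiv ℝ ψ z (frame i)) z (frame i) := by
  have hz0 : 0 < z.2 := hz
  have h : ∀ i, fderiv ℝ (fun z => z.2 ^ (1 - 2 * α) * fderiv ℝ ψ z (frame i)) z (frame i) =
      z.2 ^ (1 - 2 * α) * fderiv ℝ (fun z => fderiv ℝ ψ z (frame i)) z (frame i) +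
        (1 - 2 * α) * z.2 ^ (1 - 2 * α - 1) * (frame i).2 * fderiv ℝ ψ z (frame i) := by
    intro i
    have hd : DifferentiableAt ℝ (fun z => fderiv ℝ ψ z (frame i)) z :=
      ((hψ.fderiv_right (m := ∞) (by simp)).clm_apply contDiff_const).differentiable (by simp) z
    have hm : HasFDerivAt (fun z => z.2 ^ (1 - 2 * α) * fderiv ℝ ψ z (frame i)) _ z :=
      (hasFDerivAt_weight (1 - 2 * α) hz).mul hd.hasFDerivAt
    rw [hm.fderiv]
    simp
    ring
  simp_rw [h]
  rw [spatialOp_eq_sum hψ, mul_add, Finset.mul_sum, Finset.sum_add_distrib]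
  congr 1
  rw [Fintype.sum_option, Real.rpow_sub_one hz0.ne']
  simp [frame]
  ring

end Calculus

/-! ### Weak gradients in the half-space -/

section WeakGradient

open scoped RealInnerProductSpace

variable {d : ℕ} {α : ℝ}

/-- `G` is the weak gradient of `v` in the open half-space. -/
structure IsWeakGrad (v : Space d × ℝ → ℝ) (G : Space d × ℝ → Grad d) : Prop where
  integrable : LocallyIntegrableOn v (halfSpace d) volume
  integrable_grad : LocallyIntegrableOn G (halfSpace d) volume
  eq : ∀ φ, IsTestOn (halfSpace d) φ → ∀ e : Space d × ℝ,
    ∫ z in halfSpace d, v z * fderiv ℝ φ z e =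
      -∫ z in halfSpace d, ⟪G z, WithLp.toLp 2 e⟫ * φ z

theorem locallyIntegrableOn_inner {G : Space d × ℝ → Grad d}
    (hG : LocallyIntegrableOn G (halfSpace d) volume) (c : Grad d) :
    LocallyIntegrableOn (fun z => ⟪G z, c⟫) (halfSpace d) volume := by
  have := ((innerSL ℝ) c).locallyIntegrableOn_comp hG
  simpa only [Function.comp_def, innerSL_apply_apply, real_inner_comm] using this

theorem IsWeakGrad.integrable_mul {v : Space d × ℝ → ℝ} {G : Space d × ℝ → Grad d}
    (h : IsWeakGrad v G) {φ : Space d × ℝ → ℝ} (hφ : IsTestOn (halfSpace d) φ) :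
    Integrable (fun z => v z * φ z) (volume.restrict (halfSpace d)) :=
  integrable_mul_of_locallyIntegrableOn h.integrable hφ.1.continuous hφ.2.1 hφ.2.2

theorem IsWeakGrad.integrable_inner_mul {v : Space d × ℝ → ℝ} {G : Space d × ℝ → Grad d}
    (h : IsWeakGrad v G) {φ : Space d × ℝ → ℝ} (hφ : IsTestOn (halfSpace d) φ) (c : Grad d) :
    Integrable (fun z => ⟪G z, c⟫ * φ z) (volume.restrict (halfSpace d)) :=
  integrable_mul_of_locallyIntegrableOn (locallyIntegrableOn_inner h.integrable_grad c)
    hφ.1.continuous hφ.2.1 hφ.2.2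

theorem isWeakGrad_of_contDiff {f : Space d × ℝ → ℝ} (hf : ContDiff ℝ 1 f) :
    IsWeakGrad f (grad f) where
  integrable := hf.continuous.locallyIntegrable.locallyIntegrableOn _
  integrable_grad := (continuous_grad hf).locallyIntegrable.locallyIntegrableOn _
  eq φ hφ e := by
    rw [setIntegral_mul_eq_of_isTestOn _ hφ, setIntegral_mul_eq_of_isTestOn _ (hφ.fderiv_apply e),
      Measure.volume_eq_prod, integral_mul_fderiv_of_isTestOn hf hφ]
    simp_rw [grad_inner (hf.differentiable one_ne_zero _)]

theorem IsWeakGrad.sub {v v' : Space d × ℝ → ℝ} {G G' : Space d × ℝ → Grad d}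
    (h : IsWeakGrad v G) (h' : IsWeakGrad v' G') :
    IsWeakGrad (fun z => v z - v' z) (fun z => G z - G' z) where
  integrable := h.integrable.sub h'.integrable
  integrable_grad := h.integrable_grad.sub h'.integrable_grad
  eq φ hφ e := by
    simp only [sub_mul, inner_sub_left]
    rw [integral_sub (h.integrable_mul (hφ.fderiv_apply e)) (h'.integrable_mul (hφ.fderiv_apply e)),
      integral_sub (h.integrable_inner_mul hφ _) (h'.integrable_inner_mul hφ _), h.eq φ hφ e,
      h'.eq φ hφ e]
    ring

theorem IsWeakGrad.add {v v' : Space d × ℝ → ℝ} {G G' : Space d × ℝ → Grad d}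
    (h : IsWeakGrad v G) (h' : IsWeakGrad v' G') :
    IsWeakGrad (fun z => v z + v' z) (fun z => G z + G' z) where
  integrable := h.integrable.add h'.integrable
  integrable_grad := h.integrable_grad.add h'.integrable_grad
  eq φ hφ e := by
    simp only [add_mul, inner_add_left]
    rw [integral_add (h.integrable_mul (hφ.fderiv_apply e)) (h'.integrable_mul (hφ.fderiv_apply e)),
      integral_add (h.integrable_inner_mul hφ _) (h'.integrable_inner_mul hφ _), h.eq φ hφ e,
      h'.eq φ hφ e]
    ring

theorem eq_zero_of_inner_frame_eq_zero {G : Grad d}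
    (h : ∀ i, ⟪G, WithLp.toLp 2 (frame i)⟫ = 0) : G = 0 := by
  have := sum_inner_frame G
  simp only [h, zero_smul, Finset.sum_const_zero] at this
  exact (WithLp.ofLp_injective 2) this.symm

theorem IsWeakGrad.unique {v : Space d × ℝ → ℝ} {G G' : Space d × ℝ → Grad d}
    (h : IsWeakGrad v G) (h' : IsWeakGrad v G') : G =ᵐ[volume.restrict (halfSpace d)] G' := by
  have key : ∀ i : Option (Fin d), ∀ᵐ z ∂volume.restrict (halfSpace d),
      ⟪G z - G' z, WithLp.toLp 2 (frame i)⟫ = 0 := by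
    intro i
    rw [ae_restrict_iff' isOpen_halfSpace.measurableSet]
    refine IsOpen.ae_eq_zero_of_integral_contDiff_smul_eq_zero isOpen_halfSpace
      (locallyIntegrableOn_inner (h.integrable_grad.sub h'.integrable_grad) _)
      fun g hg hgc hgU => ?_
    have ht : IsTestOn (halfSpace d) g := ⟨hg, hgc, hgU⟩
    have h1 := (h.sub h').eq g ht (frame i)
    simp only [sub_self, zero_mul, integral_zero] at h1
    rw [setIntegral_mul_eq_of_isTestOn _ ht, zero_eq_neg] at h1
    rw [← h1]
    refine integral_congr_ae (Eventually.of_forall fun z => ?_)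
    simp [mul_comm]
  rw [← ae_all_iff] at key
  filter_upwards [key] with z hz
  exact sub_eq_zero.1 (eq_zero_of_inner_frame_eq_zero hz)

/-- The weak gradient of an element of `Ḣ¹_α`. -/
theorem HasHomGrad.isWeakGrad {v : Space d × ℝ → ℝ} {G : Space d × ℝ → Grad d}
    (h : HasHomGrad α v G) : IsWeakGrad v G := by
  obtain ⟨hv, hG, φ, hφ, hlimG, hlim⟩ := h
  refine ⟨hv, locallyIntegrableOn_halfSpace hG, fun ψ hψ e => ?_⟩
  have hw : ∀ m, IsWeakGrad (φ m) (grad (φ m)) := fun m =>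
    isWeakGrad_of_contDiff ((hφ m).1.of_le (by simp))
  have h1 := tendsto_setIntegral_mul_of_isTestOn (m := volume) (fun m => (hw m).integrable) hv
    (hψ.fderiv_apply e) (hlim _ (hψ.fderiv_apply e).2.1 (hψ.fderiv_apply e).2.2)
  have h2 := tendsto_setIntegral_mul_of_isTestOn (m := volume)
    (f := fun m z => ⟪grad (φ m) z, WithLp.toLp 2 e⟫) (g := fun z => ⟪G z, WithLp.toLp 2 e⟫)
    (fun m => locallyIntegrableOn_inner (hw m).integrable_grad _)
    (locallyIntegrableOn_inner (locallyIntegrableOn_halfSpace hG) _) hψ ?_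
  · refine tendsto_nhds_unique h1 (h2.neg.congr fun m => ?_)
    exact ((hw m).eq ψ hψ e).symm
  · obtain ⟨c, hc, hle⟩ := exists_lintegral_le_eLpNorm (F := Grad d) (α := α) hψ.2.1 hψ.2.2
    have h0 := ENNReal.Tendsto.const_mul hlimG
      (a := ‖(WithLp.toLp 2 e : Grad d)‖ₑ * c)
      (Or.inr (ENNReal.mul_ne_top enorm_ne_top hc))
    rw [mul_zero] at h0
    refine tendsto_of_tendsto_of_tendsto_of_le_of_le tendsto_const_nhds h0 (fun _ => zero_le)
      fun m => ?_
    have hm : AEStronglyMeasurable (fun z => grad (φ m) z - G z) (wMeasure d α) :=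
      (continuous_grad ((hφ m).1.of_le (by simp))).aestronglyMeasurable.sub hG.1
    simp only [mul_assoc]
    refine le_trans ?_ (mul_le_mul_right (hle _ hm) _)
    rw [← lintegral_const_mul' _ _ enorm_ne_top]
    refine lintegral_mono fun z => ?_
    rw [← inner_sub_left, mul_comm]
    rw [← ofReal_norm, ← ofReal_norm, ← ofReal_norm, ← ENNReal.ofReal_mul (norm_nonneg _)]
    exact ENNReal.ofReal_le_ofReal (norm_inner_le_norm _ _)

/-- The weak form of the operator `Δ_x + ∂_yy + ((1 - 2α) / y) ∂_y`. -/
theorem IsWeakGrad.integral_mul_spatialOp {v : Space d × ℝ → ℝ} {G : Space d × ℝ → Grad d}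
    (h : IsWeakGrad v G) {ψ : Space d × ℝ → ℝ} (hψ : IsTestOn (halfSpace d) ψ) :
    ∫ z, v z * spatialOp α ψ z ∂wMeasure d α = -∫ z, ⟪G z, grad ψ z⟫ ∂wMeasure d α := by
  have ht : ∀ i, IsTestOn (halfSpace d) fun z => z.2 ^ (1 - 2 * α) * fderiv ℝ ψ z (frame i) :=
    fun i => (hψ.fderiv_apply (frame i)).weight_mul _
  rw [integral_wMeasure, integral_wMeasure]
  have e1 : ∫ z in halfSpace d, z.2 ^ (1 - 2 * α) • (v z * spatialOp α ψ z) =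
      ∑ i, ∫ z in halfSpace d, v z *
        fderiv ℝ (fun z => z.2 ^ (1 - 2 * α) * fderiv ℝ ψ z (frame i)) z (frame i) := by
    rw [← integral_finsetSum _ fun i _ => h.integrable_mul ((ht i).fderiv_apply _)]
    refine setIntegral_congr_fun isOpen_halfSpace.measurableSet fun z hz => ?_
    simp only [smul_eq_mul]
    rw [← Finset.mul_sum, ← weight_mul_spatialOp hψ.1 hz]
    ring
  have e2 : ∫ z in halfSpace d, z.2 ^ (1 - 2 * α) • ⟪G z, grad ψ z⟫ =
      ∑ i, ∫ z in halfSpace d, ⟪G z, WithLp.toLp 2 (frame i)⟫ *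
        (z.2 ^ (1 - 2 * α) * fderiv ℝ ψ z (frame i)) := by
    rw [← integral_finsetSum _ fun i _ => h.integrable_inner_mul (ht i) _]
    refine setIntegral_congr_fun isOpen_halfSpace.measurableSet fun z _ => ?_
    simp only [smul_eq_mul]
    rw [inner_grad_eq_sum (hψ.1.differentiable (by simp) z), Finset.mul_sum]
    exact Finset.sum_congr rfl fun i _ => by ring
  rw [e1, e2, ← Finset.sum_neg_distrib]
  exact Finset.sum_congr rfl fun i _ => h.eq _ (ht i) _

/-- The operator `Δ_x + ∂_yy + ((1 - 2α) / y) ∂_y` is symmetric with respect to the weight. -/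
theorem integral_mul_spatialOp_comm {f ψ : Space d × ℝ → ℝ} (hf : ContDiff ℝ ∞ f)
    (hψ : IsTestOn (halfSpace d) ψ) :
    ∫ z, f z * spatialOp α ψ z ∂wMeasure d α = ∫ z, spatialOp α f z * ψ z ∂wMeasure d α := by
  have hfi : ∀ i : Option (Fin d), ContDiff ℝ ∞ fun z => fderiv ℝ f z (frame i) := fun i =>
    (hf.fderiv_right (m := ∞) (by simp)).clm_apply contDiff_const
  have hfw := fun i => isWeakGrad_of_contDiff ((hfi i).of_le (m := 1) (by simp))
  have hω := hψ.weight_mul (1 - 2 * α)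
  have hω' := (hψ.weight_mul (1 - 2 * α - 1)).const_mul (1 - 2 * α)
  rw [(isWeakGrad_of_contDiff (hf.of_le (m := 1) (by simp))).integral_mul_spatialOp hψ,
    integral_wMeasure, integral_wMeasure]
  have e1 : ∀ z ∈ halfSpace d, z.2 ^ (1 - 2 * α) • ⟪grad f z, grad ψ z⟫ =
      ∑ i, fderiv ℝ f z (frame i) *
          fderiv ℝ (fun z => z.2 ^ (1 - 2 * α) * ψ z) z (frame i) -
        fderiv ℝ f z (frame none) * ((1 - 2 * α) * (z.2 ^ (1 - 2 * α - 1) * ψ z)) := by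
    intro z hz
    have hm : HasFDerivAt (fun z => z.2 ^ (1 - 2 * α) * ψ z) _ z :=
      (hasFDerivAt_weight (1 - 2 * α) hz).mul (hψ.1.differentiable (by simp) z).hasFDerivAt
    rw [inner_grad_eq_sum (hψ.1.differentiable (by simp) z), Fintype.sum_option,
      Fintype.sum_option, hm.fderiv]
    simp only [grad_inner (hf.differentiable (by simp) z)]
    simp [frame, mul_add, Finset.mul_sum, mul_left_comm]
    ring
  have e2 : ∀ z ∈ halfSpace d, z.2 ^ (1 - 2 * α) • (spatialOp α f z * ψ z) =
      ∑ i, fderiv ℝ (fun z => fderiv ℝ f z (frame i)) z (frame i) *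
          (z.2 ^ (1 - 2 * α) * ψ z) +
        fderiv ℝ f z (frame none) * ((1 - 2 * α) * (z.2 ^ (1 - 2 * α - 1) * ψ z)) := by
    intro z hz
    have hz0 : 0 < z.2 := hz
    rw [spatialOp_eq_sum hf, Real.rpow_sub_one hz0.ne', ← Finset.sum_mul, smul_eq_mul]
    ring
  rw [setIntegral_congr_fun isOpen_halfSpace.measurableSet e1,
    setIntegral_congr_fun isOpen_halfSpace.measurableSet e2,
    integral_sub (integrable_finsetSum _ fun i _ =>
      (hfw i).integrable_mul (hω.fderiv_apply _)) ((hfw none).integrable_mul hω'),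
    integral_add (integrable_finsetSum _ fun i _ => integrable_mul_of_locallyIntegrableOn
      ((((hfi i).fderiv_right (m := ∞) (by simp)).clm_apply
        contDiff_const).continuous.locallyIntegrable.locallyIntegrableOn _)
        hω.1.continuous hω.2.1 hω.2.2) ((hfw none).integrable_mul hω'),
    integral_finsetSum _ fun i _ => (hfw i).integrable_mul (hω.fderiv_apply _),
    integral_finsetSum _ fun i _ => integrable_mul_of_locallyIntegrableOn
      ((((hfi i).fderiv_right (m := ∞) (by simp)).clm_apply
        contDiff_const).continuous.locallyIntegrable.locallyIntegrableOn _)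
        hω.1.continuous hω.2.1 hω.2.2, neg_sub, sub_eq_add_neg, add_comm,
    ← Finset.sum_neg_distrib]
  congr 1
  refine Finset.sum_congr rfl fun i _ => ?_
  rw [(hfw i).eq _ hω, neg_neg]
  simp_rw [grad_inner ((hfi i).differentiable (by simp) _)]

end WeakGradient

/-! ### The energy space and Hardy's inequality -/

section EnergySpace

open scoped RealInnerProductSpace

variable {d : ℕ} {α : ℝ}

theorem eLpNorm_two_eq_ofReal_sqrt {X F : Type*} [MeasurableSpace X] {m : Measure X}
    [NormedAddCommGroup F] {f : X → F} (hf : MemLp f 2 m) :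
    eLpNorm f 2 m = ENNReal.ofReal √(∫ x, ‖f x‖ ^ 2 ∂m) := by
  rw [hf.eLpNorm_eq_integral_rpow_norm two_ne_zero ENNReal.ofNat_ne_top, Real.sqrt_eq_rpow]
  simp

theorem integrable_norm_sq {X F : Type*} [MeasurableSpace X] {m : Measure X}
    [NormedAddCommGroup F] {f : X → F} (hf : MemLp f 2 m) :
    Integrable (fun x => ‖f x‖ ^ 2) m := by
  simpa using hf.integrable_norm_rpow two_ne_zero ENNReal.ofNat_ne_top

theorem grad_add {φ ψ : Space d × ℝ → ℝ} {z : Space d × ℝ} (hφ : DifferentiableAt ℝ φ z)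
    (hψ : DifferentiableAt ℝ ψ z) : grad (φ + ψ) z = grad φ z + grad ψ z := by
  rw [grad_eq_sum hφ, grad_eq_sum hψ, grad_eq_sum (hφ.add hψ), fderiv_add hφ hψ,
    ← Finset.sum_add_distrib]
  simp [add_smul]

theorem grad_const_mul {φ : Space d × ℝ → ℝ} {z : Space d × ℝ} (hφ : DifferentiableAt ℝ φ z)
    (c : ℝ) : grad (fun z => c * φ z) z = c • grad φ z := by
  rw [grad_eq_sum hφ, grad_eq_sum (hφ.const_mul c), fderiv_const_mul hφ, Finset.smul_sum]
  simp [smul_smul]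

/-- The graph of the gradient on the test functions of the open half-space. -/
noncomputable def testGraph (d : ℕ) (α : ℝ) :
    Submodule ℝ (WithLp 2 (Lp ℝ 2 (wMeasure d α) × Lp (Grad d) 2 (wMeasure d α))) where
  carrier := {p | ∃ φ, IsTestOn (halfSpace d) φ ∧ p.fst =ᵐ[wMeasure d α] φ ∧
    p.snd =ᵐ[wMeasure d α] grad φ}
  zero_mem' := by
    refine ⟨0, ⟨contDiff_const, HasCompactSupport.zero, by simp⟩, Lp.coeFn_zero _ _ _, ?_⟩
    filter_upwards [Lp.coeFn_zero (Grad d) 2 (wMeasure d α)] with z hz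
    have : grad (0 : Space d × ℝ → ℝ) z = 0 := by
      rw [grad_eq_sum (φ := 0) (differentiableAt_const 0)]
      simp
    rw [this]
    exact hz
  add_mem' := by
    rintro p q ⟨φ, hφ, h1, h2⟩ ⟨ψ, hψ, h3, h4⟩
    refine ⟨φ + ψ, hφ.add hψ, ?_, ?_⟩
    · filter_upwards [h1, h3, Lp.coeFn_add p.fst q.fst] with z e1 e3 e
      rw [WithLp.add_fst, e, Pi.add_apply, e1, e3, Pi.add_apply]
    · filter_upwards [h2, h4, Lp.coeFn_add p.snd q.snd] with z e1 e3 e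
      rw [WithLp.add_snd, e, Pi.add_apply, e1, e3,
        grad_add (hφ.1.differentiable (by simp) z) (hψ.1.differentiable (by simp) z)]
  smul_mem' := by
    rintro c p ⟨φ, hφ, h1, h2⟩
    refine ⟨_, hφ.const_mul c, ?_, ?_⟩
    · filter_upwards [h1, Lp.coeFn_smul c p.fst] with z e1 e
      rw [WithLp.smul_fst, e, Pi.smul_apply, e1, smul_eq_mul]
    · filter_upwards [h2, Lp.coeFn_smul c p.snd] with z e1 e
      rw [WithLp.smul_snd, e, Pi.smul_apply, e1,
        grad_const_mul (hφ.1.differentiable (by simp) z)]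

/-- The energy space: the closure, in the graph norm of the gradient, of the test functions of the
open half-space. Its elements are pairs of a function in `L²_α` with its gradient. -/
noncomputable def energySpace (d : ℕ) (α : ℝ) :
    Submodule ℝ (WithLp 2 (Lp ℝ 2 (wMeasure d α) × Lp (Grad d) 2 (wMeasure d α))) :=
  (testGraph d α).topologicalClosure

instance : CompleteSpace (energySpace d α) :=
  (Submodule.isClosed_topologicalClosure _).completeSpace_coe

theorem IsTestOn.memLp {φ : Space d × ℝ → ℝ} (h : IsTestOn (halfSpace d) φ) :
    MemLp φ 2 (wMeasure d α) :=
  memLp_wMeasure_of_hasCompactSupport h.1.continuous h.2.1 h.2.2 2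

theorem IsTestOn.memLp_grad {φ : Space d × ℝ → ℝ} (h : IsTestOn (halfSpace d) φ) :
    MemLp (grad φ) 2 (wMeasure d α) := by
  have h1 : ContDiff ℝ 1 φ := h.1.of_le (by simp)
  exact memLp_wMeasure_of_hasCompactSupport (continuous_grad h1)
    (h.2.1.of_isClosed_subset (isClosed_tsupport _) (tsupport_grad_subset h1))
    ((tsupport_grad_subset h1).trans h.2.2) 2

theorem IsTestOn.mem_testGraph {φ : Space d × ℝ → ℝ} (h : IsTestOn (halfSpace d) φ) :
    WithLp.toLp 2 (h.memLp.toLp φ, h.memLp_grad.toLp (grad φ)) ∈ testGraph d α :=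
  ⟨φ, h, h.memLp.coeFn_toLp, h.memLp_grad.coeFn_toLp⟩

theorem IsTestOn.mem_energySpace {φ : Space d × ℝ → ℝ} (h : IsTestOn (halfSpace d) φ) :
    WithLp.toLp 2 (h.memLp.toLp φ, h.memLp_grad.toLp (grad φ)) ∈ energySpace d α :=
  Submodule.le_topologicalClosure _ h.mem_testGraph

theorem exists_seq_of_mem_energySpace
    {p : WithLp 2 (Lp ℝ 2 (wMeasure d α) × Lp (Grad d) 2 (wMeasure d α))}
    (hp : p ∈ energySpace d α) :
    ∃ φ : ℕ → Space d × ℝ → ℝ, (∀ m, IsTestOn (halfSpace d) (φ m)) ∧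
      Tendsto (fun m => eLpNorm (fun z => φ m z - p.fst z) 2 (wMeasure d α)) atTop (𝓝 0) ∧
      Tendsto (fun m => eLpNorm (fun z => grad (φ m) z - p.snd z) 2 (wMeasure d α)) atTop
        (𝓝 0) := by
  obtain ⟨q, hq, hlim⟩ := mem_closure_iff_seq_limit.1 hp
  choose φ hφ h1 h2 using hq
  refine ⟨φ, hφ, ?_, ?_⟩
  · have hc := ((WithLp.prod_continuous_ofLp 2 _ _).fst.tendsto p).comp hlim
    refine (Lp.tendsto_Lp_iff_tendsto_eLpNorm' _ _).1 hc |>.congr fun m => ?_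
    exact eLpNorm_congr_ae ((h1 m).mono fun z hz => by
      simp only [Pi.sub_apply, Function.comp_apply]; exact congrArg (· - _) hz)
  · have hc := ((WithLp.prod_continuous_ofLp 2 _ _).snd.tendsto p).comp hlim
    refine (Lp.tendsto_Lp_iff_tendsto_eLpNorm' _ _).1 hc |>.congr fun m => ?_
    exact eLpNorm_congr_ae ((h2 m).mono fun z hz => by
      simp only [Pi.sub_apply, Function.comp_apply]; exact congrArg (· - _) hz)

theorem toLp_mem_energySpace_of_seq {v : Space d × ℝ → ℝ} {G : Space d × ℝ → Grad d}
    (hv : MemLp v 2 (wMeasure d α)) (hG : MemLp G 2 (wMeasure d α))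
    {q : ℕ → WithLp 2 (Lp ℝ 2 (wMeasure d α) × Lp (Grad d) 2 (wMeasure d α))}
    (hq : ∀ m, q m ∈ energySpace d α)
    (h1 : Tendsto (fun m => eLpNorm (fun z => (q m).fst z - v z) 2 (wMeasure d α)) atTop (𝓝 0))
    (h2 : Tendsto (fun m => eLpNorm (fun z => (q m).snd z - G z) 2 (wMeasure d α)) atTop
      (𝓝 0)) :
    WithLp.toLp 2 (hv.toLp v, hG.toLp G) ∈ energySpace d α := by
  refine (Submodule.isClosed_topologicalClosure (testGraph d α)).mem_of_tendsto
    (b := atTop) (f := q) ?_ (Eventually.of_forall hq)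
  have e1 : Tendsto (fun m => (q m).fst) atTop (𝓝 (hv.toLp v)) := by
    refine (Lp.tendsto_Lp_iff_tendsto_eLpNorm' _ _).2 (h1.congr fun m => ?_)
    exact eLpNorm_congr_ae (hv.coeFn_toLp.mono fun z hz => by
      simp only [Pi.sub_apply]; rw [hz])
  have e2 : Tendsto (fun m => (q m).snd) atTop (𝓝 (hG.toLp G)) := by
    refine (Lp.tendsto_Lp_iff_tendsto_eLpNorm' _ _).2 (h2.congr fun m => ?_)
    exact eLpNorm_congr_ae (hG.coeFn_toLp.mono fun z hz => by
      simp only [Pi.sub_apply]; rw [hz])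
  exact ((WithLp.prod_continuous_toLp 2 _ _).tendsto _).comp (e1.prodMk_nhds e2)

/-- Elements of the energy space belong to `Ḣ¹_α`. -/
theorem hasHomGrad_of_mem_energySpace
    {p : WithLp 2 (Lp ℝ 2 (wMeasure d α) × Lp (Grad d) 2 (wMeasure d α))}
    (hp : p ∈ energySpace d α) {v : Space d × ℝ → ℝ} {G : Space d × ℝ → Grad d}
    (hv : v =ᵐ[wMeasure d α] p.fst) (hG : G =ᵐ[wMeasure d α] p.snd) : HasHomGrad α v G := by
  obtain ⟨φ, hφ, h1, h2⟩ := exists_seq_of_mem_energySpace hp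
  have hvm : MemLp v 2 (wMeasure d α) := (memLp_congr_ae hv).2 (Lp.memLp _)
  have hGm : MemLp G 2 (wMeasure d α) := (memLp_congr_ae hG).2 (Lp.memLp _)
  refine ⟨locallyIntegrableOn_halfSpace hvm, hGm, φ, fun m => ⟨(hφ m).1, (hφ m).2.1⟩,
    h2.congr fun m => eLpNorm_congr_ae (hG.mono fun z hz => by simp only [hz]),
    fun K hK hKU => ?_⟩
  obtain ⟨c, hc, hle⟩ := exists_lintegral_le_eLpNorm (F := ℝ) (α := α) hK hKU
  have h0 := ENNReal.Tendsto.const_mul h1 (a := c) (Or.inr hc)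
  rw [mul_zero] at h0
  refine tendsto_of_tendsto_of_tendsto_of_le_of_le tendsto_const_nhds h0 (fun _ => zero_le)
    fun m => (hle _ ((hφ m).1.continuous.aestronglyMeasurable.sub hvm.1)).trans ?_
  gcongr
  exact (eLpNorm_congr_ae (hv.mono fun z hz => by simp only [Pi.sub_apply, hz])).le

theorem norm_fderiv_frame_le {φ : Space d × ℝ → ℝ} {z : Space d × ℝ}
    (h : DifferentiableAt ℝ φ z) : |fderiv ℝ φ z (frame none)| ≤ ‖grad φ z‖ := by
  rw [← grad_inner h]
  refine (abs_real_inner_le_norm _ _).trans (mul_le_of_le_one_right (norm_nonneg _) ?_)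
  rw [← sq_le_one_iff₀ (norm_nonneg _), WithLp.prod_norm_sq_eq_of_L2]
  simp [frame]

/-- Hardy's inequality for test functions. -/
theorem hardy_of_isTestOn (hα : 0 < α) {φ : Space d × ℝ → ℝ} (h : IsTestOn (halfSpace d) φ) :
    eLpNorm (fun z => z.2⁻¹ * φ z) 2 (wMeasure d α) ≤
      ENNReal.ofReal α⁻¹ * eLpNorm (grad φ) 2 (wMeasure d α) := by
  have hinv : IsTestOn (halfSpace d) fun z => z.2⁻¹ * φ z :=
    h.contDiffOn_mul isOpen_halfSpace fun z hz =>
      ContDiffAt.contDiffWithinAt (contDiffAt_snd.inv (ne_of_gt hz))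
  set D : Space d × ℝ → ℝ := fun z => fderiv ℝ φ z (frame none) with hD
  have hDt : IsTestOn (halfSpace d) D := h.fderiv_apply _
  have hw := isWeakGrad_of_contDiff (h.1.of_le (m := 1) (by simp))
  have hwD := isWeakGrad_of_contDiff (hDt.1.of_le (m := 1) (by simp))
  set a := ∫ z in halfSpace d, φ z * (z.2 ^ (-(2 * α) - 1) * φ z) with ha
  set b := ∫ z in halfSpace d, D z * (z.2 ^ (1 - 2 * α) * D z) with hb
  set c := ∫ z in halfSpace d, D z * (z.2 ^ (-(2 * α)) * φ z) with hc
  have ia := hw.integrable_mul (h.weight_mul (-(2 * α) - 1))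
  have ib := hwD.integrable_mul (hDt.weight_mul (1 - 2 * α))
  have ic := hwD.integrable_mul (h.weight_mul (-(2 * α)))
  -- integrate by parts the normal derivative in `y ^ (-2α) φ²`
  have hac : α * a = c := by
    have h1 := hw.eq _ (h.weight_mul (-(2 * α))) (frame none)
    simp only [grad_inner (h.1.differentiable (by simp) _)] at h1
    have h2 : ∫ z in halfSpace d, φ z *
        fderiv ℝ (fun z => z.2 ^ (-(2 * α)) * φ z) z (frame none) = -(2 * α) * a + c := by
      rw [ha, hc, ← integral_const_mul, ← integral_add (ia.const_mul _) ic]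
      refine setIntegral_congr_fun isOpen_halfSpace.measurableSet fun z hz => ?_
      have hm : HasFDerivAt (fun z => z.2 ^ (-(2 * α)) * φ z) _ z :=
        (hasFDerivAt_weight (-(2 * α)) hz).mul (h.1.differentiable (by simp) z).hasFDerivAt
      simp only [hm.fderiv]
      simp [frame, hD]
      ring
    rw [h2] at h1
    change -(2 * α) * a + c = -c at h1
    linarith
  -- `2 φ φ_y ≤ α y⁻¹ φ² + α⁻¹ y φ_y²`, weighted with `y ^ (-2α)`
  have hcab : c ≤ α / 2 * a + (2 * α)⁻¹ * b := by
    rw [ha, hb, hc, ← integral_const_mul, ← integral_const_mul,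
      ← integral_add (ia.const_mul _) (ib.const_mul _)]
    refine setIntegral_mono_on ic ((ia.const_mul _).add (ib.const_mul _))
      isOpen_halfSpace.measurableSet fun z hz => ?_
    have hz0 : 0 < z.2 := hz
    have e1 : z.2 ^ (-(2 * α) - 1) = z.2 ^ (-(2 * α)) * z.2⁻¹ := by
      rw [Real.rpow_sub_one hz0.ne', div_eq_mul_inv]
    have e2 : z.2 ^ (1 - 2 * α) = z.2 ^ (-(2 * α)) * z.2 := by
      rw [show 1 - 2 * α = -(2 * α) + 1 by ring, Real.rpow_add_one hz0.ne']
    have hp : 0 < z.2 ^ (-(2 * α)) := Real.rpow_pos_of_pos hz0 _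
    rw [e1, e2, ← sub_nonneg]
    have : α / 2 * (φ z * (z.2 ^ (-(2 * α)) * z.2⁻¹ * φ z)) +
        (2 * α)⁻¹ * (D z * (z.2 ^ (-(2 * α)) * z.2 * D z)) -
        D z * (z.2 ^ (-(2 * α)) * φ z) =
        z.2 ^ (-(2 * α)) * z.2 * ((2 * α)⁻¹ * (α * φ z * z.2⁻¹ - D z) ^ 2) := by
      field_simp
      ring
    rw [this]
    positivity
  have hab : a ≤ α⁻¹ ^ 2 * b := by
    have : α * a ≤ α / 2 * a + (2 * α)⁻¹ * b := hac ▸ hcab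
    have h2 : α ^ 2 * a ≤ b := by
      have := mul_le_mul_of_nonneg_left this (by positivity : 0 ≤ 2 * α)
      field_simp at this
      nlinarith
    rw [inv_pow, ← div_eq_inv_mul, le_div_iff₀ (by positivity)]
    linarith
  have eL : ∫ z, ‖z.2⁻¹ * φ z‖ ^ 2 ∂wMeasure d α = a := by
    rw [integral_wMeasure]
    refine setIntegral_congr_fun isOpen_halfSpace.measurableSet fun z hz => ?_
    have hz0 : 0 < z.2 := hz
    rw [show 1 - 2 * α = -(2 * α) - 1 + 1 + 1 by ring, Real.rpow_add_one hz0.ne',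
      Real.rpow_add_one hz0.ne', Real.norm_eq_abs, sq_abs, smul_eq_mul]
    field_simp
  have eR : b ≤ ∫ z, ‖grad φ z‖ ^ 2 ∂wMeasure d α := by
    have hint : ∫ z, ‖D z‖ ^ 2 ∂wMeasure d α = b := by
      rw [integral_wMeasure]
      refine setIntegral_congr_fun isOpen_halfSpace.measurableSet fun z hz => ?_
      rw [Real.norm_eq_abs, sq_abs, smul_eq_mul]
      ring
    rw [← hint]
    refine integral_mono (integrable_norm_sq hDt.memLp) (integrable_norm_sq h.memLp_grad)
      fun z => ?_
    have := norm_fderiv_frame_le (h.1.differentiable (by simp) z)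
    simp only [Real.norm_eq_abs]
    gcongr
  rw [eLpNorm_two_eq_ofReal_sqrt hinv.memLp, eLpNorm_two_eq_ofReal_sqrt h.memLp_grad,
    ← ENNReal.ofReal_mul (by positivity), eL]
  refine ENNReal.ofReal_le_ofReal ?_
  rw [← Real.sqrt_sq (inv_nonneg.2 hα.le), ← Real.sqrt_mul (sq_nonneg _)]
  refine Real.sqrt_le_sqrt (hab.trans ?_)
  gcongr

/-- Hardy's inequality in the energy space. -/
theorem hardy_of_mem_energySpace (hα : 0 < α)
    {p : WithLp 2 (Lp ℝ 2 (wMeasure d α) × Lp (Grad d) 2 (wMeasure d α))}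
    (hp : p ∈ energySpace d α) : eLpNorm (fun z => z.2⁻¹ * p.fst z) 2 (wMeasure d α) ≤
      ENNReal.ofReal α⁻¹ * eLpNorm p.snd 2 (wMeasure d α) := by
  obtain ⟨φ, hφ, h1, h2⟩ := exists_seq_of_mem_energySpace hp
  have hin : TendstoInMeasure (wMeasure d α) φ atTop p.fst :=
    tendstoInMeasure_of_tendsto_eLpNorm two_ne_zero
      (fun m => (hφ m).1.continuous.aestronglyMeasurable) (Lp.aestronglyMeasurable _) h1
  -- a subsequence of test functions converges almost everywhere; apply Fatou to it
  obtain ⟨ns, hns, hae⟩ := hin.exists_seq_tendsto_ae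
  have hm : Measurable fun z : Space d × ℝ => z.2⁻¹ := by fun_prop
  refine (Lp.eLpNorm_lim_le_liminf_eLpNorm (f := fun n z => z.2⁻¹ * φ (ns n) z)
    (fun n => hm.aestronglyMeasurable.mul (hφ _).1.continuous.aestronglyMeasurable) _
    (hae.mono fun z hz => hz.const_mul _)).trans ?_
  have hle : ∀ n, eLpNorm (fun z => z.2⁻¹ * φ (ns n) z) 2 (wMeasure d α) ≤
      ENNReal.ofReal α⁻¹ * (eLpNorm (fun z => grad (φ (ns n)) z - p.snd z) 2 (wMeasure d α) +
        eLpNorm p.snd 2 (wMeasure d α)) := by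
    intro n
    refine (hardy_of_isTestOn hα (hφ _)).trans ?_
    gcongr
    have h3 := eLpNorm_add_le (μ := wMeasure d α) (p := 2)
      (f := fun z => grad (φ (ns n)) z - p.snd z) (g := p.snd)
      ((hφ (ns n)).memLp_grad.1.sub (Lp.aestronglyMeasurable _)) (Lp.aestronglyMeasurable _)
      (by norm_num)
    refine le_trans (le_of_eq ?_) h3
    congr 1
    ext z
    simp
  have hlim := ENNReal.Tendsto.const_mul (a := ENNReal.ofReal α⁻¹)
    ((h2.comp hns.tendsto_atTop).add_const (eLpNorm p.snd 2 (wMeasure d α)))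
    (Or.inr ENNReal.ofReal_ne_top)
  rw [zero_add] at hlim
  rw [← hlim.liminf_eq]
  exact liminf_le_liminf (Eventually.of_forall hle)

end EnergySpace

/-! ### Curves of square-integrable functions -/

section Curves

variable {X : Type*} [MeasurableSpace X] {m : Measure X}

/-- A continuous curve of square-integrable functions has a jointly measurable representative. -/
theorem exists_jointly_measurable {F : Type*} [NormedAddCommGroup F] [CompleteSpace F]
    [SecondCountableTopology F] [MeasurableSpace F] [BorelSpace F]
    {V : ℝ → Lp F 2 m} (hV : Continuous V) :
    ∃ v : ℝ × X → F, StronglyMeasurable v ∧ ∀ t, (fun x => v (t, x)) =ᵐ[m] V t := by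
  classical
  set q : ℕ → ℝ := TopologicalSpace.denseSeq ℝ with hq
  -- `V t` is approximated by its values at points of a countable dense set of times, chosen
  -- measurably in `t`; errors `(1 / 4) ^ N` are summable, so the approximations converge almost
  -- everywhere
  have hex : ∀ (N : ℕ) (t : ℝ), ∃ n, ‖V t - V (q n)‖ < (1 / 4) ^ N := by
    intro N t
    have ho : IsOpen {s | ‖V t - V s‖ < (1 / 4 : ℝ) ^ N} :=
      isOpen_lt (by fun_prop) continuous_const
    exact (TopologicalSpace.denseRange_denseSeq ℝ).exists_mem_open ho ⟨t, by simp⟩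
  have hmeas : ∀ N, Measurable fun t => Nat.find (hex N t) := fun N =>
    measurable_find (hex N) fun n => (isOpen_lt (by fun_prop) continuous_const).measurableSet
  set f : ℕ → ℝ × X → F := fun N p => V (q (Nat.find (hex N p.1))) p.2 with hf
  have hfm : ∀ N, StronglyMeasurable (f N) := by
    intro N
    have h1 : Measurable fun p : ℕ × X => V (q p.1) p.2 :=
      measurable_from_prod_countable_right fun n => (Lp.stronglyMeasurable (V (q n))).measurable
    exact (h1.comp (((hmeas N).comp measurable_fst).prodMk measurable_snd)).stronglyMeasurable
  refine ⟨fun p => limUnder atTop fun N => f N p, StronglyMeasurable.limUnder hfm, fun t => ?_⟩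
  have hb : ∀ N, eLpNorm (fun x => f N (t, x) - V t x) 2 m ≤ ENNReal.ofReal ((1 / 4) ^ N) := by
    intro N
    have h1 := Nat.find_spec (hex N t)
    rw [norm_sub_rev, Lp.norm_def] at h1
    refine ((ENNReal.le_ofReal_iff_toReal_le (Lp.eLpNorm_ne_top _) (by positivity)).2 h1.le).trans'
      (le_of_eq (eLpNorm_congr_ae ?_))
    filter_upwards [Lp.coeFn_sub (V (q (Nat.find (hex N t)))) (V t)] with x hx
    rw [hx]
    rfl
  have hsm : ∀ N, AEStronglyMeasurable (fun x => f N (t, x)) m := fun N =>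
    Lp.aestronglyMeasurable (V (q (Nat.find (hex N t))))
  have hb2 : ∀ N n, N ≤ n →
      eLpNorm (fun x => f n (t, x) - V t x) 2 m ≤ ENNReal.ofReal ((1 / 4) ^ N) := fun N n hn =>
    (hb n).trans (ENNReal.ofReal_le_ofReal (pow_le_pow_of_le_one (by norm_num) (by norm_num) hn))
  have hlim0 : Tendsto (fun n => eLpNorm (fun x => f n (t, x) - V t x) 2 m) atTop (𝓝 0) := by
    have h1 : Tendsto (fun N : ℕ => ENNReal.ofReal ((1 / 4 : ℝ) ^ N)) atTop (𝓝 0) := by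
      rw [← ENNReal.ofReal_zero]
      exact ENNReal.tendsto_ofReal
        (tendsto_pow_atTop_nhds_zero_of_lt_one (by norm_num) (by norm_num))
    exact tendsto_of_tendsto_of_tendsto_of_le_of_le tendsto_const_nhds h1 (fun _ => zero_le) hb
  have hcau := Lp.ae_tendsto_of_cauchy_eLpNorm (μ := m) (p := 2) (f := fun N x => f N (t, x)) hsm
    (by norm_num) (B := fun N => ENNReal.ofReal (3 * (1 / 4) ^ N)) ?_ ?_
  · obtain ⟨ns, hns, hae⟩ := (tendstoInMeasure_of_tendsto_eLpNorm two_ne_zero hsm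
      (Lp.aestronglyMeasurable _) hlim0).exists_seq_tendsto_ae
    filter_upwards [hcau, hae] with x ⟨l, hl⟩ hx
    rw [← tendsto_nhds_unique (hl.comp hns.tendsto_atTop) hx]
    exact hl.limUnder_eq
  · have hs : Summable fun N : ℕ => 3 * (1 / 4 : ℝ) ^ N :=
      (summable_geometric_of_lt_one (by norm_num) (by norm_num)).mul_left 3
    exact hs.tsum_ofReal_ne_top
  · intro N n k hn hk
    have h1 := eLpNorm_sub_le (μ := m) (p := 2) (f := fun x => f n (t, x) - V t x)
      (g := fun x => f k (t, x) - V t x) ((hsm n).sub (Lp.aestronglyMeasurable _))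
      ((hsm k).sub (Lp.aestronglyMeasurable _)) (by norm_num)
    have h2 : ((fun x => f n (t, x) - V t x) - fun x => f k (t, x) - V t x) =
        (fun x => f n (t, x)) - fun x => f k (t, x) := by
      ext x
      simp
    rw [h2] at h1
    refine h1.trans_lt ((add_le_add (hb2 N n hn) (hb2 N k hk)).trans_lt ?_)
    rw [← ENNReal.ofReal_add (by positivity) (by positivity)]
    refine (ENNReal.ofReal_lt_ofReal_iff (by positivity)).2 ?_
    have : (0 : ℝ) < (1 / 4) ^ N := by positivity
    linarith

/-- A curve of functions that is differentiable pointwise, with a derivative that is Lipschitz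
continuous in time with a square-integrable constant, is differentiable in `L²`. -/
theorem hasDerivAt_toLp {f f₁ : ℝ → X → ℝ} {M : X → ℝ} (hf : ∀ t, MemLp (f t) 2 m)
    (hf₁ : ∀ t, MemLp (f₁ t) 2 m) (hM : MemLp M 2 m)
    (hd : ∀ t x, HasDerivAt (fun s => f s x) (f₁ t x) t)
    (hlip : ∀ t s x, |f₁ t x - f₁ s x| ≤ |t - s| * M x) (t : ℝ) :
    HasDerivAt (fun t => (hf t).toLp (f t)) ((hf₁ t).toLp (f₁ t)) t := by
  rw [hasDerivAt_iff_isLittleO]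
  -- the remainder in the Taylor expansion is quadratic in `s - t`, pointwise in `x`
  have hbound : ∀ s x, |f s x - f t x - (s - t) * f₁ t x| ≤ (s - t) ^ 2 * M x := by
    intro s x
    have h := (convex_uIcc t s).norm_image_sub_le_of_norm_hasDerivWithin_le
      (f := fun r => f r x - r * f₁ t x) (f' := fun r => f₁ r x - f₁ t x) (C := |s - t| * M x)
      (fun r _ => ((hd r x).sub (by simpa using (hasDerivAt_id r).mul_const (f₁ t x))).hasDerivWithinAt)
      (fun r hr => ?_) left_mem_uIcc right_mem_uIcc
    · have e : f s x - s * f₁ t x - (f t x - t * f₁ t x) = f s x - f t x - (s - t) * f₁ t x := by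
        ring
      rw [e, Real.norm_eq_abs, Real.norm_eq_abs] at h
      refine h.trans (le_of_eq ?_)
      rw [← sq_abs]
      ring
    · rw [Real.norm_eq_abs]
      have h1 := hlip r t x
      have h2 : |r - t| ≤ |s - t| := abs_sub_left_of_mem_uIcc hr
      have hM0 : 0 ≤ M x := by
        have := (abs_nonneg _).trans (hlip 1 0 x)
        simpa using this
      exact h1.trans (mul_le_mul_of_nonneg_right h2 hM0)
  refine (Asymptotics.IsBigO.of_bound ‖hM.toLp M‖ (Eventually.of_forall fun s => ?_)).trans_isLittleO
    (Asymptotics.isLittleO_pow_sub_sub t (m := 2) (by norm_num))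
  rw [mul_comm]
  refine Lp.norm_le_mul_norm_of_ae_le_mul ?_
  filter_upwards [Lp.coeFn_sub ((hf s).toLp (f s) - (hf t).toLp (f t))
      ((s - t) • (hf₁ t).toLp (f₁ t)), Lp.coeFn_sub ((hf s).toLp (f s)) ((hf t).toLp (f t)),
    Lp.coeFn_smul (s - t) ((hf₁ t).toLp (f₁ t)), (hf s).coeFn_toLp, (hf t).coeFn_toLp,
    (hf₁ t).coeFn_toLp, hM.coeFn_toLp] with x h1 h2 h3 h4 h5 h6 h7
  rw [h1, Pi.sub_apply, h2, Pi.sub_apply, h3, Pi.smul_apply, h4, h5, h6, h7, smul_eq_mul,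
    norm_pow]
  simp only [Real.norm_eq_abs, sq_abs]
  exact (hbound s x).trans (mul_le_mul_of_nonneg_left (le_abs_self _) (sq_nonneg _))

end Curves

/-! ### Profiles and product curves -/

section Profiles

variable {d : ℕ} {α : ℝ}

/-- The measure `y^{1-2α} dy` on the half-line `y > 0`. -/
noncomputable def normalMeasure (α : ℝ) : Measure ℝ :=
  (volume.restrict (Ioi 0)).withDensity (fun y => ENNReal.ofReal (y ^ (1 - 2 * α)))

instance : SFinite (normalMeasure α) := by
  unfold normalMeasure; infer_instance

theorem wMeasure_eq_prod :
    wMeasure d α = (volume : Measure (Space d)).prod (normalMeasure α) := by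
  have hb : halfSpace d = univ ×ˢ Ioi 0 := by ext; simp [halfSpace]
  rw [normalMeasure, prod_withDensity_right (by fun_prop), wMeasure, hb,
    Measure.volume_eq_prod (Space d) ℝ, ← Measure.prod_restrict, Measure.restrict_univ]

theorem memLp_mul_prod {X Y : Type*} [MeasurableSpace X] [MeasurableSpace Y] {m : Measure X}
    {n : Measure Y} [SFinite m] [SFinite n] {f : X → ℝ} {g : Y → ℝ} (hf : MemLp f 2 m)
    (hg : MemLp g 2 n) : MemLp (fun p : X × Y => f p.1 * g p.2) 2 (m.prod n) := by
  refine (memLp_two_iff_integrable_sq (hf.1.comp_fst.mul hg.1.comp_snd)).2 ?_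
  simp only [Pi.mul_apply, mul_pow]
  exact hf.integrable_sq.mul_prod hg.integrable_sq

/-- Profiles in the normal variable that vanish for `y > 2` and are `O(y^r)` at the boundary are
square-integrable for `r > α - 1`. -/
theorem memLp_normalMeasure {γ : ℝ → ℝ} (hc : ContinuousOn γ (Ioi 0)) {A r : ℝ} (hr : 0 ≤ r)
    (hrα : -1 < 2 * r + (1 - 2 * α)) (h1 : ∀ y ∈ Ioo (0 : ℝ) 1, |γ y| ≤ A * y ^ r)
    (h2 : ∀ y > 2, γ y = 0) : MemLp γ 2 (normalMeasure α) := by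
  obtain ⟨B, hB⟩ := (isCompact_Icc (a := (1 : ℝ)) (b := 2)).exists_bound_of_continuousOn
    (hc.mono fun y hy => lt_of_lt_of_le one_pos hy.1)
  set C := max A B with hC
  have hbound : ∀ y ∈ Ioc (0 : ℝ) 2, |γ y| ≤ C * y ^ r := by
    intro y hy
    rcases lt_or_ge y 1 with hy1 | hy1
    · exact (h1 y ⟨hy.1, hy1⟩).trans (mul_le_mul_of_nonneg_right (le_max_left _ _)
        (Real.rpow_nonneg hy.1.le _))
    · have h := hB y ⟨hy1, hy.2⟩
      have hB0 : 0 ≤ B := (norm_nonneg _).trans h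
      calc |γ y| ≤ B * 1 := by simpa using h
        _ ≤ C * y ^ r := mul_le_mul (le_max_right _ _) (Real.one_le_rpow hy1 hr) zero_le_one
            (hB0.trans (le_max_right _ _))
  have hmeas : AEStronglyMeasurable γ (volume.restrict (Ioi 0)) :=
    hc.aestronglyMeasurable measurableSet_Ioi
  have hmeas' : AEStronglyMeasurable γ (normalMeasure α) :=
    hmeas.mono_ac (withDensity_absolutelyContinuous _ _)
  rw [memLp_two_iff_integrable_sq hmeas', normalMeasure,
    integrable_withDensity_iff_integrable_smul' (by fun_prop) (by simp)]
  have hint : IntegrableOn (fun y : ℝ => C ^ 2 * y ^ (2 * r + (1 - 2 * α))) (Ioc 0 2) :=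
    ((intervalIntegrable_iff_integrableOn_Ioc_of_le (by norm_num)).1
      (intervalIntegral.intervalIntegrable_rpow' hrα)).const_mul _
  rw [← integrable_indicator_iff measurableSet_Ioc] at hint
  refine (hint.mono_measure Measure.restrict_le_self).mono' ?_ ?_
  · have hw : Measurable fun y : ℝ => (ENNReal.ofReal (y ^ (1 - 2 * α))).toReal := by fun_prop
    exact hw.aestronglyMeasurable.smul (hmeas.pow 2)
  · filter_upwards [ae_restrict_mem measurableSet_Ioi] with y hy
    have hy0 : (0 : ℝ) < y := hy
    rw [ENNReal.toReal_ofReal (Real.rpow_nonneg hy0.le _), smul_eq_mul, Real.norm_eq_abs,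
      abs_of_nonneg (by positivity)]
    rcases le_or_gt y 2 with hy2 | hy2
    · rw [indicator_of_mem (show y ∈ Ioc (0 : ℝ) 2 from ⟨hy0, hy2⟩), Real.rpow_add hy0,
        mul_comm 2 r, Real.rpow_mul hy0.le, Real.rpow_two]
      have := pow_le_pow_left₀ (abs_nonneg _) (hbound y ⟨hy0, hy2⟩) 2
      rw [sq_abs, mul_pow] at this
      have := mul_le_mul_of_nonneg_right this (Real.rpow_nonneg hy0.le (1 - 2 * α))
      linarith
    · rw [h2 y hy2]
      simp only [ne_eq, OfNat.ofNat_ne_zero, not_false_eq_true, zero_pow, mul_zero]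
      refine indicator_nonneg (fun x hx => ?_) y
      exact mul_nonneg (sq_nonneg _) (Real.rpow_nonneg hx.1.le _)

/-- A compactly supported function on `ℝ × ℝ^d` is bounded by a product of indicators. -/
theorem exists_bound_of_hasCompactSupport {a : ℝ × Space d → ℝ} (ha : Continuous a)
    (hac : HasCompactSupport a) : ∃ C r : ℝ, 0 ≤ C ∧ ∀ t x,
      |a (t, x)| ≤ C * ((Icc (-r) r).indicator (fun _ => 1) t *
        (Metric.closedBall (0 : Space d) r).indicator (fun _ => 1) x) := by
  obtain ⟨C, hC⟩ := hac.exists_bound_of_continuous ha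
  obtain ⟨r, hr⟩ := hac.isCompact.isBounded.subset_closedBall 0
  have hC0 : 0 ≤ C := (norm_nonneg _).trans (hC 0)
  refine ⟨C, r, hC0, fun t x => ?_⟩
  by_cases h : (t, x) ∈ tsupport a
  · have h1 := hr h
    rw [mem_closedBall_zero_iff, Prod.norm_def, max_le_iff] at h1
    rw [indicator_of_mem (show t ∈ Icc (-r) r from abs_le.1 h1.1),
      indicator_of_mem (mem_closedBall_zero_iff.2 h1.2)]
    simpa using hC (t, x)
  · rw [image_eq_zero_of_notMem_tsupport h, abs_zero]
    exact mul_nonneg hC0 (mul_nonneg (indicator_nonneg (by simp) _) (indicator_nonneg (by simp) _))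

theorem memLp_indicator_one {X : Type*} [MeasurableSpace X] {m : Measure X} {s : Set X}
    (hs : MeasurableSet s) (hm : m s ≠ ⊤) (p : ℝ≥0∞) :
    MemLp (s.indicator fun _ => (1 : ℝ)) p m :=
  memLp_indicator_const p hs 1 (Or.inr hm)

theorem memLp_slice_mul {a : ℝ × Space d → ℝ} (ha : Continuous a) (hac : HasCompactSupport a)
    {γ : ℝ → ℝ} (hγ : MemLp γ 2 (normalMeasure α)) (t : ℝ) :
    MemLp (fun z : Space d × ℝ => a (t, z.1) * γ z.2) 2 (wMeasure d α) := by
  obtain ⟨C, r, hC, h⟩ := exists_bound_of_hasCompactSupport ha hac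
  rw [wMeasure_eq_prod]
  refine memLp_mul_prod (f := fun x => a (t, x)) ?_ hγ
  refine (memLp_indicator_one (Metric.isClosed_closedBall.measurableSet)
    (measure_closedBall_lt_top (x := (0 : Space d)) (r := r)).ne 2).of_le_mul (c := C)
    (by fun_prop) (Eventually.of_forall fun x => ?_)
  have h1 := h t x
  have h2 : (Icc (-r) r).indicator (fun _ => (1 : ℝ)) t ≤ 1 :=
    indicator_le_self' (f := fun _ => (1 : ℝ)) (fun _ _ => zero_le_one) t
  rw [Real.norm_eq_abs, Real.norm_eq_abs, abs_of_nonneg (indicator_nonneg (by simp) x)]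
  refine h1.trans (mul_le_mul_of_nonneg_left (mul_le_of_le_one_left
    (indicator_nonneg (by simp) x) h2) hC)

theorem memLp_bulk_mul {a : ℝ × Space d → ℝ} (ha : Continuous a) (hac : HasCompactSupport a)
    {γ : ℝ → ℝ} (hγ : MemLp γ 2 (normalMeasure α)) :
    MemLp (fun p : ℝ × Space d × ℝ => a (p.1, p.2.1) * γ p.2.2) 2 (bulkMeasure d α) := by
  obtain ⟨C, r, hC, h⟩ := exists_bound_of_hasCompactSupport ha hac
  rw [bulkMeasure, wMeasure_eq_prod]
  have hI : MemLp ((Icc (-r) r).indicator fun _ => (1 : ℝ)) 2 volume :=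
    memLp_indicator_one measurableSet_Icc (by simp) 2
  have hx := memLp_indicator_one (m := (volume : Measure (Space d)))
    (Metric.isClosed_closedBall.measurableSet)
    (measure_closedBall_lt_top (x := (0 : Space d)) (r := r)).ne 2
  refine (memLp_mul_prod hI (memLp_mul_prod hx hγ)).of_le_mul (c := C) ?_
    (Eventually.of_forall fun p => ?_)
  · exact (ha.comp (by fun_prop : Continuous fun p : ℝ × Space d × ℝ =>
      (p.1, p.2.1))).aestronglyMeasurable.mul hγ.1.comp_snd.comp_snd
  · have h1 := h p.1 p.2.1
    rw [norm_mul, norm_mul, norm_mul, Real.norm_eq_abs, Real.norm_eq_abs, Real.norm_eq_abs,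
      Real.norm_eq_abs, abs_of_nonneg (indicator_nonneg (by simp) _),
      abs_of_nonneg (indicator_nonneg (by simp) _), ← mul_assoc, ← mul_assoc]
    refine mul_le_mul_of_nonneg_right (h1.trans (le_of_eq ?_)) (abs_nonneg _)
    ring

end Profiles

section ProductCurves

variable {d : ℕ} {α : ℝ}

/-- The derivative of `a` with respect to `t`. -/
noncomputable def dt {X : Type*} [NormedAddCommGroup X] [NormedSpace ℝ X] (a : ℝ × X → ℝ) :
    ℝ × X → ℝ :=
  fun q => fderiv ℝ a q (1, 0)

theorem IsTestOn.dt {X : Type*} [NormedAddCommGroup X] [NormedSpace ℝ X] {U : Set (ℝ × X)}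
    {a : ℝ × X → ℝ} (h : IsTestOn U a) : IsTestOn U (dt a) :=
  h.fderiv_apply _

theorem hasDerivAt_dt {X : Type*} [NormedAddCommGroup X] [NormedSpace ℝ X] {a : ℝ × X → ℝ}
    (ha : ContDiff ℝ 1 a) (t : ℝ) (x : X) : HasDerivAt (fun s => a (s, x)) (dt a (t, x)) t :=
  (ha.differentiable one_ne_zero (t, x)).hasFDerivAt.comp_hasDerivAt t
    ((hasDerivAt_id t).prodMk (hasDerivAt_const t x))

theorem abs_sub_le_of_bound_dt {X : Type*} [NormedAddCommGroup X] [NormedSpace ℝ X]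
    {a : ℝ × X → ℝ} (ha : ContDiff ℝ 1 a) {C : ℝ} (hC : ∀ q, |dt a q| ≤ C) (t s : ℝ) (x : X) :
    |a (t, x) - a (s, x)| ≤ |t - s| * C := by
  have := Convex.norm_image_sub_le_of_norm_hasDerivWithin_le (f := fun r => a (r, x))
    (f' := fun r => AdSWave.dt a (r, x)) (C := C) (s := univ) (x := s) (y := t)
    (fun r _ => (hasDerivAt_dt ha r x).hasDerivWithinAt) (fun r _ => hC _) convex_univ
    (mem_univ _) (mem_univ _)
  simpa [mul_comm] using this

theorem IsTestOn.abs_slice_sub_le {X : Type*} [NormedAddCommGroup X] [NormedSpace ℝ X]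
    {U : Set (ℝ × X)} {a : ℝ × X → ℝ} (h : IsTestOn U a) : ∃ C, ∀ t s x,
      |a (t, x) - a (s, x)| ≤
        |t - s| * (Prod.snd '' tsupport a).indicator (fun _ => C) x := by
  obtain ⟨C, hC⟩ := h.dt.2.1.exists_bound_of_continuous h.dt.1.continuous
  refine ⟨C, fun t s x => ?_⟩
  by_cases hx : x ∈ Prod.snd '' tsupport a
  · rw [indicator_of_mem hx]
    exact abs_sub_le_of_bound_dt (h.1.of_le (by simp)) hC t s x
  · have h0 : ∀ r, a (r, x) = 0 := fun r =>
      image_eq_zero_of_notMem_tsupport fun hr => hx ⟨(r, x), hr, rfl⟩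
    simp [h0, indicator_of_notMem hx]

/-- The curve in `L²_α` given by a test function of the space-time domain. -/
noncomputable def testCurve {φ : ℝ × Space d × ℝ → ℝ} (h : IsTestOn (bulk d) φ) :
    ℝ → Lp ℝ 2 (wMeasure d α) := fun t => (h.slice t).memLp.toLp _

theorem hasDerivAt_testCurve {φ : ℝ × Space d × ℝ → ℝ} (h : IsTestOn (bulk d) φ) (t : ℝ) :
    HasDerivAt (testCurve (α := α) h) (testCurve h.dt t) t := by
  obtain ⟨C, hC⟩ := h.dt.abs_slice_sub_le
  have hK : IsCompact (Prod.snd '' tsupport (dt φ)) := h.dt.2.1.isCompact.image continuous_snd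
  have hKU : Prod.snd '' tsupport (dt φ) ⊆ halfSpace d := by
    rintro _ ⟨p, hp, rfl⟩
    exact h.dt.2.2 hp
  exact hasDerivAt_toLp (fun t => (h.slice t).memLp) (fun t => (h.dt.slice t).memLp)
    (memLp_indicator_const 2 hK.measurableSet C
      (Or.inr (withDensity_apply_lt_top hK hKU continuousOn_weight).ne))
    (fun t x => hasDerivAt_dt (h.1.of_le (by simp)) t x) hC t

/-- The curve `t ↦ a(t, x) γ(y)` in `L²_α`. -/
noncomputable def productCurve {a : ℝ × Space d → ℝ} (ha : IsTestOn univ a) {γ : ℝ → ℝ}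
    (hγ : MemLp γ 2 (normalMeasure α)) : ℝ → Lp ℝ 2 (wMeasure d α) :=
  fun t => (memLp_slice_mul ha.1.continuous ha.2.1 hγ t).toLp _

theorem hasDerivAt_productCurve {a : ℝ × Space d → ℝ} (ha : IsTestOn univ a) {γ : ℝ → ℝ}
    (hγ : MemLp γ 2 (normalMeasure α)) (t : ℝ) :
    HasDerivAt (productCurve ha hγ) (productCurve ha.dt hγ t) t := by
  obtain ⟨C, hC⟩ := ha.dt.abs_slice_sub_le
  have hK : IsCompact (Prod.snd '' tsupport (dt a)) := ha.dt.2.1.isCompact.image continuous_snd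
  have hM : MemLp (fun z : Space d × ℝ =>
      (Prod.snd '' tsupport (dt a)).indicator (fun _ => C) z.1 * |γ z.2|) 2 (wMeasure d α) := by
    rw [wMeasure_eq_prod]
    exact memLp_mul_prod (memLp_indicator_const 2 hK.measurableSet C
      (Or.inr hK.measure_lt_top.ne)) hγ.abs
  refine hasDerivAt_toLp _ _ hM (fun t z => (hasDerivAt_dt (ha.1.of_le (by simp)) t z.1).mul_const _)
    (fun t s z => ?_) t
  rw [← sub_mul, abs_mul, ← mul_assoc]
  exact mul_le_mul_of_nonneg_right (hC t s z.1) (abs_nonneg _)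

theorem contDiff_productCurve {a : ℝ × Space d → ℝ} (ha : IsTestOn univ a) {γ : ℝ → ℝ}
    (hγ : MemLp γ 2 (normalMeasure α)) : ContDiff ℝ ∞ (productCurve ha hγ) := by
  have ht : ∀ j, IsTestOn univ (dt^[j] a) := fun j => by
    induction j with
    | zero => exact ha
    | succ j ih =>
      rw [Function.iterate_succ_apply']
      exact ih.dt
  refine contDiff_of_hasDerivAt_seq (g := fun j => productCurve (ht j) hγ) (fun j t => ?_) 0
  have := hasDerivAt_productCurve (ht j) hγ t
  simpa only [← Function.iterate_succ_apply'] using this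

theorem productCurve_eq_zero {a : ℝ × Space d → ℝ} (ha : IsTestOn univ a) {γ : ℝ → ℝ}
    (hγ : MemLp γ 2 (normalMeasure α)) {t : ℝ} (h : ∀ x, a (t, x) = 0) :
    productCurve ha hγ t = 0 := by
  refine (Lp.eq_zero_iff_ae_eq_zero).2 ((MemLp.coeFn_toLp _).trans
    (Eventually.of_forall fun z => by simp [h]))

end ProductCurves

/-! ### The wave operator on the space-time domain -/

section WaveOperator

variable {d : ℕ} {α : ℝ}

theorem IsTestOn.sub {E : Type*} [NormedAddCommGroup E] [NormedSpace ℝ E] {U : Set E}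
    {φ ψ : E → ℝ} (h : IsTestOn U φ) (h' : IsTestOn U ψ) : IsTestOn U fun x => φ x - ψ x := by
  have := h.add (h'.const_mul (-1))
  refine (congrArg (IsTestOn U) (funext fun x => ?_)).mp this
  simp [sub_eq_add_neg]

theorem isTestOn_sum {E ι : Type*} [NormedAddCommGroup E] [NormedSpace ℝ E] {U : Set E}
    {s : Finset ι} {φ : ι → E → ℝ} (h : ∀ i ∈ s, IsTestOn U (φ i)) :
    IsTestOn U fun x => ∑ i ∈ s, φ i x := by
  classical
  induction s using Finset.induction_on with
  | empty =>
    simp only [Finset.sum_empty]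
    change IsTestOn U (0 : E → ℝ)
    exact ⟨contDiff_const, HasCompactSupport.zero, by simp⟩
  | insert i s hi ih =>
    simp only [Finset.sum_insert hi]
    exact (h i (Finset.mem_insert_self i s)).add
      (ih fun j hj => h j (Finset.mem_insert_of_mem hj))

theorem IsTestOn.integrable_bulkMeasure {φ : ℝ × Space d × ℝ → ℝ} (h : IsTestOn (bulk d) φ) :
    Integrable φ (bulkMeasure d α) :=
  memLp_one_iff_integrable.1
    (memLp_bulkMeasure_of_hasCompactSupport h.1.continuous h.2.1 h.2.2 1)

theorem contDiff_dt {X : Type*} [NormedAddCommGroup X] [NormedSpace ℝ X] {a : ℝ × X → ℝ}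
    (ha : ContDiff ℝ ∞ a) : ContDiff ℝ ∞ (dt a) :=
  (ha.fderiv_right (m := ∞) (by simp)).clm_apply contDiff_const

theorem iteratedDeriv_two_eq_dt {X : Type*} [NormedAddCommGroup X] [NormedSpace ℝ X]
    {a : ℝ × X → ℝ} (ha : ContDiff ℝ ∞ a) (t : ℝ) (x : X) :
    iteratedDeriv 2 (fun s => a (s, x)) t = dt (dt a) (t, x) :=
  iteratedDeriv_two_comp_affine ha
    (fun s => (hasDerivAt_id s).prodMk (hasDerivAt_const s x)) t

theorem fderiv_slice {φ : ℝ × Space d × ℝ → ℝ} (hφ : ContDiff ℝ ∞ φ) (t : ℝ)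
    (z e : Space d × ℝ) : fderiv ℝ (fun z => φ (t, z)) z e = fderiv ℝ φ (t, z) (0, e) := by
  have h : HasFDerivAt (fun z => φ (t, z)) _ z :=
    HasFDerivAt.comp (g := φ) z (f := fun z => (t, z))
      (hφ.differentiable (by simp) (t, z)).hasFDerivAt (hasFDerivAt_prodMk_right t z)
  rw [h.fderiv]
  simp

theorem waveOp_eq_sum {φ : ℝ × Space d × ℝ → ℝ} (hφ : ContDiff ℝ ∞ φ) (p : ℝ × Space d × ℝ) :
    waveOp α φ p = dt (dt φ) p -
      (∑ i, fderiv ℝ (fun p => fderiv ℝ φ p (0, frame i)) p (0, frame i) +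
        (1 - 2 * α) / p.2.2 * fderiv ℝ φ p (0, frame none)) := by
  obtain ⟨t, z⟩ := p
  have hs : ContDiff ℝ ∞ fun z => φ (t, z) := hφ.comp (contDiff_const.prodMk contDiff_id)
  rw [waveOp_eq, iteratedDeriv_two_eq_dt hφ, spatialOp_eq_sum hs]
  simp only [fderiv_slice hφ]
  congr 2
  refine Finset.sum_congr rfl fun i _ => ?_
  exact fderiv_slice (φ := fun p => fderiv ℝ φ p (0, frame i))
    ((hφ.fderiv_right (m := ∞) (by simp)).clm_apply contDiff_const) t z _

theorem contDiffOn_bulk_inv (c : ℝ) :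
    ContDiffOn ℝ ∞ (fun p : ℝ × Space d × ℝ => c / p.2.2) (bulk d) :=
  contDiffOn_const.div (by fun_prop) fun _ hp => ne_of_gt hp

theorem contDiffOn_waveOp {φ : ℝ × Space d × ℝ → ℝ} (hφ : ContDiff ℝ ∞ φ) :
    ContDiffOn ℝ ∞ (waveOp α φ) (bulk d) := by
  have h1 : ∀ (ψ : ℝ × Space d × ℝ → ℝ), ContDiff ℝ ∞ ψ → ∀ e,
      ContDiff ℝ ∞ fun p => fderiv ℝ ψ p e := fun ψ hψ e =>
    (hψ.fderiv_right (m := ∞) (by simp)).clm_apply contDiff_const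
  rw [funext (waveOp_eq_sum hφ)]
  exact (contDiff_dt (contDiff_dt hφ)).contDiffOn.sub
    ((ContDiff.sum fun i _ => h1 _ (h1 φ hφ _) _).contDiffOn.add
      ((contDiffOn_bulk_inv _).mul (h1 φ hφ _).contDiffOn))

theorem IsTestOn.waveOp {φ : ℝ × Space d × ℝ → ℝ} (h : IsTestOn (bulk d) φ) :
    IsTestOn (bulk d) (waveOp α φ) := by
  rw [funext (waveOp_eq_sum h.1)]
  exact h.dt.dt.sub ((isTestOn_sum fun i _ => (h.fderiv_apply _).fderiv_apply _).add
    ((h.fderiv_apply _).contDiffOn_mul isOpen_bulk (contDiffOn_bulk_inv _)))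

theorem integral_bulkMeasure (f : ℝ × Space d × ℝ → ℝ) :
    ∫ p, f p ∂bulkMeasure d α = ∫ p in bulk d, p.2.2 ^ (1 - 2 * α) * f p := by
  rw [bulkMeasure_eq]
  exact integral_withDensity_ofReal isOpen_bulk.measurableSet measurable_bulk_weight
    bulk_weight_pos f

theorem dt_bulk_weight_mul {φ : ℝ × Space d × ℝ → ℝ} (hφ : ContDiff ℝ ∞ φ)
    {p : ℝ × Space d × ℝ} (hp : p ∈ bulk d) :
    dt (fun p => p.2.2 ^ (1 - 2 * α) * φ p) p = p.2.2 ^ (1 - 2 * α) * dt φ p := by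
  have h1 : HasFDerivAt (fun p : ℝ × Space d × ℝ => p.2.2 ^ (1 - 2 * α)) _ p :=
    HasFDerivAt.comp (g := fun z : Space d × ℝ => z.2 ^ (1 - 2 * α)) p
      (hasFDerivAt_weight (1 - 2 * α) (z := p.2) hp) hasFDerivAt_snd
  have h2 : HasFDerivAt (fun p => p.2.2 ^ (1 - 2 * α) * φ p) _ p :=
    h1.mul (hφ.differentiable (by simp) p).hasFDerivAt
  rw [dt, h2.fderiv]
  simp [dt]

theorem contDiffOn_bulk_rpow (s : ℝ) :
    ContDiffOn ℝ ∞ (fun p : ℝ × Space d × ℝ => p.2.2 ^ s) (bulk d) := fun _ hz =>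
  ContDiffAt.contDiffWithinAt (ContDiffAt.comp (g := fun y : ℝ => y ^ s) (f := fun p : ℝ × Space d × ℝ => p.2.2) _
    (Real.contDiffAt_rpow_const_of_ne (ne_of_gt hz)) (contDiff_snd.comp contDiff_snd).contDiffAt)

instance : (volume : Measure (Space d × ℝ)).IsAddHaarMeasure := by
  rw [Measure.volume_eq_prod]; infer_instance

instance : (volume : Measure (ℝ × Space d × ℝ)).IsAddHaarMeasure := by
  rw [Measure.volume_eq_prod]; infer_instance

theorem integral_mul_dt {g φ : ℝ × Space d × ℝ → ℝ} (hg : ContDiff ℝ ∞ g)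
    (hφ : IsTestOn (bulk d) φ) :
    ∫ p, g p * dt φ p ∂bulkMeasure d α = -∫ p, dt g p * φ p ∂bulkMeasure d α := by
  have hω : IsTestOn (bulk d) fun p => p.2.2 ^ (1 - 2 * α) * φ p :=
    hφ.contDiffOn_mul isOpen_bulk (contDiffOn_bulk_rpow _)
  have h := integral_mul_fderiv_of_isTestOn (m := volume) (hg.of_le (m := 1) (by simp)) hω (1, 0)
  rw [← setIntegral_mul_eq_of_isTestOn _ (hω.fderiv_apply _),
    ← setIntegral_mul_eq_of_isTestOn _ hω] at h
  rw [integral_bulkMeasure, integral_bulkMeasure]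
  convert h using 1
  · refine setIntegral_congr_fun isOpen_bulk.measurableSet fun p hp => ?_
    have := dt_bulk_weight_mul (α := α) hφ.1 hp
    rw [dt] at this
    simp only [this]
    ring
  · congr 1
    refine setIntegral_congr_fun isOpen_bulk.measurableSet fun p hp => ?_
    simp only [dt]
    ring

/-- The wave operator is symmetric with respect to the weight. -/
theorem integral_mul_waveOp_comm {g φ : ℝ × Space d × ℝ → ℝ} (hg : ContDiff ℝ ∞ g)
    (hφ : IsTestOn (bulk d) φ) :
    ∫ p, g p * waveOp α φ p ∂bulkMeasure d α = ∫ p, waveOp α g p * φ p ∂bulkMeasure d α := by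
  have hgs : ∀ t, ContDiff ℝ ∞ fun z => g (t, z) := fun t =>
    hg.comp (contDiff_const.prodMk contDiff_id)
  have t1 : IsTestOn (bulk d) fun p => g p * dt (dt φ) p := hφ.dt.dt.contDiff_mul hg
  have t2 : IsTestOn (bulk d) fun p => dt (dt g) p * φ p :=
    hφ.contDiff_mul (contDiff_dt (contDiff_dt hg))
  have t3 : IsTestOn (bulk d) fun p => g p * waveOp α φ p := hφ.waveOp.contDiff_mul hg
  have t4 : IsTestOn (bulk d) fun p => waveOp α g p * φ p :=
    hφ.contDiffOn_mul isOpen_bulk (contDiffOn_waveOp hg)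
  have e0 : ∫ p, g p * dt (dt φ) p ∂bulkMeasure d α = ∫ p, dt (dt g) p * φ p ∂bulkMeasure d α := by
    rw [integral_mul_dt hg hφ.dt, integral_mul_dt (contDiff_dt hg) hφ, neg_neg]
  have i1 : Integrable (fun p => g p * dt (dt φ) p - g p * waveOp α φ p) (bulkMeasure d α) :=
    t1.integrable_bulkMeasure.sub t3.integrable_bulkMeasure
  have i2 : Integrable (fun p => dt (dt g) p * φ p - waveOp α g p * φ p) (bulkMeasure d α) :=
    t2.integrable_bulkMeasure.sub t4.integrable_bulkMeasure
  have e1 : ∫ p, (g p * dt (dt φ) p - g p * waveOp α φ p) ∂bulkMeasure d α =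
      ∫ p, (dt (dt g) p * φ p - waveOp α g p * φ p) ∂bulkMeasure d α := by
    rw [bulkMeasure] at i1 i2 ⊢
    rw [integral_prod _ i1, integral_prod _ i2]
    refine integral_congr_ae (Eventually.of_forall fun t => ?_)
    have h := integral_mul_spatialOp_comm (α := α) (hgs t) (hφ.slice t)
    simp only [waveOp_eq, iteratedDeriv_two_eq_dt hg, iteratedDeriv_two_eq_dt hφ.1, mul_sub,
      sub_mul, sub_sub_cancel]
    exact h
  rw [integral_sub t1.integrable_bulkMeasure t3.integrable_bulkMeasure,
    integral_sub t2.integrable_bulkMeasure t4.integrable_bulkMeasure, e0] at e1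
  linarith

/-- The operator `η'' + ((1 - 2α) / y) η'` in the normal variable. -/
noncomputable def normalOp (α : ℝ) (η : ℝ → ℝ) (y : ℝ) : ℝ :=
  iteratedDeriv 2 η y + (1 - 2 * α) / y * deriv η y

theorem waveOp_mul {a : ℝ × Space d → ℝ} (ha : ContDiff ℝ ∞ a) (η : ℝ → ℝ)
    (p : ℝ × Space d × ℝ) : waveOp α (fun p => a (p.1, p.2.1) * η p.2.2) p =
      box a (p.1, p.2.1) * η p.2.2 - a (p.1, p.2.1) * normalOp α η p.2.2 := by
  obtain ⟨t, x, y⟩ := p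
  have h1 : ∀ (f : ℝ → ℝ) (c : ℝ) (s : ℝ),
      iteratedDeriv 2 (fun s => f s * c) s = iteratedDeriv 2 f s * c := by
    intro f c s
    simp [iteratedDeriv_succ, iteratedDeriv_zero]
  have h2 : ∀ (f : ℝ → ℝ) (c : ℝ) (s : ℝ),
      iteratedDeriv 2 (fun s => c * f s) s = c * iteratedDeriv 2 f s := by
    intro f c s
    simp [iteratedDeriv_succ, iteratedDeriv_zero]
  have h3 : Laplacian.laplacian (fun x : Space d => a (t, x) * η y) x =
      Laplacian.laplacian (fun x : Space d => a (t, x)) x * η y := by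
    have hs : ContDiff ℝ ∞ fun x => a (t, x) := ha.comp (contDiff_const.prodMk contDiff_id)
    have := InnerProductSpace.laplacian_smul (η y)
      ((contDiff_infty.1 hs 2).contDiffAt (x := x))
    have e : (fun x : Space d => a (t, x) * η y) = η y • fun x => a (t, x) := by
      ext x
      simp [mul_comm]
    rw [e, this, smul_eq_mul, mul_comm]
  simp only [waveOp, box, normalOp, h1, h2, h3, deriv_const_mul_field']
  ring

theorem box_eq {f : ℝ × Space d → ℝ} (hf : ContDiff ℝ ∞ f) (q : ℝ × Space d) :
    box f q = dt (dt f) q - ∑ i, fderiv ℝ (fun q => fderiv ℝ f q (0, EuclideanSpace.single i 1)) q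
      (0, EuclideanSpace.single i 1) := by
  obtain ⟨t, x⟩ := q
  rw [box, iteratedDeriv_two_eq_dt hf, laplacian_comp_affine hf (A := fun x => (t, x))
    (fun x => hasFDerivAt_prodMk_right t x)]
  simp

theorem IsTestOn.box {U : Set (ℝ × Space d)} {f : ℝ × Space d → ℝ} (h : IsTestOn U f) :
    IsTestOn U (box f) := by
  rw [funext (box_eq h.1)]
  exact h.dt.dt.sub (isTestOn_sum fun i _ => (h.fderiv_apply _).fderiv_apply _)

theorem IsTestOn.iterate_box {U : Set (ℝ × Space d)} {f : ℝ × Space d → ℝ} (h : IsTestOn U f)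
    (j : ℕ) : IsTestOn U (AdSWave.box^[j] f) := by
  induction j with
  | zero => exact h
  | succ j ih =>
    rw [Function.iterate_succ_apply']
    exact ih.box

theorem contDiff_tensor {a : ℝ × Space d → ℝ} (ha : ContDiff ℝ ∞ a) {η : ℝ → ℝ}
    (hη : ContDiff ℝ ∞ η) :
    ContDiff ℝ ∞ fun p : ℝ × Space d × ℝ => a (p.1, p.2.1) * η p.2.2 :=
  (ha.comp (by fun_prop)).mul (hη.comp (by fun_prop))

theorem continuousOn_normalOp {η : ℝ → ℝ} (hη : ContDiff ℝ ∞ η) :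
    ContinuousOn (normalOp α η) (Ioi 0) := by
  have h1 : Continuous (iteratedDeriv 2 η) := (contDiff_infty.1 hη 2).continuous_iteratedDeriv 2 le_rfl
  have h2 : Continuous (deriv η) := hη.continuous_deriv (by simp)
  exact h1.continuousOn.add ((continuousOn_const.div continuousOn_id fun y hy => ne_of_gt hy).mul
    h2.continuousOn)

end WaveOperator

/-! ### Functions on time slabs -/

section Slabs

open scoped RealInnerProductSpace

variable {d : ℕ} {α : ℝ} {F : Type*} [NormedAddCommGroup F]

theorem lintegral_slabMeasure (a b : ℝ) {f : ℝ × Space d × ℝ → ℝ≥0∞} (hf : AEMeasurable f (slabMeasure d α a b)) :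
    ∫⁻ p, f p ∂slabMeasure d α a b = ∫⁻ t in Icc a b, ∫⁻ z, f (t, z) ∂wMeasure d α :=
  lintegral_prod _ hf

theorem eLpNorm_two_sq {X : Type*} [MeasurableSpace X] {m : Measure X} (f : X → F) :
    eLpNorm f 2 m ^ 2 = ∫⁻ x, ‖f x‖ₑ ^ 2 ∂m := by
  rw [eLpNorm_eq_lintegral_rpow_enorm_toReal two_ne_zero ENNReal.ofNat_ne_top, ← ENNReal.rpow_natCast,
    ← ENNReal.rpow_mul]
  simp

theorem memLp_slab_iff {f : ℝ × Space d × ℝ → F} {a b : ℝ}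
    (hf : AEStronglyMeasurable f (slabMeasure d α a b)) :
    MemLp f 2 (slabMeasure d α a b) ↔
      ∫⁻ t in Icc a b, eLpNorm (fun z => f (t, z)) 2 (wMeasure d α) ^ 2 < ⊤ := by
  simp only [eLpNorm_two_sq]
  rw [← lintegral_slabMeasure a b (hf.enorm.pow_const 2), ← eLpNorm_two_sq, MemLp]
  simp [hf]

theorem aestronglyMeasurable_slab {f : ℝ × Space d × ℝ → F}
    (hf : AEStronglyMeasurable f (bulkMeasure d α)) (a b : ℝ) :
    AEStronglyMeasurable f (slabMeasure d α a b) := by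
  rw [slabMeasure_eq]
  exact hf.mono_measure Measure.restrict_le_self

theorem memLp_slab_of_bound {f : ℝ × Space d × ℝ → F}
    (hf : AEStronglyMeasurable f (bulkMeasure d α)) {a b : ℝ} {C : ℝ≥0∞} (hC : C ≠ ⊤)
    (h : ∀ᵐ t ∂volume.restrict (Icc a b), eLpNorm (fun z => f (t, z)) 2 (wMeasure d α) ≤ C) :
    MemLp f 2 (slabMeasure d α a b) := by
  rw [memLp_slab_iff (aestronglyMeasurable_slab hf a b)]
  refine (lintegral_mono_ae (h.mono fun t ht => pow_le_pow_left' ht 2)).trans_lt ?_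
  rw [setLIntegral_const]
  exact ENNReal.mul_lt_top (ENNReal.pow_lt_top hC.lt_top) (by simp)

theorem memLp_slab_of_curve [MeasurableSpace F] {V : ℝ → Lp F 2 (wMeasure d α)}
    (hV : Continuous V) {v : ℝ × Space d × ℝ → F}
    (hv : StronglyMeasurable v) (h : ∀ t, (fun z => v (t, z)) =ᵐ[wMeasure d α] V t) (a b : ℝ) :
    MemLp v 2 (slabMeasure d α a b) := by
  obtain ⟨C, hC⟩ := (isCompact_Icc (a := a) (b := b)).exists_bound_of_continuousOn hV.continuousOn
  refine memLp_slab_of_bound hv.aestronglyMeasurable (C := ENNReal.ofReal C) ENNReal.ofReal_ne_top ?_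
  filter_upwards [ae_restrict_mem measurableSet_Icc] with t ht
  rw [eLpNorm_congr_ae (h t), ← ENNReal.ofReal_toReal (Lp.eLpNorm_ne_top _), ← Lp.norm_def]
  exact ENNReal.ofReal_le_ofReal (hC t ht)

theorem IsTestOn.exists_time_bound {X : Type*} [NormedAddCommGroup X] [NormedSpace ℝ X]
    {U : Set (ℝ × X)} {φ : ℝ × X → ℝ}
    (h : IsTestOn U φ) : ∃ r : ℝ, ∀ p, p.1 ∉ Icc (-r) r → p ∉ tsupport φ := by
  obtain ⟨r, hr⟩ := h.2.1.isCompact.isBounded.subset_closedBall 0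
  refine ⟨r, fun p hp hs => hp ?_⟩
  have h1 := hr hs
  rw [mem_closedBall_zero_iff] at h1
  exact abs_le.1 ((norm_fst_le p).trans h1)

theorem integrable_inner_of_slab [InnerProductSpace ℝ F] {f g : ℝ × Space d × ℝ → F} {r : ℝ}
    (hf : MemLp f 2 (slabMeasure d α (-r) r)) (hg : MemLp g 2 (bulkMeasure d α))
    (h : ∀ p, p.1 ∉ Icc (-r) r → g p = 0) :
    Integrable (fun p => ⟪f p, g p⟫) (bulkMeasure d α) := by
  have hS : MeasurableSet (Icc (-r) r ×ˢ (univ : Set (Space d × ℝ))) :=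
    measurableSet_Icc.prod MeasurableSet.univ
  have hg' : MemLp g 2 (slabMeasure d α (-r) r) := by
    rw [slabMeasure_eq]
    exact hg.mono_measure Measure.restrict_le_self
  have h1 : Integrable (fun p => ⟪f p, g p⟫) (slabMeasure d α (-r) r) :=
    (hf.norm.integrable_mul hg'.norm).mono' (hf.1.inner hg'.1)
      (Eventually.of_forall fun p => by simpa using norm_inner_le_norm (𝕜 := ℝ) (f p) (g p))
  rw [slabMeasure_eq] at h1
  have h2 : IntegrableOn (fun p => ⟪f p, g p⟫) (Icc (-r) r ×ˢ univ) (bulkMeasure d α) := h1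
  rwa [integrableOn_iff_integrable_of_support_subset] at h2
  intro p hp
  by_contra hn
  refine hp ?_
  simp only
  rw [h p fun h' => hn ⟨h', mem_univ _⟩, inner_zero_right]

theorem IsTestOn.integrable_mul_slab {f φ : ℝ × Space d × ℝ → ℝ}
    (hf : ∀ a b, MemLp f 2 (slabMeasure d α a b)) (h : IsTestOn (bulk d) φ) :
    Integrable (fun p => f p * φ p) (bulkMeasure d α) := by
  obtain ⟨r, hr⟩ := h.exists_time_bound
  have := integrable_inner_of_slab (r := r) (hf _ _)
    (memLp_bulkMeasure_of_hasCompactSupport h.1.continuous h.2.1 h.2.2 2)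
    fun p hp => image_eq_zero_of_notMem_tsupport (hr p hp)
  simpa [mul_comm] using this

/-- The gradient of a space-time function in the variables `(x, y)`. -/
noncomputable def sliceGrad (φ : ℝ × Space d × ℝ → ℝ) : ℝ × Space d × ℝ → Grad d :=
  fun p => grad (fun z => φ (p.1, z)) p.2

theorem sliceGrad_eq_sum {φ : ℝ × Space d × ℝ → ℝ} (hφ : ContDiff ℝ 1 φ) (p : ℝ × Space d × ℝ) :
    sliceGrad φ p = ∑ i, fderiv ℝ φ p (0, frame i) • WithLp.toLp 2 (frame i) := by
  have hs : ContDiff ℝ 1 fun z => φ (p.1, z) := hφ.comp (contDiff_const.prodMk contDiff_id)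
  rw [sliceGrad, grad_eq_sum (hs.differentiable one_ne_zero _)]
  refine Finset.sum_congr rfl fun i _ => ?_
  have h : HasFDerivAt (fun z => φ (p.1, z)) _ p.2 :=
    HasFDerivAt.comp (g := φ) p.2 (f := fun z => (p.1, z))
      (hφ.differentiable (by simp) (p.1, p.2)).hasFDerivAt (hasFDerivAt_prodMk_right p.1 p.2)
  rw [h.fderiv]
  simp

theorem continuous_sliceGrad {φ : ℝ × Space d × ℝ → ℝ} (hφ : ContDiff ℝ 1 φ) :
    Continuous (sliceGrad φ) := by
  rw [funext (sliceGrad_eq_sum hφ)]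
  exact continuous_finsetSum _ fun i _ =>
    ((hφ.continuous_fderiv one_ne_zero).clm_apply continuous_const).smul continuous_const

theorem IsTestOn.sliceGrad_eq_zero {φ : ℝ × Space d × ℝ → ℝ} {U : Set (ℝ × Space d × ℝ)}
    (h : IsTestOn U φ) {p : ℝ × Space d × ℝ} (hp : p ∉ tsupport φ) : sliceGrad φ p = 0 := by
  rw [sliceGrad_eq_sum (h.1.of_le (by simp)), fderiv_of_notMem_tsupport ℝ hp]
  simp

theorem IsTestOn.memLp_sliceGrad {φ : ℝ × Space d × ℝ → ℝ} (h : IsTestOn (bulk d) φ) :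
    MemLp (sliceGrad φ) 2 (bulkMeasure d α) := by
  have hsub : tsupport (sliceGrad φ) ⊆ tsupport φ :=
    closure_minimal (fun p hp => by
      by_contra hn
      exact hp (h.sliceGrad_eq_zero hn)) (isClosed_tsupport _)
  exact memLp_bulkMeasure_of_hasCompactSupport (continuous_sliceGrad (h.1.of_le (by simp)))
    (h.2.1.of_isClosed_subset (isClosed_tsupport _) hsub) (hsub.trans h.2.2) 2

theorem IsTestOn.integrable_inner_sliceGrad {G : ℝ × Space d × ℝ → Grad d}
    (hG : ∀ a b, MemLp G 2 (slabMeasure d α a b)) {φ : ℝ × Space d × ℝ → ℝ}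
    (h : IsTestOn (bulk d) φ) :
    Integrable (fun p => ⟪G p, sliceGrad φ p⟫) (bulkMeasure d α) := by
  obtain ⟨r, hr⟩ := h.exists_time_bound
  exact integrable_inner_of_slab (r := r) (hG _ _) h.memLp_sliceGrad
    fun p hp => h.sliceGrad_eq_zero (hr p hp)

/-- The weak form of the wave operator, for a function with a weak gradient at almost every
time. -/
theorem integral_mul_waveOp_eq {v : ℝ × Space d × ℝ → ℝ} {G : ℝ × Space d × ℝ → Grad d}
    (hv : ∀ a b, MemLp v 2 (slabMeasure d α a b)) (hG : ∀ a b, MemLp G 2 (slabMeasure d α a b))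
    (hw : ∀ᵐ t : ℝ, IsWeakGrad (fun z => v (t, z)) (fun z => G (t, z)))
    {φ : ℝ × Space d × ℝ → ℝ} (h : IsTestOn (bulk d) φ) :
    ∫ p, v p * waveOp α φ p ∂bulkMeasure d α =
      ∫ p, v p * dt (dt φ) p ∂bulkMeasure d α + ∫ p, ⟪G p, sliceGrad φ p⟫ ∂bulkMeasure d α := by
  have i1 := (h.waveOp (α := α)).integrable_mul_slab hv
  have i2 := h.dt.dt.integrable_mul_slab (α := α) hv
  have i3 := h.integrable_inner_sliceGrad (α := α) hG
  rw [← sub_eq_iff_eq_add', ← integral_sub i1 i2]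
  have i4 := i1.sub i2
  rw [bulkMeasure] at i3 i4 ⊢
  rw [integral_prod _ i3]
  refine (integral_prod _ i4).trans ?_
  refine integral_congr_ae (hw.mono fun t ht => ?_)
  have h1 := ht.integral_mul_spatialOp (α := α) (h.slice t)
  rw [eq_neg_iff_add_eq_zero, add_comm, ← eq_neg_iff_add_eq_zero, ← integral_neg] at h1
  simp only [Pi.sub_apply]
  change _ = ∫ z, ⟪G (t, z), grad (fun z => φ (t, z)) z⟫ ∂wMeasure d α
  rw [h1]
  refine integral_congr_ae (Eventually.of_forall fun z => ?_)
  simp only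
  rw [waveOp_eq, iteratedDeriv_two_eq_dt h.1]
  ring

theorem locallyIntegrableOn_bulk_of_continuous {E : Type*} [NormedAddCommGroup E]
    {g : ℝ × Space d × ℝ → E} (hg : Continuous g) : LocallyIntegrableOn g (bulk d) volume :=
  hg.locallyIntegrable.locallyIntegrableOn _

theorem isWeakTimeDeriv_of_contDiff {g : ℝ × Space d × ℝ → ℝ} (hg : ContDiff ℝ ∞ g) :
    IsWeakTimeDeriv α g (dt g) := by
  refine ⟨locallyIntegrableOn_bulk_of_continuous hg.continuous,
    locallyIntegrableOn_bulk_of_continuous (contDiff_dt hg).continuous, fun φ hφ => ?_⟩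
  rw [← integral_mul_dt hg hφ]
  refine integral_congr_ae (Eventually.of_forall fun p => ?_)
  simp only [(hasDerivAt_dt (hφ.1.of_le (by simp)) p.1 p.2).deriv]

theorem deriv_eq_dt {X : Type*} [NormedAddCommGroup X] [NormedSpace ℝ X] {a : ℝ × X → ℝ}
    (ha : ContDiff ℝ ∞ a) (p : ℝ × X) : deriv (fun s => a (s, p.2)) p.1 = dt a p :=
  (hasDerivAt_dt (ha.of_le (by simp)) p.1 p.2).deriv

theorem IsTestOn.integrable_mul_locallyIntegrableOn {f φ : ℝ × Space d × ℝ → ℝ}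
    (hf : LocallyIntegrableOn f (bulk d) volume) (h : IsTestOn (bulk d) φ) :
    Integrable (fun p => f p * φ p) (bulkMeasure d α) := by
  have h1 : IsTestOn (bulk d) fun p => p.2.2 ^ (1 - 2 * α) * φ p :=
    h.contDiffOn_mul isOpen_bulk (contDiffOn_bulk_rpow _)
  have h2 := integrable_mul_of_locallyIntegrableOn hf h1.1.continuous h1.2.1 h1.2.2
  rw [bulkMeasure_eq, integrable_withDensity_iff_integrable_smul' (by fun_prop) (by simp)]
  refine h2.congr ?_
  filter_upwards [ae_restrict_mem isOpen_bulk.measurableSet] with p hp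
  rw [ENNReal.toReal_ofReal (bulk_weight_pos p hp).le, smul_eq_mul]
  ring

theorem IsWeakTimeDeriv.add {u g u' g' : ℝ × Space d × ℝ → ℝ} (h : IsWeakTimeDeriv α u g)
    (h' : IsWeakTimeDeriv α u' g') :
    IsWeakTimeDeriv α (fun p => u p + u' p) (fun p => g p + g' p) := by
  refine ⟨h.1.add h'.1, h.2.1.add h'.2.1, fun φ hφ => ?_⟩
  have e := h.2.2 φ hφ
  have e' := h'.2.2 φ hφ
  simp only [deriv_eq_dt hφ.1, add_mul] at e e' ⊢
  have hφ' : IsTestOn (bulk d) φ := hφ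
  rw [integral_add (hφ'.dt.integrable_mul_locallyIntegrableOn h.1)
    (hφ'.dt.integrable_mul_locallyIntegrableOn h'.1),
    integral_add (hφ'.integrable_mul_locallyIntegrableOn h.2.1)
    (hφ'.integrable_mul_locallyIntegrableOn h'.2.1), e, e', neg_add]

theorem IsWeakTimeDeriv.neg {u g : ℝ × Space d × ℝ → ℝ} (h : IsWeakTimeDeriv α u g) :
    IsWeakTimeDeriv α (fun p => -u p) (fun p => -g p) := by
  refine ⟨h.1.neg, h.2.1.neg, fun φ hφ => ?_⟩
  have e := h.2.2 φ hφ
  simp only [neg_mul, integral_neg] at e ⊢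
  rw [e]

theorem IsWeakTimeDeriv.sub {u g u' g' : ℝ × Space d × ℝ → ℝ} (h : IsWeakTimeDeriv α u g)
    (h' : IsWeakTimeDeriv α u' g') :
    IsWeakTimeDeriv α (fun p => u p - u' p) (fun p => g p - g' p) := by
  simpa only [sub_eq_add_neg] using h.add h'.neg

/-- Fubini's theorem for representatives of curves of square-integrable functions. -/
theorem integral_inner_curve [InnerProductSpace ℝ F] {V W : ℝ → Lp F 2 (wMeasure d α)}
    {v w : ℝ × Space d × ℝ → F} (hv : ∀ t, (fun z => v (t, z)) =ᵐ[wMeasure d α] V t)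
    (hw : ∀ t, (fun z => w (t, z)) =ᵐ[wMeasure d α] W t)
    (hi : Integrable (fun p => ⟪v p, w p⟫) (bulkMeasure d α)) :
    ∫ p, ⟪v p, w p⟫ ∂bulkMeasure d α = ∫ t, ⟪V t, W t⟫ := by
  rw [bulkMeasure] at hi ⊢
  rw [integral_prod _ hi]
  refine integral_congr_ae (Eventually.of_forall fun t => ?_)
  simp only
  rw [L2.inner_def]
  refine integral_congr_ae ?_
  filter_upwards [hv t, hw t] with z h1 h2
  rw [h1, h2]

theorem testCurve_ae {φ : ℝ × Space d × ℝ → ℝ} (h : IsTestOn (bulk d) φ) (t : ℝ) :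
    (fun z => φ (t, z)) =ᵐ[wMeasure d α] testCurve (α := α) h t :=
  (h.slice t).memLp.coeFn_toLp.symm

theorem testCurve_eq_zero {φ : ℝ × Space d × ℝ → ℝ} (h : IsTestOn (bulk d) φ) {t : ℝ}
    (ht : ∀ z, φ (t, z) = 0) : testCurve (α := α) h t = 0 :=
  (Lp.eq_zero_iff_ae_eq_zero).2 ((testCurve_ae h t).symm.trans (Eventually.of_forall ht))

theorem hasCompactSupport_testCurve {φ : ℝ × Space d × ℝ → ℝ} (h : IsTestOn (bulk d) φ) :
    HasCompactSupport (testCurve (α := α) h) := by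
  obtain ⟨r, hr⟩ := h.exists_time_bound
  refine HasCompactSupport.intro (isCompact_Icc (a := -r) (b := r)) fun t ht => ?_
  exact testCurve_eq_zero h fun z => image_eq_zero_of_notMem_tsupport (hr (t, z) ht)

theorem continuous_testCurve {φ : ℝ × Space d × ℝ → ℝ} (h : IsTestOn (bulk d) φ) :
    Continuous (testCurve (α := α) h) :=
  continuous_iff_continuousAt.2 fun t => (hasDerivAt_testCurve h t).continuousAt

theorem integral_mul_testCurve {V : ℝ → Lp ℝ 2 (wMeasure d α)} (hV : Continuous V)
    {v : ℝ × Space d × ℝ → ℝ} (hv : StronglyMeasurable v)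
    (h : ∀ t, (fun z => v (t, z)) =ᵐ[wMeasure d α] V t) {φ : ℝ × Space d × ℝ → ℝ}
    (hφ : IsTestOn (bulk d) φ) :
    ∫ p, v p * φ p ∂bulkMeasure d α = ∫ t, ⟪V t, testCurve hφ t⟫ := by
  have hi := hφ.integrable_mul_slab fun a b => memLp_slab_of_curve hV hv h a b
  rw [← integral_inner_curve h (testCurve_ae hφ)]
  · simp [mul_comm]
  · simpa [mul_comm] using hi

theorem integrable_inner_testCurve {W : ℝ → Lp ℝ 2 (wMeasure d α)} (hW : Continuous W)
    {φ : ℝ × Space d × ℝ → ℝ} (h : IsTestOn (bulk d) φ) :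
    Integrable fun t => ⟪W t, testCurve h t⟫ := by
  refine (hW.inner (continuous_testCurve h)).integrable_of_hasCompactSupport ?_
  refine (hasCompactSupport_testCurve (α := α) h).mono fun t ht h0 => ht ?_
  simp only
  rw [h0, inner_zero_right]

/-- Integration by parts in time against a test function. -/
theorem integral_inner_testCurve_dt {V V' : ℝ → Lp ℝ 2 (wMeasure d α)}
    (hV : ∀ t, HasDerivAt V (V' t) t) (hV' : Continuous V') {φ : ℝ × Space d × ℝ → ℝ}
    (hφ : IsTestOn (bulk d) φ) :
    ∫ t, ⟪V t, testCurve hφ.dt t⟫ = -∫ t, ⟪V' t, testCurve hφ t⟫ := by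
  have hc : Continuous V := continuous_iff_continuousAt.2 fun t => (hV t).continuousAt
  have := integral_bilinear_hasDerivAt_right_eq_neg_left_of_integrable
    (L := innerSL ℝ) (u := V) (u' := V') (v := testCurve hφ) (v' := testCurve hφ.dt)
    (fun t _ => hV t) (fun t _ => hasDerivAt_testCurve hφ t)
    (integrable_inner_testCurve hc hφ.dt) (integrable_inner_testCurve hV' hφ)
    (integrable_inner_testCurve hc hφ)
  exact this

/-- A differentiable curve in `L²_α` has a weak time derivative. -/
theorem isWeakTimeDeriv_of_curve {V V' : ℝ → Lp ℝ 2 (wMeasure d α)}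
    (hV : ∀ t, HasDerivAt V (V' t) t) (hV' : Continuous V') {v v' : ℝ × Space d × ℝ → ℝ}
    (hv : StronglyMeasurable v) (hv' : StronglyMeasurable v')
    (h : ∀ t, (fun z => v (t, z)) =ᵐ[wMeasure d α] V t)
    (h' : ∀ t, (fun z => v' (t, z)) =ᵐ[wMeasure d α] V' t) : IsWeakTimeDeriv α v v' := by
  have hc : Continuous V := continuous_iff_continuousAt.2 fun t => (hV t).continuousAt
  refine ⟨locallyIntegrableOn_bulk (memLp_slab_of_curve hc hv h),
    locallyIntegrableOn_bulk (memLp_slab_of_curve hV' hv' h'), fun φ hφ => ?_⟩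
  have hφ' : IsTestOn (bulk d) φ := hφ
  simp only [deriv_eq_dt hφ.1]
  rw [integral_mul_testCurve hc hv h hφ'.dt, integral_mul_testCurve hV' hv' h' hφ',
    integral_inner_testCurve_dt hV hV']

end Slabs

/-! ### The expansion at the boundary -/

section Coefficients

variable {α : ℝ} {k : ℕ} {χ : ℝ → ℝ}

/-- The coefficients of the expansion at the boundary: `y^{2j} □^j f` with these coefficients is a
formal power series solution of the equation. -/
noncomputable def coeff (α : ℝ) : ℕ → ℝ
  | 0 => 1
  | j + 1 => coeff α j / (4 * (j + 1) * (j + 1 - α))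

/-- The profile `y^{2j} χ(y)`. -/
def powerCutoff (χ : ℝ → ℝ) (j : ℕ) (y : ℝ) : ℝ := y ^ (2 * j) * χ y

theorem contDiff_powerCutoff (hχ : ContDiff ℝ ∞ χ) (j : ℕ) : ContDiff ℝ ∞ (powerCutoff χ j) :=
  (contDiff_id.pow _).mul hχ

theorem normalOp_congr {η ζ : ℝ → ℝ} {y : ℝ} (h : η =ᶠ[𝓝 y] ζ) :
    normalOp α η y = normalOp α ζ y := by
  rw [normalOp, normalOp, (h.iteratedDeriv_eq 2), h.deriv_eq]

theorem normalOp_const (c y : ℝ) : normalOp α (fun _ => c) y = 0 := by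
  simp [normalOp, iteratedDeriv_succ, iteratedDeriv_zero]

theorem normalOp_pow (j : ℕ) {y : ℝ} (hy : y ≠ 0) :
    normalOp α (fun y => y ^ (2 * (j + 1))) y = 4 * (j + 1) * (j + 1 - α) * y ^ (2 * j) := by
  have h1 : deriv (fun y : ℝ => y ^ (2 * (j + 1))) = fun y : ℝ => (2 * ((j : ℝ) + 1)) * y ^ (2 * j + 1) := by
    ext y
    rw [deriv_pow_field]
    push_cast
    congr 1
  rw [normalOp, iteratedDeriv_succ, iteratedDeriv_one, h1, deriv_const_mul_field, deriv_pow_field]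
  push_cast
  field_simp
  ring

theorem powerCutoff_eventuallyEq (h1 : ∀ y < 1, χ y = 1) (j : ℕ) {y : ℝ} (hy : y < 1) :
    powerCutoff χ j =ᶠ[𝓝 y] fun y => y ^ (2 * j) := by
  filter_upwards [isOpen_Iio.mem_nhds hy] with x hx
  rw [powerCutoff, h1 x hx, mul_one]

theorem powerCutoff_eventuallyEq_zero (h2 : ∀ y > 2, χ y = 0) (j : ℕ) {y : ℝ} (hy : 2 < y) :
    powerCutoff χ j =ᶠ[𝓝 y] fun _ => 0 := by
  filter_upwards [isOpen_Ioi.mem_nhds hy] with x hx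
  rw [powerCutoff, h2 x hx, mul_zero]

/-- The contribution of the wave operator on the boundary to the profile of `□^j f`. -/
noncomputable def shiftedProfile (α : ℝ) (χ : ℝ → ℝ) : ℕ → ℝ → ℝ
  | 0 => fun _ => 0
  | j + 1 => fun y => coeff α j * powerCutoff χ j y

/-- The profile of `□^j f` in the image of the expansion under the wave operator. -/
noncomputable def sourceProfile (α : ℝ) (k : ℕ) (χ : ℝ → ℝ) (j : ℕ) (y : ℝ) : ℝ :=
  shiftedProfile α χ j y - if j < k then coeff α j * normalOp α (powerCutoff χ j) y else 0

theorem continuousOn_sourceProfile (hχ : ContDiff ℝ ∞ χ) (j : ℕ) :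
    ContinuousOn (sourceProfile α k χ j) (Ioi 0) := by
  refine ContinuousOn.sub ?_ ?_
  · cases j with
    | zero => exact continuousOn_const
    | succ j => exact (continuous_const.mul (contDiff_powerCutoff hχ j).continuous).continuousOn
  · split_ifs
    · exact continuousOn_const.mul (continuousOn_normalOp (contDiff_powerCutoff hχ j))
    · exact continuousOn_const

theorem sourceProfile_eq_zero_of_gt (h2 : ∀ y > 2, χ y = 0) (j : ℕ) {y : ℝ} (hy : 2 < y) :
    sourceProfile α k χ j y = 0 := by
  have e1 : shiftedProfile α χ j y = 0 := by
    cases j with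
    | zero => rfl
    | succ j => simp [shiftedProfile, powerCutoff, h2 y hy]
  rw [sourceProfile, e1, normalOp_congr (powerCutoff_eventuallyEq_zero h2 j hy), normalOp_const]
  simp

/-- The coefficients are chosen such that all powers of `y` but the last one cancel. -/
theorem sourceProfile_eq_zero_of_lt (hα : ∀ m : ℕ, α ≠ m) (h1 : ∀ y < 1, χ y = 1) {j : ℕ}
    (hj : j < k) {y : ℝ} (hy : y ∈ Ioo (0 : ℝ) 1) : sourceProfile α k χ j y = 0 := by
  rw [sourceProfile, if_pos hj, normalOp_congr (powerCutoff_eventuallyEq h1 j hy.2)]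
  cases j with
  | zero => simp [shiftedProfile, normalOp_const]
  | succ j =>
    rw [normalOp_pow j hy.1.ne']
    simp only [shiftedProfile, powerCutoff, h1 y hy.2, coeff]
    have h3 : (j + 1 : ℝ) - α ≠ 0 := sub_ne_zero.2 fun h => hα (j + 1) (by rw [← h]; simp)
    have h4 : (j + 1 : ℝ) ≠ 0 := by positivity
    field_simp
    ring

theorem memLp_sourceProfile (hα : ∀ m : ℕ, α ≠ m) (hk : (1 + α) / 2 < k) (hk0 : k ≠ 0)
    (hχ : ContDiff ℝ ∞ χ) (h1 : ∀ y < 1, χ y = 1) (h2 : ∀ y > 2, χ y = 0) {j : ℕ}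
    (hj : j ≤ k) : MemLp (sourceProfile α k χ j) 2 (normalMeasure α) := by
  obtain ⟨i, rfl⟩ := Nat.exists_eq_succ_of_ne_zero hk0
  refine memLp_normalMeasure (continuousOn_sourceProfile hχ j) (A := |coeff α i|)
    (r := (2 * i : ℕ)) (by positivity) ?_ ?_ fun y hy => sourceProfile_eq_zero_of_gt h2 j hy
  · push_cast at hk ⊢
    linarith
  · intro y hy
    rcases hj.lt_or_eq with hj' | rfl
    · rw [sourceProfile_eq_zero_of_lt hα h1 hj' hy, abs_zero]
      have := hy.1.le
      positivity
    · rw [sourceProfile, if_neg (lt_irrefl _), sub_zero]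
      simp only [shiftedProfile, powerCutoff]
      rw [h1 y hy.2, mul_one, abs_mul, Real.rpow_natCast, abs_of_pos (pow_pos hy.1 _)]

end Coefficients

section Expansion

variable {d : ℕ} {α : ℝ} {k : ℕ} {χ : ℝ → ℝ}

theorem expansion_eq (b : ℕ → ℝ × Space d → ℝ) (p : ℝ × Space d × ℝ) :
    expansion k χ b p = ∑ j ∈ Finset.range k, b j (p.1, p.2.1) * powerCutoff χ j p.2.2 := by
  rw [expansion]
  exact Finset.sum_congr rfl fun j _ => by rw [powerCutoff]; ring

theorem contDiff_expansion (hχ : ContDiff ℝ ∞ χ) {b : ℕ → ℝ × Space d → ℝ}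
    (hb : ∀ j, ContDiff ℝ ∞ (b j)) : ContDiff ℝ ∞ (expansion k χ b) := by
  rw [funext (expansion_eq b)]
  exact ContDiff.sum fun j _ => contDiff_tensor (hb j) (contDiff_powerCutoff hχ j)

theorem dt_tensor {a : ℝ × Space d → ℝ} (ha : ContDiff ℝ ∞ a) {η : ℝ → ℝ}
    (hη : ContDiff ℝ ∞ η) (p : ℝ × Space d × ℝ) :
    dt (fun p : ℝ × Space d × ℝ => a (p.1, p.2.1) * η p.2.2) p = dt a (p.1, p.2.1) * η p.2.2 := by
  rw [← deriv_eq_dt (contDiff_tensor ha hη)]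
  exact ((hasDerivAt_dt (ha.of_le (by simp)) p.1 p.2.1).mul_const (η p.2.2)).deriv

/-- The wave operator maps the expansion with coefficients `c_j □^j f` to a sum in which the
profiles vanish to high order at the boundary. -/
theorem integral_expansion_mul_waveOp (hχ : ContDiff ℝ ∞ χ) {f : ℝ × Space d → ℝ}
    (hf : ∀ j, ContDiff ℝ ∞ (box^[j] f)) {φ : ℝ × Space d × ℝ → ℝ}
    (hφ : IsTestOn (bulk d) φ) :
    ∫ p, expansion k χ (fun j q => coeff α j * (box^[j] f) q) p * waveOp α φ p ∂bulkMeasure d α =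
      ∫ p, (∑ j ∈ Finset.range (k + 1),
        (box^[j] f) (p.1, p.2.1) * sourceProfile α k χ j p.2.2) * φ p ∂bulkMeasure d α := by
  have ht : ∀ j, ContDiff ℝ ∞ fun p : ℝ × Space d × ℝ =>
      (box^[j] f) (p.1, p.2.1) * powerCutoff χ j p.2.2 := fun j =>
    contDiff_tensor (hf j) (contDiff_powerCutoff hχ j)
  have e1 : ∀ p : ℝ × Space d × ℝ, ∑ j ∈ Finset.range (k + 1),
      (box^[j] f) (p.1, p.2.1) * sourceProfile α k χ j p.2.2 = ∑ j ∈ Finset.range k,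
        coeff α j * waveOp α (fun p => (box^[j] f) (p.1, p.2.1) * powerCutoff χ j p.2.2) p := by
    intro p
    simp only [waveOp_mul (hf _), sourceProfile, mul_sub, Finset.sum_sub_distrib]
    congr 1
    · rw [Finset.sum_range_succ']
      simp only [shiftedProfile, Function.iterate_succ_apply', mul_zero, add_zero]
      exact Finset.sum_congr rfl fun j _ => by ring
    · rw [Finset.sum_range_succ, if_neg (lt_irrefl _), mul_zero, add_zero]
      refine Finset.sum_congr rfl fun j hj => ?_
      rw [if_pos (Finset.mem_range.1 hj)]
      ring
  simp only [e1, expansion_eq, Finset.sum_mul]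
  rw [integral_finsetSum, integral_finsetSum]
  · refine Finset.sum_congr rfl fun j _ => ?_
    simp only [mul_assoc, integral_const_mul]
    congr 1
    simpa only [mul_assoc] using integral_mul_waveOp_comm (ht j) hφ
  · intro j _
    have := (hφ.contDiffOn_mul isOpen_bulk (contDiffOn_waveOp (α := α) (ht j))).const_mul (coeff α j)
    simpa only [mul_assoc] using this.integrable_bulkMeasure
  · intro j _
    have := ((hφ.waveOp (α := α)).contDiff_mul (ht j)).const_mul (coeff α j)
    simpa only [mul_assoc] using this.integrable_bulkMeasure

end Expansion

section Source

open scoped RealInnerProductSpace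

variable {d : ℕ} {α : ℝ} {k : ℕ} {χ : ℝ → ℝ}

/-- The projection of the energy space to `L²_α`. -/
noncomputable def energyFst (d : ℕ) (α : ℝ) : energySpace d α →L[ℝ] Lp ℝ 2 (wMeasure d α) :=
  (WithLp.fstL 2 ℝ _ _).comp (energySpace d α).subtypeL

/-- The gradient as an operator on the energy space. -/
noncomputable def energySnd (d : ℕ) (α : ℝ) :
    energySpace d α →L[ℝ] Lp (Grad d) 2 (wMeasure d α) :=
  (WithLp.sndL 2 ℝ _ _).comp (energySpace d α).subtypeL

theorem energyFst_apply (x : energySpace d α) : energyFst d α x = x.1.fst := rfl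

theorem energySnd_apply (x : energySpace d α) : energySnd d α x = x.1.snd := rfl

/-- The inhomogeneous wave equation in the energy space. -/
theorem exists_wave_solution_energySpace {F : ℝ → Lp ℝ 2 (wMeasure d α)} (hF : ContDiff ℝ ∞ F)
    (hFc : HasCompactSupport F) : ∃ u : ℝ → energySpace d α, ContDiff ℝ ∞ u ∧
      (∀ t ψ, ⟪energyFst d α (deriv (deriv u) t), energyFst d α ψ⟫ +
        ⟪energySnd d α (u t), energySnd d α ψ⟫ = ⟪F t, energyFst d α ψ⟫) ∧
      (∃ C, ∀ t, ‖energySnd d α (u t)‖ ^ 2 ≤ C) ∧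
      ∀ t₀, (∀ t < t₀, F t = 0) → ∀ t < t₀, u t = 0 := by
  have hsplit : ∀ x y : energySpace d α, ⟪x, y⟫ - ⟪energyFst d α x, energyFst d α y⟫ =
      ⟪energySnd d α x, energySnd d α y⟫ := by
    intro x y
    rw [Submodule.coe_inner, WithLp.prod_inner_apply]
    exact add_sub_cancel_left _ _
  obtain ⟨u, hu, heq, ⟨C, hC⟩, hz⟩ := exists_wave_solution (J := energyFst d α)
    (fun x => WithLp.norm_fst_le _ x.1) hF hFc
  refine ⟨u, hu, fun t ψ => ?_, ⟨C, fun t => ?_⟩, hz⟩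
  · rw [← hsplit]
    exact heq t ψ
  · have := hsplit (u t) (u t)
    simp only [real_inner_self_eq_norm_sq] at this
    rw [← this]
    exact hC t

end Source

/-! ### Traces at the boundary -/

section NearBoundary

variable {d : ℕ} {α : ℝ} {F : Type*} [NormedAddCommGroup F]

theorem enorm_le_sq_mul_add_inv (x : F) {w : ℝ} (hw : 0 < w) :
    ‖x‖ₑ ≤ ENNReal.ofReal w * ‖x‖ₑ ^ 2 + ENNReal.ofReal w⁻¹ := by
  rw [← ofReal_norm, ← ENNReal.ofReal_pow (norm_nonneg _), ← ENNReal.ofReal_mul hw.le,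
    ← ENNReal.ofReal_add (by positivity) (by positivity)]
  refine ENNReal.ofReal_le_ofReal ?_
  have : w * ‖x‖ ^ 2 + w⁻¹ - 2 * ‖x‖ = w⁻¹ * (w * ‖x‖ - 1) ^ 2 := by
    field_simp
    ring
  nlinarith [norm_nonneg x, mul_nonneg (inv_nonneg.2 hw.le) (sq_nonneg (w * ‖x‖ - 1))]

theorem lintegral_enorm_le_withDensity {X : Type*} [MeasurableSpace X] {m : Measure X}
    {U S : Set X} {w : X → ℝ} (hw : Measurable w) (hpos : ∀ x ∈ U, 0 < w x)
    (hS : MeasurableSet S) (hSU : S ⊆ U) (f : X → F) :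
    ∫⁻ x in S, ‖f x‖ₑ ∂m ≤
      ∫⁻ x in S, ‖f x‖ₑ ^ 2 ∂(m.restrict U).withDensity (fun x => ENNReal.ofReal (w x)) +
        ∫⁻ x in S, ENNReal.ofReal (w x)⁻¹ ∂m := by
  rw [restrict_withDensity hS, lintegral_withDensity_eq_lintegral_mul_non_measurable _
    (by fun_prop) (by simp), Measure.restrict_restrict hS, inter_eq_self_of_subset_left hSU,
    ← lintegral_add_right _ (by fun_prop)]
  exact setLIntegral_mono' hS fun x hx => enorm_le_sq_mul_add_inv _ (hpos x (hSU hx))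

theorem integrableOn_inv_weight (hα : 0 < α) (R : ℝ) :
    IntegrableOn (fun y : ℝ => (y ^ (1 - 2 * α))⁻¹) (Ioo 0 R) := by
  rcases le_or_gt R 0 with hR | hR
  · simp [Ioo_eq_empty_of_le hR]
  have h : IntegrableOn (fun y : ℝ => y ^ (-(1 - 2 * α))) (Ioc 0 R) :=
    (intervalIntegrable_iff_integrableOn_Ioc_of_le hR.le).1
      (intervalIntegral.intervalIntegrable_rpow' (by linarith))
  refine (h.mono_set Ioo_subset_Ioc_self).congr_fun (fun y hy => ?_) measurableSet_Ioo
  simp only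
  rw [Real.rpow_neg hy.1.le]

theorem lintegral_inv_weight_lt_top (hα : 0 < α) (r R : ℝ) :
    ∫⁻ z in Metric.closedBall (0 : Space d) r ×ˢ Ioo 0 R, ENNReal.ofReal (z.2 ^ (1 - 2 * α))⁻¹ <
      ⊤ := by
  rw [Measure.volume_eq_prod, ← Measure.prod_restrict, lintegral_prod _ (by fun_prop)]
  simp only [lintegral_const]
  refine ENNReal.mul_lt_top ?_ (by simpa using measure_closedBall_lt_top)
  refine lt_of_le_of_lt (lintegral_mono fun y => ?_) (integrableOn_inv_weight hα R).2
  exact Real.ofReal_le_enorm _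

/-- The set of points `(t, x, y)` with `(t, x) ∈ K` and `0 < y < ε`. -/
def strip (K : Set (ℝ × Space d)) (ε : ℝ) : Set (ℝ × Space d × ℝ) :=
  {p | (p.1, p.2.1) ∈ K ∧ p.2.2 ∈ Ioo 0 ε}

theorem measurableSet_strip {K : Set (ℝ × Space d)} (hK : MeasurableSet K) (ε : ℝ) :
    MeasurableSet (strip K ε) := by
  have h1 : Measurable fun p : ℝ × Space d × ℝ => (p.1, p.2.1) := by fun_prop
  have h2 : Measurable fun p : ℝ × Space d × ℝ => p.2.2 := by fun_prop
  exact (h1 hK).inter (h2 measurableSet_Ioo)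

theorem strip_subset_bulk (K : Set (ℝ × Space d)) (ε : ℝ) : strip K ε ⊆ bulk d :=
  fun _ hp => hp.2.1

theorem exists_strip_subset {K : Set (ℝ × Space d)} (hK : IsCompact K) : ∃ r : ℝ, ∀ ε,
    strip K ε ⊆ Icc (-r) r ×ˢ (Metric.closedBall (0 : Space d) r ×ˢ Ioo 0 ε) := by
  obtain ⟨r, hr⟩ := hK.isBounded.subset_closedBall 0
  refine ⟨r, fun ε p hp => ?_⟩
  have h1 := hr hp.1
  rw [mem_closedBall_zero_iff, Prod.norm_def, max_le_iff] at h1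
  exact ⟨abs_le.1 h1.1, mem_closedBall_zero_iff.2 h1.2, hp.2⟩

/-- Square-integrable functions on slabs are integrable up to the boundary. -/
theorem lintegral_strip_lt_top (hα : 0 < α) {f : ℝ × Space d × ℝ → F}
    (hf : ∀ a b, MemLp f 2 (slabMeasure d α a b)) {K : Set (ℝ × Space d)} (hK : IsCompact K)
    (R : ℝ) : ∫⁻ p in strip K R, ‖f p‖ₑ < ⊤ := by
  obtain ⟨r, hr⟩ := exists_strip_subset hK
  set S := Icc (-r) r ×ˢ (Metric.closedBall (0 : Space d) r ×ˢ Ioo 0 R) with hS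
  have hSm : MeasurableSet S := measurableSet_Icc.prod
    (Metric.isClosed_closedBall.measurableSet.prod measurableSet_Ioo)
  refine (lintegral_mono_set (hr R)).trans_lt ((lintegral_enorm_le_withDensity (U := bulk d)
    (measurable_bulk_weight (α := α)) bulk_weight_pos hSm (fun p hp => hp.2.2.1) f).trans_lt
    (ENNReal.add_lt_top.2 ⟨?_, ?_⟩))
  · rw [← bulkMeasure_eq]
    have h := (hf (-r) r).2
    rw [← ENNReal.pow_lt_top_iff (n := 2) |>.trans (or_iff_left two_ne_zero), eLpNorm_two_sq,
      slabMeasure_eq] at h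
    exact (lintegral_mono_set (prod_mono_right (subset_univ _))).trans_lt h
  · rw [hS, Measure.volume_eq_prod ℝ (Space d × ℝ), ← Measure.prod_restrict,
      lintegral_prod _ (by fun_prop)]
    simp only [lintegral_const]
    exact ENNReal.mul_lt_top (lintegral_inv_weight_lt_top hα r R) (by simp)

theorem volume_strip_lt_top {K : Set (ℝ × Space d)} (hK : IsCompact K) (R : ℝ) :
    volume (strip K R) < ⊤ := by
  obtain ⟨r, hr⟩ := exists_strip_subset hK
  refine (measure_mono (hr R)).trans_lt ?_
  rw [Measure.volume_eq_prod ℝ (Space d × ℝ), Measure.prod_prod, Measure.volume_eq_prod,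
    Measure.prod_prod]
  exact ENNReal.mul_lt_top (by simp) (ENNReal.mul_lt_top measure_closedBall_lt_top (by simp))

theorem tendsto_volume_strip {K : Set (ℝ × Space d)} (hK : IsCompact K) :
    Tendsto (fun ε => volume (strip K ε)) (𝓝[>] 0) (𝓝 0) := by
  obtain ⟨r, hr⟩ := exists_strip_subset hK
  have h0 : Tendsto (fun ε : ℝ => volume (Icc (-r) r) * (volume (Metric.closedBall (0 : Space d) r) *
      ENNReal.ofReal ε)) (𝓝[>] 0) (𝓝 0) := by
    have h1 : Tendsto (fun ε : ℝ => ENNReal.ofReal ε) (𝓝[>] 0) (𝓝 0) := by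
      rw [← ENNReal.ofReal_zero]
      exact (ENNReal.tendsto_ofReal tendsto_id).mono_left nhdsWithin_le_nhds
    have h2 := ENNReal.Tendsto.const_mul (a := volume (Icc (-r) r))
      (ENNReal.Tendsto.const_mul (a := volume (Metric.closedBall (0 : Space d) r)) h1
        (Or.inr measure_closedBall_lt_top.ne)) (Or.inr (by simp))
    simpa using h2
  refine tendsto_of_tendsto_of_tendsto_of_le_of_le tendsto_const_nhds h0 (fun _ => zero_le)
    fun ε => (measure_mono (hr ε)).trans (le_of_eq ?_)
  rw [Measure.volume_eq_prod ℝ (Space d × ℝ), Measure.prod_prod, Measure.volume_eq_prod,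
    Measure.prod_prod, Real.volume_Ioo, sub_zero]

/-- Functions `g` such that `g / y` is integrable up to the boundary have trace zero. -/
theorem tendsto_average_of_lintegral_inv_mul {g : ℝ × Space d × ℝ → ℝ} {K : Set (ℝ × Space d)}
    (hK : IsCompact K) (h : ∫⁻ p in strip K 1, ‖p.2.2⁻¹ * g p‖ₑ < ⊤) :
    Tendsto (fun ε : ℝ => (ENNReal.ofReal ε)⁻¹ * ∫⁻ p in strip K ε, ‖g p‖ₑ) (𝓝[>] 0) (𝓝 0) := by
  have h1 := tendsto_setLIntegral_zero (μ := volume.restrict (strip K 1)) h.ne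
    (l := 𝓝[>] 0) (s := fun ε => strip K ε) (tendsto_of_tendsto_of_tendsto_of_le_of_le
      tendsto_const_nhds (tendsto_volume_strip hK) (fun _ => zero_le)
      fun ε => Measure.restrict_apply_le _ _)
  refine tendsto_of_tendsto_of_tendsto_of_le_of_le' tendsto_const_nhds h1
    (Eventually.of_forall fun _ => zero_le) ?_
  filter_upwards [Ioo_mem_nhdsGT one_pos] with ε hε
  have hsub : strip K ε ⊆ strip K 1 := fun p hp => ⟨hp.1, hp.2.1, hp.2.2.trans hε.2⟩
  have hm := measurableSet_strip hK.measurableSet ε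
  rw [Measure.restrict_restrict hm, inter_eq_self_of_subset_left hsub,
    ← ENNReal.div_eq_inv_mul]
  refine ENNReal.div_le_of_le_mul ?_
  rw [mul_comm, ← lintegral_const_mul' _ _ ENNReal.ofReal_ne_top]
  refine setLIntegral_mono' hm fun p hp => ?_
  have hp0 : 0 < p.2.2 := hp.2.1
  rw [← ofReal_norm, ← ofReal_norm, ← ENNReal.ofReal_mul hε.1.le]
  refine ENNReal.ofReal_le_ofReal ?_
  rw [norm_mul, norm_inv, Real.norm_of_nonneg hp0.le, ← mul_assoc]
  refine le_mul_of_one_le_left (norm_nonneg _) ?_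
  rw [← div_eq_mul_inv, one_le_div hp0]
  exact hp.2.2.le

/-- The expansion has the boundary value `b_0`. -/
theorem lintegral_inv_mul_expansion_sub_lt_top {k : ℕ} (hk : k ≠ 0) {χ : ℝ → ℝ}
    (h1 : ∀ y < 1, χ y = 1) {b : ℕ → ℝ × Space d → ℝ}
    (hb : ∀ j, ContDiff ℝ ∞ (b j) ∧ HasCompactSupport (b j)) {K : Set (ℝ × Space d)}
    (hK : IsCompact K) :
    ∫⁻ p in strip K 1, ‖p.2.2⁻¹ * (expansion k χ b p - b 0 (p.1, p.2.1))‖ₑ < ⊤ := by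
  obtain ⟨i, rfl⟩ := Nat.exists_eq_succ_of_ne_zero hk
  choose C hC using fun j => (hb j).2.exists_bound_of_continuous (hb j).1.continuous
  have hm := measurableSet_strip hK.measurableSet 1
  refine (setLIntegral_mono' hm (g := fun _ => ENNReal.ofReal (∑ j ∈ Finset.range i, C (j + 1)))
    fun p hp => ?_).trans_lt ?_
  · have hp0 : 0 < p.2.2 := hp.2.1
    rw [expansion, Finset.sum_range_succ', h1 _ hp.2.2]
    simp only [mul_zero, pow_zero, mul_one, one_mul, add_sub_cancel_right]
    rw [← ofReal_norm, Finset.mul_sum]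
    refine ENNReal.ofReal_le_ofReal ((norm_sum_le _ _).trans (Finset.sum_le_sum fun j _ => ?_))
    have e : p.2.2⁻¹ * (p.2.2 ^ (2 * (j + 1)) * b (j + 1) (p.1, p.2.1)) =
        p.2.2 ^ (2 * j + 1) * b (j + 1) (p.1, p.2.1) := by
      field_simp
      ring
    rw [e, norm_mul, norm_pow, Real.norm_of_nonneg hp0.le]
    exact (mul_le_of_le_one_left (norm_nonneg _) (pow_le_one₀ hp0.le hp.2.2.le)).trans (hC _ _)
  · rw [setLIntegral_const]
    exact ENNReal.mul_lt_top ENNReal.ofReal_lt_top (volume_strip_lt_top hK 1)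

end NearBoundary

/-! ### Existence -/

section Existence

open scoped RealInnerProductSpace

variable {d : ℕ} {α : ℝ} {k : ℕ} {χ : ℝ → ℝ}

/-- The gradient of the time slices of a test function, as a curve in `L²_α`. -/
theorem sliceGrad_ae {φ : ℝ × Space d × ℝ → ℝ} (h : IsTestOn (bulk d) φ) (t : ℝ) :
    (fun z => sliceGrad φ (t, z)) =ᵐ[wMeasure d α]
      ((h.slice t).memLp_grad (α := α)).toLp (grad fun z => φ (t, z)) :=
  (h.slice t).memLp_grad.coeFn_toLp.symm

/-- Smooth solutions of the wave equation in the energy space are distributional solutions. -/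
theorem integral_mul_waveOp_of_energySpace {U : ℝ → energySpace d α} (hU : ContDiff ℝ ∞ U)
    {F : ℝ → Lp ℝ 2 (wMeasure d α)} (hF : Continuous F)
    (heq : ∀ t ψ, ⟪energyFst d α (deriv (deriv U) t), energyFst d α ψ⟫ +
        ⟪energySnd d α (U t), energySnd d α ψ⟫ = ⟪F t, energyFst d α ψ⟫)
    {v : ℝ × Space d × ℝ → ℝ} (hv : StronglyMeasurable v)
    (hvU : ∀ t, (fun z => v (t, z)) =ᵐ[wMeasure d α] energyFst d α (U t))
    {G : ℝ × Space d × ℝ → Grad d} (hG : StronglyMeasurable G)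
    (hGU : ∀ t, (fun z => G (t, z)) =ᵐ[wMeasure d α] energySnd d α (U t))
    {φ : ℝ × Space d × ℝ → ℝ} (h : IsTestOn (bulk d) φ) :
    ∫ p, v p * waveOp α φ p ∂bulkMeasure d α = ∫ t, ⟪F t, testCurve h t⟫ := by
  have c0 : Continuous fun t => energyFst d α (U t) := (energyFst d α).continuous.comp hU.continuous
  have c1 : Continuous fun t => energySnd d α (U t) := (energySnd d α).continuous.comp hU.continuous
  have hU1 : ContDiff ℝ ∞ (deriv U) := (contDiff_infty_iff_deriv.1 hU).2
  have hU2 : ContDiff ℝ ∞ (deriv (deriv U)) := (contDiff_infty_iff_deriv.1 hU1).2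
  have d0 : ∀ t, HasDerivAt (fun t => energyFst d α (U t)) (energyFst d α (deriv U t)) t := fun t =>
    (energyFst d α).hasFDerivAt.comp_hasDerivAt t (hU.differentiable (by simp) t).hasDerivAt
  have d1 : ∀ t, HasDerivAt (fun t => energyFst d α (deriv U t))
      (energyFst d α (deriv (deriv U) t)) t := fun t =>
    (energyFst d α).hasFDerivAt.comp_hasDerivAt t (hU1.differentiable (by simp) t).hasDerivAt
  have c2 : Continuous fun t => energyFst d α (deriv U t) :=
    (energyFst d α).continuous.comp hU1.continuous
  have c3 : Continuous fun t => energyFst d α (deriv (deriv U) t) :=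
    (energyFst d α).continuous.comp hU2.continuous
  have sv := memLp_slab_of_curve c0 hv hvU
  have sG := memLp_slab_of_curve c1 hG hGU
  rw [integral_mul_waveOp_eq sv sG (Eventually.of_forall fun t =>
      (hasHomGrad_of_mem_energySpace (U t).2 (hvU t) (hGU t)).isWeakGrad) h,
    integral_mul_testCurve c0 hv hvU h.dt.dt, integral_inner_testCurve_dt d0 c2 h.dt,
    integral_inner_testCurve_dt d1 c3 h, neg_neg,
    integral_inner_curve hGU (sliceGrad_ae h) (h.integrable_inner_sliceGrad sG),
    add_comm, ← eq_sub_iff_add_eq, ← integral_sub (integrable_inner_testCurve hF h)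
      (integrable_inner_testCurve c3 h)]
  refine integral_congr_ae (Eventually.of_forall fun t => ?_)
  exact eq_sub_of_add_eq' (heq t ⟨_, (h.slice t).mem_energySpace⟩)

theorem memLp_slab_of_memLp_bulk {F : Type*} [NormedAddCommGroup F] {f : ℝ × Space d × ℝ → F}
    (hf : MemLp f 2 (bulkMeasure d α)) (a b : ℝ) : MemLp f 2 (slabMeasure d α a b) := by
  rw [slabMeasure_eq]
  exact hf.mono_measure Measure.restrict_le_self

theorem memLp_bulk_sum {s : Finset ℕ} {a : ℕ → ℝ × Space d → ℝ} (ha : ∀ j, IsTestOn univ (a j))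
    {γ : ℕ → ℝ → ℝ} (hγ : ∀ j ∈ s, MemLp (γ j) 2 (normalMeasure α)) :
    MemLp (fun p : ℝ × Space d × ℝ => ∑ j ∈ s, a j (p.1, p.2.1) * γ j p.2.2) 2
      (bulkMeasure d α) :=
  memLp_finsetSum (f := fun j (p : ℝ × Space d × ℝ) => a j (p.1, p.2.1) * γ j p.2.2) s
    fun j hj => memLp_bulk_mul (ha j).1.continuous (ha j).2.1 (hγ j hj)

/-- The function `∑ j, □^j f (t, x) γ_j(y)`, regarded as a smooth, compactly supported curve of
square-integrable functions of `(x, y)`. -/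
theorem exists_sourceCurve {f : ℝ × Space d → ℝ} (hf : ContDiff ℝ ∞ f)
    (hfc : HasCompactSupport f) {m : ℕ} {γ : ℕ → ℝ → ℝ}
    (hγ : ∀ j : Fin m, MemLp (γ j) 2 (normalMeasure α)) :
    ∃ F : ℝ → Lp ℝ 2 (wMeasure d α), ContDiff ℝ ∞ F ∧ HasCompactSupport F ∧
      (∀ t₀ : ℝ, (∀ t x, t < t₀ → f (t, x) = 0) → ∀ t < t₀, F t = 0) ∧
      ∀ t, (fun z : Space d × ℝ => ∑ j ∈ Finset.range m,
        (box^[j] f) (t, z.1) * γ j z.2) =ᵐ[wMeasure d α] F t := by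
  have ht : IsTestOn univ f := ⟨hf, hfc, subset_univ _⟩
  have hb := fun j => ht.iterate_box j
  set F : ℝ → Lp ℝ 2 (wMeasure d α) := fun t => ∑ j : Fin m, productCurve (hb j) (hγ j) t with hFdef
  have hF : ContDiff ℝ ∞ F := ContDiff.sum fun j _ => contDiff_productCurve (hb j) (hγ j)
  have hF0 : ∀ t₀ : ℝ, (∀ t x, t < t₀ → f (t, x) = 0) → ∀ t < t₀, F t = 0 := by
    intro t₀ h0 t htt
    have hU : IsTestOn {q : ℝ × Space d | t₀ ≤ q.1} f := by
      refine ⟨hf, hfc, closure_minimal (fun q hq => ?_) (isClosed_le continuous_const continuous_fst)⟩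
      by_contra hn
      exact hq (h0 q.1 q.2 (not_le.1 hn))
    refine Finset.sum_eq_zero fun j _ => productCurve_eq_zero _ _ fun x => ?_
    exact (hU.iterate_box j).eq_zero (not_le.2 htt)
  have hFc : HasCompactSupport F := by
    obtain ⟨r, hr⟩ := ht.exists_time_bound
    have hU : IsTestOn {q : ℝ × Space d | q.1 ∈ Icc (-r) r} f := by
      refine ⟨hf, hfc, fun q hq => ?_⟩
      by_contra hn
      exact hr q hn hq
    refine HasCompactSupport.intro (isCompact_Icc (a := -r) (b := r)) fun t htr => ?_
    exact Finset.sum_eq_zero fun j _ => productCurve_eq_zero _ _ fun x =>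
      (hU.iterate_box j).eq_zero htr
  have hFae : ∀ t, (fun z : Space d × ℝ => ∑ j ∈ Finset.range m,
      (box^[j] f) (t, z.1) * γ j z.2) =ᵐ[wMeasure d α] F t := by
    intro t
    have h1 : ∀ j : Fin m, productCurve (hb j) (hγ j) t =ᵐ[wMeasure d α]
        fun z => (box^[j] f) (t, z.1) * γ j z.2 := fun j =>
      (memLp_slice_mul (hb j).1.continuous (hb j).2.1 (hγ j) t).coeFn_toLp
    filter_upwards [Lp.coeFn_finsetSum Finset.univ fun j : Fin m => productCurve (hb j) (hγ j) t,
      ae_all_iff.2 h1] with z h2 h3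
    rw [hFdef, h2, Finset.sum_range fun j => (box^[j] f) (t, z.1) * γ j z.2]
    simp only [Finset.sum_apply, h3]
  exact ⟨F, hF, hFc, hF0, hFae⟩

/-- The part of the solution of finite energy. -/
theorem exists_remainder (hα : 0 < α) {f : ℝ × Space d → ℝ} (hf : ContDiff ℝ ∞ f)
    (hfc : HasCompactSupport f) {m : ℕ} {γ : ℕ → ℝ → ℝ}
    (hγ : ∀ j : Fin m, MemLp (γ j) 2 (normalMeasure α)) :
    ∃ v v' : ℝ × Space d × ℝ → ℝ, StronglyMeasurable v ∧ StronglyMeasurable v' ∧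
      MemLInftyHom α v ∧ MemL2LocHom α v ∧ IsWeakTimeDeriv α v v' ∧
      (∀ a b, MemLp v 2 (slabMeasure d α a b)) ∧ (∀ a b, MemLp v' 2 (slabMeasure d α a b)) ∧
      (∀ a b, MemLp (fun p => p.2.2⁻¹ * v p) 2 (slabMeasure d α a b)) ∧
      (∀ φ, IsTestOn (bulk d) φ → ∫ p, v p * waveOp α φ p ∂bulkMeasure d α =
        -∫ p, (∑ j ∈ Finset.range m, (box^[j] f) (p.1, p.2.1) * γ j p.2.2) * φ p
          ∂bulkMeasure d α) ∧
      ∀ t₀ : ℝ, (∀ t x, t < t₀ → f (t, x) = 0) → ∀ t < t₀,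
        (fun z => v (t, z)) =ᵐ[wMeasure d α] 0 ∧ (fun z => v' (t, z)) =ᵐ[wMeasure d α] 0 := by
  have hb := fun j => (IsTestOn.iterate_box ⟨hf, hfc, subset_univ _⟩ j : IsTestOn univ _)
  obtain ⟨F, hF, hFc, hF0, hFae⟩ := exists_sourceCurve hf hfc hγ
  obtain ⟨U, hU, heq, ⟨C, hC⟩, hU0⟩ := exists_wave_solution_energySpace hF.neg
    (HasCompactSupport.comp_left (g := fun x => -x) hFc neg_zero)
  have hU1 : ContDiff ℝ ∞ (deriv U) := (contDiff_infty_iff_deriv.1 hU).2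
  have c0 : Continuous fun t => energyFst d α (U t) := (energyFst d α).continuous.comp hU.continuous
  have c1 : Continuous fun t => energyFst d α (deriv U t) :=
    (energyFst d α).continuous.comp hU1.continuous
  have c2 : Continuous fun t => energySnd d α (U t) := (energySnd d α).continuous.comp hU.continuous
  obtain ⟨v, hv, hvU⟩ := exists_jointly_measurable c0
  obtain ⟨v', hv', hvU'⟩ := exists_jointly_measurable c1
  obtain ⟨G, hG, hGU⟩ := exists_jointly_measurable c2
  have hom : ∀ t, HasHomGrad α (fun z => v (t, z)) (fun z => G (t, z)) := fun t =>
    hasHomGrad_of_mem_energySpace (U t).2 (hvU t) (hGU t)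
  have hGn : ∀ t, eLpNorm (fun z => G (t, z)) 2 (wMeasure d α) ≤ ENNReal.ofReal √C := by
    intro t
    rw [eLpNorm_congr_ae (hGU t), ← ENNReal.ofReal_toReal (Lp.eLpNorm_ne_top _), ← Lp.norm_def]
    exact ENNReal.ofReal_le_ofReal (Real.le_sqrt_of_sq_le (hC t))
  refine ⟨v, v', hv, hv', ⟨hv.aestronglyMeasurable, G, hG.aestronglyMeasurable, (√C).toNNReal,
    Eventually.of_forall fun t => ⟨hom t, hGn t⟩⟩, ⟨hv.aestronglyMeasurable, G,
    Eventually.of_forall hom, memLp_slab_of_curve c2 hG hGU⟩,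
    isWeakTimeDeriv_of_curve (fun t => (energyFst d α).hasFDerivAt.comp_hasDerivAt t
      (hU.differentiable (by simp) t).hasDerivAt) c1 hv hv' hvU hvU',
    memLp_slab_of_curve c0 hv hvU, memLp_slab_of_curve c1 hv' hvU', fun a b => ?_,
    fun φ hφ => ?_, fun t₀ h0 t htt => ?_⟩
  · have hm : Measurable fun p : ℝ × Space d × ℝ => p.2.2⁻¹ := by fun_prop
    refine memLp_slab_of_bound (hm.aestronglyMeasurable.mul hv.aestronglyMeasurable)
      (C := ENNReal.ofReal α⁻¹ * ENNReal.ofReal √C)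
      (ENNReal.mul_ne_top ENNReal.ofReal_ne_top ENNReal.ofReal_ne_top)
      (Eventually.of_forall fun t => ?_)
    have h1 := hardy_of_mem_energySpace hα (U t).2
    rw [← energyFst_apply, ← energySnd_apply, ← eLpNorm_congr_ae (hGU t)] at h1
    refine le_trans (le_of_eq (eLpNorm_congr_ae ?_)) (h1.trans (mul_le_mul_right (hGn t) _))
    filter_upwards [hvU t] with z hz
    rw [← hz]
    rfl
  · rw [integral_mul_waveOp_of_energySpace hU hF.continuous.neg heq hv hvU hG hGU hφ]
    simp only [Pi.neg_apply, inner_neg_left, integral_neg]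
    have hi : ∀ a b, MemLp (fun p : ℝ × Space d × ℝ => ∑ j ∈ Finset.range m,
        (box^[j] f) (p.1, p.2.1) * γ j p.2.2) 2 (slabMeasure d α a b) := by
      exact memLp_slab_of_memLp_bulk (memLp_bulk_sum (fun j => (hb j)) fun j hj =>
        hγ ⟨j, Finset.mem_range.1 hj⟩)
    have := integral_inner_curve (V := F) (W := testCurve hφ) (w := φ) (v := fun p => ∑ j ∈ Finset.range m,
        (box^[j] f) (p.1, p.2.1) * γ j p.2.2) hFae (testCurve_ae hφ)
      (by simpa [mul_comm] using hφ.integrable_mul_slab hi)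
    rw [← this]
    simp [mul_comm]
  · have hz : ∀ s < t₀, U s = 0 := hU0 t₀ fun s hs => by simp [hF0 t₀ h0 s hs]
    have hz' : deriv U t = 0 := by
      have : U =ᶠ[𝓝 t] fun _ => 0 := by
        filter_upwards [isOpen_Iio.mem_nhds htt] with s hs using hz s hs
      rw [this.deriv_eq, deriv_const]
    have e1 := hvU t
    have e2 := hvU' t
    rw [hz t htt, map_zero] at e1
    rw [hz', map_zero] at e2
    exact ⟨e1.trans (Lp.coeFn_zero _ _ _), e2.trans (Lp.coeFn_zero _ _ _)⟩

theorem ae_bulk_of_ae_slice {P : ℝ × Space d × ℝ → Prop} (hP : MeasurableSet {p | P p})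
    (h : ∀ᵐ t : ℝ, ∀ᵐ z ∂wMeasure d α, P (t, z)) : ∀ᵐ p ∂volume.restrict (bulk d), P p := by
  rw [← ae_bulkMeasure_iff (α := α), bulkMeasure, Measure.ae_prod_iff_ae_ae hP]
  exact h

/-- Existence of the solution. -/
theorem exists_solution (hα : 0 < α) (hα' : ∀ m : ℕ, α ≠ m) (hk : (1 + α) / 2 < k)
    (hχ : ContDiff ℝ ∞ χ) (h1 : ∀ y < 1, χ y = 1) (h2 : ∀ y > 2, χ y = 0)
    {f : ℝ × Space d → ℝ} (hf : ContDiff ℝ ∞ f) (hfc : HasCompactSupport f) :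
    ∃ v : ℝ × Space d × ℝ → ℝ, MemLInftyHom α v ∧
      IsSolution α k χ f
        (fun p => expansion k χ (fun j q => coeff α j * (box^[j] f) q) p + v p) ∧
      ∀ t₀ : ℝ, (∀ t x, t < t₀ → f (t, x) = 0) → ∀ᵐ p ∂(volume.restrict (bulk d)), p.1 < t₀ →
        expansion k χ (fun j q => coeff α j * (box^[j] f) q) p + v p = 0 := by
  have hk0 : k ≠ 0 := by
    rintro rfl
    norm_num at hk
    linarith
  have ht : IsTestOn univ f := ⟨hf, hfc, subset_univ _⟩
  set b : ℕ → ℝ × Space d → ℝ := fun j q => coeff α j * (box^[j] f) q with hbdef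
  have hb : ∀ j, IsTestOn univ (b j) := fun j => (ht.iterate_box j).const_mul _
  have hE : ContDiff ℝ ∞ (expansion k χ b) := contDiff_expansion hχ fun j => (hb j).1
  have hE0 : ∀ t₀ : ℝ, (∀ t x, t < t₀ → f (t, x) = 0) → ∀ t < t₀, ∀ z,
      expansion k χ b (t, z) = 0 := by
    intro t₀ h0 t htt z
    have hU : IsTestOn {q : ℝ × Space d | t₀ ≤ q.1} f := by
      refine ⟨hf, hfc, closure_minimal (fun q hq => ?_) (isClosed_le continuous_const continuous_fst)⟩
      by_contra hn
      exact hq (h0 q.1 q.2 (not_le.1 hn))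
    refine Finset.sum_eq_zero fun j _ => ?_
    simp only [hbdef]
    rw [(hU.iterate_box j).eq_zero (not_le.2 htt), mul_zero, mul_zero]
  obtain ⟨v, v', hv, hv', hLi, hL2, hwt, hvs, hvs', hhardy, heq, hz⟩ :=
    exists_remainder hα hf hfc (m := k + 1) (γ := sourceProfile α k χ) fun j =>
      memLp_sourceProfile hα' hk hk0 hχ h1 h2 (Nat.lt_succ_iff.1 j.2)
  have hsum : ∀ p : ℝ × Space d × ℝ, expansion k χ b p + v p - expansion k χ b p = v p :=
    fun p => add_sub_cancel_left _ _
  have hwu := (isWeakTimeDeriv_of_contDiff (α := α) hE).add hwt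
  refine ⟨v, hLi, ⟨⟨b, fun j => ⟨(hb j).1, (hb j).2.1⟩, ?_, ?_⟩, ⟨hwu.1, fun φ hφ => ?_⟩,
    fun K hK => ?_, ⟨_, hwu, ?_⟩⟩, fun t₀ h0 => ?_⟩
  · simpa only [hsum] using hL2
  · simp only [hsum]
    exact ⟨v', hwt, fun a b => ⟨hvs a b, hvs' a b⟩⟩
  -- the equation: the remainder compensates the error of the expansion
  · have hφ' : IsTestOn (bulk d) φ := hφ
    have i1 : Integrable (fun p => expansion k χ b p * waveOp α φ p) (bulkMeasure d α) :=
      ((hφ'.waveOp (α := α)).contDiff_mul hE).integrable_bulkMeasure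
    simp only [add_mul]
    rw [integral_add i1 ((hφ'.waveOp (α := α)).integrable_mul_slab hvs),
      integral_expansion_mul_waveOp hχ (fun j => (ht.iterate_box j).1) hφ', heq φ hφ',
      add_neg_cancel]
  -- the boundary value: the quotient of `u - f` by `y` is integrable near the boundary, for the
  -- remainder by Hardy's inequality
  · refine tendsto_average_of_lintegral_inv_mul (g := fun p => expansion k χ b p + v p -
      f (p.1, p.2.1)) hK ?_
    have e1 := lintegral_inv_mul_expansion_sub_lt_top hk0 h1
      (fun j => ⟨(hb j).1, (hb j).2.1⟩) hK
    have e2 := lintegral_strip_lt_top hα hhardy hK 1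
    have hm : Measurable fun p : ℝ × Space d × ℝ => ‖p.2.2⁻¹ * v p‖ₑ :=
      ((by fun_prop : Measurable fun p : ℝ × Space d × ℝ => p.2.2⁻¹).mul hv.measurable).enorm
    refine lt_of_le_of_lt ?_ (ENNReal.add_lt_top.2 ⟨e1, e2⟩)
    rw [← lintegral_add_right _ hm]
    refine lintegral_mono fun p => ?_
    refine le_trans (le_of_eq (congrArg _ ?_)) (enorm_add_le _ _)
    have : b 0 (p.1, p.2.1) = f (p.1, p.2.1) := by simp [hbdef, coeff]
    rw [this]
    ring
  -- the initial condition: the solution vanishes before the support of `f`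
  · obtain ⟨r, hr⟩ := ht.exists_time_bound
    have h0 : ∀ t x, t < -r → f (t, x) = 0 := fun t x htt =>
      image_eq_zero_of_notMem_tsupport (hr (t, x) fun h => absurd h.1 (not_le.2 htt))
    refine fun ε hε => ⟨-r, Eventually.of_forall fun t htt => ⟨⟨0, ?_, by simp⟩, ?_⟩⟩
    · refine hasHomGrad_of_mem_energySpace (p := 0) (zero_mem _) ?_ (Lp.coeFn_zero _ _ _).symm
      filter_upwards [(hz _ h0 t htt).1, Lp.coeFn_zero ℝ 2 (wMeasure d α)] with z e1 e2
      rw [hE0 _ h0 t htt, zero_add, e1]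
      exact e2.symm
    · rw [eLpNorm_congr_ae (g := 0)]
      · simp
      · filter_upwards [(hz _ h0 t htt).2] with z e1
        rw [e1, ← deriv_eq_dt hE]
        have : (fun s => expansion k χ b (s, z)) =ᶠ[𝓝 t] fun _ => 0 := by
          filter_upwards [isOpen_Iio.mem_nhds htt] with s hs using hE0 _ h0 s hs z
        simp [this.deriv_eq]
  · refine ae_bulk_of_ae_slice (α := α) ?_ (Eventually.of_forall fun t => ?_)
    · have h3 : Measurable fun p => expansion k χ b p + v p :=
        hE.continuous.measurable.add hv.measurable
      have h4 : MeasurableSet {p : ℝ × Space d × ℝ | p.1 < t₀} := measurableSet_lt (by fun_prop) (by fun_prop)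
      simp only [imp_iff_not_or, Set.ofPred_or]
      exact h4.compl.union (h3 (measurableSet_singleton 0))
    · by_cases htt : t < t₀
      · filter_upwards [(hz _ h0 t htt).1] with z e1 _
        rw [hE0 _ h0 t htt, zero_add, e1]
        rfl
      · exact Eventually.of_forall fun z h => absurd h htt

end Existence

/-! ### Functions with trace zero -/

section Primitive

variable {d : ℕ} {α : ℝ}

/-- The primitive `∫_y^∞ ζ(x, s) ds` in the normal variable. -/
noncomputable def tailIntegral (ζ : Space d × ℝ → ℝ) (z : Space d × ℝ) : ℝ :=
  ∫ s in Ioi z.2, ζ (z.1, s)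

theorem tailIntegral_eq_convolution (ζ : Space d × ℝ → ℝ) (z : Space d × ℝ) :
    tailIntegral ζ z = (convolution ((Iio (0 : ℝ)).indicator fun _ => (1 : ℝ))
      (fun s => ζ (z.1, s)) (ContinuousLinearMap.lsmul ℝ ℝ) volume) z.2 := by
  rw [tailIntegral, convolution, ← integral_indicator measurableSet_Ioi,
    ← integral_sub_left_eq_self _ volume z.2]
  refine integral_congr_ae (Eventually.of_forall fun t => ?_)
  by_cases ht : t < 0
  · simp [indicator, ht]
  · have h : ¬z.2 < z.2 - t := fun h => ht (by linarith)
    simp [indicator, ht, h]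

theorem contDiff_tailIntegral {ζ : Space d × ℝ → ℝ} (hζ : ContDiff ℝ ∞ ζ)
    (hc : HasCompactSupport ζ) : ContDiff ℝ ∞ (tailIntegral ζ) := by
  rw [funext (tailIntegral_eq_convolution ζ), ← contDiffOn_univ, ← univ_prod_univ]
  refine contDiffOn_convolution_right_with_param (ContinuousLinearMap.lsmul ℝ ℝ)
    (g := fun x s => ζ (x, s)) isOpen_univ (hc.isCompact.image continuous_snd) ?_ ?_ ?_
  · intro x s _ hs
    exact image_eq_zero_of_notMem_tsupport fun h => hs ⟨(x, s), h, rfl⟩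
  · exact (locallyIntegrable_const (1 : ℝ)).indicator measurableSet_Iio
  · exact hζ.contDiffOn

theorem integrable_slice_of_hasCompactSupport {ζ : Space d × ℝ → ℝ} (hζ : Continuous ζ)
    (hc : HasCompactSupport ζ) (x : Space d) : Integrable fun s => ζ (x, s) := by
  have hs : Continuous fun s => ζ (x, s) := hζ.comp (by fun_prop)
  refine hs.integrable_of_hasCompactSupport ?_
  refine HasCompactSupport.intro (hc.isCompact.image continuous_snd) fun s hs => ?_
  exact image_eq_zero_of_notMem_tsupport fun h => hs ⟨(x, s), h, rfl⟩

theorem fderiv_tailIntegral {ζ : Space d × ℝ → ℝ} (hζ : ContDiff ℝ ∞ ζ)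
    (hc : HasCompactSupport ζ) (z : Space d × ℝ) :
    fderiv ℝ (tailIntegral ζ) z (frame none) = -ζ z := by
  have h1 : HasDerivAt (fun s => tailIntegral ζ (z.1, s)) (fderiv ℝ (tailIntegral ζ) z (0, 1)) z.2 :=
    HasFDerivAt.comp_hasDerivAt (l := tailIntegral ζ) (f := fun s => (z.1, s)) z.2
      ((contDiff_tailIntegral hζ hc).differentiable (by simp) z).hasFDerivAt
      ((hasDerivAt_const z.2 z.1).prodMk (hasDerivAt_id z.2))
  have hi := integrable_slice_of_hasCompactSupport hζ.continuous hc z.1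
  have h2 : HasDerivAt (fun s => tailIntegral ζ (z.1, s)) (-ζ z) z.2 := by
    have e : (fun s => tailIntegral ζ (z.1, s)) =
        fun s => tailIntegral ζ (z.1, z.2) - ∫ t in z.2..s, ζ (z.1, t) := by
      ext s
      rw [← intervalIntegral.integral_Ioi_sub_Ioi' hi.integrableOn hi.integrableOn]
      simp [tailIntegral]
    rw [e]
    have h3 := intervalIntegral.integral_hasDerivAt_right (f := fun t => ζ (z.1, t)) (a := z.2)
      (b := z.2) hi.intervalIntegrable
      (Continuous.stronglyMeasurableAtFilter (by have := hζ.continuous; fun_prop) _ _)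
      (by have := hζ.continuous; fun_prop)
    exact h3.const_sub _
  exact h1.unique h2

end Primitive

section Trace

open scoped RealInnerProductSpace

variable {d : ℕ} {α : ℝ}

/-- Square-integrable functions are integrable up to the boundary. -/
theorem integrableOn_cylinder {F : Type*} [NormedAddCommGroup F] (hα : 0 < α) {f : Space d × ℝ → F}
    (hf : MemLp f 2 (wMeasure d α)) (r R : ℝ) :
    IntegrableOn f (Metric.closedBall (0 : Space d) r ×ˢ Ioo 0 R) volume := by
  have hsub : Metric.closedBall (0 : Space d) r ×ˢ Ioo 0 R ⊆ halfSpace d := fun z hz => hz.2.1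
  have hS : MeasurableSet (Metric.closedBall (0 : Space d) r ×ˢ Ioo (0 : ℝ) R) :=
    Metric.isClosed_closedBall.measurableSet.prod measurableSet_Ioo
  refine ⟨(aestronglyMeasurable_wMeasure_iff.1 hf.1).mono_measure
    (Measure.restrict_mono hsub le_rfl), ?_⟩
  refine (lintegral_enorm_le_withDensity (U := halfSpace d)
    (measurable_weight (α := α)) weight_pos hS hsub f).trans_lt (ENNReal.add_lt_top.2
      ⟨?_, lintegral_inv_weight_lt_top hα r R⟩)
  change ∫⁻ x in _, ‖f x‖ₑ ^ 2 ∂wMeasure d α < ⊤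
  have h := hf.2
  rw [← ENNReal.pow_lt_top_iff (n := 2) |>.trans (or_iff_left two_ne_zero), eLpNorm_two_sq] at h
  exact (setLIntegral_le_lintegral _ _).trans_lt h

/-- A smooth function of `y` that vanishes for `y ≤ ε` and is equal to one for `y ≥ 2 ε`. -/
noncomputable def lowerCutoff (ε y : ℝ) : ℝ := Real.smoothTransition (y / ε - 1)

theorem contDiff_lowerCutoff (ε : ℝ) : ContDiff ℝ ∞ (lowerCutoff ε) :=
  Real.smoothTransition.contDiff.comp ((contDiff_id.div_const ε).sub contDiff_const)

theorem lowerCutoff_of_le {ε y : ℝ} (hε : 0 < ε) (h : y ≤ ε) : lowerCutoff ε y = 0 :=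
  Real.smoothTransition.zero_of_nonpos (by rw [sub_nonpos, div_le_one hε]; exact h)

theorem lowerCutoff_of_ge {ε y : ℝ} (hε : 0 < ε) (h : 2 * ε ≤ y) : lowerCutoff ε y = 1 :=
  Real.smoothTransition.one_of_one_le (by
    have : 2 ≤ y / ε := (le_div_iff₀ hε).2 h
    linarith)

theorem abs_lowerCutoff_le (ε y : ℝ) : |lowerCutoff ε y| ≤ 1 := by
  rw [lowerCutoff, abs_of_nonneg (Real.smoothTransition.nonneg _)]
  exact Real.smoothTransition.le_one _

theorem exists_abs_deriv_lowerCutoff_le : ∃ C : ℝ, 0 ≤ C ∧ ∀ ε > 0, ∀ y,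
    |deriv (lowerCutoff ε) y| ≤ (Ioo ε (2 * ε)).indicator (fun _ => C * ε⁻¹) y := by
  have hd : ContDiff ℝ ∞ Real.smoothTransition := Real.smoothTransition.contDiff
  have hc : Continuous (deriv Real.smoothTransition) := hd.continuous_deriv (by simp)
  obtain ⟨C, hC⟩ := (isCompact_Icc (a := (0 : ℝ)) (b := 1)).exists_bound_of_continuousOn
    hc.continuousOn
  have hC0 : 0 ≤ C := (norm_nonneg _).trans (hC 0 (by simp))
  -- outside `(0, 1)` the transition attains its extremal values, so its derivative vanishes
  have h0 : ∀ y : ℝ, y ∉ Ioo (0 : ℝ) 1 → deriv Real.smoothTransition y = 0 := by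
    intro y hy
    have hmin : IsLocalMin Real.smoothTransition y ∨ IsLocalMax Real.smoothTransition y := by
      rcases le_or_gt y 0 with h | h
      · left
        refine Eventually.of_forall fun x => ?_
        rw [Real.smoothTransition.zero_of_nonpos h]
        exact Real.smoothTransition.nonneg x
      · right
        have h1 : 1 ≤ y := not_lt.1 fun h1 => hy ⟨h, h1⟩
        refine Eventually.of_forall fun x => ?_
        rw [Real.smoothTransition.one_of_one_le h1]
        exact Real.smoothTransition.le_one x
    exact hmin.elim (fun h => h.deriv_eq_zero) fun h => h.deriv_eq_zero
  refine ⟨C, hC0, fun ε hε y => ?_⟩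
  have e : deriv (lowerCutoff ε) y = deriv Real.smoothTransition (y / ε - 1) * ε⁻¹ := by
    have h1 : HasDerivAt (fun y : ℝ => y / ε - 1) ε⁻¹ y := by
      simpa using ((hasDerivAt_id y).div_const ε).sub_const 1
    exact ((hd.differentiable (by simp) _).hasDerivAt.comp y h1).deriv
  have hiff : y / ε - 1 ∈ Ioo (0 : ℝ) 1 ↔ y ∈ Ioo ε (2 * ε) := by
    rw [mem_Ioo, mem_Ioo, sub_pos, one_lt_div hε, sub_lt_iff_lt_add, div_lt_iff₀ hε]
    norm_num
  rw [e, abs_mul, abs_of_pos (inv_pos.2 hε)]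
  by_cases hy : y ∈ Ioo ε (2 * ε)
  · rw [indicator_of_mem hy]
    have := hC _ (Ioo_subset_Icc_self (hiff.2 hy))
    exact mul_le_mul_of_nonneg_right this (inv_pos.2 hε).le
  · rw [indicator_of_notMem hy, h0 _ fun h => hy (hiff.1 h), abs_zero, zero_mul]

/-- A function on the half-space has trace zero in the averaged sense. -/
def HasZeroTrace (Z : Space d × ℝ → ℝ) : Prop :=
  ∀ r : ℝ, Tendsto (fun ε : ℝ => (ENNReal.ofReal ε)⁻¹ *
    ∫⁻ z in Metric.closedBall (0 : Space d) r ×ˢ Ioo 0 ε, ‖Z z‖ₑ) (𝓝[>] 0) (𝓝 0)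

/-- For functions with trace zero, the definition of the weak normal derivative extends to test
functions that are not supported away from the boundary. -/
theorem integral_mul_eq_integral_tailIntegral (hα : 0 < α) {Z : Space d × ℝ → ℝ}
    {G : Space d × ℝ → Grad d} (hZ : MemLp Z 2 (wMeasure d α)) (hG : MemLp G 2 (wMeasure d α))
    (hw : IsWeakGrad Z G) (htr : HasZeroTrace Z) {ζ : Space d × ℝ → ℝ}
    (hζ : IsTestOn (halfSpace d) ζ) :
    ∫ z in halfSpace d, Z z * ζ z =
      ∫ z in halfSpace d, ⟪G z, WithLp.toLp 2 (frame none)⟫ * tailIntegral ζ z := by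
  set Ψ := tailIntegral ζ with hΨ
  have hΨs : ContDiff ℝ ∞ Ψ := contDiff_tailIntegral hζ.1 hζ.2.1
  set ε : ℕ → ℝ := fun n => ((n : ℝ) + 1)⁻¹ with hε
  have hε0 : ∀ n, 0 < ε n := fun n => by positivity
  have hεl : Tendsto ε atTop (𝓝 0) := tendsto_inv_atTop_zero.comp
    (tendsto_atTop_add_const_right _ _ tendsto_natCast_atTop_atTop)
  have hεl' : Tendsto (fun n => 2 * ε n) atTop (𝓝[>] 0) := tendsto_nhdsWithin_iff.2
    ⟨by simpa using hεl.const_mul 2, Eventually.of_forall fun n => mul_pos two_pos (hε0 n)⟩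
  -- a box that contains the support of the test function
  obtain ⟨r, hr⟩ := hζ.2.1.isCompact.isBounded.subset_closedBall 0
  have hζ0 : ∀ x y, x ∉ Metric.closedBall (0 : Space d) r ∨ r < y → ζ (x, y) = 0 := by
    intro x y h
    refine image_eq_zero_of_notMem_tsupport fun hs => ?_
    have h1 := hr hs
    rw [mem_closedBall_zero_iff, Prod.norm_def, max_le_iff] at h1
    rcases h with h | h
    · exact h (mem_closedBall_zero_iff.2 h1.1)
    · exact absurd ((le_abs_self y).trans h1.2) (not_le.2 h)
  set B := Metric.closedBall (0 : Space d) r ×ˢ Ioo 0 (r + 1) with hB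
  have hBm : MeasurableSet B := Metric.isClosed_closedBall.measurableSet.prod measurableSet_Ioo
  have hBU : B ⊆ halfSpace d := fun z hz => hz.2.1
  have hΨ0 : ∀ z ∈ halfSpace d, z ∉ B → Ψ z = 0 := by
    intro z hz hzB
    refine setIntegral_eq_zero_of_forall_eq_zero fun s hs => hζ0 _ _ ?_
    by_contra hn
    push Not at hn
    exact hzB ⟨hn.1, hz, lt_of_lt_of_le hs (hn.2.trans (by linarith))⟩
  have hζB : ∀ z ∈ halfSpace d, z ∉ B → ζ z = 0 := by
    intro z hz hzB
    refine hζ0 _ _ ?_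
    by_contra hn
    push Not at hn
    exact hzB ⟨hn.1, hz, lt_of_le_of_lt hn.2 (by linarith)⟩
  have hKc : IsCompact (Metric.closedBall (0 : Space d) r ×ˢ Icc 0 (r + 1)) :=
    (isCompact_closedBall _ _).prod isCompact_Icc
  obtain ⟨M, hM⟩ := hKc.exists_bound_of_continuousOn hΨs.continuous.continuousOn
  have hMB : ∀ z ∈ B, ‖Ψ z‖ ≤ M := fun z hz => hM z ⟨hz.1, Ioo_subset_Icc_self hz.2⟩
  have hcut : ∀ n, ContDiff ℝ ∞ fun z : Space d × ℝ => lowerCutoff (ε n) z.2 := fun n =>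
    (contDiff_lowerCutoff _).comp contDiff_snd
  have hdcut : ∀ n (z : Space d × ℝ),
      fderiv ℝ (fun z : Space d × ℝ => lowerCutoff (ε n) z.2) z (frame none) =
        deriv (lowerCutoff (ε n)) z.2 := by
    intro n z
    have h1 := (((contDiff_lowerCutoff (ε n)).differentiable (by simp) z.2).hasDerivAt).hasFDerivAt.comp
      z (hasFDerivAt_snd (𝕜 := ℝ) (E := Space d) (F := ℝ) (p := z))
    rw [show (fun z : Space d × ℝ => lowerCutoff (ε n) z.2) = lowerCutoff (ε n) ∘ Prod.snd from rfl,
      h1.fderiv]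
    simp [frame]
  -- `Ψ` times a cutoff that vanishes near the boundary is a legitimate test function
  have htest : ∀ n, IsTestOn (halfSpace d) fun z => lowerCutoff (ε n) z.2 * Ψ z := by
    intro n
    have hsub : tsupport (fun z : Space d × ℝ => lowerCutoff (ε n) z.2 * Ψ z) ⊆
        Metric.closedBall (0 : Space d) r ×ˢ Icc (ε n) (r + 1) := by
      refine closure_minimal (fun z hz => ?_) (Metric.isClosed_closedBall.prod isClosed_Icc)
      have h1 : ε n < z.2 := not_le.1 fun h => hz (by simp [lowerCutoff_of_le (hε0 n) h])
      have h2 : z ∈ B := by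
        by_contra h
        exact hz (by simp [hΨ0 z ((hε0 n).trans h1) h])
      exact ⟨h2.1, h1.le, h2.2.2.le⟩
    refine ⟨(hcut n).mul hΨs, ((isCompact_closedBall _ _).prod isCompact_Icc).of_isClosed_subset
      (isClosed_tsupport _) hsub, hsub.trans fun z hz => lt_of_lt_of_le (hε0 n) hz.2.1⟩
  have hfd : ∀ n z, fderiv ℝ (fun z => lowerCutoff (ε n) z.2 * Ψ z) z (frame none) =
      deriv (lowerCutoff (ε n)) z.2 * Ψ z - lowerCutoff (ε n) z.2 * ζ z := by
    intro n z
    have h1 : HasFDerivAt (fun z => lowerCutoff (ε n) z.2 * Ψ z) _ z :=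
      ((hcut n).differentiable (by simp) z).hasFDerivAt.mul
        (hΨs.differentiable (by simp) z).hasFDerivAt
    rw [h1.fderiv]
    simp only [add_apply, smul_apply, smul_eq_mul, hdcut]
    rw [hΨ, fderiv_tailIntegral hζ.1 hζ.2.1]
    ring
  have iZ : IntegrableOn Z B := integrableOn_cylinder hα hZ _ _
  have iG : IntegrableOn G B := integrableOn_cylinder hα hG _ _
  -- integrals over the half-space reduce to the box
  have red : ∀ {F H : Space d × ℝ → ℝ}, (∀ z ∈ halfSpace d, z ∉ B → H z = 0) →
      ∫ z in halfSpace d, F z * H z = ∫ z in B, F z * H z := by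
    intro F H h
    refine (setIntegral_eq_of_subset_of_forall_sdiff_eq_zero isOpen_halfSpace.measurableSet hBU
      fun z hz => ?_)
    rw [h z hz.1 hz.2, mul_zero]
  have hlim1 : Tendsto (fun n => ∫ z in B, Z z * (lowerCutoff (ε n) z.2 * ζ z)) atTop
      (𝓝 (∫ z in B, Z z * ζ z)) := by
    obtain ⟨C, hC⟩ := hζ.2.1.exists_bound_of_continuous hζ.1.continuous
    refine tendsto_integral_of_dominated_convergence (fun z => ‖Z z‖ * C) (fun n => ?_)
      (iZ.norm.mul_const _) (fun n => Eventually.of_forall fun z => ?_) ?_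
    · exact iZ.aestronglyMeasurable.mul ((hcut n).continuous.mul hζ.1.continuous).aestronglyMeasurable
    · rw [norm_mul, norm_mul]
      refine mul_le_mul_of_nonneg_left ?_ (norm_nonneg _)
      exact (mul_le_of_le_one_left (norm_nonneg _) (abs_lowerCutoff_le _ _)).trans (hC z)
    · filter_upwards [ae_restrict_mem hBm] with z hz
      refine tendsto_const_nhds.congr' ?_
      have hz0 : 0 < z.2 := hz.2.1
      filter_upwards [(hεl'.mono_right nhdsWithin_le_nhds).eventually (Iio_mem_nhds hz0)] with n hn
      rw [lowerCutoff_of_ge (hε0 n) (le_of_lt hn), one_mul]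
  have hlim2 : Tendsto (fun n => ∫ z in B, ⟪G z, WithLp.toLp 2 (frame none)⟫ *
      (lowerCutoff (ε n) z.2 * Ψ z)) atTop
      (𝓝 (∫ z in B, ⟪G z, WithLp.toLp 2 (frame none)⟫ * Ψ z)) := by
    have iG' : IntegrableOn (fun z => ⟪G z, WithLp.toLp 2 (frame none)⟫) B :=
      iG.inner_const _
    refine tendsto_integral_of_dominated_convergence
      (fun z => ‖⟪G z, WithLp.toLp 2 (frame none)⟫‖ * M) (fun n => ?_)
      (iG'.norm.mul_const _) (fun n => ?_) ?_
    · exact iG'.aestronglyMeasurable.mul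
        ((hcut n).continuous.mul hΨs.continuous).aestronglyMeasurable
    · filter_upwards [ae_restrict_mem hBm] with z hz
      rw [norm_mul, norm_mul]
      refine mul_le_mul_of_nonneg_left ?_ (norm_nonneg _)
      exact (mul_le_of_le_one_left (norm_nonneg _) (abs_lowerCutoff_le _ _)).trans (hMB z hz)
    · filter_upwards [ae_restrict_mem hBm] with z hz
      refine tendsto_const_nhds.congr' ?_
      have hz0 : 0 < z.2 := hz.2.1
      filter_upwards [(hεl'.mono_right nhdsWithin_le_nhds).eventually (Iio_mem_nhds hz0)] with n hn
      rw [lowerCutoff_of_ge (hε0 n) (le_of_lt hn), one_mul]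
  -- the derivative of the cutoff is `O(1 / ε)` on `ε < y < 2 ε`, so trace zero removes this term
  have hlim3 : Tendsto (fun n => ∫ z in B, Z z * (deriv (lowerCutoff (ε n)) z.2 * Ψ z)) atTop
      (𝓝 0) := by
    obtain ⟨C, hC0, hC⟩ := exists_abs_deriv_lowerCutoff_le
    have hM0 : 0 ≤ max M 0 := le_max_right _ _
    have h1 : Tendsto (fun n => ENNReal.ofReal (2 * C * max M 0) * ((ENNReal.ofReal (2 * ε n))⁻¹ *
        ∫⁻ z in Metric.closedBall (0 : Space d) r ×ˢ Ioo 0 (2 * ε n), ‖Z z‖ₑ)) atTop (𝓝 0) := by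
      have := ENNReal.Tendsto.const_mul (a := ENNReal.ofReal (2 * C * max M 0)) ((htr r).comp hεl')
        (Or.inr ENNReal.ofReal_ne_top)
      simpa using this
    rw [tendsto_iff_edist_tendsto_0]
    refine tendsto_of_tendsto_of_tendsto_of_le_of_le tendsto_const_nhds h1 (fun _ => zero_le)
      fun n => ?_
    rw [edist_zero_right]
    refine (enorm_integral_le_lintegral_enorm _).trans ?_
    have hS : MeasurableSet (Metric.closedBall (0 : Space d) r ×ˢ Ioo 0 (2 * ε n)) :=
      Metric.isClosed_closedBall.measurableSet.prod measurableSet_Ioo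
    rw [← lintegral_const_mul' _ _ (by simp [hε0 n]), ← lintegral_const_mul' _ _ ENNReal.ofReal_ne_top,
      ← lintegral_indicator hBm, ← lintegral_indicator hS]
    refine lintegral_mono fun z => ?_
    by_cases hz : z ∈ B
    · rw [indicator_of_mem hz]
      by_cases hz2 : z.2 ∈ Ioo (ε n) (2 * ε n)
      · rw [indicator_of_mem (show z ∈ Metric.closedBall (0 : Space d) r ×ˢ Ioo 0 (2 * ε n) from
          ⟨hz.1, hz.2.1, hz2.2⟩), ← ofReal_norm, ← ofReal_norm,
          ← ENNReal.ofReal_inv_of_pos (mul_pos two_pos (hε0 n)),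
          ← ENNReal.ofReal_mul (inv_nonneg.2 (mul_pos two_pos (hε0 n)).le),
          ← ENNReal.ofReal_mul (by positivity)]
        refine ENNReal.ofReal_le_ofReal ?_
        have h2 := hC (ε n) (hε0 n) z.2
        rw [indicator_of_mem hz2] at h2
        rw [norm_mul, norm_mul]
        have h3 : ‖deriv (lowerCutoff (ε n)) z.2‖ * ‖Ψ z‖ ≤ C * (ε n)⁻¹ * max M 0 :=
          mul_le_mul h2 ((hMB z hz).trans (le_max_left _ _)) (norm_nonneg _)
            (mul_nonneg hC0 (inv_nonneg.2 (hε0 n).le))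
        refine (mul_le_mul_of_nonneg_left h3 (norm_nonneg _)).trans (le_of_eq ?_)
        have := (hε0 n).ne'
        field_simp
      · have h2 := hC (ε n) (hε0 n) z.2
        rw [indicator_of_notMem hz2] at h2
        rw [abs_nonpos_iff.1 h2]
        simp
    · rw [indicator_of_notMem hz]
      exact zero_le
  have key : ∀ n, (∫ z in B, Z z * (deriv (lowerCutoff (ε n)) z.2 * Ψ z)) -
      (∫ z in B, Z z * (lowerCutoff (ε n) z.2 * ζ z)) =
      -∫ z in B, ⟪G z, WithLp.toLp 2 (frame none)⟫ * (lowerCutoff (ε n) z.2 * Ψ z) := by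
    intro n
    have h1 := hw.eq _ (htest n) (frame none)
    simp only [hfd] at h1
    rw [red fun z hz hzB => by rw [hΨ0 z hz hzB, hζB z hz hzB]; simp,
      red fun z hz hzB => by rw [hΨ0 z hz hzB, mul_zero]] at h1
    rw [← h1, ← integral_sub]
    · simp only [mul_sub]
    · have hc : Continuous fun z : Space d × ℝ => deriv (lowerCutoff (ε n)) z.2 * Ψ z :=
        (((contDiff_lowerCutoff (ε n)).continuous_deriv (by simp)).comp continuous_snd).mul
          hΨs.continuous
      obtain ⟨C, hC⟩ := hKc.exists_bound_of_continuousOn hc.continuousOn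
      refine iZ.mul_bdd (c := C) hc.aestronglyMeasurable ?_
      filter_upwards [ae_restrict_mem hBm] with z hz
      exact hC z ⟨hz.1, Ioo_subset_Icc_self hz.2⟩
    · have hc : Continuous fun z : Space d × ℝ => lowerCutoff (ε n) z.2 * ζ z :=
        (hcut n).continuous.mul hζ.1.continuous
      obtain ⟨C, hC⟩ := hKc.exists_bound_of_continuousOn hc.continuousOn
      refine iZ.mul_bdd (c := C) hc.aestronglyMeasurable ?_
      filter_upwards [ae_restrict_mem hBm] with z hz
      exact hC z ⟨hz.1, Ioo_subset_Icc_self hz.2⟩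
  rw [red hζB, red hΨ0]
  have := tendsto_nhds_unique ((hlim3.sub hlim1).congr key) hlim2.neg
  linarith

end Trace

/-! ### Primitives in the normal variable -/

section BoundaryPrimitive

variable {d : ℕ} {α : ℝ} {g : Space d × ℝ → ℝ}

/-- The primitive `∫_0^y g(x, s) ds` that vanishes at the boundary. -/
noncomputable def primitive (g : Space d × ℝ → ℝ) (z : Space d × ℝ) : ℝ :=
  ∫ s in Ioo 0 z.2, g (z.1, s)

theorem stronglyMeasurable_primitive (hg : StronglyMeasurable g) :
    StronglyMeasurable (primitive g) := by
  have hS : MeasurableSet {q : (Space d × ℝ) × ℝ | q.2 ∈ Ioo 0 q.1.2} :=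
    (measurableSet_lt measurable_const measurable_snd).inter
      (measurableSet_lt measurable_snd measurable_fst.snd)
  have h1 : StronglyMeasurable fun q : (Space d × ℝ) × ℝ => g (q.1.1, q.2) :=
    hg.comp_measurable (by fun_prop)
  have h2 := (h1.indicator hS).integral_prod_right' (ν := (volume : Measure ℝ))
  refine (congrArg StronglyMeasurable (funext fun z => ?_)).mp h2
  rw [primitive, ← integral_indicator measurableSet_Ioo]
  rfl

/-- The part of the half-space over a ball, up to the height `R`. -/
def cylinder (d : ℕ) (r R : ℝ) : Set (Space d × ℝ) := Metric.closedBall (0 : Space d) r ×ˢ Ioo 0 R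

theorem measurableSet_cylinder (r R : ℝ) : MeasurableSet (cylinder d r R) :=
  Metric.isClosed_closedBall.measurableSet.prod measurableSet_Ioo

theorem cylinder_subset (r R : ℝ) : cylinder d r R ⊆ halfSpace d := fun _ hz => hz.2.1

theorem abs_primitive_le {r R : ℝ} {z : Space d × ℝ} (hz : z ∈ cylinder d r R)
    (hx : Integrable fun s => (cylinder d r R).indicator g (z.1, s)) :
    ‖primitive g z‖ ≤ ∫ s, ‖(cylinder d r R).indicator g (z.1, s)‖ := by
  have e : ∀ s ∈ Ioo 0 z.2, g (z.1, s) = (cylinder d r R).indicator g (z.1, s) := fun s hs =>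
    (indicator_of_mem (show (z.1, s) ∈ cylinder d r R from ⟨hz.1, hs.1, hs.2.trans hz.2.2⟩) g).symm
  rw [primitive, setIntegral_congr_fun measurableSet_Ioo e]
  refine (norm_integral_le_integral_norm _).trans ?_
  exact setIntegral_le_integral hx.norm (Eventually.of_forall fun s => norm_nonneg _)

theorem integrableOn_primitive (hg : StronglyMeasurable g) {r R : ℝ}
    (hgi : IntegrableOn g (cylinder d r R)) : IntegrableOn (primitive g) (cylinder d r R) := by
  have h1 : Integrable ((cylinder d r R).indicator g) :=
    (integrable_indicator_iff (measurableSet_cylinder r R)).2 hgi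
  rw [Measure.volume_eq_prod] at h1
  have h2 := h1.integral_norm_prod_left
  have h3 : Integrable fun z : Space d × ℝ =>
      (∫ s, ‖(cylinder d r R).indicator g (z.1, s)‖) * (Ioo 0 R).indicator (fun _ => (1 : ℝ)) z.2 := by
    rw [Measure.volume_eq_prod]
    exact h2.mul_prod ((integrable_indicator_iff measurableSet_Ioo).2 (by simp))
  refine h3.integrableOn.mono' (stronglyMeasurable_primitive hg).aestronglyMeasurable ?_
  have h4 : ∀ᵐ z : Space d × ℝ, Integrable fun s => (cylinder d r R).indicator g (z.1, s) := by
    rw [Measure.volume_eq_prod]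
    exact Measure.quasiMeasurePreserving_fst.ae h1.prod_right_ae
  filter_upwards [ae_restrict_mem (measurableSet_cylinder r R), ae_restrict_of_ae h4] with z hz hi
  rw [indicator_of_mem hz.2, mul_one]
  exact abs_primitive_le hz hi

/-- Duality between integration from the boundary and integration to infinity in the normal
variable: Fubini's theorem. -/
theorem integral_primitive_mul (hg : StronglyMeasurable g)
    (hgi : ∀ r R, IntegrableOn g (cylinder d r R)) {ζ : Space d × ℝ → ℝ}
    (hζ : IsTestOn (halfSpace d) ζ) :
    ∫ z in halfSpace d, primitive g z * ζ z = ∫ z in halfSpace d, g z * tailIntegral ζ z := by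
  obtain ⟨r, hr⟩ := hζ.2.1.isCompact.isBounded.subset_closedBall 0
  set B := cylinder d r (r + 1) with hB
  have hBm : MeasurableSet B := measurableSet_cylinder _ _
  have hζ0 : ∀ z, z ∉ B → ζ z = 0 := by
    intro z hzB
    refine image_eq_zero_of_notMem_tsupport fun hs => hzB ?_
    have h1 := hr hs
    rw [mem_closedBall_zero_iff, Prod.norm_def, max_le_iff] at h1
    exact ⟨mem_closedBall_zero_iff.2 h1.1, hζ.2.2 hs,
      lt_of_le_of_lt ((le_abs_self _).trans h1.2) (by linarith)⟩
  obtain ⟨C, hC⟩ := hζ.2.1.exists_bound_of_continuous hζ.1.continuous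
  set b := B.indicator g with hb
  have ib : Integrable b := (integrable_indicator_iff hBm).2 (hgi _ _)
  have hbm : StronglyMeasurable b := hg.indicator hBm
  set c : ℝ → ℝ := (Ioo 0 (r + 1)).indicator fun _ => C with hc
  have ic : Integrable c := (integrable_indicator_iff measurableSet_Ioo).2 (by simp)
  have hζc : ∀ x y, ‖ζ (x, y)‖ ≤ c y := by
    intro x y
    by_cases hy : y ∈ Ioo 0 (r + 1)
    · rw [hc, indicator_of_mem hy]
      exact hC _
    · rw [hζ0 _ fun h => hy h.2, hc, indicator_of_notMem hy, norm_zero]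
  -- the integrand in the variables `((x, s), y)`
  set H : (Space d × ℝ) × ℝ → ℝ := fun q =>
    b q.1 * {q : (Space d × ℝ) × ℝ | q.1.2 < q.2}.indicator (fun q => ζ (q.1.1, q.2)) q with hH
  have hHm : StronglyMeasurable H := by
    refine (hbm.comp_measurable measurable_fst).mul (StronglyMeasurable.indicator ?_
      (measurableSet_lt measurable_fst.snd measurable_snd))
    exact hζ.1.continuous.stronglyMeasurable.comp_measurable (by fun_prop)
  have hHle : ∀ q, ‖H q‖ ≤ ‖b q.1‖ * c q.2 := by
    intro q
    rw [hH, norm_mul]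
    refine mul_le_mul_of_nonneg_left ?_ (norm_nonneg _)
    exact (norm_indicator_le_norm_self _ _).trans (hζc _ _)
  have iH : Integrable H := by
    rw [Measure.volume_eq_prod]
    exact (ib.norm.mul_prod ic).mono' hHm.aestronglyMeasurable (Eventually.of_forall hHle)
  have hHs : ∀ x, Integrable (fun s => b (x, s)) →
      Integrable fun q : ℝ × ℝ => H ((x, q.1), q.2) := by
    intro x hx
    rw [Measure.volume_eq_prod]
    exact (hx.norm.mul_prod ic).mono' (hHm.comp_measurable (by fun_prop)).aestronglyMeasurable
      (Eventually.of_forall fun q => hHle ((x, q.1), q.2))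
  have e1 : ∀ z, ∫ y, H (z, y) = b z * tailIntegral ζ z := by
    intro z
    rw [tailIntegral, ← integral_indicator measurableSet_Ioi, ← integral_const_mul]
    rfl
  have e2 : ∀ x y, ∫ s, H ((x, s), y) = primitive g (x, y) * ζ (x, y) := by
    intro x y
    by_cases hxy : (x, y) ∈ B
    · rw [primitive, ← integral_indicator measurableSet_Ioo, ← integral_mul_const]
      refine integral_congr_ae (Eventually.of_forall fun s => ?_)
      by_cases hs : s ∈ Ioo 0 y
      · have h1 : (x, s) ∈ B := ⟨hxy.1, hs.1, hs.2.trans hxy.2.2⟩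
        simp only [hH, hb, indicator_of_mem h1, indicator_of_mem hs]
        rw [indicator_of_mem (show ((x, s), y) ∈ {q : (Space d × ℝ) × ℝ | q.1.2 < q.2} from hs.2)]
      · simp only [indicator_of_notMem hs, zero_mul, hH]
        by_cases hsy : s < y
        · have h1 : (x, s) ∉ B := fun h => hs ⟨h.2.1, hsy⟩
          rw [hb, indicator_of_notMem h1, zero_mul]
        · rw [indicator_of_notMem (show ((x, s), y) ∉ {q : (Space d × ℝ) × ℝ | q.1.2 < q.2} from
            hsy), mul_zero]
    · have h0 : ∀ s, H ((x, s), y) = 0 := by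
        intro s
        have : {q : (Space d × ℝ) × ℝ | q.1.2 < q.2}.indicator (fun q => ζ (q.1.1, q.2))
            ((x, s), y) = 0 := indicator_apply_eq_zero.2 fun _ => hζ0 _ hxy
        rw [hH]
        simp only [this, mul_zero]
      simp only [h0, integral_zero, hζ0 _ hxy, mul_zero]
  have iP : Integrable fun z => primitive g z * ζ z := by
    have h1 : IntegrableOn (fun z => primitive g z * ζ z) B :=
      (integrableOn_primitive hg (hgi r (r + 1))).mul_bdd (c := C)
        hζ.1.continuous.aestronglyMeasurable (Eventually.of_forall hC)
    rwa [integrableOn_iff_integrable_of_support_subset] at h1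
    intro z hz
    by_contra hn
    exact hz (by simp [hζ0 z hn])
  have iΨ : Integrable fun z => b z * tailIntegral ζ z := by
    have h1 := iH
    rw [Measure.volume_eq_prod (Space d × ℝ) ℝ] at h1
    have := h1.integral_prod_left
    simpa only [e1] using this
  have hl : ∫ z in halfSpace d, primitive g z * ζ z = ∫ z, primitive g z * ζ z := by
    refine setIntegral_eq_integral_of_forall_compl_eq_zero fun z hz => ?_
    rw [hζ.eq_zero hz, mul_zero]
  have hr' : ∫ z in halfSpace d, g z * tailIntegral ζ z = ∫ z, b z * tailIntegral ζ z := by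
    rw [← integral_indicator isOpen_halfSpace.measurableSet]
    refine integral_congr_ae (Eventually.of_forall fun z => ?_)
    by_cases hz : z ∈ B
    · simp only [hb]
      rw [indicator_of_mem (cylinder_subset _ _ hz), indicator_of_mem hz]
    · simp only [hb]
      rw [indicator_of_notMem hz, zero_mul]
      refine indicator_apply_eq_zero.2 fun hzU => ?_
      have : tailIntegral ζ z = 0 := by
        refine setIntegral_eq_zero_of_forall_eq_zero fun s hs => hζ0 _ fun h => hz ?_
        exact ⟨h.1, hzU, lt_trans hs h.2.2⟩
      rw [this, mul_zero]
  rw [hl, hr']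
  rw [Measure.volume_eq_prod] at iP iΨ ib ⊢
  rw [integral_prod _ iP, integral_prod _ iΨ]
  refine integral_congr_ae (ib.prod_right_ae.mono fun x hx => ?_)
  simp only [← e2, ← e1]
  exact (integral_integral_swap (f := fun s y => H ((x, s), y)) (hHs x hx)).symm

/-- A weighted Cauchy–Schwarz inequality for the primitive. -/
theorem enorm_primitive_sq_le (hα : 0 < α) (hg : StronglyMeasurable g) (z : Space d × ℝ)
    (hz : 0 < z.2) : ‖primitive g z‖ₑ ^ 2 ≤ ENNReal.ofReal (z.2 ^ (2 * α) / (2 * α)) *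
      ∫⁻ s in Ioo 0 z.2, ‖g (z.1, s)‖ₑ ^ 2 ∂normalMeasure α := by
  have hgm : Measurable fun s => g (z.1, s) := hg.measurable.comp (by fun_prop)
  have h1 : ‖primitive g z‖ₑ ≤ ∫⁻ s in Ioo 0 z.2, ‖g (z.1, s)‖ₑ := enorm_integral_le_lintegral_enorm _
  have h2 : ∫⁻ s in Ioo 0 z.2, ‖g (z.1, s)‖ₑ =
      ∫⁻ s in Ioo 0 z.2, (fun s => ENNReal.ofReal (s ^ (-(1 - 2 * α) / 2))) s *
        (fun s => ENNReal.ofReal (s ^ ((1 - 2 * α) / 2)) * ‖g (z.1, s)‖ₑ) s := by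
    refine setLIntegral_congr_fun measurableSet_Ioo fun s hs => ?_
    simp only
    rw [← mul_assoc, ← ENNReal.ofReal_mul (Real.rpow_nonneg hs.1.le _), ← Real.rpow_add hs.1,
      show -(1 - 2 * α) / 2 + (1 - 2 * α) / 2 = 0 by ring]
    simp
  have h3 := ENNReal.lintegral_mul_le_Lp_mul_Lq (volume.restrict (Ioo 0 z.2))
    Real.HolderConjugate.two_two
    (f := fun s => ENNReal.ofReal (s ^ (-(1 - 2 * α) / 2)))
    (g := fun s => ENNReal.ofReal (s ^ ((1 - 2 * α) / 2)) * ‖g (z.1, s)‖ₑ)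
    (by fun_prop) (by fun_prop)
  have h4 : ‖primitive g z‖ₑ ^ 2 ≤
      (∫⁻ s in Ioo 0 z.2, (ENNReal.ofReal (s ^ (-(1 - 2 * α) / 2))) ^ (2 : ℝ)) *
      ∫⁻ s in Ioo 0 z.2, (ENNReal.ofReal (s ^ ((1 - 2 * α) / 2)) * ‖g (z.1, s)‖ₑ) ^ (2 : ℝ) := by
    refine (pow_le_pow_left' (h1.trans (h2.le.trans h3)) 2).trans (le_of_eq ?_)
    rw [mul_pow, ← ENNReal.rpow_natCast, ← ENNReal.rpow_natCast, ← ENNReal.rpow_mul,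
      ← ENNReal.rpow_mul]
    simp
  refine h4.trans (mul_le_mul' ?_ ?_)
  · have e : ∫⁻ s in Ioo 0 z.2, (ENNReal.ofReal (s ^ (-(1 - 2 * α) / 2))) ^ (2 : ℝ) =
        ∫⁻ s in Ioc 0 z.2, ENNReal.ofReal (s ^ (2 * α - 1)) := by
      rw [← restrict_Ioo_eq_restrict_Ioc]
      refine setLIntegral_congr_fun measurableSet_Ioo fun s hs => ?_
      rw [ENNReal.ofReal_rpow_of_nonneg (Real.rpow_nonneg hs.1.le _) two_pos.le,
        ← Real.rpow_mul hs.1.le]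
      congr 2
      ring
    have hi : IntegrableOn (fun s : ℝ => s ^ (2 * α - 1)) (Ioc 0 z.2) :=
      (intervalIntegrable_iff_integrableOn_Ioc_of_le hz.le).1
        (intervalIntegral.intervalIntegrable_rpow' (by linarith))
    rw [e, ← ofReal_integral_eq_lintegral_ofReal hi]
    · refine ENNReal.ofReal_le_ofReal (le_of_eq ?_)
      rw [← intervalIntegral.integral_of_le hz.le, integral_rpow (Or.inl (by linarith))]
      rw [sub_add_cancel, Real.zero_rpow (by positivity), sub_zero]
    · filter_upwards [ae_restrict_mem measurableSet_Ioc] with s hs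
      exact Real.rpow_nonneg hs.1.le _
  · have hsub : Ioo 0 z.2 ∩ Ioi 0 = Ioo 0 z.2 := inter_eq_self_of_subset_left fun s hs => hs.1
    rw [normalMeasure, restrict_withDensity measurableSet_Ioo,
      Measure.restrict_restrict measurableSet_Ioo, hsub,
      lintegral_withDensity_eq_lintegral_mul_non_measurable _ (by fun_prop) (by simp)]
    refine (setLIntegral_congr_fun measurableSet_Ioo fun s hs => ?_).le
    simp only [Pi.mul_apply]
    rw [ENNReal.mul_rpow_of_nonneg _ _ two_pos.le,
      ENNReal.ofReal_rpow_of_nonneg (Real.rpow_nonneg hs.1.le _) two_pos.le,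
      ← Real.rpow_mul hs.1.le, ENNReal.rpow_ofNat]
    congr 3
    ring

/-- In a strip of width `a` near the boundary, the primitive is of size `a`. -/
theorem lintegral_primitive_sq_le (hα : 0 < α) (hg : StronglyMeasurable g) {a : ℝ} (ha : 0 < a) :
    ∫⁻ z in univ ×ˢ Ioo a (2 * a), ‖primitive g z‖ₑ ^ 2 ∂wMeasure d α ≤
      ENNReal.ofReal (a ^ 2 / α) *
        ∫⁻ z in univ ×ˢ Ioo 0 (2 * a), ‖g z‖ₑ ^ 2 ∂wMeasure d α := by
  have hgm := hg.measurable
  have hPm := (stronglyMeasurable_primitive hg).measurable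
  rw [wMeasure_eq_prod, ← Measure.prod_restrict, ← Measure.prod_restrict,
    lintegral_prod _ (by fun_prop), lintegral_prod _ (by fun_prop),
    ← lintegral_const_mul' _ _ ENNReal.ofReal_ne_top, Measure.restrict_univ]
  refine lintegral_mono fun x => ?_
  simp only
  set D := ∫⁻ s in Ioo 0 (2 * a), ‖g (x, s)‖ₑ ^ 2 ∂normalMeasure α with hD
  have h1 : ∫⁻ y in Ioo a (2 * a), ‖primitive g (x, y)‖ₑ ^ 2 ∂normalMeasure α ≤
      ∫⁻ y in Ioo a (2 * a), ENNReal.ofReal (y ^ (2 * α) / (2 * α)) * D ∂normalMeasure α := by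
    refine setLIntegral_mono' measurableSet_Ioo fun y hy => ?_
    refine (enorm_primitive_sq_le hα hg (x, y) (ha.trans hy.1)).trans (mul_le_mul_right ?_ _)
    exact lintegral_mono_set (Ioo_subset_Ioo_right hy.2.le)
  refine h1.trans ?_
  rw [lintegral_mul_const _ (by fun_prop)]
  refine mul_le_mul_left ?_ _
  have hsub : Ioo a (2 * a) ∩ Ioi 0 = Ioo a (2 * a) :=
    inter_eq_self_of_subset_left fun s hs => ha.trans hs.1
  rw [normalMeasure, restrict_withDensity measurableSet_Ioo,
      Measure.restrict_restrict measurableSet_Ioo, hsub,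
      lintegral_withDensity_eq_lintegral_mul_non_measurable _ (by fun_prop) (by simp)]
  have h2 : ∀ y ∈ Ioo a (2 * a), ((fun y => ENNReal.ofReal (y ^ (1 - 2 * α))) *
      fun y => ENNReal.ofReal (y ^ (2 * α) / (2 * α))) y ≤ ENNReal.ofReal (a / α) := by
    intro y hy
    have hy0 : 0 < y := ha.trans hy.1
    simp only [Pi.mul_apply]
    rw [← ENNReal.ofReal_mul (Real.rpow_nonneg hy0.le _), ← mul_div_assoc, ← Real.rpow_add hy0]
    refine ENNReal.ofReal_le_ofReal ?_
    rw [sub_add_cancel, Real.rpow_one, div_le_div_iff₀ (by positivity) hα]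
    nlinarith [hy.2, hα]
  refine (setLIntegral_mono' measurableSet_Ioo h2).trans ?_
  rw [setLIntegral_const, Real.volume_Ioo, ← ENNReal.ofReal_mul (by positivity)]
  refine ENNReal.ofReal_le_ofReal (le_of_eq ?_)
  ring

end BoundaryPrimitive

section TraceEstimate

open scoped RealInnerProductSpace

variable {d : ℕ} {α : ℝ}

/-- Functions with trace zero are primitives of their normal derivative, hence small near the
boundary. -/
theorem exists_lintegral_strip_le (hα : 0 < α) {Z : Space d × ℝ → ℝ}
    {G : Space d × ℝ → Grad d} (hZ : MemLp Z 2 (wMeasure d α)) (hG : MemLp G 2 (wMeasure d α))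
    (hw : IsWeakGrad Z G) (htr : HasZeroTrace Z) {a : ℝ} (ha : 0 < a) :
    ∫⁻ z in univ ×ˢ Ioo a (2 * a), ‖Z z‖ₑ ^ 2 ∂wMeasure d α ≤ ENNReal.ofReal (a ^ 2 / α) *
        ∫⁻ z in univ ×ˢ Ioo 0 (2 * a), ‖G z‖ₑ ^ 2 ∂wMeasure d α := by
  have hGn : MemLp (fun z => ⟪G z, WithLp.toLp 2 (frame none)⟫) 2 (wMeasure d α) :=
    hG.inner_const _
  obtain ⟨g, hg, hgG⟩ := hGn.1
  have hg2 : MemLp g 2 (wMeasure d α) := (memLp_congr_ae hgG).1 hGn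
  have hgi : ∀ r R, IntegrableOn g (cylinder d r R) := fun r R => integrableOn_cylinder hα hg2 r R
  have hgG' := ae_wMeasure_iff.1 hgG
  -- `Z` and the primitive of its normal derivative have the same pairings with test functions
  have hZP : Z =ᵐ[wMeasure d α] primitive g := by
    rw [EventuallyEq, ae_wMeasure_iff]
    have hP : LocallyIntegrableOn (primitive g) (halfSpace d) volume := by
      rw [locallyIntegrableOn_iff isOpen_halfSpace.isLocallyClosed]
      intro K hKU hK
      obtain ⟨r, hr⟩ := hK.isBounded.subset_closedBall 0
      refine (integrableOn_primitive hg (hgi r (r + 1))).mono_set fun z hz => ?_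
      have h1 := hr hz
      rw [mem_closedBall_zero_iff, Prod.norm_def, max_le_iff] at h1
      exact ⟨mem_closedBall_zero_iff.2 h1.1, hKU hz,
        lt_of_le_of_lt ((le_abs_self _).trans h1.2) (by linarith)⟩
    have hd := IsOpen.ae_eq_zero_of_integral_contDiff_smul_eq_zero isOpen_halfSpace
      (hw.integrable.sub hP) fun ζ h1 h2 h3 => ?_
    · rw [ae_restrict_iff' isOpen_halfSpace.measurableSet]
      exact hd.mono fun z hz hzU => sub_eq_zero.1 (hz hzU)
    · have hζ : IsTestOn (halfSpace d) ζ := ⟨h1, h2, h3⟩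
      have e1 := integral_mul_eq_integral_tailIntegral hα hZ hG hw htr hζ
      have e2 := integral_primitive_mul hg hgi hζ
      have e3 : ∫ z in halfSpace d, ⟪G z, WithLp.toLp 2 (frame none)⟫ * tailIntegral ζ z =
          ∫ z in halfSpace d, g z * tailIntegral ζ z :=
        integral_congr_ae (hgG'.mono fun z hz => by simp only [hz])
      rw [e3, ← e2, ← sub_eq_zero, ← integral_sub (hw.integrable_mul hζ)
        (integrable_mul_of_locallyIntegrableOn hP h1.continuous h2 h3)] at e1
      rw [← e1, ← setIntegral_eq_integral_of_forall_compl_eq_zero (s := halfSpace d)]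
      · refine integral_congr_ae (Eventually.of_forall fun z => ?_)
        simp only [smul_eq_mul, Pi.sub_apply]
        ring
      · intro z hz
        rw [hζ.eq_zero hz, zero_smul]
  have h := lintegral_primitive_sq_le hα hg ha
  rw [lintegral_congr_ae (ae_restrict_of_ae (hZP.mono fun z hz => by rw [hz]))]
  refine h.trans (mul_le_mul_right ?_ _)
  refine lintegral_mono_ae (ae_restrict_of_ae (hgG.mono fun z hz => ?_))
  rw [← hz]
  refine pow_le_pow_left' ?_ 2
  rw [enorm_le_iff_norm_le]
  refine (norm_inner_le_norm _ _).trans (mul_le_of_le_one_right (norm_nonneg _) ?_)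
  rw [← sq_le_one_iff₀ (norm_nonneg _), WithLp.prod_norm_sq_eq_of_L2]
  simp [frame]

end TraceEstimate

/-! ### Mollification -/

section Mollification

set_option linter.unusedSectionVars false

variable {E F : Type*} [NormedAddCommGroup E] [NormedSpace ℝ E] [FiniteDimensional ℝ E]
  [MeasurableSpace E] [BorelSpace E] [NormedAddCommGroup F] [NormedSpace ℝ F]

/-- The mollification of `f` by a normalised bump function. -/
noncomputable def mollify (m : Measure E) (φ : ContDiffBump (0 : E)) (f : E → F) : E → F :=
  convolution (φ.normed m) f (ContinuousLinearMap.lsmul ℝ ℝ) m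

variable {m : Measure E} [m.IsAddHaarMeasure] (φ : ContDiffBump (0 : E))

theorem mollify_apply (f : E → F) (x : E) :
    mollify m φ f x = ∫ t, φ.normed m t • f (x - t) ∂m := rfl

theorem mollify_apply_swap (f : E → F) (x : E) :
    mollify m φ f x = ∫ t, φ.normed m (x - t) • f t ∂m := by
  rw [mollify, convolution_lsmul_swap]

theorem mollify_congr {f g : E → F} (h : f =ᵐ[m] g) : mollify m φ f = mollify m φ g :=
  convolution_congr _ (ae_eq_refl _) h

theorem lintegral_normed : ∫⁻ t, ENNReal.ofReal (φ.normed m t) ∂m = 1 := by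
  rw [← ofReal_integral_eq_lintegral_ofReal φ.integrable_normed
    (Eventually.of_forall φ.nonneg_normed), φ.integral_normed, ENNReal.ofReal_one]

/-- Jensen's inequality for the averages defining a mollification. -/
theorem enorm_mollify_sq_le {f : E → F} (hf : StronglyMeasurable f) (x : E) :
    ‖mollify m φ f x‖ₑ ^ 2 ≤ ∫⁻ t, ENNReal.ofReal (φ.normed m t) * ‖f (x - t)‖ₑ ^ 2 ∂m := by
  have hφ : Measurable fun t => ENNReal.ofReal (φ.normed m t) :=
    φ.continuous_normed.measurable.ennreal_ofReal
  set ν := m.withDensity fun t => ENNReal.ofReal (φ.normed m t) with hν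
  have hp : IsProbabilityMeasure ν := ⟨by rw [hν, withDensity_apply _ MeasurableSet.univ,
    Measure.restrict_univ, lintegral_normed]⟩
  have hfx : StronglyMeasurable fun t => f (x - t) :=
    hf.comp_measurable (measurable_const.sub measurable_id)
  have h1 : ‖mollify m φ f x‖ₑ ≤ eLpNorm (fun t => f (x - t)) 1 ν := by
    rw [mollify_apply, eLpNorm_one_eq_lintegral_enorm, hν,
      lintegral_withDensity_eq_lintegral_mul _ hφ hfx.enorm]
    refine (enorm_integral_le_lintegral_enorm _).trans (lintegral_mono fun t => ?_)
    rw [enorm_smul, Real.enorm_of_nonneg (φ.nonneg_normed t)]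
    rfl
  have h2 := h1.trans (eLpNorm_le_eLpNorm_of_exponent_le (μ := ν) (one_le_two)
    hfx.aestronglyMeasurable)
  calc ‖mollify m φ f x‖ₑ ^ 2 ≤ eLpNorm (fun t => f (x - t)) 2 ν ^ 2 := by gcongr
    _ = _ := by
      rw [eLpNorm_two_sq, hν, lintegral_withDensity_eq_lintegral_mul _ hφ (hfx.enorm.pow_const _)]
      rfl

theorem eLpNorm_mollify_le {f : E → F} (hf : AEStronglyMeasurable f m) :
    eLpNorm (mollify m φ f) 2 m ≤ eLpNorm f 2 m := by
  obtain ⟨g, hg, hfg⟩ := hf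
  rw [mollify_congr φ hfg, eLpNorm_congr_ae hfg, ← (ENNReal.pow_right_strictMono two_ne_zero).le_iff_le,
    eLpNorm_two_sq, eLpNorm_two_sq]
  have hφ : Measurable fun t => ENNReal.ofReal (φ.normed m t) :=
    φ.continuous_normed.measurable.ennreal_ofReal
  calc ∫⁻ x, ‖mollify m φ g x‖ₑ ^ 2 ∂m
      ≤ ∫⁻ x, ∫⁻ t, ENNReal.ofReal (φ.normed m t) * ‖g (x - t)‖ₑ ^ 2 ∂m ∂m :=
        lintegral_mono fun x => enorm_mollify_sq_le φ hg x
    _ = ∫⁻ t, ∫⁻ x, ENNReal.ofReal (φ.normed m t) * ‖g (x - t)‖ₑ ^ 2 ∂m ∂m := by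
        refine lintegral_lintegral_swap (Measurable.aemeasurable ?_)
        exact (hφ.comp measurable_snd).mul
          (((hg.comp_measurable (measurable_fst.sub measurable_snd)).enorm).pow_const 2)
    _ = ∫⁻ t, ENNReal.ofReal (φ.normed m t) * ∫⁻ x, ‖g x‖ₑ ^ 2 ∂m ∂m := by
        refine lintegral_congr fun t => ?_
        have hm : Measurable fun x => ‖g (x - t)‖ₑ ^ 2 :=
          (hg.comp_measurable (measurable_id.sub_const t)).enorm.pow_const 2
        rw [lintegral_const_mul _ hm, lintegral_sub_right_eq_self (fun x => ‖g x‖ₑ ^ 2)]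
    _ = ∫⁻ x, ‖g x‖ₑ ^ 2 ∂m := by
        rw [lintegral_mul_const _ hφ, lintegral_normed, one_mul]

theorem continuous_mollify {f : E → F} (hf : LocallyIntegrable f m) : Continuous (mollify m φ f) :=
  φ.hasCompactSupport_normed.continuous_convolution_left _ φ.continuous_normed hf

theorem mollify_sub {f g : E → F} (hf : LocallyIntegrable f m) (hg : LocallyIntegrable g m) :
    mollify m φ (f - g) = mollify m φ f - mollify m φ g := by
  have hi {h : E → F} (hh : LocallyIntegrable h m) :
      ConvolutionExists (φ.normed m) h (ContinuousLinearMap.lsmul ℝ ℝ) m :=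
    (φ.hasCompactSupport_normed (μ := m)).convolutionExists_left (ContinuousLinearMap.lsmul ℝ ℝ)
      φ.continuous_normed hh
  ext x
  rw [Pi.sub_apply, mollify_apply]
  simp only [Pi.sub_apply, smul_sub]
  exact integral_sub (hi hf x) (hi hg x)

theorem support_mollify_subset (f : E → F) :
    Function.support (mollify m φ f) ⊆ Metric.thickening φ.rOut (Function.support f) := by
  refine (support_convolution_subset _).trans ?_
  rw [φ.support_normed_eq]
  rintro _ ⟨x, hx, y, hy, rfl⟩
  exact Metric.mem_thickening_iff.2 ⟨y, hy, by simpa [dist_eq_norm] using hx⟩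

/-- Mollifications of a square-integrable function converge to it in `L²`. -/
theorem tendsto_eLpNorm_mollify_sub [CompleteSpace F] {ι : Type*} {l : Filter ι}
    {φ : ι → ContDiffBump (0 : E)}
    (hφ : Tendsto (fun i => (φ i).rOut) l (𝓝 0)) {f : E → F} (hf : MemLp f 2 m) :
    Tendsto (fun i => eLpNorm (mollify m (φ i) f - f) 2 m) l (𝓝 0) := by
  rw [ENNReal.tendsto_nhds_zero]
  intro ε hε
  have hε3 : ε / 3 ≠ 0 := (ENNReal.div_pos hε.ne' (by simp)).ne'
  -- approximate `f` by a continuous compactly supported `g`, whose mollifications converge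
  -- uniformly
  obtain ⟨g, hgc, hfg, hg, hgL⟩ := hf.exists_hasCompactSupport_eLpNorm_sub_le (by simp) hε3
  set K := Metric.cthickening 1 (tsupport g) with hK
  have hKc : IsCompact K := hgc.isCompact.cthickening
  obtain ⟨δ, hδ, hδ'⟩ : ∃ δ : ℝ, 0 < δ ∧ ENNReal.ofReal δ * m K ^ (1 / 2 : ℝ) ≤ ε / 3 := by
    have h1 : m K ^ (1 / 2 : ℝ) ≠ ⊤ :=
      ENNReal.rpow_ne_top_of_nonneg (by norm_num) hKc.measure_lt_top.ne
    have h2 : Tendsto (fun δ : ℝ => ENNReal.ofReal δ * m K ^ (1 / 2 : ℝ)) (𝓝[>] 0) (𝓝 0) := by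
      have : Tendsto (fun δ : ℝ => ENNReal.ofReal δ) (𝓝[>] 0) (𝓝 (ENNReal.ofReal 0)) :=
        (ENNReal.continuous_ofReal.tendsto 0).mono_left nhdsWithin_le_nhds
      simpa using ENNReal.Tendsto.mul_const this (Or.inr h1)
    have h3 := (h2.eventually (ge_mem_nhds (pos_iff_ne_zero.2 hε3))).and self_mem_nhdsWithin
    obtain ⟨δ, hδ⟩ := h3.exists
    exact ⟨δ, hδ.2, hδ.1⟩
  obtain ⟨r, hr, hr'⟩ := Metric.uniformContinuous_iff.1 (hgc.uniformContinuous_of_continuous hg) δ hδ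
  filter_upwards [hφ.eventually (gt_mem_nhds hr), hφ.eventually (gt_mem_nhds one_pos)] with i hi hi1
  have hgb : eLpNorm (mollify m (φ i) g - g) 2 m ≤ ε / 3 := by
    have h0 : ∀ x ∉ K, (mollify m (φ i) g - g) x = 0 := by
      intro x hx
      have hx1 : g x = 0 := image_eq_zero_of_notMem_tsupport
        fun h => hx (Metric.self_subset_cthickening _ h)
      have hx2 : mollify m (φ i) g x = 0 := by
        by_contra hne
        refine hx (Metric.thickening_subset_cthickening _ _
          (Metric.thickening_mono hi1.le _ (Metric.thickening_subset_of_subset _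
            (subset_tsupport g) (support_mollify_subset (φ i) g hne))))
      rw [Pi.sub_apply, hx1, hx2, sub_zero]
    have hKm : MeasurableSet K := Metric.isClosed_cthickening.measurableSet
    rw [← eLpNorm_restrict_eq_of_support_subset (s := K)
      (Function.support_subset_iff'.2 h0)]
    refine (eLpNorm_le_of_ae_bound (C := δ) (Eventually.of_forall fun x => ?_)).trans ?_
    · rw [Pi.sub_apply, ← dist_eq_norm]
      exact (φ i).dist_normed_convolution_le hg.aestronglyMeasurable
        fun y hy => (hr' (lt_trans hy hi)).le
    · rw [Measure.restrict_apply_univ, mul_comm]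
      simpa using hδ'
  have hfi : LocallyIntegrable f m := hf.locallyIntegrable one_le_two
  have hgi : LocallyIntegrable g m := hg.locallyIntegrable
  have heq : mollify m (φ i) f - f = mollify m (φ i) (f - g) + (mollify m (φ i) g - g) - (f - g) := by
    rw [mollify_sub (φ i) hfi hgi]; abel
  have hms := (hf.1.sub hg.aestronglyMeasurable)
  have hmm : AEStronglyMeasurable (mollify m (φ i) (f - g)) m :=
    (continuous_mollify (φ i) (hfi.sub hgi)).aestronglyMeasurable
  have hmg : AEStronglyMeasurable (mollify m (φ i) g - g) m :=
    ((continuous_mollify (φ i) hgi).sub hg).aestronglyMeasurable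
  rw [heq]
  calc _ ≤ eLpNorm (mollify m (φ i) (f - g)) 2 m + eLpNorm (mollify m (φ i) g - g) 2 m
        + eLpNorm (f - g) 2 m :=
        (eLpNorm_sub_le (hmm.add hmg) hms one_le_two).trans
          (add_le_add_left (eLpNorm_add_le hmm hmg one_le_two) _)
    _ ≤ ε / 3 + ε / 3 + ε / 3 := by
        gcongr
        exact (eLpNorm_mollify_le (φ i) hms).trans hfg
    _ = ε := ENNReal.add_thirds ε

theorem contDiff_mollify {f : E → F} [CompleteSpace F] (hf : LocallyIntegrable f m) :
    ContDiff ℝ ∞ (mollify m φ f) :=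
  φ.hasCompactSupport_normed.contDiff_convolution_left _ φ.contDiff_normed hf

theorem fderiv_mollify {f : E → ℝ} (hf : LocallyIntegrable f m) (x e : E) :
    fderiv ℝ (mollify m φ f) x e = ∫ t, fderiv ℝ (φ.normed m) (x - t) e * f t ∂m := by
  have hc : ContDiff ℝ 1 (φ.normed m) := φ.contDiff_normed
  have h := φ.hasCompactSupport_normed.hasFDerivAt_convolution_right
    (ContinuousLinearMap.lsmul ℝ ℝ).flip hf hc x
  have h2 : mollify m φ f = convolution f (φ.normed m) (ContinuousLinearMap.lsmul ℝ ℝ).flip m := by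
    rw [mollify, convolution_flip]
  rw [h2, h.fderiv, convolution_precompR_apply _ hf (φ.hasCompactSupport_normed.fderiv ℝ)
    (hc.continuous_fderiv one_ne_zero)]
  rfl

end Mollification

/-! ### Localization in the open half-space -/

section Localization

open scoped RealInnerProductSpace

variable {d : ℕ} {α : ℝ}

theorem norm_grad_le {φ : Space d × ℝ → ℝ} {z : Space d × ℝ} (h : DifferentiableAt ℝ φ z) :
    ‖grad φ z‖ ≤ ‖fderiv ℝ φ z‖ := by
  have h1 : ‖grad φ z‖ ^ 2 ≤ ‖fderiv ℝ φ z‖ * ‖grad φ z‖ := by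
    rw [← real_inner_self_eq_norm_sq, inner_grad h]
    refine (le_abs_self _).trans (((fderiv ℝ φ z).le_opNorm _).trans ?_)
    gcongr
    rw [Prod.norm_def]
    refine max_le ?_ ?_
    · exact WithLp.prod_norm_eq_of_L2 (grad φ z) ▸ Real.le_sqrt_of_sq_le
        (le_add_of_nonneg_right (sq_nonneg _))
    · exact WithLp.prod_norm_eq_of_L2 (grad φ z) ▸ Real.le_sqrt_of_sq_le
        (le_add_of_nonneg_left (sq_nonneg _))
  by_contra! hlt
  nlinarith [norm_nonneg (fderiv ℝ φ z), norm_nonneg (grad φ z)]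

theorem memLp_volume_of_eq_zero {F : Type*} [NormedAddCommGroup F] {K : Set (Space d × ℝ)}
    (hK : IsCompact K) (hKU : K ⊆ halfSpace d) {f : Space d × ℝ → F}
    (hf : MemLp f 2 (wMeasure d α)) (h0 : ∀ z ∉ K, f z = 0) : MemLp f 2 volume := by
  obtain ⟨c, hc, hle⟩ := exists_restrict_le_withDensity (m := (volume : Measure (Space d × ℝ)))
    hK hKU (continuousOn_weight (α := α)) weight_pos
  have h1 : MemLp f 2 (volume.restrict K) := hf.of_measure_le_smul hc hle
  have h2 : f = K.indicator f := by
    ext z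
    by_cases hz : z ∈ K
    · rw [indicator_of_mem hz]
    · rw [indicator_of_notMem hz, h0 z hz]
  rw [h2]
  exact (memLp_indicator_iff_restrict hK.measurableSet).2 h1

theorem exists_eLpNorm_wMeasure_le {K : Set (Space d × ℝ)}
    (hK : IsCompact K) (hKU : K ⊆ halfSpace d) :
    ∃ c : ℝ≥0∞, c ≠ ⊤ ∧ ∀ {F : Type} [NormedAddCommGroup F] {f : Space d × ℝ → F},
      (∀ z ∉ K, f z = 0) → eLpNorm f 2 (wMeasure d α) ≤ c * eLpNorm f 2 volume := by
  obtain ⟨C, hC⟩ := hK.exists_bound_of_continuousOn ((continuousOn_weight (α := α)).mono hKU)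
  refine ⟨ENNReal.ofReal √(|C|), ENNReal.ofReal_ne_top, fun {F} _ f h0 => ?_⟩
  have hle : (wMeasure d α).restrict K ≤ ENNReal.ofReal |C| • volume := by
    refine Measure.le_iff.2 fun s hs => ?_
    rw [Measure.restrict_apply hs, wMeasure,
      withDensity_apply _ (hs.inter hK.measurableSet)]
    calc _ ≤ ∫⁻ z in s ∩ K, ENNReal.ofReal |C| ∂(volume.restrict (halfSpace d)) := by
          refine setLIntegral_mono measurable_const fun z hz => ENNReal.ofReal_le_ofReal ?_
          exact (le_abs_self _).trans ((hC z hz.2).trans (le_abs_self _))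
      _ = ENNReal.ofReal |C| * volume.restrict (halfSpace d) (s ∩ K) := by
          rw [setLIntegral_const]
      _ ≤ ENNReal.ofReal |C| * volume s := by
          exact mul_le_mul_right ((Measure.restrict_apply_le _ _).trans
            (measure_mono inter_subset_left)) _
  have h1 : eLpNorm f 2 (wMeasure d α) = eLpNorm f 2 ((wMeasure d α).restrict K) :=
    (eLpNorm_restrict_eq_of_support_subset (Function.support_subset_iff'.2 h0)).symm
  rw [h1]
  refine (eLpNorm_mono_measure f hle).trans ?_
  rw [eLpNorm_smul_measure_of_ne_top (by simp), smul_eq_mul]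
  gcongr
  rw [ENNReal.ofReal_rpow_of_nonneg (abs_nonneg _) (by simp), Real.sqrt_eq_rpow]
  norm_num

/-- The product rule for `κ Z`. Since `κ` has compact support in the half-space, `ψ` need not. -/
theorem IsWeakGrad.integral_test_mul {Z : Space d × ℝ → ℝ} {G : Space d × ℝ → Grad d}
    (h : IsWeakGrad Z G) {κ ψ : Space d × ℝ → ℝ} (hκ : IsTestOn (halfSpace d) κ)
    (hψ : ContDiff ℝ ∞ ψ) (e : Space d × ℝ) :
    ∫ z in halfSpace d, (κ z * Z z) * fderiv ℝ ψ z e =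
      -∫ z in halfSpace d, ⟪κ z • G z + Z z • grad κ z, WithLp.toLp 2 e⟫ * ψ z := by
  have hκψ : IsTestOn (halfSpace d) fun z => ψ z * κ z := hκ.contDiff_mul hψ
  have hκd : IsTestOn (halfSpace d) fun z => ψ z * fderiv ℝ κ z e :=
    (hκ.fderiv_apply e).contDiff_mul hψ
  have h1 := h.eq _ hκψ e
  have hd (z : Space d × ℝ) : fderiv ℝ (fun z => ψ z * κ z) z e =
      ψ z * fderiv ℝ κ z e + κ z * fderiv ℝ ψ z e := by
    rw [fderiv_fun_mul (hψ.differentiable (by simp) z) (hκ.1.differentiable (by simp) z)]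
    simp
  have hi1 := h.integrable_mul hκd
  have hi2 := h.integrable_mul (hκψ.fderiv_apply e)
  have hi3 := h.integrable_inner_mul hκψ (WithLp.toLp 2 e)
  have hl : ∫ z in halfSpace d, (κ z * Z z) * fderiv ℝ ψ z e =
      (∫ z in halfSpace d, Z z * fderiv ℝ (fun z => ψ z * κ z) z e) -
        ∫ z in halfSpace d, Z z * (ψ z * fderiv ℝ κ z e) := by
    rw [← integral_sub hi2 hi1]
    refine integral_congr_ae (Eventually.of_forall fun z => ?_)
    simp only [hd]
    ring
  have hr : ∫ z in halfSpace d, ⟪κ z • G z + Z z • grad κ z, WithLp.toLp 2 e⟫ * ψ z =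
      (∫ z in halfSpace d, ⟪G z, WithLp.toLp 2 e⟫ * (ψ z * κ z)) +
        ∫ z in halfSpace d, Z z * (ψ z * fderiv ℝ κ z e) := by
    rw [← integral_add hi3 hi1]
    refine integral_congr_ae (Eventually.of_forall fun z => ?_)
    simp only [inner_add_left, real_inner_smul_left,
      grad_inner (hκ.1.differentiable (by simp) z)]
    ring
  rw [hl, hr, h1]
  ring

/-- A function with a weak gradient, both square-integrable, lies in the energy space after
multiplication by a test function: mollify. -/
theorem exists_mem_energySpace_test_mul {Z : Space d × ℝ → ℝ} {G : Space d × ℝ → Grad d}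
    (hZ : MemLp Z 2 (wMeasure d α)) (hG : MemLp G 2 (wMeasure d α)) (h : IsWeakGrad Z G)
    {κ : Space d × ℝ → ℝ} (hκ : IsTestOn (halfSpace d) κ) :
    ∃ p ∈ energySpace d α, p.fst =ᵐ[wMeasure d α] (fun z => κ z * Z z) ∧
      p.snd =ᵐ[wMeasure d α] fun z => κ z • G z + Z z • grad κ z := by
  set f : Space d × ℝ → ℝ := fun z => κ z * Z z with hf
  set H : Space d × ℝ → Grad d := fun z => κ z • G z + Z z • grad κ z with hH
  set K := tsupport κ with hKd
  have hK : IsCompact K := hκ.2.1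
  have hf0 : ∀ z ∉ K, f z = 0 := fun z hz => by
    simp [hf, image_eq_zero_of_notMem_tsupport hz]
  have hκ1 : ContDiff ℝ 1 κ := hκ.1.of_le (by simp)
  have hH0 : ∀ z ∉ K, H z = 0 := fun z hz => by
    simp [hH, image_eq_zero_of_notMem_tsupport hz, grad_eq_zero_of_notMem hκ1 hz]
  have hκc := hκ.1.continuous
  obtain ⟨C, hC⟩ := hκ.2.1.exists_bound_of_continuous hκc
  have hgc : HasCompactSupport (grad κ) := hK.of_isClosed_subset (isClosed_tsupport _)
    (tsupport_grad_subset hκ1)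
  obtain ⟨C', hC'⟩ := hgc.exists_bound_of_continuous (continuous_grad hκ1)
  have hfμ : MemLp f 2 (wMeasure d α) := by
    refine (hZ.const_mul C).mono (hκc.aestronglyMeasurable.mul hZ.1)
      (Eventually.of_forall fun z => ?_)
    rw [hf, norm_mul, norm_mul]
    gcongr
    exact (hC z).trans (le_abs_self C)
  have hHμ : MemLp H 2 (wMeasure d α) := by
    refine MemLp.add ?_ ?_
    · refine (hG.const_smul C).mono (hκc.aestronglyMeasurable.smul hG.1)
        (Eventually.of_forall fun z => ?_)
      rw [norm_smul, Pi.smul_apply, norm_smul]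
      gcongr
      exact (hC z).trans (le_abs_self C)
    · refine (hZ.const_mul C').mono
        (hZ.1.smul (continuous_grad hκ1).aestronglyMeasurable)
        (Eventually.of_forall fun z => ?_)
      rw [norm_smul, norm_mul, mul_comm]
      gcongr
      exact (hC' z).trans (le_abs_self C')
  -- on compact subsets of the half-space the weight is bounded above and below
  have hfv := memLp_volume_of_eq_zero hK hκ.2.2 hfμ hf0
  have hHv := memLp_volume_of_eq_zero hK hκ.2.2 hHμ hH0
  have hfi : LocallyIntegrable f volume := hfv.locallyIntegrable one_le_two
  have hHi : LocallyIntegrable H volume := hHv.locallyIntegrable one_le_two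
  obtain ⟨δ, hδ, hδU⟩ := hK.exists_cthickening_subset_open isOpen_halfSpace hκ.2.2
  set K' := Metric.cthickening δ K with hK'd
  have hK' : IsCompact K' := hK.cthickening
  obtain ⟨c, hc, hcle⟩ := exists_eLpNorm_wMeasure_le (α := α) hK' hδU
  let φ : ℕ → ContDiffBump (0 : Space d × ℝ) := fun m =>
    ⟨δ / (m + 2), δ / (m + 1), by positivity, by gcongr; norm_num⟩
  have hφr : Tendsto (fun m => (φ m).rOut) atTop (𝓝 0) := by
    have := (tendsto_const_nhds (x := δ)).mul tendsto_one_div_add_atTop_nhds_zero_nat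
    simpa [φ, div_eq_mul_inv] using this
  have hφδ (m : ℕ) : (φ m).rOut ≤ δ := div_le_self hδ.le (by simp)
  have hzero {F : Type} [NormedAddCommGroup F] [NormedSpace ℝ F] {g : Space d × ℝ → F}
      (hg : ∀ z ∉ K, g z = 0) (m : ℕ) : ∀ z ∉ K', mollify volume (φ m) g z = 0 := by
    intro z hz
    by_contra hne
    refine hz (Metric.thickening_subset_cthickening _ _ (Metric.thickening_mono (hφδ m) _
      (Metric.thickening_subset_of_subset _ (Function.support_subset_iff'.2 hg)
        (support_mollify_subset (φ m) g hne))))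
  -- the derivative of a mollification falls on the bump, and moves from there to `κ Z`
  have hgrad (m : ℕ) (x : Space d × ℝ) :
      grad (mollify volume (φ m) f) x = mollify volume (φ m) H x := by
    have hd : DifferentiableAt ℝ (mollify volume (φ m) f) x :=
      (contDiff_mollify (φ m) hfi).differentiable (by simp) x
    refine sub_eq_zero.1 (eq_zero_of_inner_frame_eq_zero fun i => ?_)
    rw [inner_sub_left, grad_inner hd, fderiv_mollify (φ m) hfi, sub_eq_zero]
    set ψ : Space d × ℝ → ℝ := fun t => (φ m).normed volume (x - t) with hψd
    have hψ : ContDiff ℝ ∞ ψ := (φ m).contDiff_normed.comp (contDiff_const.sub contDiff_id)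
    have hψ' (t : Space d × ℝ) : fderiv ℝ ψ t (frame i) =
        -fderiv ℝ ((φ m).normed volume) (x - t) (frame i) := by
      have h1 : HasFDerivAt ((φ m).normed volume) (fderiv ℝ ((φ m).normed volume) (x - t)) (x - t) :=
        ((φ m).contDiff_normed (n := 1).differentiable (by simp) _).hasFDerivAt
      have h2 : HasFDerivAt (fun t : Space d × ℝ => x - t) (-ContinuousLinearMap.id ℝ _) t :=
        (hasFDerivAt_id t).const_sub x
      rw [show fderiv ℝ ψ t = _ from (h1.comp t h2).fderiv]
      simp
    have hw := h.integral_test_mul hκ hψ (frame i)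
    rw [setIntegral_eq_integral_of_forall_compl_eq_zero
        (fun z hz => by rw [hκ.eq_zero hz]; simp),
      setIntegral_eq_integral_of_forall_compl_eq_zero
        (fun z hz => by
          have := hH0 z fun hzK => hz (hκ.2.2 hzK)
          rw [show κ z • G z + Z z • grad κ z = 0 from this]; simp)] at hw
    have e1 : ∫ t, fderiv ℝ ((φ m).normed volume) (x - t) (frame i) * f t =
        -∫ t, (κ t * Z t) * fderiv ℝ ψ t (frame i) := by
      rw [← integral_neg]
      refine integral_congr_ae (Eventually.of_forall fun t => ?_)
      simp only [hψ', hf]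
      ring
    have hint : Integrable (fun t => (φ m).normed volume (x - t) • H t) := by
      have := ((φ m).hasCompactSupport_normed (μ := volume)).convolutionExists_left
        (ContinuousLinearMap.lsmul ℝ ℝ) (φ m).continuous_normed hHi x
      have h3 := this.integrable_swap
      simpa using h3
    rw [e1, hw, neg_neg, mollify_apply_swap, real_inner_comm, ← integral_inner hint]
    refine integral_congr_ae (Eventually.of_forall fun t => ?_)
    simp only [real_inner_smul_right, hψd, hH]
    rw [real_inner_comm, mul_comm]
  have htest (m : ℕ) : IsTestOn (halfSpace d) (mollify volume (φ m) f) := by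
    have hsub : tsupport (mollify volume (φ m) f) ⊆ K' :=
      closure_minimal (Function.support_subset_iff'.2 (hzero hf0 m)) hK'.isClosed
    exact ⟨contDiff_mollify (φ m) hfi, hK'.of_isClosed_subset (isClosed_tsupport _) hsub,
      hsub.trans hδU⟩
  have hKK' {z : Space d × ℝ} (hz : z ∉ K') : z ∉ K :=
    fun h' => hz (Metric.self_subset_cthickening _ h')
  have ht1 : Tendsto (fun m => eLpNorm (mollify volume (φ m) f - f) 2 (wMeasure d α)) atTop
      (𝓝 0) := by
    have := ENNReal.Tendsto.const_mul (tendsto_eLpNorm_mollify_sub hφr hfv) (Or.inr hc)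
    rw [mul_zero] at this
    refine tendsto_of_tendsto_of_tendsto_of_le_of_le tendsto_const_nhds this
      (fun _ => zero_le) fun m => hcle fun z hz => ?_
    rw [Pi.sub_apply, hzero hf0 m z hz, hf0 z (hKK' hz), sub_zero]
  have ht2 : Tendsto (fun m => eLpNorm (mollify volume (φ m) H - H) 2 (wMeasure d α)) atTop
      (𝓝 0) := by
    have := ENNReal.Tendsto.const_mul (tendsto_eLpNorm_mollify_sub hφr hHv) (Or.inr hc)
    rw [mul_zero] at this
    refine tendsto_of_tendsto_of_tendsto_of_le_of_le tendsto_const_nhds this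
      (fun _ => zero_le) fun m => hcle fun z hz => ?_
    rw [Pi.sub_apply, hzero hH0 m z hz, hH0 z (hKK' hz), sub_zero]
  refine ⟨_, toLp_mem_energySpace_of_seq hfμ hHμ (fun m => (htest m).mem_energySpace) ?_ ?_,
    hfμ.coeFn_toLp, hHμ.coeFn_toLp⟩
  · refine ht1.congr fun m => eLpNorm_congr_ae ?_
    filter_upwards [(htest m).memLp.coeFn_toLp (μ := wMeasure d α)] with z hz
    exact congrArg (· - f z) hz.symm
  · refine ht2.congr fun m => eLpNorm_congr_ae ?_
    filter_upwards [(htest m).memLp_grad.coeFn_toLp (μ := wMeasure d α)] with z hz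
    rw [Pi.sub_apply, ← hgrad]
    exact congrArg (· - H z) hz.symm

end Localization

/-! ### Trace zero and the energy space -/

section ZeroTrace

open scoped RealInnerProductSpace

variable {d : ℕ} {α : ℝ}

theorem tendsto_lintegral_sq_of_eventually_zero {X F : Type*} [MeasurableSpace X] {m : Measure X}
    [NormedAddCommGroup F] {F' : Type*} [NormedAddCommGroup F'] {f : ℕ → X → F} {g : X → F'}
    (hf : ∀ n, AEStronglyMeasurable (f n) m)
    (hg : MemLp g 2 m) (hle : ∀ n, ∀ᵐ x ∂m, ‖f n x‖ ≤ ‖g x‖)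
    (h0 : ∀ᵐ x ∂m, ∀ᶠ n in atTop, f n x = 0) :
    Tendsto (fun n => ∫⁻ x, ‖f n x‖ₑ ^ 2 ∂m) atTop (𝓝 0) := by
  have h := tendsto_lintegral_of_dominated_convergence' (μ := m)
    (F := fun n x => ‖f n x‖ₑ ^ 2) (f := fun _ => 0) (fun x => ‖g x‖ₑ ^ 2)
    (fun n => (hf n).enorm.pow_const 2) (fun n => ?_) ?_ ?_
  · simpa using h
  · filter_upwards [hle n] with x hx
    gcongr
    exact enorm_le_iff_norm_le.2 hx
  · rw [← eLpNorm_two_sq]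
    exact ENNReal.pow_ne_top hg.2.ne
  · filter_upwards [h0] with x hx
    exact tendsto_nhds_of_eventually_eq (hx.mono fun n hn => by simp [hn])

theorem tendsto_eLpNorm_of_sq {X F : Type*} [MeasurableSpace X] {m : Measure X}
    [NormedAddCommGroup F] {f : ℕ → X → F}
    (h : Tendsto (fun n => ∫⁻ x, ‖f n x‖ₑ ^ 2 ∂m) atTop (𝓝 0)) :
    Tendsto (fun n => eLpNorm (f n) 2 m) atTop (𝓝 0) := by
  have h1 := (ENNReal.continuous_rpow_const (y := (1 / 2 : ℝ))).tendsto 0 |>.comp h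
  rw [ENNReal.zero_rpow_of_pos (by norm_num)] at h1
  refine h1.congr fun n => ?_
  rw [Function.comp_apply, ← eLpNorm_two_sq, ← ENNReal.rpow_natCast, ← ENNReal.rpow_mul]
  norm_num

theorem tendsto_eLpNorm_of_eventually_zero {X F : Type*} [MeasurableSpace X] {m : Measure X}
    [NormedAddCommGroup F] {F' : Type*} [NormedAddCommGroup F'] {f : ℕ → X → F} {g : X → F'}
    (hf : ∀ n, AEStronglyMeasurable (f n) m)
    (hg : MemLp g 2 m) (hle : ∀ n, ∀ᵐ x ∂m, ‖f n x‖ ≤ ‖g x‖)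
    (h0 : ∀ᵐ x ∂m, ∀ᶠ n in atTop, f n x = 0) :
    Tendsto (fun n => eLpNorm (f n) 2 m) atTop (𝓝 0) :=
  tendsto_eLpNorm_of_sq (tendsto_lintegral_sq_of_eventually_zero hf hg hle h0)

/-- A bump function equal to one on the unit ball. -/
noncomputable def unitBump (d : ℕ) : ContDiffBump (0 : Space d × ℝ) :=
  ⟨1, 2, one_pos, one_lt_two⟩

/-- The cutoff function that equals one for `y ≥ 2 ε`, `|(x, y)| ≤ 1 / ε` and vanishes for `y ≤ ε`
and for `|(x, y)| ≥ 2 / ε`. -/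
noncomputable def boxCutoff (d : ℕ) (ε : ℝ) (z : Space d × ℝ) : ℝ :=
  lowerCutoff ε z.2 * unitBump d (ε • z)

theorem contDiff_boxCutoff (ε : ℝ) : ContDiff ℝ ∞ (boxCutoff d ε) :=
  ((contDiff_lowerCutoff ε).comp contDiff_snd).mul
    ((unitBump d).contDiff.comp (contDiff_const_smul ε))

theorem isTestOn_boxCutoff {ε : ℝ} (hε : 0 < ε) : IsTestOn (halfSpace d) (boxCutoff d ε) := by
  have h1 : HasCompactSupport fun z : Space d × ℝ => unitBump d (ε • z) :=
    (unitBump d).hasCompactSupport.comp_homeomorph (Homeomorph.smulOfNeZero ε hε.ne')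
  refine ⟨contDiff_boxCutoff ε, h1.mul_left, ?_⟩
  have hcl : IsClosed {z : Space d × ℝ | ε ≤ z.2} := isClosed_le continuous_const continuous_snd
  refine (closure_minimal (fun z hz => ?_) hcl).trans fun z hz => lt_of_lt_of_le hε hz
  by_contra! h
  exact hz (by simp [boxCutoff, lowerCutoff_of_le hε (not_le.1 h).le])

theorem abs_boxCutoff_le (ε : ℝ) (z : Space d × ℝ) : |boxCutoff d ε z| ≤ 1 := by
  rw [boxCutoff, abs_mul]
  refine mul_le_one₀ (abs_lowerCutoff_le _ _) (abs_nonneg _) ?_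
  rw [abs_of_nonneg (unitBump d).nonneg]
  exact (unitBump d).le_one

theorem eventually_boxCutoff_eq_one {z : Space d × ℝ} (hz : z ∈ halfSpace d) :
    ∀ᶠ ε in 𝓝[>] (0 : ℝ), boxCutoff d ε z = 1 := by
  have hz' : 0 < z.2 := hz
  have h1 : ∀ᶠ ε in 𝓝[>] (0 : ℝ), ε < z.2 / 2 :=
    nhdsWithin_le_nhds (gt_mem_nhds (by positivity))
  have h2 : ∀ᶠ ε in 𝓝[>] (0 : ℝ), ε • z ∈ Metric.closedBall (0 : Space d × ℝ) 1 := by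
    have : Tendsto (fun ε : ℝ => ε • z) (𝓝[>] 0) (𝓝 ((0 : ℝ) • z)) :=
      ((continuous_id.smul continuous_const).tendsto 0).mono_left nhdsWithin_le_nhds
    rw [zero_smul] at this
    exact this.eventually (Metric.closedBall_mem_nhds _ one_pos)
  filter_upwards [h1, h2, self_mem_nhdsWithin] with ε h1 h2 hε
  rw [boxCutoff, lowerCutoff_of_ge hε (by linarith), (unitBump d).one_of_mem_closedBall h2, one_mul]

theorem exists_norm_grad_boxCutoff_le : ∃ C : ℝ, 0 ≤ C ∧ ∀ ε > 0, ∀ z : Space d × ℝ,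
    ‖grad (boxCutoff d ε) z‖ ≤
      C * ((univ ×ˢ Ioo ε (2 * ε)).indicator (fun _ => ε⁻¹) z + ε) := by
  obtain ⟨C, hC, hle⟩ := exists_abs_deriv_lowerCutoff_le
  obtain ⟨C', hC'⟩ := ((unitBump d).hasCompactSupport.fderiv ℝ).exists_bound_of_continuous
    ((unitBump d).contDiff (n := 1).continuous_fderiv one_ne_zero)
  refine ⟨C + |C'|, by positivity, fun ε hε z => ?_⟩
  refine (norm_grad_le ((contDiff_boxCutoff ε).differentiable (by simp) z)).trans ?_
  have h1 : HasFDerivAt (fun z : Space d × ℝ => lowerCutoff ε z.2)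
      (deriv (lowerCutoff ε) z.2 • ContinuousLinearMap.snd ℝ (Space d) ℝ) z :=
    (((contDiff_lowerCutoff ε).differentiable (by simp) z.2).hasDerivAt).comp_hasFDerivAt z
      hasFDerivAt_snd
  have h2 : HasFDerivAt (fun z : Space d × ℝ => unitBump d (ε • z))
      ((fderiv ℝ (unitBump d) (ε • z)).comp (ε • ContinuousLinearMap.id ℝ (Space d × ℝ))) z :=
    (((unitBump d).contDiff (n := 1).differentiable (by simp) (ε • z)).hasFDerivAt).comp z
      ((hasFDerivAt_id z).const_smul ε)
  rw [show fderiv ℝ (boxCutoff d ε) z = _ from (h1.mul h2).fderiv]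
  refine (norm_add_le _ _).trans ?_
  have e1 : ‖lowerCutoff ε z.2 • ((fderiv ℝ (unitBump d) (ε • z)).comp
      (ε • ContinuousLinearMap.id ℝ (Space d × ℝ)))‖ ≤ |C'| * ε := by
    rw [ContinuousLinearMap.comp_smul, ContinuousLinearMap.comp_id, norm_smul, norm_smul,
      Real.norm_eq_abs, Real.norm_of_nonneg hε.le]
    calc _ ≤ 1 * (ε * |C'|) := by
          gcongr
          · exact abs_lowerCutoff_le _ _
          · exact (hC' _).trans (le_abs_self _)
      _ = _ := by ring
  have e2 : ‖unitBump d (ε • z) • deriv (lowerCutoff ε) z.2 •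
      ContinuousLinearMap.snd ℝ (Space d) ℝ‖ ≤
        (univ ×ˢ Ioo ε (2 * ε)).indicator (fun _ => C * ε⁻¹) z := by
    rw [norm_smul, norm_smul, Real.norm_of_nonneg (unitBump d).nonneg, Real.norm_eq_abs]
    have hi : (univ ×ˢ Ioo ε (2 * ε)).indicator (fun _ => C * ε⁻¹) z =
        (Ioo ε (2 * ε)).indicator (fun _ => C * ε⁻¹) z.2 := by
      simp [indicator]
    rw [hi]
    calc _ ≤ 1 * ((Ioo ε (2 * ε)).indicator (fun _ => C * ε⁻¹) z.2 * 1) := by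
          gcongr
          · exact (unitBump d).le_one
          · exact (abs_nonneg _).trans (hle ε hε z.2)
          · exact hle ε hε z.2
          · exact ContinuousLinearMap.norm_snd_le _ _ _
      _ = _ := by ring
  refine (add_le_add e1 e2).trans ?_
  have hn : 0 ≤ (univ ×ˢ Ioo ε (2 * ε)).indicator (fun _ => ε⁻¹) z :=
    indicator_nonneg (fun _ _ => (inv_pos.2 hε).le) _
  have hi : (univ ×ˢ Ioo ε (2 * ε)).indicator (fun _ => C * ε⁻¹) z =
      C * (univ ×ˢ Ioo ε (2 * ε)).indicator (fun _ => ε⁻¹) z := by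
    by_cases hz : z ∈ univ ×ˢ Ioo ε (2 * ε)
    · rw [indicator_of_mem hz, indicator_of_mem hz]
    · rw [indicator_of_notMem hz, indicator_of_notMem hz, mul_zero]
  rw [hi]
  nlinarith [abs_nonneg C', mul_nonneg (abs_nonneg C') hn, mul_nonneg hC hε.le]

theorem measurableSet_normal_strip (a b : ℝ) :
    MeasurableSet ((univ : Set (Space d)) ×ˢ Ioo a b) := MeasurableSet.univ.prod measurableSet_Ioo

/-- Square-integrable functions with square-integrable gradient and trace zero belong to the
energy space. -/
theorem mem_energySpace_of_hasZeroTrace (hα : 0 < α) {Z : Space d × ℝ → ℝ}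
    {G : Space d × ℝ → Grad d} (hZ : MemLp Z 2 (wMeasure d α)) (hG : MemLp G 2 (wMeasure d α))
    (hw : IsWeakGrad Z G) (htr : HasZeroTrace Z) :
    WithLp.toLp 2 (hZ.toLp Z, hG.toLp G) ∈ energySpace d α := by
  set ε : ℕ → ℝ := fun n => 1 / ((n : ℝ) + 1) with hεd
  have hε : ∀ n, 0 < ε n := fun n => by positivity
  have hε0 : Tendsto ε atTop (𝓝 0) := tendsto_one_div_add_atTop_nhds_zero_nat
  have hε1 : Tendsto ε atTop (𝓝[>] 0) :=
    tendsto_nhdsWithin_iff.2 ⟨hε0, Eventually.of_forall hε⟩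
  choose q hq hq1 hq2 using fun n => exists_mem_energySpace_test_mul (α := α) hZ hG hw
    (isTestOn_boxCutoff (d := d) (hε n))
  have hcont (n : ℕ) : AEStronglyMeasurable (boxCutoff d (ε n)) (wMeasure d α) :=
    (contDiff_boxCutoff (ε n)).continuous.aestronglyMeasurable
  have hgc (n : ℕ) : AEStronglyMeasurable (grad (boxCutoff d (ε n))) (wMeasure d α) :=
    (continuous_grad ((contDiff_boxCutoff (ε n)).of_le (by simp))).aestronglyMeasurable
  have hev : ∀ᵐ z ∂wMeasure d α, ∀ᶠ n in atTop, boxCutoff d (ε n) z = 1 := by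
    rw [ae_wMeasure_iff]
    filter_upwards [ae_restrict_mem isOpen_halfSpace.measurableSet] with z hz
    exact hε1.eventually (eventually_boxCutoff_eq_one hz)
  have hb (n : ℕ) (z : Space d × ℝ) : ‖boxCutoff d (ε n) z - 1‖ ≤ 2 := by
    have := abs_boxCutoff_le (ε n) z
    rw [Real.norm_eq_abs]
    refine (abs_sub _ _).trans ?_
    rw [abs_one]
    linarith
  have key {F : Type} [NormedAddCommGroup F] [NormedSpace ℝ F] {f : Space d × ℝ → F}
      (hf : MemLp f 2 (wMeasure d α)) :
      Tendsto (fun n => eLpNorm (fun z => (boxCutoff d (ε n) z - 1) • f z) 2 (wMeasure d α))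
        atTop (𝓝 0) := by
    refine tendsto_eLpNorm_of_eventually_zero
      (fun n => ((hcont n).sub aestronglyMeasurable_const).smul hf.1)
      (hf.const_smul (2 : ℝ)) (fun n => Eventually.of_forall fun z => ?_) ?_
    · rw [norm_smul, Pi.smul_apply, norm_smul, Real.norm_ofNat]
      gcongr
      exact hb n z
    · filter_upwards [hev] with z hz
      exact hz.mono fun n hn => by rw [hn, sub_self, zero_smul]
  -- the critical term: near the boundary the gradient of the cutoff is of size `1 / ε`, and the
  -- norm of `Z / ε` on the strip `ε < y < 2 ε` is controlled by that of `G` on `y < 2 ε`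
  have hZt : Tendsto (fun n => eLpNorm (fun z => Z z • grad (boxCutoff d (ε n)) z) 2
      (wMeasure d α)) atTop (𝓝 0) := by
    obtain ⟨C, hC, hle⟩ := exists_norm_grad_boxCutoff_le (d := d)
    have hGt : Tendsto (fun n => ∫⁻ z in univ ×ˢ Ioo 0 (2 * ε n), ‖G z‖ₑ ^ 2 ∂wMeasure d α) atTop
        (𝓝 0) := by
      have := tendsto_lintegral_sq_of_eventually_zero (m := wMeasure d α)
        (f := fun n => (univ ×ˢ Ioo 0 (2 * ε n)).indicator G) (g := G)
        (fun n => hG.1.indicator (measurableSet_normal_strip _ _)) hG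
        (fun n => Eventually.of_forall fun z => norm_indicator_le_norm_self _ _) ?_
      · refine this.congr fun n => ?_
        rw [← lintegral_indicator (measurableSet_normal_strip _ _)]
        refine lintegral_congr fun z => ?_
        by_cases hz : z ∈ univ ×ˢ Ioo 0 (2 * ε n)
        · simp only [indicator_of_mem hz]
        · simp only [indicator_of_notMem hz, enorm_zero, ne_eq, OfNat.ofNat_ne_zero,
            not_false_eq_true, zero_pow]
      · rw [ae_wMeasure_iff]
        filter_upwards [ae_restrict_mem isOpen_halfSpace.measurableSet] with z hz
        have hz' : 0 < z.2 := hz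
        filter_upwards [hε0.eventually (gt_mem_nhds (show 0 < z.2 / 2 by positivity))] with n hn
        exact indicator_of_notMem (fun h => by linarith [h.2.2]) _
    have hs (n : ℕ) : eLpNorm ((univ ×ˢ Ioo (ε n) (2 * ε n)).indicator fun z => (ε n)⁻¹ * Z z) 2
        (wMeasure d α) ^ 2 ≤ ENNReal.ofReal α⁻¹ *
          ∫⁻ z in univ ×ˢ Ioo 0 (2 * ε n), ‖G z‖ₑ ^ 2 ∂wMeasure d α := by
      rw [eLpNorm_indicator_eq_eLpNorm_restrict (measurableSet_normal_strip _ _), eLpNorm_two_sq]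
      simp only [enorm_mul, mul_pow]
      rw [lintegral_const_mul'' _ (hZ.1.restrict.enorm.pow_const 2)]
      calc _ ≤ ‖(ε n)⁻¹‖ₑ ^ 2 * (ENNReal.ofReal (ε n ^ 2 / α) *
            ∫⁻ z in univ ×ˢ Ioo 0 (2 * ε n), ‖G z‖ₑ ^ 2 ∂wMeasure d α) := by
            gcongr
            exact exists_lintegral_strip_le hα hZ hG hw htr (hε n)
        _ = _ := by
            rw [← mul_assoc, Real.enorm_of_nonneg (inv_pos.2 (hε n)).le,
              ← ENNReal.ofReal_pow (inv_pos.2 (hε n)).le,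
              ← ENNReal.ofReal_mul (by have := hε n; positivity)]
            congr 2
            have := (hε n).ne'
            field_simp
    have h1 : Tendsto (fun n => eLpNorm ((univ ×ˢ Ioo (ε n) (2 * ε n)).indicator
        fun z => (ε n)⁻¹ * Z z) 2 (wMeasure d α)) atTop (𝓝 0) := by
      refine tendsto_eLpNorm_of_sq ?_
      simp only [← eLpNorm_two_sq]
      have := ENNReal.Tendsto.const_mul (a := ENNReal.ofReal α⁻¹) hGt
        (Or.inr ENNReal.ofReal_ne_top)
      rw [mul_zero] at this
      exact tendsto_of_tendsto_of_tendsto_of_le_of_le tendsto_const_nhds this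
        (fun _ => zero_le) hs
    have h2 : Tendsto (fun n => eLpNorm (fun z => ε n * Z z) 2 (wMeasure d α)) atTop (𝓝 0) := by
      have h3 : Tendsto (fun n => ENNReal.ofReal (ε n) * eLpNorm Z 2 (wMeasure d α)) atTop
          (𝓝 0) := by
        have h4 : Tendsto (fun n => ENNReal.ofReal (ε n)) atTop (𝓝 0) := by
          simpa using ENNReal.tendsto_ofReal hε0
        simpa using ENNReal.Tendsto.mul_const h4 (Or.inr hZ.2.ne)
      refine h3.congr fun n => ?_
      rw [show (fun z => ε n * Z z) = ε n • Z from rfl, eLpNorm_const_smul,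
        Real.enorm_of_nonneg (hε n).le]
    have h3 : Tendsto (fun n => ENNReal.ofReal C *
        (eLpNorm ((univ ×ˢ Ioo (ε n) (2 * ε n)).indicator
        fun z => (ε n)⁻¹ * Z z) 2 (wMeasure d α) + eLpNorm (fun z => ε n * Z z) 2 (wMeasure d α)))
        atTop (𝓝 0) := by
      simpa using ENNReal.Tendsto.const_mul (a := ENNReal.ofReal C) (h1.add h2)
        (Or.inr ENNReal.ofReal_ne_top)
    refine tendsto_of_tendsto_of_tendsto_of_le_of_le tendsto_const_nhds h3
      (fun _ => zero_le) fun n => ?_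
    have hm1 : AEStronglyMeasurable ((univ ×ˢ Ioo (ε n) (2 * ε n)).indicator
        fun z => (ε n)⁻¹ * Z z) (wMeasure d α) :=
      (hZ.1.const_mul _).indicator (measurableSet_normal_strip _ _)
    have hm2 : AEStronglyMeasurable (fun z => ε n * Z z) (wMeasure d α) := hZ.1.const_mul _
    calc _ ≤ ENNReal.ofReal C * eLpNorm (fun z => ‖((univ ×ˢ Ioo (ε n) (2 * ε n)).indicator
        fun z => (ε n)⁻¹ * Z z) z‖ + ‖ε n * Z z‖) 2 (wMeasure d α) := by
          refine eLpNorm_le_mul_eLpNorm_of_ae_le_mul (Eventually.of_forall fun z => ?_) 2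
          rw [norm_smul, mul_comm, Real.norm_of_nonneg (by positivity : 0 ≤ ‖_‖ + ‖_‖)]
          refine (mul_le_mul_of_nonneg_right (hle _ (hε n) z) (norm_nonneg _)).trans_eq ?_
          rw [mul_assoc, add_mul, norm_mul (ε n), Real.norm_of_nonneg (hε n).le]
          congr 2
          by_cases hz : z ∈ univ ×ˢ Ioo (ε n) (2 * ε n)
          · simp only [indicator_of_mem hz]
            rw [norm_mul, Real.norm_of_nonneg (inv_pos.2 (hε n)).le]
          · simp only [indicator_of_notMem hz, zero_mul, norm_zero]
      _ ≤ _ := by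
          gcongr
          refine (eLpNorm_add_le hm1.norm hm2.norm one_le_two).trans_eq ?_
          rw [eLpNorm_norm, eLpNorm_norm]
  refine toLp_mem_energySpace_of_seq hZ hG hq ?_ ?_
  · refine (key hZ).congr fun n => eLpNorm_congr_ae ?_
    filter_upwards [hq1 n] with z hz
    rw [hz, smul_eq_mul]
    ring
  · have := (key hG).add hZt
    rw [add_zero] at this
    refine tendsto_of_tendsto_of_tendsto_of_le_of_le tendsto_const_nhds this
      (fun _ => zero_le) fun n => ?_
    have hle := eLpNorm_add_le (p := 2)
      (((hcont n).sub (aestronglyMeasurable_const (b := (1 : ℝ)))).smul hG.1)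
      (hZ.1.smul (hgc n)) one_le_two
    refine le_trans (le_of_eq (eLpNorm_congr_ae ?_)) hle
    filter_upwards [hq2 n] with z hz
    simp only [hz, Pi.add_apply, Pi.smul_apply', Pi.sub_apply, sub_smul, one_smul]
    abel

end ZeroTrace

/-! ### Averages in time -/

section TimeAverages

open scoped RealInnerProductSpace

variable {d : ℕ} {α : ℝ} {F : Type*} [NormedAddCommGroup F]

/-- The average `∫ θ(t) f(t, x, y) dt`. -/
noncomputable def timeAvg [NormedSpace ℝ F] (θ : ℝ → ℝ) (f : ℝ × Space d × ℝ → F)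
    (z : Space d × ℝ) : F :=
  ∫ t, θ t • f (t, z)

theorem bounded_support_of_isTestOn {θ : ℝ → ℝ} (hθ : IsTestOn univ θ) :
    ∃ r : ℝ, 0 ≤ r ∧ ∀ t ∉ Icc (-r) r, θ t = 0 := by
  obtain ⟨r, hr⟩ := hθ.2.1.isCompact.isBounded.subset_closedBall 0
  refine ⟨|r|, abs_nonneg _, fun t ht => image_eq_zero_of_notMem_tsupport fun hs => ht ?_⟩
  have h1 := hr hs
  rw [mem_closedBall_zero_iff, Real.norm_eq_abs] at h1
  exact abs_le.1 (h1.trans (le_abs_self _))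

section

variable [NormedSpace ℝ F]

theorem timeAvg_eq {θ : ℝ → ℝ} {a b : ℝ} (h0 : ∀ t ∉ Icc a b, θ t = 0)
    (f : ℝ × Space d × ℝ → F) (z : Space d × ℝ) :
    timeAvg θ f z = ∫ t in Icc a b, θ t • f (t, z) :=
  (setIntegral_eq_integral_of_forall_compl_eq_zero fun t ht => by rw [h0 t ht, zero_smul]).symm

theorem enorm_timeAvg_le {θ : ℝ → ℝ} {a b M : ℝ} (h0 : ∀ t ∉ Icc a b, θ t = 0)
    (hM : ∀ t, |θ t| ≤ M) (f : ℝ × Space d × ℝ → F) (z : Space d × ℝ) :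
    ‖timeAvg θ f z‖ₑ ≤ ENNReal.ofReal M * ∫⁻ t in Icc a b, ‖f (t, z)‖ₑ := by
  rw [timeAvg_eq h0, ← lintegral_const_mul' _ _ ENNReal.ofReal_ne_top]
  refine (enorm_integral_le_lintegral_enorm _).trans (lintegral_mono fun t => ?_)
  rw [enorm_smul, ← ofReal_norm (θ t), Real.norm_eq_abs]
  gcongr
  exact hM t

theorem aestronglyMeasurable_timeAvg {θ : ℝ → ℝ} (hθ : Continuous θ) {a b : ℝ}
    (h0 : ∀ t ∉ Icc a b, θ t = 0) {f : ℝ × Space d × ℝ → F}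
    (hf : AEStronglyMeasurable f (slabMeasure d α a b)) :
    AEStronglyMeasurable (timeAvg θ f) (wMeasure d α) := by
  rw [funext (timeAvg_eq h0 f)]
  have h1 : AEStronglyMeasurable (fun p : ℝ × Space d × ℝ => θ p.1 • f p)
      (slabMeasure d α a b) :=
    (hθ.comp continuous_fst).aestronglyMeasurable.smul hf
  exact h1.prod_swap.integral_prod_right'

theorem lintegral_slab_symm {a b : ℝ} {f : ℝ × Space d × ℝ → ℝ≥0∞}
    (hf : AEMeasurable f (slabMeasure d α a b)) :
    ∫⁻ p, f p ∂slabMeasure d α a b = ∫⁻ z, (∫⁻ t in Icc a b, f (t, z)) ∂wMeasure d α :=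
  lintegral_prod_symm _ hf

theorem eLpNorm_timeAvg_sq_le {θ : ℝ → ℝ} {a b M : ℝ} (h0 : ∀ t ∉ Icc a b, θ t = 0)
    (hM : ∀ t, |θ t| ≤ M) {f : ℝ × Space d × ℝ → F}
    (hf : AEStronglyMeasurable f (slabMeasure d α a b)) :
    eLpNorm (timeAvg θ f) 2 (wMeasure d α) ^ 2 ≤
      ENNReal.ofReal M ^ 2 * ENNReal.ofReal (b - a) * eLpNorm f 2 (slabMeasure d α a b) ^ 2 := by
  have hmeas : ∀ᵐ z ∂wMeasure d α,
      AEStronglyMeasurable (fun t => f (t, z)) (volume.restrict (Icc a b)) :=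
    hf.prod_swap.prodMk_left
  have hpt : ∀ᵐ z ∂wMeasure d α, ‖timeAvg θ f z‖ₑ ^ 2 ≤
      ENNReal.ofReal M ^ 2 * ENNReal.ofReal (b - a) * ∫⁻ t in Icc a b, ‖f (t, z)‖ₑ ^ 2 := by
    filter_upwards [hmeas] with z hz
    have h1 := enorm_timeAvg_le h0 hM f z
    have h2 : (∫⁻ t in Icc a b, ‖f (t, z)‖ₑ) ^ 2 ≤
        ENNReal.ofReal (b - a) * ∫⁻ t in Icc a b, ‖f (t, z)‖ₑ ^ 2 := by
      have h3 := eLpNorm_le_eLpNorm_mul_rpow_measure_univ (p := 1) (q := 2) one_le_two hz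
      rw [eLpNorm_one_eq_lintegral_enorm] at h3
      refine (pow_le_pow_left' h3 2).trans_eq ?_
      rw [mul_pow, eLpNorm_two_sq, Measure.restrict_apply_univ, Real.volume_Icc,
        ← ENNReal.rpow_natCast, ← ENNReal.rpow_mul, mul_comm]
      norm_num
    calc _ ≤ (ENNReal.ofReal M * ∫⁻ t in Icc a b, ‖f (t, z)‖ₑ) ^ 2 := pow_le_pow_left' h1 2
      _ ≤ _ := by
        rw [mul_pow, mul_assoc]
        gcongr
  rw [eLpNorm_two_sq, eLpNorm_two_sq, lintegral_slab_symm (hf.enorm.pow_const 2),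
    ← lintegral_const_mul' _ _ (ENNReal.mul_ne_top (by simp) (by simp))]
  exact lintegral_mono_ae hpt

theorem memLp_timeAvg {θ : ℝ → ℝ} (hθ : IsTestOn univ θ) {f : ℝ × Space d × ℝ → F}
    (hf : ∀ a b, MemLp f 2 (slabMeasure d α a b)) : MemLp (timeAvg θ f) 2 (wMeasure d α) := by
  obtain ⟨r, hr, h0⟩ := bounded_support_of_isTestOn hθ
  obtain ⟨M, hM⟩ := hθ.2.1.exists_bound_of_continuous hθ.1.continuous
  refine ⟨aestronglyMeasurable_timeAvg hθ.1.continuous h0 (hf (-r) r).1, ?_⟩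
  have h1 := (eLpNorm_timeAvg_sq_le h0 hM (hf (-r) r).1).trans_lt
    (ENNReal.mul_lt_top (ENNReal.mul_lt_top (by simp) (by simp))
      (ENNReal.pow_lt_top (hf (-r) r).2))
  exact lt_top_iff_ne_top.2 fun h => by simp [h] at h1

theorem timeAvg_integrable {f : ℝ × Space d × ℝ → F}
    (hf : ∀ a b, MemLp f 2 (slabMeasure d α a b)) {θ : ℝ → ℝ} (hθ : IsTestOn univ θ) :
    ∀ᵐ z ∂wMeasure d α, Integrable fun t => θ t • f (t, z) := by
  obtain ⟨r, hr, h0⟩ := bounded_support_of_isTestOn hθ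
  obtain ⟨M, hM⟩ := hθ.2.1.exists_bound_of_continuous hθ.1.continuous
  have h1 : ∫⁻ z, (∫⁻ t in Icc (-r) r, ‖f (t, z)‖ₑ ^ 2) ∂wMeasure d α < ⊤ := by
    rw [← lintegral_slab_symm ((hf _ _).1.enorm.pow_const 2), ← eLpNorm_two_sq]
    exact ENNReal.pow_lt_top (hf _ _).2
  have h2 : AEMeasurable (fun z => ∫⁻ t in Icc (-r) r, ‖f (t, z)‖ₑ ^ 2) (wMeasure d α) :=
    ((hf (-r) r).1.enorm.pow_const 2).prod_swap.lintegral_prod_right'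
  filter_upwards [ae_lt_top' h2 h1.ne, ((hf (-r) r).1).prod_swap.prodMk_left] with z hz hm
  have h3 : MemLp (fun t => f (t, z)) 2 (volume.restrict (Icc (-r) r)) := by
    refine ⟨hm, lt_top_iff_ne_top.2 fun h => ?_⟩
    rw [← eLpNorm_two_sq, h] at hz
    simp at hz
  have h4 : IntegrableOn (fun t => θ t • f (t, z)) (Icc (-r) r) :=
    (h3.integrable one_le_two).bdd_smul M hθ.1.continuous.aestronglyMeasurable
      (Eventually.of_forall hM)
  rwa [integrableOn_iff_integrable_of_support_subset] at h4
  intro t ht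
  by_contra hn
  exact ht (by simp [h0 t hn])

theorem timeAvg_add {f : ℝ × Space d × ℝ → F}
    (hf : ∀ a b, MemLp f 2 (slabMeasure d α a b)) {θ η : ℝ → ℝ} (hθ : IsTestOn univ θ)
    (hη : IsTestOn univ η) :
    timeAvg (fun t => θ t + η t) f =ᵐ[wMeasure d α] timeAvg θ f + timeAvg η f := by
  filter_upwards [timeAvg_integrable hf hθ, timeAvg_integrable hf hη] with z h1 h2
  rw [Pi.add_apply, timeAvg, timeAvg, timeAvg, ← integral_add h1 h2]
  simp only [add_smul]

theorem timeAvg_const_mul (f : ℝ × Space d × ℝ → F) (c : ℝ) (θ : ℝ → ℝ) :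
    timeAvg (fun t => c * θ t) f = c • timeAvg θ f := by
  ext z
  rw [Pi.smul_apply, timeAvg, timeAvg, ← integral_smul]
  simp only [mul_smul]

end

section

variable [InnerProductSpace ℝ F]

theorem memLp_tensor {θ : ℝ → ℝ} (hθ : IsTestOn univ θ) {ψ : Space d × ℝ → F}
    (hψ : MemLp ψ 2 (wMeasure d α)) :
    MemLp (fun p : ℝ × Space d × ℝ => θ p.1 • ψ p.2) 2 (bulkMeasure d α) := by
  have h1 := memLp_mul_prod (m := (volume : Measure ℝ))
    (hθ.1.continuous.memLp_of_hasCompactSupport hθ.2.1 (p := 2)) hψ.norm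
  refine h1.mono (hθ.1.continuous.aestronglyMeasurable.comp_fst.smul hψ.1.comp_snd)
    (Eventually.of_forall fun p => ?_)
  rw [norm_smul, norm_mul, norm_norm]

theorem integrable_inner_tensor {θ : ℝ → ℝ} (hθ : IsTestOn univ θ) {f : ℝ × Space d × ℝ → F}
    (hf : ∀ a b, MemLp f 2 (slabMeasure d α a b)) {ψ : Space d × ℝ → F}
    (hψ : MemLp ψ 2 (wMeasure d α)) :
    Integrable (fun p => ⟪f p, θ p.1 • ψ p.2⟫) (bulkMeasure d α) := by
  obtain ⟨r, hr, h0⟩ := bounded_support_of_isTestOn hθ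
  exact integrable_inner_of_slab (hf (-r) r) (memLp_tensor hθ hψ)
    fun p hp => by rw [h0 _ hp, zero_smul]

theorem integral_inner_timeAvg [CompleteSpace F] {θ : ℝ → ℝ} (hθ : IsTestOn univ θ)
    {f : ℝ × Space d × ℝ → F}
    (hf : ∀ a b, MemLp f 2 (slabMeasure d α a b)) {ψ : Space d × ℝ → F}
    (hψ : MemLp ψ 2 (wMeasure d α)) :
    ∫ z, ⟪timeAvg θ f z, ψ z⟫ ∂wMeasure d α =
      ∫ p, ⟪f p, θ p.1 • ψ p.2⟫ ∂bulkMeasure d α := by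
  rw [bulkMeasure, integral_prod_symm _ (integrable_inner_tensor hθ hf hψ)]
  refine integral_congr_ae ?_
  filter_upwards [timeAvg_integrable hf hθ] with z hz
  rw [timeAvg, real_inner_comm, ← integral_inner hz]
  refine integral_congr_ae (Eventually.of_forall fun t => ?_)
  simp only [real_inner_smul_right]
  rw [real_inner_comm]

theorem integral_inner_timeAvg' [CompleteSpace F] {θ : ℝ → ℝ} (hθ : IsTestOn univ θ)
    {f : ℝ × Space d × ℝ → F}
    (hf : ∀ a b, MemLp f 2 (slabMeasure d α a b)) {ψ : Space d × ℝ → F}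
    (hψ : MemLp ψ 2 (wMeasure d α)) :
    ∫ z, ⟪timeAvg θ f z, ψ z⟫ ∂wMeasure d α =
      ∫ t, θ t * ∫ z, ⟪f (t, z), ψ z⟫ ∂wMeasure d α := by
  rw [integral_inner_timeAvg hθ hf hψ, bulkMeasure,
    integral_prod _ (integrable_inner_tensor hθ hf hψ)]
  refine integral_congr_ae (Eventually.of_forall fun t => ?_)
  simp only [real_inner_smul_right]
  rw [integral_const_mul]

end

/-- Functions on the half-space are determined by their integrals against test functions. -/
theorem ae_eq_zero_of_integral_test_eq_zero {f : Space d × ℝ → ℝ}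
    (hf : LocallyIntegrableOn f (halfSpace d) volume)
    (h : ∀ ψ, IsTestOn (halfSpace d) ψ → ∫ z, f z * ψ z ∂wMeasure d α = 0) :
    f =ᵐ[wMeasure d α] 0 := by
  rw [EventuallyEq, ae_wMeasure_iff, ae_restrict_iff' isOpen_halfSpace.measurableSet]
  refine IsOpen.ae_eq_zero_of_integral_contDiff_smul_eq_zero isOpen_halfSpace hf
    fun g hg hgc hgU => ?_
  have ht : IsTestOn (halfSpace d) g := ⟨hg, hgc, hgU⟩
  have h1 := h _ (ht.weight_mul (-(1 - 2 * α)))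
  rw [integral_wMeasure] at h1
  simp only [smul_eq_mul]
  rw [← h1, integral_congr_ae (Eventually.of_forall fun z => mul_comm (g z) (f z)),
    ← setIntegral_mul_eq_of_isTestOn (U := halfSpace d) f ht]
  refine setIntegral_congr_fun isOpen_halfSpace.measurableSet fun z hz => ?_
  have h2 := (weight_pos (α := α) z hz).ne'
  simp only [Real.rpow_neg (le_of_lt hz), smul_eq_mul]
  field_simp

/-- Averages in time inherit weak gradients. -/
theorem isWeakGrad_timeAvg {v : ℝ × Space d × ℝ → ℝ} {G : ℝ × Space d × ℝ → Grad d}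
    (hv : ∀ a b, MemLp v 2 (slabMeasure d α a b)) (hG : ∀ a b, MemLp G 2 (slabMeasure d α a b))
    (hw : ∀ᵐ t : ℝ, IsWeakGrad (fun z => v (t, z)) fun z => G (t, z)) {θ : ℝ → ℝ}
    (hθ : IsTestOn univ θ) : IsWeakGrad (timeAvg θ v) (timeAvg θ G) where
  integrable := locallyIntegrableOn_halfSpace (memLp_timeAvg hθ hv)
  integrable_grad := locallyIntegrableOn_halfSpace (memLp_timeAvg hθ hG)
  eq φ hφ e := by
    -- unweighted pairings as weighted ones, for which averages in time can be computed
    have hw' {f : Space d × ℝ → ℝ} {ψ : Space d × ℝ → ℝ} :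
        ∫ z in halfSpace d, f z * ψ z =
          ∫ z, f z * (z.2 ^ (-(1 - 2 * α)) * ψ z) ∂wMeasure d α := by
      rw [integral_wMeasure]
      refine setIntegral_congr_fun isOpen_halfSpace.measurableSet fun z hz => ?_
      have h2 := (weight_pos (α := α) z hz).ne'
      simp only [Real.rpow_neg (le_of_lt hz), smul_eq_mul]
      field_simp
    have t1 : IsTestOn (halfSpace d) fun z => z.2 ^ (-(1 - 2 * α)) * fderiv ℝ φ z e :=
      (hφ.fderiv_apply e).weight_mul _
    have t2 : IsTestOn (halfSpace d) fun z => z.2 ^ (-(1 - 2 * α)) * φ z := hφ.weight_mul _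
    have t2' : MemLp (fun z => (z.2 ^ (-(1 - 2 * α)) * φ z) • (WithLp.toLp 2 e : Grad d)) 2
        (wMeasure d α) := by
      refine (t2.memLp.norm.mul_const ‖(WithLp.toLp 2 e : Grad d)‖).mono
        (t2.memLp.1.smul aestronglyMeasurable_const) (Eventually.of_forall fun z => ?_)
      rw [norm_smul, norm_mul (‖_‖), norm_norm, norm_norm]
    have e1 := integral_inner_timeAvg' hθ hv (t1.memLp (α := α))
    have e2 := integral_inner_timeAvg' hθ hG t2'
    have c1 : ∫ z in halfSpace d, timeAvg θ v z * fderiv ℝ φ z e =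
        ∫ t, θ t * ∫ z in halfSpace d, v (t, z) * fderiv ℝ φ z e := by
      simp only [hw']
      refine Eq.trans (integral_congr_ae (Eventually.of_forall fun z => ?_)) (e1.trans
        (integral_congr_ae (Eventually.of_forall fun t => ?_)))
      · simp [mul_comm]
      · simp [mul_comm]
    have c2 : ∫ z in halfSpace d, ⟪timeAvg θ G z, WithLp.toLp 2 e⟫ * φ z =
        ∫ t, θ t * ∫ z in halfSpace d, ⟪G (t, z), WithLp.toLp 2 e⟫ * φ z := by
      simp only [hw']
      refine Eq.trans (integral_congr_ae (Eventually.of_forall fun z => ?_)) (e2.trans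
        (integral_congr_ae (Eventually.of_forall fun t => ?_)))
      · simp only [real_inner_smul_right]
        ring
      · simp only [real_inner_smul_right]
        congr 1
        refine integral_congr_ae (Eventually.of_forall fun z => ?_)
        simp only
        ring
    rw [c1, c2, ← integral_neg]
    refine integral_congr_ae ?_
    filter_upwards [hw] with t ht
    rw [ht.eq φ hφ e, mul_neg]

theorem integral_mul_time_tensor {v g : ℝ × Space d × ℝ → ℝ} (h : IsWeakTimeDeriv α v g)
    {θ : ℝ → ℝ} (hθ : IsTestOn univ θ) {ψ : Space d × ℝ → ℝ} (hψ : IsTestOn (halfSpace d) ψ) :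
    ∫ p, v p * (deriv θ p.1 * ψ p.2) ∂bulkMeasure d α =
      -∫ p, g p * (θ p.1 * ψ p.2) ∂bulkMeasure d α := by
  rw [← h.2.2 _ (hθ.time_mul hψ)]
  refine integral_congr_ae (Eventually.of_forall fun p => ?_)
  simp only
  rw [deriv_mul_const_field]

theorem IsTestOn.deriv {θ : ℝ → ℝ} (hθ : IsTestOn univ θ) : IsTestOn univ (deriv θ) := by
  have := hθ.fderiv_apply (1 : ℝ)
  simpa using this

/-- Weak derivatives in time pass to the weight of an average. -/
theorem timeAvg_deriv {v g : ℝ × Space d × ℝ → ℝ} (h : IsWeakTimeDeriv α v g)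
    (hv : ∀ a b, MemLp v 2 (slabMeasure d α a b)) (hg : ∀ a b, MemLp g 2 (slabMeasure d α a b))
    {θ : ℝ → ℝ} (hθ : IsTestOn univ θ) :
    timeAvg (deriv θ) v =ᵐ[wMeasure d α] -timeAvg θ g := by
  have h1 := memLp_timeAvg hθ.deriv hv
  have h2 := memLp_timeAvg hθ hg
  have hz := ae_eq_zero_of_integral_test_eq_zero (α := α)
    (locallyIntegrableOn_halfSpace (h1.add h2)) fun ψ hψ => ?_
  · filter_upwards [hz] with z hz
    exact eq_neg_of_add_eq_zero_left hz
  · have e1 := integral_inner_timeAvg hθ.deriv hv (hψ.memLp (α := α))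
    have e2 := integral_inner_timeAvg hθ hg (hψ.memLp (α := α))
    have e3 := integral_mul_time_tensor h hθ hψ
    have i1 : Integrable (fun z => timeAvg (deriv θ) v z * ψ z) (wMeasure d α) :=
      h1.integrable_mul hψ.memLp
    have i2 : Integrable (fun z => timeAvg θ g z * ψ z) (wMeasure d α) :=
      h2.integrable_mul hψ.memLp
    simp only [Pi.add_apply, add_mul]
    rw [integral_add i1 i2]
    simp only [smul_eq_mul, RCLike.inner_apply, conj_trivial] at e1 e2
    have e1' : ∫ z, timeAvg (deriv θ) v z * ψ z ∂wMeasure d α =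
        ∫ p, v p * (deriv θ p.1 * ψ p.2) ∂bulkMeasure d α := by
      simpa only [mul_comm, mul_left_comm] using e1
    have e2' : ∫ z, timeAvg θ g z * ψ z ∂wMeasure d α =
        ∫ p, g p * (θ p.1 * ψ p.2) ∂bulkMeasure d α := by
      simpa only [mul_comm, mul_left_comm] using e2
    rw [e1', e2', e3, neg_add_cancel]

/-- Averages in time inherit trace zero. -/
theorem hasZeroTrace_timeAvg {v : ℝ × Space d × ℝ → ℝ}
    (hm : LocallyIntegrableOn v (bulk d) volume) (h : HasBoundaryValue v 0)
    {θ : ℝ → ℝ} (hθ : IsTestOn univ θ) : HasZeroTrace (timeAvg θ v) := by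
  intro R
  obtain ⟨r, hr, h0⟩ := bounded_support_of_isTestOn hθ
  obtain ⟨M, hM⟩ := hθ.2.1.exists_bound_of_continuous hθ.1.continuous
  have h1 := h (Icc (-r) r ×ˢ Metric.closedBall 0 R) (isCompact_Icc.prod (isCompact_closedBall _ _))
  have h2 := ENNReal.Tendsto.const_mul (a := ENNReal.ofReal M) h1 (Or.inr ENNReal.ofReal_ne_top)
  rw [mul_zero] at h2
  refine tendsto_of_tendsto_of_tendsto_of_le_of_le tendsto_const_nhds h2
    (fun _ => zero_le) fun ε => ?_
  simp only
  rw [mul_left_comm]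
  gcongr
  set S := Metric.closedBall (0 : Space d) R ×ˢ Ioo 0 ε with hS
  have hset : {p : ℝ × Space d × ℝ | (p.1, p.2.1) ∈ Icc (-r) r ×ˢ Metric.closedBall (0 : Space d) R ∧
      p.2.2 ∈ Ioo 0 ε} = Icc (-r) r ×ˢ S := by
    ext p
    simp only [mem_ofPred_eq, mem_prod, hS]
    tauto
  have hSb : Icc (-r) r ×ˢ S ⊆ bulk d := fun p hp => hp.2.2.1
  have hmeas : AEStronglyMeasurable v (volume.restrict (Icc (-r) r ×ˢ S)) :=
    hm.aestronglyMeasurable.mono_measure (Measure.restrict_mono_set _ hSb)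
  rw [hset]
  simp only [Pi.zero_apply, sub_zero]
  have hprod : (volume : Measure (ℝ × Space d × ℝ)).restrict (Icc (-r) r ×ˢ S) =
      (volume.restrict (Icc (-r) r)).prod (volume.restrict S) := by
    rw [Measure.volume_eq_prod, ← Measure.prod_restrict]
  rw [hprod] at hmeas ⊢
  rw [lintegral_prod_symm _ hmeas.enorm, ← lintegral_const_mul' _ _ ENNReal.ofReal_ne_top]
  exact lintegral_mono fun z => enorm_timeAvg_le h0 hM v z

end TimeAverages

/-! ### Averages in time as curves -/

section EnergyConservation

open scoped RealInnerProductSpace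

variable {d : ℕ} {α : ℝ} {F : Type*} [NormedAddCommGroup F]

theorem IsTestOn.shift {θ : ℝ → ℝ} (hθ : IsTestOn univ θ) (s : ℝ) :
    IsTestOn univ fun t => θ (t - s) :=
  ⟨hθ.1.comp (contDiff_id.sub contDiff_const),
    hθ.2.1.comp_homeomorph (Homeomorph.subRight s), subset_univ _⟩

theorem deriv_shift (θ : ℝ → ℝ) (s : ℝ) :
    deriv (fun t => θ (t - s)) = fun t => deriv θ (t - s) := by
  ext t
  rw [deriv_comp_sub_const]

theorem exists_taylor_bound {θ : ℝ → ℝ} (hθ : IsTestOn univ θ) :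
    ∃ K : ℝ, ∀ a b, |θ b - θ a - (b - a) * deriv θ a| ≤ K * (b - a) ^ 2 := by
  obtain ⟨K, hK⟩ := hθ.deriv.deriv.2.1.exists_bound_of_continuous hθ.deriv.deriv.1.continuous
  have hd (x : ℝ) : HasDerivAt θ (deriv θ x) x := (hθ.1.differentiable (by simp) x).hasDerivAt
  have hd2 (x : ℝ) : HasDerivAt (deriv θ) (deriv (deriv θ) x) x :=
    (hθ.deriv.1.differentiable (by simp) x).hasDerivAt
  have hlip (x y : ℝ) : |deriv θ y - deriv θ x| ≤ K * |y - x| := by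
    simpa using Convex.norm_image_sub_le_of_norm_hasDerivWithin_le (f := deriv θ)
      (fun r _ => (hd2 r).hasDerivWithinAt) (fun r _ => hK r) convex_univ (mem_univ x) (mem_univ y)
  refine ⟨K, fun a b => ?_⟩
  have h := (convex_uIcc a b).norm_image_sub_le_of_norm_hasDerivWithin_le
    (f := fun r => θ r - r * deriv θ a) (f' := fun r => deriv θ r - deriv θ a)
    (C := K * |b - a|)
    (fun r _ => ((hd r).sub (by simpa using (hasDerivAt_id r).mul_const (deriv θ a))).hasDerivWithinAt)
    (fun r hr => (hlip a r).trans (mul_le_mul_of_nonneg_left (abs_sub_left_of_mem_uIcc hr)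
      ((abs_nonneg _).trans (hK 0)))) left_mem_uIcc right_mem_uIcc
  have e : θ b - b * deriv θ a - (θ a - a * deriv θ a) = θ b - θ a - (b - a) * deriv θ a := by
    ring
  rw [e, Real.norm_eq_abs, Real.norm_eq_abs] at h
  refine h.trans (le_of_eq ?_)
  rw [mul_assoc, abs_mul_abs_self, sq]

theorem eLpNorm_timeAvg_le [NormedSpace ℝ F] {θ : ℝ → ℝ} {a b M : ℝ} (hab : a ≤ b)
    (h0 : ∀ t ∉ Icc a b, θ t = 0)
    (hM : ∀ t, |θ t| ≤ M) {f : ℝ × Space d × ℝ → F}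
    (hf : AEStronglyMeasurable f (slabMeasure d α a b)) :
    eLpNorm (timeAvg θ f) 2 (wMeasure d α) ≤
      ENNReal.ofReal (M * √(b - a)) * eLpNorm f 2 (slabMeasure d α a b) := by
  have hM0 : 0 ≤ M := (abs_nonneg _).trans (hM 0)
  rw [← (ENNReal.pow_right_strictMono two_ne_zero).le_iff_le]
  refine (eLpNorm_timeAvg_sq_le h0 hM hf).trans_eq ?_
  simp only [mul_pow]
  rw [← ENNReal.ofReal_pow (by positivity : 0 ≤ M * √(b - a)), mul_pow,
    Real.sq_sqrt (by linarith), ENNReal.ofReal_mul (by positivity), ENNReal.ofReal_pow hM0]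

/-- The average of `f` in time with the weight `θ`, as an element of `L²_α`. -/
noncomputable def avgLp [NormedSpace ℝ F] {θ : ℝ → ℝ} (hθ : IsTestOn univ θ)
    {f : ℝ × Space d × ℝ → F}
    (hf : ∀ a b, MemLp f 2 (slabMeasure d α a b)) : Lp F 2 (wMeasure d α) :=
  (memLp_timeAvg hθ hf).toLp _

/-- Translations of the weight act differentiably on averages in time. -/
theorem hasDerivAt_avgLp [NormedSpace ℝ F] {θ : ℝ → ℝ} (hθ : IsTestOn univ θ)
    {f : ℝ × Space d × ℝ → F}
    (hf : ∀ a b, MemLp f 2 (slabMeasure d α a b)) (s : ℝ) :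
    HasDerivAt (fun s => avgLp (hθ.shift s) hf) (-avgLp (hθ.deriv.shift s) hf) s := by
  obtain ⟨K, hK⟩ := exists_taylor_bound hθ
  obtain ⟨r, hr, h0⟩ := bounded_support_of_isTestOn hθ
  obtain ⟨r', hr', h0'⟩ := bounded_support_of_isTestOn hθ.deriv
  set R := r + r' + |s| + 1 with hR
  have hR0 : 0 ≤ R := by positivity
  rw [hasDerivAt_iff_isLittleO]
  refine (Asymptotics.IsBigO.of_bound
    (K * √(R - -R) * (eLpNorm f 2 (slabMeasure d α (-R) R)).toReal) ?_).trans_isLittleO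
    (Asymptotics.isLittleO_pow_sub_sub s (m := 2) (by norm_num))
  filter_upwards [Metric.ball_mem_nhds s one_pos] with x hx
  rw [Metric.mem_ball, Real.dist_eq] at hx
  have t1 : IsTestOn univ fun t => (-1) * θ (t - s) := (hθ.shift s).const_mul _
  have t2 : IsTestOn univ fun t => (x - s) * deriv θ (t - s) := (hθ.deriv.shift s).const_mul _
  have t3 : IsTestOn univ fun t => (-1) * θ (t - s) + (x - s) * deriv θ (t - s) := t1.add t2
  -- the remainder of the difference quotient is the average with the weight `η`, which is `O((x -
  -- s)²)` by Taylor's theorem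
  set η : ℝ → ℝ := fun t => θ (t - x) + ((-1) * θ (t - s) + (x - s) * deriv θ (t - s)) with hη
  have ha : timeAvg η f =ᵐ[wMeasure d α]
      ⇑(avgLp (hθ.shift x) hf - avgLp (hθ.shift s) hf - (x - s) • -avgLp (hθ.deriv.shift s) hf) := by
    filter_upwards [timeAvg_add hf (hθ.shift x) t3, timeAvg_add hf t1 t2,
      Lp.coeFn_sub (avgLp (hθ.shift x) hf - avgLp (hθ.shift s) hf)
        ((x - s) • -avgLp (hθ.deriv.shift s) hf),
      Lp.coeFn_sub (avgLp (hθ.shift x) hf) (avgLp (hθ.shift s) hf),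
      Lp.coeFn_smul (x - s) (-avgLp (hθ.deriv.shift s) hf),
      Lp.coeFn_neg (avgLp (hθ.deriv.shift s) hf),
      (memLp_timeAvg (hθ.shift x) hf).coeFn_toLp, (memLp_timeAvg (hθ.shift s) hf).coeFn_toLp,
      (memLp_timeAvg (hθ.deriv.shift s) hf).coeFn_toLp] with z h1 h2 h3 h4 h5 h6 h7 h8 h9
    simp only [timeAvg_const_mul, Pi.add_apply, Pi.sub_apply, Pi.smul_apply, Pi.neg_apply]
      at h1 h2 h3 h4 h5 h6
    rw [h1, h2, h3, h4, h5, h6, avgLp, avgLp, avgLp, h7, h8, h9]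
    simp only [neg_smul, one_smul, smul_neg, sub_neg_eq_add]
    abel
  have hη0 : ∀ t ∉ Icc (-R) R, η t = 0 := by
    intro t ht
    have hx' : |x| ≤ |s| + 1 := by
      have := abs_add_le (x - s) s
      rw [sub_add_cancel] at this
      linarith
    have hlt : R < |t| := by
      by_contra! h
      exact ht (abs_le.1 h)
    have hns (c : ℝ) (hc : |c| ≤ |s| + 1) : r + r' < |t - c| := by
      have := abs_add_le (t - c) c
      rw [sub_add_cancel] at this
      linarith
    have hs := hns s (by linarith)
    have hxx := hns x hx'
    simp only [hη]
    rw [h0 (t - x) fun h => ?_, h0 (t - s) fun h => ?_, h0' (t - s) fun h => ?_]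
    · simp
    · linarith [abs_le.2 h]
    · linarith [abs_le.2 h]
    · linarith [abs_le.2 h]
  have hηM : ∀ t, |η t| ≤ K * (x - s) ^ 2 := by
    intro t
    have := hK (t - s) (t - x)
    have e1 : θ (t - x) - θ (t - s) - (t - x - (t - s)) * deriv θ (t - s) = η t := by
      simp only [hη]; ring
    have e2 : (t - x - (t - s)) ^ 2 = (x - s) ^ 2 := by ring
    rwa [e1, e2] at this
  have hle := eLpNorm_timeAvg_le (α := α) (by linarith) hη0 hηM (hf (-R) R).1
  rw [Lp.norm_def, ← eLpNorm_congr_ae ha]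
  have hM0 : 0 ≤ K * (x - s) ^ 2 := (abs_nonneg _).trans (hηM 0)
  refine (ENNReal.toReal_mono (ENNReal.mul_ne_top (by simp) (hf _ _).2.ne) hle).trans_eq ?_
  rw [ENNReal.toReal_mul, ENNReal.toReal_ofReal (by positivity), norm_pow, Real.norm_eq_abs,
    sq_abs, Real.norm_eq_abs, sq_abs]
  ring

theorem eLpNorm_timeAvg_le_of_slice [NormedSpace ℝ F] {θ : ℝ → ℝ} {a b M : ℝ} (hab : a ≤ b)
    (h0 : ∀ t ∉ Icc a b, θ t = 0)
    (hM : ∀ t, |θ t| ≤ M) {f : ℝ × Space d × ℝ → F}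
    (hf : AEStronglyMeasurable f (slabMeasure d α a b)) {ε : ℝ≥0}
    (h : ∀ᵐ t, t ∈ Icc a b → eLpNorm (fun z => f (t, z)) 2 (wMeasure d α) ≤ ε) :
    eLpNorm (timeAvg θ f) 2 (wMeasure d α) ≤ ENNReal.ofReal (M * (b - a) * ε) := by
  have hM0 : 0 ≤ M := (abs_nonneg _).trans (hM 0)
  have h1 : eLpNorm f 2 (slabMeasure d α a b) ≤ ENNReal.ofReal (√(b - a) * ε) := by
    rw [← (ENNReal.pow_right_strictMono two_ne_zero).le_iff_le]
    rw [eLpNorm_two_sq, lintegral_slabMeasure a b (hf.enorm.pow_const 2),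
      ← ENNReal.ofReal_pow (by positivity), mul_pow, Real.sq_sqrt (by linarith)]
    calc _ ≤ ∫⁻ t in Icc a b, (ε : ℝ≥0∞) ^ 2 := by
          refine lintegral_mono_ae ?_
          rw [ae_restrict_iff' measurableSet_Icc]
          filter_upwards [h] with t ht htab
          rw [← eLpNorm_two_sq]
          exact pow_le_pow_left' (ht htab) 2
      _ = _ := by
          rw [setLIntegral_const, Real.volume_Icc, mul_comm, ENNReal.ofReal_mul (by linarith),
            ENNReal.ofReal_pow (by positivity), ENNReal.ofReal_coe_nnreal]
  refine (eLpNorm_timeAvg_le hab h0 hM hf).trans ((mul_le_mul_right h1 _).trans_eq ?_)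
  rw [← ENNReal.ofReal_mul (by positivity)]
  congr 1
  rw [mul_assoc, ← mul_assoc √(b - a), Real.mul_self_sqrt (by linarith), mul_assoc]

/-- The weak form of the equation, averaged in time, extends to the energy space. -/
theorem inner_avgLp_eq_zero {z : ℝ × Space d × ℝ → ℝ} {G : ℝ × Space d × ℝ → Grad d}
    (hz : ∀ a b, MemLp z 2 (slabMeasure d α a b)) (hG : ∀ a b, MemLp G 2 (slabMeasure d α a b))
    (hw : ∀ᵐ t : ℝ, IsWeakGrad (fun x => z (t, x)) fun x => G (t, x)) (heq : IsWeakSol α z)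
    {θ : ℝ → ℝ} (hθ : IsTestOn univ θ)
    {p : WithLp 2 (Lp ℝ 2 (wMeasure d α) × Lp (Grad d) 2 (wMeasure d α))}
    (hp : p ∈ energySpace d α) :
    ⟪avgLp hθ.deriv.deriv hz, p.fst⟫ + ⟪avgLp hθ hG, p.snd⟫ = 0 := by
  have key : (energySpace d α : Set _) ⊆
      {p | ⟪WithLp.toLp 2 (avgLp hθ.deriv.deriv hz, avgLp hθ hG), p⟫ = 0} := by
    -- by density it suffices to test the equation with products `θ(t) ψ(x, y)`
    refine closure_minimal ?_ (isClosed_eq (by fun_prop) continuous_const)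
    rintro q ⟨ψ, hψ, h1, h2⟩
    change ⟪avgLp hθ.deriv.deriv hz, q.fst⟫ + ⟪avgLp hθ hG, q.snd⟫ = 0
    have hφ := hθ.time_mul hψ
    have hsol := heq.2 _ hφ
    rw [integral_mul_waveOp_eq hz hG hw hφ] at hsol
    rw [← hsol, L2.inner_def, L2.inner_def]
    have hψc : ContDiff ℝ 1 ψ := hψ.1.of_le (by simp)
    congr 1
    · calc _ = ∫ x, ⟪timeAvg (deriv (deriv θ)) z x, ψ x⟫ ∂wMeasure d α := by
            refine integral_congr_ae ?_
            filter_upwards [(memLp_timeAvg hθ.deriv.deriv hz).coeFn_toLp, h1] with x hx hx'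
            rw [avgLp, hx, hx']
        _ = _ := by
            rw [integral_inner_timeAvg hθ.deriv.deriv hz hψ.memLp]
            refine integral_congr_ae (Eventually.of_forall fun p => ?_)
            have e1 : dt (fun p : ℝ × Space d × ℝ => θ p.1 * ψ p.2) =
                fun p => deriv θ p.1 * ψ p.2 := by
              ext p
              exact (deriv_eq_dt hφ.1 p).symm.trans
                (deriv_mul_const_field (u := θ) (ψ p.2))
            have e2 : dt (fun p : ℝ × Space d × ℝ => deriv θ p.1 * ψ p.2) =
                fun p => deriv (deriv θ) p.1 * ψ p.2 := by
              ext p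
              exact (deriv_eq_dt (hθ.deriv.time_mul hψ).1 p).symm.trans
                (deriv_mul_const_field (u := deriv θ) (ψ p.2))
            simp only [e1, e2]
            simp [mul_comm]
    · calc _ = ∫ x, ⟪timeAvg θ G x, grad ψ x⟫ ∂wMeasure d α := by
            refine integral_congr_ae ?_
            filter_upwards [(memLp_timeAvg hθ hG).coeFn_toLp, h2] with x hx hx'
            rw [avgLp, hx, hx']
        _ = _ := by
            rw [integral_inner_timeAvg hθ hG hψ.memLp_grad]
            refine integral_congr_ae (Eventually.of_forall fun p => ?_)
            simp only [sliceGrad]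
            rw [grad_const_mul (hψc.differentiable one_ne_zero p.2)]
  exact key hp

/-- Functions on the space-time domain whose averages in time vanish are zero. -/
theorem ae_eq_zero_of_timeAvg_eq_zero {z : ℝ × Space d × ℝ → ℝ}
    (hz : ∀ a b, MemLp z 2 (slabMeasure d α a b))
    (hm : AEStronglyMeasurable z (bulkMeasure d α))
    (h : ∀ θ, IsTestOn univ θ → timeAvg θ z =ᵐ[wMeasure d α] 0) :
    z =ᵐ[bulkMeasure d α] 0 := by
  have : Fact ((2 : ℝ≥0∞) ≠ ⊤) := ⟨by simp⟩
  have h1 (ψ : Lp ℝ 2 (wMeasure d α)) : ∀ᵐ t, ∫ x, ⟪z (t, x), ψ x⟫ ∂wMeasure d α = 0 := by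
    refine ae_eq_zero_of_integral_contDiff_smul_eq_zero ?_ fun θ hθ hθc => ?_
    · refine locallyIntegrable_iff.2 ?_
      intro K hK
      obtain ⟨r, hr⟩ := hK.isBounded.subset_closedBall 0
      rw [Real.closedBall_eq_Icc, zero_sub, zero_add] at hr
      refine IntegrableOn.mono_set ?_ hr
      have h2 : MemLp (fun p : ℝ × Space d × ℝ => ψ p.2) 2 (slabMeasure d α (-r) r) :=
        (Lp.memLp ψ).comp_snd _
      have h3 : Integrable (fun p => z p * ψ p.2) (slabMeasure d α (-r) r) :=
        (hz (-r) r).integrable_mul h2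
      have h4 := h3.integral_prod_left
      refine h4.congr (Eventually.of_forall fun t => ?_)
      simp [mul_comm]
    · have hθ' : IsTestOn univ θ := ⟨hθ, hθc, subset_univ _⟩
      have h2 := integral_inner_timeAvg' hθ' hz (Lp.memLp ψ)
      simp only [smul_eq_mul]
      rw [← h2]
      refine integral_eq_zero_of_ae ?_
      filter_upwards [h θ hθ'] with x hx
      rw [hx, Pi.zero_apply, inner_zero_left]
  -- by separability, one null set of times serves all `ψ`
  have h2 : ∀ᵐ t : ℝ, ∀ n : ℕ, ∫ x, ⟪z (t, x),
      (TopologicalSpace.denseSeq (Lp ℝ 2 (wMeasure d α)) n) x⟫ ∂wMeasure d α = 0 :=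
    ae_all_iff.2 fun n => h1 _
  have h3 : ∀ᵐ t : ℝ, MemLp (fun x => z (t, x)) 2 (wMeasure d α) := by
    have h4 : ∀ n : ℕ, ∀ᵐ t ∂(volume : Measure ℝ), t ∈ Icc (-n : ℝ) n →
        eLpNorm (fun x => z (t, x)) 2 (wMeasure d α) ^ 2 < ⊤ := by
      intro n
      rw [← ae_restrict_iff' measurableSet_Icc]
      have hlt := (memLp_slab_iff (hz (-n) n).1).1 (hz (-n) n)
      refine ae_lt_top' ?_ hlt.ne
      simp only [eLpNorm_two_sq]
      exact ((hz (-n) n).1.enorm.pow_const 2).lintegral_prod_right'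
    have h5 : ∀ᵐ t : ℝ, AEStronglyMeasurable (fun x => z (t, x)) (wMeasure d α) :=
      hm.prodMk_left
    filter_upwards [ae_all_iff.2 h4, h5] with t ht h5
    obtain ⟨n, hn⟩ := exists_nat_ge |t|
    refine ⟨h5, lt_top_iff_ne_top.2 fun h => ?_⟩
    have := ht n (abs_le.1 hn)
    simp [h] at this
  obtain ⟨z', hz', hzz'⟩ := hm
  refine hzz'.trans ?_
  refine (Measure.ae_prod_iff_ae_ae (hz'.measurable (measurableSet_singleton 0))).2 ?_
  filter_upwards [h2, h3, Measure.ae_ae_of_ae_prod hzz'] with t h2 h3 htt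
  have h6 : h3.toLp _ = 0 := by
    have heq : (fun ψ : Lp ℝ 2 (wMeasure d α) => ⟪h3.toLp _, ψ⟫) = fun _ => 0 := by
      refine (TopologicalSpace.denseRange_denseSeq (Lp ℝ 2 (wMeasure d α))).equalizer
        (by fun_prop) continuous_const (funext fun n => ?_)
      simp only [Function.comp_apply]
      rw [← h2 n, L2.inner_def]
      refine integral_congr_ae ?_
      filter_upwards [h3.coeFn_toLp] with x hx
      rw [hx]
    exact inner_self_eq_zero.1 (congrFun heq (h3.toLp _))
  have h7 := h3.coeFn_toLp
  rw [h6] at h7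
  filter_upwards [h7, Lp.coeFn_zero ℝ 2 (wMeasure d α), htt] with x h7 h8 h9
  simp only [mem_singleton_iff]
  rw [← h9, ← h7, h8]
  rfl

end EnergyConservation

/-! ### Conservation of energy and uniqueness of finite energy solutions -/

section Uniqueness

open scoped RealInnerProductSpace

variable {d : ℕ} {α : ℝ}

theorem IsWeakTimeDeriv.unique {u g g' : ℝ × Space d × ℝ → ℝ} (h : IsWeakTimeDeriv α u g)
    (h' : IsWeakTimeDeriv α u g') : g =ᵐ[bulkMeasure d α] g' := by
  have key : ∀ᵐ p ∂volume.restrict (bulk d), g p - g' p = 0 := by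
    rw [ae_restrict_iff' isOpen_bulk.measurableSet]
    refine IsOpen.ae_eq_zero_of_integral_contDiff_smul_eq_zero isOpen_bulk
      (h.2.1.sub h'.2.1) fun φ hφ hc hU => ?_
    have ht : IsTestOn (bulk d) φ := ⟨hφ, hc, hU⟩
    have ht' : IsTestOn (bulk d) fun p => p.2.2 ^ (-(1 - 2 * α)) * φ p :=
      ht.contDiffOn_mul isOpen_bulk (contDiffOn_bulk_rpow _)
    have e := (h.2.2 _ ht').symm.trans (h'.2.2 _ ht')
    have i1 := ht'.integrable_mul_locallyIntegrableOn (α := α) h.2.1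
    have i2 := ht'.integrable_mul_locallyIntegrableOn (α := α) h'.2.1
    rw [neg_inj, ← sub_eq_zero, ← integral_sub i1 i2, integral_bulkMeasure] at e
    simp only [smul_eq_mul]
    rw [← e, integral_congr_ae (Eventually.of_forall fun p => mul_comm (φ p) _),
      ← setIntegral_mul_eq_of_isTestOn (U := bulk d) _ ht]
    refine setIntegral_congr_fun isOpen_bulk.measurableSet fun p hp => ?_
    have h2 := (bulk_weight_pos (α := α) p hp).ne'
    simp only [Real.rpow_neg (le_of_lt hp)]
    field_simp
  rw [EventuallyEq, ae_bulkMeasure_iff]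
  filter_upwards [key] with p hp
  exact sub_eq_zero.1 hp

/-- Conservation of energy: the energy of an average in time is independent of time. -/
theorem energy_avgLp_eq (hα : 0 < α) {z g : ℝ × Space d × ℝ → ℝ} {G : ℝ × Space d × ℝ → Grad d}
    (hz : ∀ a b, MemLp z 2 (slabMeasure d α a b)) (hG : ∀ a b, MemLp G 2 (slabMeasure d α a b))
    (hg : ∀ a b, MemLp g 2 (slabMeasure d α a b))
    (hw : ∀ᵐ t : ℝ, IsWeakGrad (fun x => z (t, x)) fun x => G (t, x))
    (ht : IsWeakTimeDeriv α z g) (heq : IsWeakSol α z) (hb : HasBoundaryValue z 0)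
    {θ : ℝ → ℝ} (hθ : IsTestOn univ θ) (s s' : ℝ) :
    ‖avgLp (hθ.shift s) hg‖ ^ 2 + ‖avgLp (hθ.shift s) hG‖ ^ 2 =
      ‖avgLp (hθ.shift s') hg‖ ^ 2 + ‖avgLp (hθ.shift s') hG‖ ^ 2 := by
  have hmem {η : ℝ → ℝ} (hη : IsTestOn univ η) :
      WithLp.toLp 2 (avgLp hη hz, avgLp hη hG) ∈ energySpace d α :=
    mem_energySpace_of_hasZeroTrace hα (memLp_timeAvg hη hz) (memLp_timeAvg hη hG)
      (isWeakGrad_timeAvg hz hG hw hη) (hasZeroTrace_timeAvg heq.1 hb hη)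
  have hA (s : ℝ) : avgLp (hθ.deriv.shift s) hz = -avgLp (hθ.shift s) hg := by
    refine Lp.ext ?_
    have h1 := timeAvg_deriv ht hz hg (hθ.shift s)
    rw [deriv_shift] at h1
    filter_upwards [h1, (memLp_timeAvg (hθ.deriv.shift s) hz).coeFn_toLp,
      (memLp_timeAvg (hθ.shift s) hg).coeFn_toLp, Lp.coeFn_neg (avgLp (hθ.shift s) hg)]
      with x h1 h2 h3 h4
    rw [h4, Pi.neg_apply, avgLp, avgLp, h2, h3, h1, Pi.neg_apply]
  have hN (s : ℝ) : ‖avgLp (hθ.shift s) hg‖ ^ 2 = ‖avgLp (hθ.deriv.shift s) hz‖ ^ 2 := by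
    rw [hA, norm_neg]
  rw [hN, hN]
  -- test the averaged equation with the time derivative of the average
  have hE (s : ℝ) : HasDerivAt
      (fun s => ‖avgLp (hθ.deriv.shift s) hz‖ ^ 2 + ‖avgLp (hθ.shift s) hG‖ ^ 2) 0 s := by
    have h1 := (hasDerivAt_avgLp hθ.deriv hz s).norm_sq
    have h2 := (hasDerivAt_avgLp hθ hG s).norm_sq
    have h3 := inner_avgLp_eq_zero hz hG hw heq (hθ.shift s) (hmem (hθ.deriv.shift s))
    have h4 : avgLp (hθ.shift s).deriv.deriv hz = avgLp (hθ.deriv.deriv.shift s) hz := by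
      simp only [avgLp, deriv_shift]
    rw [h4] at h3
    refine (h1.add h2).congr_deriv ?_
    rw [inner_neg_right, inner_neg_right, real_inner_comm]
    change ⟪avgLp (hθ.deriv.deriv.shift s) hz, avgLp (hθ.deriv.shift s) hz⟫ +
      ⟪avgLp (hθ.shift s) hG, avgLp (hθ.deriv.shift s) hG⟫ = 0 at h3
    linarith
  exact is_const_of_deriv_eq_zero (fun s => (hE s).differentiableAt) (fun s => (hE s).deriv) s s'

/-- A solution with finite energy, trivial initial data and trace zero vanishes. -/
theorem ae_eq_zero_of_isWeakSol (hα : 0 < α) {z g : ℝ × Space d × ℝ → ℝ}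
    {G : ℝ × Space d × ℝ → Grad d}
    (hz : ∀ a b, MemLp z 2 (slabMeasure d α a b)) (hG : ∀ a b, MemLp G 2 (slabMeasure d α a b))
    (hg : ∀ a b, MemLp g 2 (slabMeasure d α a b))
    (hw : ∀ᵐ t : ℝ, IsWeakGrad (fun x => z (t, x)) fun x => G (t, x))
    (ht : IsWeakTimeDeriv α z g) (heq : IsWeakSol α z) (hb : HasBoundaryValue z 0)
    (hi : HasTrivialData α z) : z =ᵐ[volume.restrict (bulk d)] 0 := by
  have hm : AEStronglyMeasurable z (bulkMeasure d α) := by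
    have h1 := heq.1.aestronglyMeasurable
    rw [bulkMeasure_eq]
    exact h1.mono_ac (withDensity_absolutelyContinuous _ _)
  obtain ⟨g', hg', hsmall⟩ := hi
  have hgg : ∀ᵐ t : ℝ, (fun x => g (t, x)) =ᵐ[wMeasure d α] fun x => g' (t, x) :=
    Measure.ae_ae_of_ae_prod (ht.unique hg')
  have hB {θ : ℝ → ℝ} (hθ : IsTestOn univ θ) : avgLp hθ hG = 0 := by
    obtain ⟨r, hr, h0⟩ := bounded_support_of_isTestOn hθ
    obtain ⟨M, hM⟩ := hθ.2.1.exists_bound_of_continuous hθ.1.continuous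
    have hM0 : 0 ≤ M := (abs_nonneg _).trans (hM 0)
    -- the energy of the average equals the one at a time `s` in the far past, where it is small
    have hbound (ε : ℝ≥0) (hε : 0 < ε) : ‖avgLp (hθ.shift 0) hG‖ ^ 2 ≤
        2 * (M * (2 * r)) ^ 2 * (ε : ℝ) ^ 2 := by
      obtain ⟨T, hT⟩ := hsmall ε hε
      set s := T - r - 1 with hs
      have h0s : ∀ t ∉ Icc (s - r) (s + r), θ (t - s) = 0 := by
        intro t ht
        refine h0 _ fun h => ht ⟨?_, ?_⟩ <;> linarith [h.1, h.2]
      have hcase {F : Type} [NormedAddCommGroup F] [NormedSpace ℝ F] {f : ℝ × Space d × ℝ → F}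
          (hf : ∀ a b, MemLp f 2 (slabMeasure d α a b))
          (hle : ∀ᵐ t : ℝ, t < T → eLpNorm (fun x => f (t, x)) 2 (wMeasure d α) ≤ ε) :
          ‖avgLp (hθ.shift s) hf‖ ^ 2 ≤ (M * (2 * r) * ε) ^ 2 := by
        have h1 := eLpNorm_timeAvg_le_of_slice (by linarith) h0s (fun t => hM (t - s))
          (hf _ _).1 (hle.mono fun t ht htI => ht (by linarith [htI.2]))
        rw [show s + r - (s - r) = 2 * r by ring] at h1
        have h2 : ‖avgLp (hθ.shift s) hf‖ ≤ M * (2 * r) * ε := by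
          rw [avgLp, Lp.norm_toLp]
          exact ENNReal.toReal_le_of_le_ofReal (by positivity) h1
        exact pow_le_pow_left₀ (norm_nonneg _) h2 2
      have e1 := hcase hg (by
        filter_upwards [hgg, hT] with t h1 h2 htT
        rw [eLpNorm_congr_ae h1]
        exact (h2 htT).2)
      have e2 := hcase hG (by
        filter_upwards [hw, hT] with t h1 h2 htT
        obtain ⟨⟨G', hG', hle⟩, -⟩ := h2 htT
        have h3 := ae_wMeasure_iff (α := α).2 (h1.unique hG'.isWeakGrad)
        rw [eLpNorm_congr_ae h3]
        exact hle)
      have e3 := energy_avgLp_eq hα hz hG hg hw ht heq hb hθ 0 s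
      have e4 := sq_nonneg ‖avgLp (hθ.shift 0) hg‖
      calc _ ≤ (M * (2 * r) * ε) ^ 2 + (M * (2 * r) * ε) ^ 2 := by linarith
        _ = _ := by ring
    have hlim : Tendsto (fun ε : ℝ≥0 => 2 * (M * (2 * r)) ^ 2 * (ε : ℝ) ^ 2) (𝓝[>] 0) (𝓝 0) := by
      have : Tendsto (fun ε : ℝ≥0 => 2 * (M * (2 * r)) ^ 2 * (ε : ℝ) ^ 2) (𝓝 0)
          (𝓝 (2 * (M * (2 * r)) ^ 2 * ((0 : ℝ≥0) : ℝ) ^ 2)) :=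
        Continuous.tendsto (by fun_prop) 0
      simp only [NNReal.coe_zero, ne_eq, OfNat.ofNat_ne_zero, not_false_eq_true, zero_pow,
        mul_zero] at this
      exact this.mono_left nhdsWithin_le_nhds
    have h3 : ‖avgLp (hθ.shift 0) hG‖ ^ 2 ≤ 0 :=
      ge_of_tendsto hlim (eventually_nhdsWithin_of_forall fun ε hε => hbound ε hε)
    have h4 : avgLp (hθ.shift 0) hG = 0 := by
      rw [← norm_eq_zero]
      exact pow_eq_zero_iff two_ne_zero |>.1 (le_antisymm h3 (sq_nonneg _))
    rw [← h4]
    simp only [avgLp, sub_zero]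
  rw [EventuallyEq, ← ae_bulkMeasure_iff (α := α)]
  refine ae_eq_zero_of_timeAvg_eq_zero hz hm fun θ hθ => ?_
  have hmem : WithLp.toLp 2 (avgLp hθ hz, avgLp hθ hG) ∈ energySpace d α :=
    mem_energySpace_of_hasZeroTrace hα (memLp_timeAvg hθ hz) (memLp_timeAvg hθ hG)
      (isWeakGrad_timeAvg hz hG hw hθ) (hasZeroTrace_timeAvg heq.1 hb hθ)
  -- by Hardy's inequality, an average with zero gradient vanishes
  have hh := hardy_of_mem_energySpace hα hmem
  change eLpNorm (fun x => x.2⁻¹ * avgLp hθ hz x) 2 (wMeasure d α) ≤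
    ENNReal.ofReal α⁻¹ * eLpNorm (avgLp hθ hG) 2 (wMeasure d α) at hh
  rw [hB hθ, eLpNorm_congr_ae (Lp.coeFn_zero _ _ _), eLpNorm_zero, mul_zero, nonpos_iff_eq_zero] at hh
  have hmeas : AEStronglyMeasurable (fun x => x.2⁻¹ * avgLp hθ hz x) (wMeasure d α) :=
    (show Measurable fun x : Space d × ℝ => x.2⁻¹ by fun_prop).aestronglyMeasurable.mul
      (Lp.aestronglyMeasurable _)
  rw [eLpNorm_eq_zero_iff hmeas two_ne_zero] at hh
  have hpos : ∀ᵐ x ∂wMeasure d α, x ∈ halfSpace d :=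
    ae_wMeasure_iff.2 (ae_restrict_mem isOpen_halfSpace.measurableSet)
  filter_upwards [hh, hpos, (memLp_timeAvg hθ hz).coeFn_toLp] with x h1 h2 h3
  have h2' : x.2 ≠ 0 := ne_of_gt h2
  have h4 : avgLp hθ hz x = 0 := by simpa [h2'] using h1
  rw [← h3]
  exact h4

end Uniqueness

/-! ### Differences of solutions -/

section Difference

open scoped RealInnerProductSpace

variable {d : ℕ} {α : ℝ}

theorem grad_sub {φ ψ : Space d × ℝ → ℝ} {z : Space d × ℝ} (hφ : DifferentiableAt ℝ φ z)
    (hψ : DifferentiableAt ℝ ψ z) : grad (fun z => φ z - ψ z) z = grad φ z - grad ψ z := by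
  have h := grad_add hφ (hψ.const_mul (-1))
  rw [grad_const_mul hψ, neg_smul, one_smul, ← sub_eq_add_neg] at h
  rw [← h]
  congr 1
  ext z
  simp [sub_eq_add_neg]

theorem HasHomGrad.sub {v v' : Space d × ℝ → ℝ} {G G' : Space d × ℝ → Grad d}
    (h : HasHomGrad α v G) (h' : HasHomGrad α v' G') :
    HasHomGrad α (fun z => v z - v' z) (fun z => G z - G' z) := by
  obtain ⟨h1, h2, φ, h3, h4, h5⟩ := h
  obtain ⟨h1', h2', φ', h3', h4', h5'⟩ := h'
  refine ⟨h1.sub h1', h2.sub h2', fun m z => φ m z - φ' m z,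
    fun m => ⟨(h3 m).1.sub (h3' m).1, (h3 m).2.sub (h3' m).2⟩, ?_, fun K hK hKU => ?_⟩
  · have h0 := h4.add h4'
    rw [add_zero] at h0
    refine tendsto_of_tendsto_of_tendsto_of_le_of_le tendsto_const_nhds h0
      (fun _ => zero_le) fun m => ?_
    have hc := (continuous_grad ((h3 m).1.of_le (by simp))).aestronglyMeasurable
      (μ := wMeasure d α)
    have hc' := (continuous_grad ((h3' m).1.of_le (by simp))).aestronglyMeasurable
      (μ := wMeasure d α)
    refine le_trans (le_of_eq ?_) (eLpNorm_sub_le (hc.sub h2.1) (hc'.sub h2'.1) one_le_two)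
    congr 1
    ext1 z
    simp only [Pi.sub_apply]
    rw [grad_sub ((h3 m).1.differentiable (by simp) z) ((h3' m).1.differentiable (by simp) z)]
    abel
  · have h0 := (h5 K hK hKU).add (h5' K hK hKU)
    rw [add_zero] at h0
    refine tendsto_of_tendsto_of_tendsto_of_le_of_le tendsto_const_nhds h0
      (fun _ => zero_le) fun m => ?_
    have hm : AEStronglyMeasurable (fun z => φ m z - v z) (volume.restrict K) :=
      (h3 m).1.continuous.aestronglyMeasurable.sub
        (h1.aestronglyMeasurable.mono_measure (Measure.restrict_mono_set _ hKU))
    simp only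
    rw [← lintegral_add_left' hm.enorm]
    refine lintegral_mono fun z => ?_
    simp only
    rw [sub_sub_sub_comm]
    exact enorm_sub_le

theorem MemL2LocHom.sub {v v' : ℝ × Space d × ℝ → ℝ} (h : MemL2LocHom α v)
    (h' : MemL2LocHom α v') : MemL2LocHom α fun p => v p - v' p := by
  obtain ⟨h1, G, h2, h3⟩ := h
  obtain ⟨h1', G', h2', h3'⟩ := h'
  refine ⟨h1.sub h1', fun p => G p - G' p, ?_, fun a b => (h3 a b).sub (h3' a b)⟩
  filter_upwards [h2, h2'] with t ht ht'
  exact ht.sub ht'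

theorem MemH1LocL2.sub {v v' : ℝ × Space d × ℝ → ℝ} (h : MemH1LocL2 α v)
    (h' : MemH1LocL2 α v') : MemH1LocL2 α fun p => v p - v' p := by
  obtain ⟨g, h1, h2⟩ := h
  obtain ⟨g', h1', h2'⟩ := h'
  exact ⟨_, h1.sub h1', fun a b => ⟨(h2 a b).1.sub (h2' a b).1, (h2 a b).2.sub (h2' a b).2⟩⟩

theorem IsWeakSol.sub {u u' : ℝ × Space d × ℝ → ℝ} (h : IsWeakSol α u) (h' : IsWeakSol α u') :
    IsWeakSol α fun p => u p - u' p := by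
  refine ⟨h.1.sub h'.1, fun φ hφ => ?_⟩
  have hφ' : IsTestOn (bulk d) φ := hφ
  simp only [sub_mul]
  rw [integral_sub ((hφ'.waveOp (α := α)).integrable_mul_locallyIntegrableOn h.1)
    ((hφ'.waveOp (α := α)).integrable_mul_locallyIntegrableOn h'.1), h.2 φ hφ, h'.2 φ hφ, sub_zero]

theorem HasBoundaryValue.sub {u u' : ℝ × Space d × ℝ → ℝ} {f : ℝ × Space d → ℝ}
    (hu : LocallyIntegrableOn u (bulk d) volume) (hf : Continuous f) (h : HasBoundaryValue u f)
    (h' : HasBoundaryValue u' f) : HasBoundaryValue (fun p => u p - u' p) 0 := by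
  intro K hK
  have h0 := (h K hK).add (h' K hK)
  rw [add_zero] at h0
  refine tendsto_of_tendsto_of_tendsto_of_le_of_le tendsto_const_nhds h0
    (fun _ => zero_le) fun ε => ?_
  have hm : AEStronglyMeasurable (fun p : ℝ × Space d × ℝ => u p - f (p.1, p.2.1))
      (volume.restrict {p : ℝ × Space d × ℝ | (p.1, p.2.1) ∈ K ∧ p.2.2 ∈ Ioo 0 ε}) :=
    (hu.aestronglyMeasurable.mono_measure (Measure.restrict_mono_set _
      (strip_subset_bulk K ε))).sub (by fun_prop : Continuous fun p : ℝ × Space d × ℝ =>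
        f (p.1, p.2.1)).aestronglyMeasurable
  simp only [Pi.zero_apply, sub_zero]
  rw [← mul_add, ← lintegral_add_left' hm.enorm]
  gcongr with p
  rw [← sub_sub_sub_cancel_right _ _ (f (p.1, p.2.1))]
  exact enorm_sub_le

theorem HasTrivialData.sub {u u' : ℝ × Space d × ℝ → ℝ} (h : HasTrivialData α u)
    (h' : HasTrivialData α u') : HasTrivialData α fun p => u p - u' p := by
  obtain ⟨g, h1, h2⟩ := h
  obtain ⟨g', h1', h2'⟩ := h'
  have hslice {g : ℝ × Space d × ℝ → ℝ} (hg : LocallyIntegrableOn g (bulk d) volume) :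
      ∀ᵐ t : ℝ, AEStronglyMeasurable (fun z => g (t, z)) (wMeasure d α) := by
    have hm : AEStronglyMeasurable g (bulkMeasure d α) := by
      rw [bulkMeasure_eq]
      exact hg.aestronglyMeasurable.mono_ac (withDensity_absolutelyContinuous _ _)
    exact hm.prodMk_left
  refine ⟨_, h1.sub h1', fun ε hε => ?_⟩
  obtain ⟨T, hT⟩ := h2 (ε / 2) (half_pos hε)
  obtain ⟨T', hT'⟩ := h2' (ε / 2) (half_pos hε)
  refine ⟨min T T', ?_⟩
  have hεε : ((ε / 2 : ℝ≥0) : ℝ≥0∞) + (ε / 2 : ℝ≥0) = ε := by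
    rw [← ENNReal.coe_add, add_halves]
  filter_upwards [hT, hT', hslice h1.2.1, hslice h1'.2.1] with t e e' m m' ht
  obtain ⟨⟨G, hG, hGε⟩, hgε⟩ := e (ht.trans_le (min_le_left _ _))
  obtain ⟨⟨G', hG', hGε'⟩, hgε'⟩ := e' (ht.trans_le (min_le_right _ _))
  refine ⟨⟨_, hG.sub hG', ?_⟩, ?_⟩
  · exact (eLpNorm_sub_le hG.2.1.1 hG'.2.1.1 one_le_two).trans ((add_le_add hGε hGε').trans_eq hεε)
  · exact (eLpNorm_sub_le m m' one_le_two).trans ((add_le_add hgε hgε').trans_eq hεε)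

end Difference

section FiniteEnergy

variable {d : ℕ} {α : ℝ} {k : ℕ} {χ : ℝ → ℝ}

theorem fderiv_tensor {a : ℝ × Space d → ℝ} (ha : ContDiff ℝ ∞ a) {η : ℝ → ℝ}
    (hη : ContDiff ℝ ∞ η) (p e : ℝ × Space d × ℝ) :
    fderiv ℝ (fun p : ℝ × Space d × ℝ => a (p.1, p.2.1) * η p.2.2) p e =
      fderiv ℝ a (p.1, p.2.1) (e.1, e.2.1) * η p.2.2 +
        a (p.1, p.2.1) * (e.2.2 * deriv η p.2.2) := by
  let L : ℝ × Space d × ℝ →L[ℝ] ℝ × Space d :=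
    (ContinuousLinearMap.fst ℝ ℝ (Space d × ℝ)).prod
      ((ContinuousLinearMap.fst ℝ (Space d) ℝ).comp (ContinuousLinearMap.snd ℝ ℝ (Space d × ℝ)))
  let L' : ℝ × Space d × ℝ →L[ℝ] ℝ :=
    (ContinuousLinearMap.snd ℝ (Space d) ℝ).comp (ContinuousLinearMap.snd ℝ ℝ (Space d × ℝ))
  have h1 : HasFDerivAt (fun p : ℝ × Space d × ℝ => a (p.1, p.2.1))
      ((fderiv ℝ a (p.1, p.2.1)).comp L) p :=
    HasFDerivAt.comp (g := a) p (ha.differentiable (by simp) (p.1, p.2.1)).hasFDerivAt L.hasFDerivAt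
  have h2 : HasFDerivAt (fun p : ℝ × Space d × ℝ => η p.2.2) (deriv η p.2.2 • L') p :=
    ((hη.differentiable (by simp) p.2.2).hasDerivAt).comp_hasFDerivAt p L'.hasFDerivAt
  rw [show fderiv ℝ (fun p : ℝ × Space d × ℝ => a (p.1, p.2.1) * η p.2.2) p = _ from
    (h1.mul h2).fderiv]
  simp [L, L']
  ring

theorem memLp_powerCutoff (hχ : ContDiff ℝ ∞ χ) (h1 : ∀ y < 1, χ y = 1)
    (h2 : ∀ y > 2, χ y = 0) {j : ℕ} (hj : α < 2 * j ∨ (j = 0 ∧ α < 1)) :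
    MemLp (powerCutoff χ j) 2 (normalMeasure α) := by
  refine memLp_normalMeasure (contDiff_powerCutoff hχ j).continuous.continuousOn (A := 1)
    (r := ((2 * j : ℕ) : ℝ)) (by positivity) ?_ (fun y hy => ?_) fun y hy => ?_
  · push_cast
    rcases hj with hj | ⟨rfl, hj⟩
    · linarith
    · push_cast
      linarith
  · rw [powerCutoff, h1 y hy.2, mul_one, Real.rpow_natCast, one_mul,
      abs_of_nonneg (pow_nonneg hy.1.le _)]
  · rw [powerCutoff, h2 y hy, mul_zero]

theorem memLp_deriv_powerCutoff (hα : 0 < α) (hχ : ContDiff ℝ ∞ χ) (h1 : ∀ y < 1, χ y = 1)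
    (h2 : ∀ y > 2, χ y = 0) {j : ℕ} (hj : α < 2 * j ∨ (j = 0 ∧ α < 1)) :
    MemLp (deriv (powerCutoff χ j)) 2 (normalMeasure α) := by
  have hc : ContinuousOn (deriv (powerCutoff χ j)) (Ioi 0) :=
    ((contDiff_powerCutoff hχ j).continuous_deriv (by simp)).continuousOn
  have hz : ∀ y > 2, deriv (powerCutoff χ j) y = 0 := fun y hy => by
    rw [(powerCutoff_eventuallyEq_zero h2 j hy).deriv_eq, deriv_const]
  have hd : ∀ y < 1, deriv (powerCutoff χ j) y = (2 * j : ℕ) * y ^ (2 * j - 1) := fun y hy => by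
    rw [(powerCutoff_eventuallyEq h1 j hy).deriv_eq, deriv_pow_field]
  cases j with
  | zero =>
    refine memLp_normalMeasure hc (A := 0) (r := α) hα.le (by linarith) (fun y hy => ?_) hz
    rw [hd y hy.2]
    simp
  | succ j =>
    have hj' : α < 2 * (j + 1) := by
      rcases hj with hj | ⟨hj, -⟩
      · exact_mod_cast hj
      · omega
    refine memLp_normalMeasure hc (A := (2 * (j + 1) : ℕ)) (r := ((2 * j + 1 : ℕ) : ℝ))
      (by positivity) ?_ (fun y hy => ?_) hz
    · push_cast
      linarith
    · rw [hd y hy.2, Real.rpow_natCast, show 2 * (j + 1) - 1 = 2 * j + 1 by omega, abs_mul,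
        abs_of_nonneg (pow_nonneg hy.1.le _), Nat.abs_cast]

theorem memLp_expansion (hχ : ContDiff ℝ ∞ χ) (h1 : ∀ y < 1, χ y = 1)
    (h2 : ∀ y > 2, χ y = 0) {b : ℕ → ℝ × Space d → ℝ}
    (hb : ∀ j, ContDiff ℝ ∞ (b j) ∧ HasCompactSupport (b j))
    (hgood : ∀ j < k, b j = 0 ∨ α < 2 * j ∨ (j = 0 ∧ α < 1)) :
    MemLp (expansion k χ b) 2 (bulkMeasure d α) := by
  rw [funext (expansion_eq b)]
  refine memLp_finsetSum _ fun j hj => ?_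
  rcases hgood j (Finset.mem_range.1 hj) with h0 | hg
  · simp [h0]
  · exact memLp_bulk_mul (hb j).1.continuous (hb j).2 (memLp_powerCutoff hχ h1 h2 hg)

theorem memLp_fderiv_expansion (hα : 0 < α) (hχ : ContDiff ℝ ∞ χ) (h1 : ∀ y < 1, χ y = 1)
    (h2 : ∀ y > 2, χ y = 0) {b : ℕ → ℝ × Space d → ℝ}
    (hb : ∀ j, ContDiff ℝ ∞ (b j) ∧ HasCompactSupport (b j))
    (hgood : ∀ j < k, b j = 0 ∨ α < 2 * j ∨ (j = 0 ∧ α < 1)) (e : ℝ × Space d × ℝ) :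
    MemLp (fun p => fderiv ℝ (expansion k χ b) p e) 2 (bulkMeasure d α) := by
  have hE : (fun p => fderiv ℝ (expansion k χ b) p e) = fun p => ∑ j ∈ Finset.range k,
      (fderiv ℝ (b j) (p.1, p.2.1) (e.1, e.2.1) * powerCutoff χ j p.2.2 +
        b j (p.1, p.2.1) * (e.2.2 * deriv (powerCutoff χ j) p.2.2)) := by
    ext p
    rw [funext (expansion_eq b), fderiv_fun_sum fun j _ =>
      (contDiff_tensor (hb j).1 (contDiff_powerCutoff hχ j)).differentiable (by simp) p,
      _root_.sum_apply]
    exact Finset.sum_congr rfl fun j _ => fderiv_tensor (hb j).1 (contDiff_powerCutoff hχ j) p e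
  rw [hE]
  refine memLp_finsetSum _ fun j hj => ?_
  rcases hgood j (Finset.mem_range.1 hj) with h0 | hg
  · simp [h0]
  · have ht : IsTestOn univ (b j) := ⟨(hb j).1, (hb j).2, subset_univ _⟩
    have ht' := ht.fderiv_apply (e.1, e.2.1)
    exact (memLp_bulk_mul ht'.1.continuous ht'.2.1 (memLp_powerCutoff hχ h1 h2 hg)).add
      (memLp_bulk_mul (hb j).1.continuous (hb j).2
        ((memLp_deriv_powerCutoff hα hχ h1 h2 hg).const_mul e.2.2))

theorem memLp_sliceGrad_expansion (hα : 0 < α) (hχ : ContDiff ℝ ∞ χ) (h1 : ∀ y < 1, χ y = 1)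
    (h2 : ∀ y > 2, χ y = 0) {b : ℕ → ℝ × Space d → ℝ}
    (hb : ∀ j, ContDiff ℝ ∞ (b j) ∧ HasCompactSupport (b j))
    (hgood : ∀ j < k, b j = 0 ∨ α < 2 * j ∨ (j = 0 ∧ α < 1)) :
    MemLp (sliceGrad (expansion k χ b)) 2 (bulkMeasure d α) := by
  have hE : ContDiff ℝ ∞ (expansion k χ b) := contDiff_expansion hχ fun j => (hb j).1
  rw [funext (sliceGrad_eq_sum (hE.of_le (by simp)))]
  refine memLp_finsetSum _ fun i _ => ?_
  have h3 := memLp_fderiv_expansion hα hχ h1 h2 hb hgood (0, frame i)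
  refine (h3.norm.mul_const ‖(WithLp.toLp 2 (frame i) : Grad d)‖).mono
    (h3.1.smul aestronglyMeasurable_const) (Eventually.of_forall fun z => ?_)
  rw [norm_smul, norm_mul (‖_‖), norm_norm, norm_norm]

/-- Differences of solutions whose expansions have finite energy vanish. The `j`-th term `y ^ (2j)`
has finite energy if `2j > α`, and also if `j = 0` and `α < 1`, since a constant has zero derivative
and is then square-integrable near the boundary. -/
theorem ae_eq_zero_of_expansion (hα : 0 < α) (hχ : ContDiff ℝ ∞ χ) (h1 : ∀ y < 1, χ y = 1)
    (h2 : ∀ y > 2, χ y = 0) {b : ℕ → ℝ × Space d → ℝ}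
    (hb : ∀ j, ContDiff ℝ ∞ (b j) ∧ HasCompactSupport (b j))
    (hgood : ∀ j < k, b j = 0 ∨ α < 2 * j ∨ (j = 0 ∧ α < 1)) {z : ℝ × Space d × ℝ → ℝ}
    (hw1 : MemL2LocHom α fun p => z p - expansion k χ b p)
    (hw2 : MemH1LocL2 α fun p => z p - expansion k χ b p)
    (heq : IsWeakSol α z) (hbv : HasBoundaryValue z 0)
    (hi : HasTrivialData α z) : z =ᵐ[volume.restrict (bulk d)] 0 := by
  obtain ⟨-, G, hG, hGs⟩ := hw1
  obtain ⟨g, hg, hgs⟩ := hw2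
  have hE : ContDiff ℝ ∞ (expansion k χ b) := contDiff_expansion hχ fun j => (hb j).1
  have hz (p : ℝ × Space d × ℝ) : z p - expansion k χ b p + expansion k χ b p = z p := by ring
  have e1 := memLp_slab_of_memLp_bulk (memLp_expansion hχ h1 h2 hb hgood)
  have e2 := memLp_slab_of_memLp_bulk (memLp_sliceGrad_expansion hα hχ h1 h2 hb hgood)
  have e3 := memLp_slab_of_memLp_bulk (memLp_fderiv_expansion hα hχ h1 h2 hb hgood (1, 0))
  refine ae_eq_zero_of_isWeakSol hα (g := fun p => g p + dt (expansion k χ b) p)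
    (G := fun p => G p + sliceGrad (expansion k χ b) p) (fun a b => ?_)
    (fun a b => (hGs a b).add (e2 a b)) (fun a b => (hgs a b).2.add (e3 a b)) ?_ ?_ heq hbv hi
  · have := (hgs a b).1.add (e1 a b)
    rwa [show (fun p => z p - expansion k χ _ p) + expansion k χ _ = z from funext hz] at this
  · filter_upwards [hG] with t ht
    have hs : ContDiff ℝ 1 fun x => expansion k χ b (t, x) :=
      (hE.comp (contDiff_const.prodMk contDiff_id)).of_le (by simp)
    have := ht.isWeakGrad.add (isWeakGrad_of_contDiff hs)
    simp only [hz] at this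
    exact this
  · have := hg.add (isWeakTimeDeriv_of_contDiff (α := α) hE)
    simpa only [hz] using this

end FiniteEnergy

/-! ### The zeroth coefficient of the expansion -/

section BoundaryCoefficient

variable {d : ℕ} {α : ℝ} {k : ℕ} {χ : ℝ → ℝ}

theorem lintegral_slab (f : ℝ × Space d × ℝ → ℝ≥0∞) (a b : ℝ) :
    ∫⁻ p, f p ∂slabMeasure d α a b =
      ∫⁻ p in Icc a b ×ˢ univ ∩ bulk d, ENNReal.ofReal (p.2.2 ^ (1 - 2 * α)) * f p := by
  have hS : MeasurableSet (Icc a b ×ˢ (univ : Set (Space d × ℝ))) :=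
    measurableSet_Icc.prod MeasurableSet.univ
  rw [slabMeasure_eq, bulkMeasure_eq, restrict_withDensity hS,
    lintegral_withDensity_eq_lintegral_mul_non_measurable _ (by fun_prop) (by simp),
    Measure.restrict_restrict hS]
  rfl

/-- Division by `y` lowers the weight exponent `α` by one. -/
theorem memLp_slab_inv_mul {f : ℝ × Space d × ℝ → ℝ} {a b : ℝ}
    (hm : AEStronglyMeasurable f (volume.restrict (bulk d)))
    (hf : MemLp f 2 (slabMeasure d α a b)) :
    MemLp (fun p => p.2.2⁻¹ * f p) 2 (slabMeasure d (α - 1) a b) := by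
  have hc : Continuous fun p : ℝ × Space d × ℝ => p.2.2 := by fun_prop
  have hi : AEStronglyMeasurable (fun p : ℝ × Space d × ℝ => p.2.2⁻¹) (volume.restrict (bulk d)) :=
    hc.measurable.inv.aestronglyMeasurable
  have him : AEStronglyMeasurable (fun p => p.2.2⁻¹ * f p) (bulkMeasure d (α - 1)) := by
    rw [bulkMeasure_eq]
    exact (hi.mul hm).mono_ac (withDensity_absolutelyContinuous _ _)
  refine ⟨aestronglyMeasurable_slab him a b, ?_⟩
  have h := hf.2
  rw [← ENNReal.pow_lt_top_iff (n := 2) |>.trans (or_iff_left two_ne_zero), eLpNorm_two_sq,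
    lintegral_slab] at h ⊢
  refine lt_of_eq_of_lt (setLIntegral_congr_fun ?_ fun p hp => ?_) h
  · exact (measurableSet_Icc.prod MeasurableSet.univ).inter isOpen_bulk.measurableSet
  · have hp0 : 0 < p.2.2 := hp.2
    rw [enorm_mul, mul_pow, ← mul_assoc, Real.enorm_eq_ofReal (inv_nonneg.2 hp0.le),
      ← ENNReal.ofReal_pow (by positivity), ← ENNReal.ofReal_mul (by positivity)]
    congr 2
    rw [show 1 - 2 * (α - 1) = 1 - 2 * α + 2 by ring, Real.rpow_add hp0, Real.rpow_two]
    field_simp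

theorem volume_strip {K : Set (ℝ × Space d)} (ε : ℝ) :
    volume (strip K ε) = volume K * ENNReal.ofReal ε := by
  have h2 : strip K ε = MeasurableEquiv.prodAssoc.symm ⁻¹' (K ×ˢ Ioo 0 ε) := rfl
  have h3 : MeasurePreserving (MeasurableEquiv.prodAssoc.symm :
    ℝ × Space d × ℝ ≃ᵐ (ℝ × Space d) × ℝ) volume volume := 
      (measurePreserving_prodAssoc volume volume volume).symm
  rw [h2, h3.measure_preimage_equiv, Measure.volume_eq_prod, Measure.prod_prod, Real.volume_Ioo,
    sub_zero]

/-- A continuous function of `(t, x)` with trace zero vanishes. -/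
theorem eq_zero_of_tendsto_average {g : ℝ × Space d → ℝ} (hg : Continuous g)
    (h : ∀ K : Set (ℝ × Space d), IsCompact K → Tendsto (fun ε : ℝ => (ENNReal.ofReal ε)⁻¹ *
      ∫⁻ p in strip K ε, ‖g (p.1, p.2.1)‖ₑ) (𝓝[>] 0) (𝓝 0)) : g = 0 := by
  by_contra hne
  obtain ⟨q, hq⟩ : ∃ q, g q ≠ 0 := by
    by_contra! h0
    exact hne (funext h0)
  have hc : 0 < ‖g q‖ / 2 := half_pos (norm_pos_iff.2 hq)
  obtain ⟨δ, hδ, hδg⟩ := Metric.nhds_basis_closedBall.eventually_iff.1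
    (hg.norm.continuousAt.eventually_const_lt (half_lt_self (norm_pos_iff.2 hq)))
  set K := Metric.closedBall q δ with hK
  have hKc : IsCompact K := isCompact_closedBall q δ
  have hlow : ∀ᶠ ε : ℝ in 𝓝[>] 0, ENNReal.ofReal (‖g q‖ / 2) * volume K ≤
      (ENNReal.ofReal ε)⁻¹ * ∫⁻ p in strip K ε, ‖g (p.1, p.2.1)‖ₑ := by
    filter_upwards [self_mem_nhdsWithin] with ε (hε : 0 < ε)
    have h1 : ∫⁻ p in strip K ε, ENNReal.ofReal (‖g q‖ / 2) ≤
        ∫⁻ p in strip K ε, ‖g (p.1, p.2.1)‖ₑ := by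
      refine setLIntegral_mono' (measurableSet_strip hKc.measurableSet ε) fun p hp => ?_
      rw [← ofReal_norm]
      exact ENNReal.ofReal_le_ofReal (hδg hp.1).le
    refine le_trans (le_of_eq ?_) (mul_le_mul_right h1 _)
    rw [setLIntegral_const, volume_strip, mul_left_comm, mul_comm (volume K), ← mul_assoc _ _ (volume K),
      ENNReal.inv_mul_cancel (by simpa using hε) ENNReal.ofReal_ne_top, one_mul]
  have h0 := le_of_tendsto_of_tendsto tendsto_const_nhds (h K hKc) hlow
  have hvol : 0 < volume K := Metric.measure_closedBall_pos volume q hδ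
  exact (ENNReal.mul_pos (by simpa using hq) hvol.ne').not_ge h0

/-- For `α > 1` a function of finite energy has trace zero, so the zeroth coefficient of an
admissible function with trace zero vanishes. -/
theorem coeff_zero_eq_zero (hα : 1 < α) (hk : k ≠ 0) (h1 : ∀ y < 1, χ y = 1)
    (hχ : ContDiff ℝ ∞ χ) {b : ℕ → ℝ × Space d → ℝ}
    (hb : ∀ j, ContDiff ℝ ∞ (b j) ∧ HasCompactSupport (b j)) {z : ℝ × Space d × ℝ → ℝ}
    (hw : MemH1LocL2 α fun p => z p - expansion k χ b p)
    (hz : LocallyIntegrableOn z (bulk d) volume) (hbv : HasBoundaryValue z 0) : b 0 = 0 := by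
  obtain ⟨g, hg, hgs⟩ := hw
  refine eq_zero_of_tendsto_average (hb 0).1.continuous fun K hK => ?_
  have h2 := tendsto_average_of_lintegral_inv_mul hK
    (lintegral_strip_lt_top (sub_pos.2 hα) (fun a a' =>
      memLp_slab_inv_mul hg.1.aestronglyMeasurable (hgs a a').1) hK 1)
  have h3 := tendsto_average_of_lintegral_inv_mul hK
    (lintegral_inv_mul_expansion_sub_lt_top hk h1 hb hK)
  have h4 := (hbv K hK).add (h2.add h3)
  simp only [add_zero] at h4
  refine tendsto_of_tendsto_of_tendsto_of_le_of_le tendsto_const_nhds h4 (fun _ => zero_le)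
    fun ε => ?_
  have hm : AEStronglyMeasurable z (volume.restrict (strip K ε)) :=
    hz.aestronglyMeasurable.mono_measure (Measure.restrict_mono_set _ (strip_subset_bulk K ε))
  have hmw : AEStronglyMeasurable (fun p => z p - expansion k χ b p)
      (volume.restrict (strip K ε)) :=
    hm.sub (contDiff_expansion hχ fun j => (hb j).1).continuous.aestronglyMeasurable
  simp only
  rw [← mul_add, ← mul_add]
  refine mul_le_mul_right ?_ _
  change _ ≤ (∫⁻ p in strip K ε, ‖z p - (0 : ℝ × Space d → ℝ) (p.1, p.2.1)‖ₑ) + _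
  simp only [Pi.zero_apply, sub_zero]
  rw [← lintegral_add_left' hmw.enorm, ← lintegral_add_left' hm.enorm]
  refine lintegral_mono fun p => ?_
  have e : b 0 (p.1, p.2.1) = z p - ((z p - expansion k χ b p) +
      (expansion k χ b p - b 0 (p.1, p.2.1))) := by ring
  simp only
  conv_lhs => rw [e]
  exact enorm_sub_le.trans (by gcongr; exact enorm_add_le _ _)

end BoundaryCoefficient

/-! ### Test functions concentrated near the boundary -/

section Scaling

open scoped RealInnerProductSpace
open Asymptotics

variable {d : ℕ} {α : ℝ}

theorem integral_tensor (A : ℝ × Space d → ℝ) (γ : ℝ → ℝ) :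
    ∫ p, A (p.1, p.2.1) * γ p.2.2 ∂bulkMeasure d α = (∫ q, A q) * ∫ y, γ y ∂normalMeasure α := by
  rw [bulkMeasure, wMeasure_eq_prod]
  have h := (measurePreserving_prodAssoc (volume : Measure ℝ) (volume : Measure (Space d))
    (normalMeasure α)).symm.integral_comp' fun q : (ℝ × Space d) × ℝ => A q.1 * γ q.2
  exact h.trans (integral_prod_mul _ _)

theorem integral_normalMeasure (γ : ℝ → ℝ) :
    ∫ y, γ y ∂normalMeasure α = ∫ y in Ioi 0, y ^ (1 - 2 * α) * γ y :=
  integral_withDensity_ofReal measurableSet_Ioi (by fun_prop)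
    (fun _ hy => Real.rpow_pos_of_pos hy _) γ

theorem integral_normalMeasure_dilate (γ : ℝ → ℝ) {ε : ℝ} (hε : 0 < ε) :
    ∫ y, γ (ε⁻¹ * y) ∂normalMeasure α = ε ^ (2 - 2 * α) * ∫ y, γ y ∂normalMeasure α := by
  have h := integral_comp_mul_left_Ioi (fun y => ε ^ (1 - 2 * α) * (y ^ (1 - 2 * α) * γ y)) 0
    (inv_pos.2 hε)
  rw [mul_zero, integral_const_mul, inv_inv, smul_eq_mul, integral_const_mul] at h
  rw [integral_normalMeasure, integral_normalMeasure,
    show 2 - 2 * α = 1 + (1 - 2 * α) by ring, Real.rpow_add hε, Real.rpow_one, mul_assoc, ← h,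
    ← integral_const_mul]
  refine setIntegral_congr_fun measurableSet_Ioi fun y (hy : 0 < y) => ?_
  rw [Real.mul_rpow (inv_nonneg.2 hε.le) hy.le, Real.inv_rpow hε.le]
  have : ε ^ (1 - 2 * α) ≠ 0 := (Real.rpow_pos_of_pos hε _).ne'
  field_simp

theorem IsTestOn.dilate {η : ℝ → ℝ} (h : IsTestOn (Ioo 1 2) η) {ε : ℝ} (hε : 0 < ε) :
    IsTestOn (Ioo ε (2 * ε)) fun y => η (ε⁻¹ * y) := by
  have h' := h.comp_equiv (LinearEquiv.smulOfNeZero ℝ ℝ ε⁻¹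
    (inv_ne_zero hε.ne')).toContinuousLinearEquiv
  refine IsTestOn.mono (φ := fun y => η (ε⁻¹ * y)) h' fun y hy => ?_
  have hy' : 1 < ε⁻¹ * y ∧ ε⁻¹ * y < 2 := hy
  rw [lt_inv_mul_iff₀ hε, inv_mul_lt_iff₀ hε] at hy'
  exact ⟨by linarith [hy'.1], by linarith [hy'.2]⟩

theorem IsTestOn.dilate_pos {η : ℝ → ℝ} (h : IsTestOn (Ioo 1 2) η) {ε : ℝ} (hε : 0 < ε) :
    IsTestOn (Ioi 0) fun y => η (ε⁻¹ * y) :=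
  (h.dilate hε).mono fun _ hy => hε.trans hy.1

/-- Pairings of square-integrable functions with test functions concentrated at the distance `ε`
from the boundary. -/
theorem isBigO_integral_mul_dilate {f : ℝ × Space d × ℝ → ℝ}
    (hf : ∀ a b, MemLp f 2 (slabMeasure d α a b)) {a : ℝ × Space d → ℝ} (ha : IsTestOn univ a)
    {η : ℝ → ℝ} (hη : IsTestOn (Ioo 1 2) η) :
    (fun ε : ℝ => ∫ p, f p * (a (p.1, p.2.1) * η (ε⁻¹ * p.2.2)) ∂bulkMeasure d α) =O[𝓝[>] 0]
      fun ε => ε ^ (1 - α) := by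
  obtain ⟨r, hr⟩ := ha.exists_time_bound
  set S := Icc (-r) r ×ˢ (univ : Set (Space d × ℝ)) with hS
  refine IsBigO.of_bound ((∫ p, f p ^ 2 ∂slabMeasure d α (-r) r) +
    (∫ q, a q ^ 2) * ∫ y, η y ^ 2 ∂normalMeasure α) ?_
  filter_upwards [self_mem_nhdsWithin] with ε (hε : 0 < ε)
  -- the weight in Young's inequality `|f ψ| ≤ s f² + s⁻¹ ψ²` balances the norm of `f` against `∫
  -- ψ² = O(s²)`
  set s := ε ^ (1 - α) with hs
  have hs0 : 0 < s := Real.rpow_pos_of_pos hε _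
  set ψ : ℝ × Space d × ℝ → ℝ := fun p => a (p.1, p.2.1) * η (ε⁻¹ * p.2.2) with hψ
  have hψt : IsTestOn (bulk d) ψ := ha.mul_normal (hη.dilate_pos hε)
  have hψi : Integrable (fun p => ψ p ^ 2) (bulkMeasure d α) := by
    simpa only [sq] using (hψt.contDiff_mul hψt.1).integrable_bulkMeasure
  have hψs : Integrable (fun p => ψ p ^ 2) (slabMeasure d α (-r) r) := by
    rw [slabMeasure_eq]
    exact hψi.integrableOn
  have hψI : ∫ p, ψ p ^ 2 ∂bulkMeasure d α =
      s ^ 2 * ((∫ q, a q ^ 2) * ∫ y, η y ^ 2 ∂normalMeasure α) := by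
    simp only [hψ, mul_pow]
    rw [integral_tensor (fun q => a q ^ 2) fun y => η (ε⁻¹ * y) ^ 2,
      integral_normalMeasure_dilate (fun y => η y ^ 2) hε, hs, ← Real.rpow_natCast (ε ^ _),
      ← Real.rpow_mul hε.le, show (1 - α) * ((2 : ℕ) : ℝ) = 2 - 2 * α by push_cast; ring]
    ring
  have e1 : ∫ p, f p * ψ p ∂bulkMeasure d α = ∫ p, f p * ψ p ∂slabMeasure d α (-r) r := by
    rw [slabMeasure_eq]
    refine (setIntegral_eq_integral_of_forall_compl_eq_zero fun p hp => ?_).symm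
    have h0 : a (p.1, p.2.1) = 0 :=
      image_eq_zero_of_notMem_tsupport (hr _ fun h => hp ⟨h, mem_univ _⟩)
    simp [hψ, h0]
  have hfi := (hf (-r) r).integrable_sq
  rw [e1, Real.norm_of_nonneg hs0.le]
  refine (norm_integral_le_of_norm_le ((hfi.const_mul s).add (hψs.const_mul s⁻¹))
    (Eventually.of_forall fun p => ?_)).trans ?_
  · simp only [Pi.add_apply]
    rw [Real.norm_eq_abs, abs_le]
    have h1 : s * f p ^ 2 + s⁻¹ * ψ p ^ 2 + f p * ψ p =
        s⁻¹ * ((s * f p + ψ p / 2) ^ 2 + 3 / 4 * ψ p ^ 2) := by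
      field_simp
      ring
    have h2 : s * f p ^ 2 + s⁻¹ * ψ p ^ 2 - f p * ψ p =
        s⁻¹ * ((s * f p - ψ p / 2) ^ 2 + 3 / 4 * ψ p ^ 2) := by
      field_simp
      ring
    have h3 : 0 ≤ s⁻¹ * ((s * f p + ψ p / 2) ^ 2 + 3 / 4 * ψ p ^ 2) := by positivity
    have h4 : 0 ≤ s⁻¹ * ((s * f p - ψ p / 2) ^ 2 + 3 / 4 * ψ p ^ 2) := by positivity
    constructor <;> linarith
  · simp only [Pi.add_apply]
    rw [integral_add (hfi.const_mul s) (hψs.const_mul s⁻¹), integral_const_mul, integral_const_mul]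
    have h5 : ∫ p, ψ p ^ 2 ∂slabMeasure d α (-r) r ≤ ∫ p, ψ p ^ 2 ∂bulkMeasure d α := by
      rw [slabMeasure_eq]
      exact setIntegral_le_integral hψi (Eventually.of_forall fun p => sq_nonneg _)
    have h6 := mul_le_mul_of_nonneg_left (h5.trans_eq hψI) (inv_nonneg.2 hs0.le)
    have h7 : s⁻¹ * (s ^ 2 * ((∫ q, a q ^ 2) * ∫ y, η y ^ 2 ∂normalMeasure α)) =
        s * ((∫ q, a q ^ 2) * ∫ y, η y ^ 2 ∂normalMeasure α) := by
      field_simp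
    rw [h7] at h6
    linarith

theorem deriv_dilate {η : ℝ → ℝ} (ε y : ℝ) :
    deriv (fun y => η (ε⁻¹ * y)) y = ε⁻¹ * deriv η (ε⁻¹ * y) := by
  rw [deriv_comp_mul_left, smul_eq_mul]

/-- The equation for a function of finite energy, tested at the distance `ε` from the boundary. -/
theorem isBigO_integral_mul_waveOp_dilate {v : ℝ × Space d × ℝ → ℝ}
    {G : ℝ × Space d × ℝ → Grad d} (hv : ∀ a b, MemLp v 2 (slabMeasure d α a b))
    (hG : ∀ a b, MemLp G 2 (slabMeasure d α a b))
    (hw : ∀ᵐ t : ℝ, IsWeakGrad (fun z => v (t, z)) (fun z => G (t, z)))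
    {a : ℝ × Space d → ℝ} (ha : IsTestOn univ a) {η : ℝ → ℝ} (hη : IsTestOn (Ioo 1 2) η) :
    (fun ε : ℝ => ∫ p, v p *
        waveOp α (fun p : ℝ × Space d × ℝ => a (p.1, p.2.1) * η (ε⁻¹ * p.2.2)) p
        ∂bulkMeasure d α) =O[𝓝[>] 0] fun ε => ε ^ (-α) := by
  have hη' : IsTestOn (Ioo 1 2) (deriv η) := by
    have := hη.fderiv_apply 1
    simpa only [fderiv_apply_one_eq_deriv] using this
  have hpow : (fun ε : ℝ => ε ^ (1 - α)) =O[𝓝[>] 0] fun ε => ε ^ (-α) := by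
    refine IsBigO.of_bound 1 ?_
    filter_upwards [Ioo_mem_nhdsGT one_pos] with ε hε
    rw [one_mul, Real.norm_of_nonneg (Real.rpow_nonneg hε.1.le _),
      Real.norm_of_nonneg (Real.rpow_nonneg hε.1.le _)]
    exact Real.rpow_le_rpow_of_exponent_ge hε.1 hε.2.le (by linarith)
  have hinv : ∀ F : ℝ → ℝ, (F =O[𝓝[>] 0] fun ε => ε ^ (1 - α)) →
      (fun ε => ε⁻¹ * F ε) =O[𝓝[>] 0] fun ε : ℝ => ε ^ (-α) := fun F hF => by
    refine ((isBigO_refl (fun ε : ℝ => ε⁻¹) _).mul hF).congr' EventuallyEq.rfl ?_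
    filter_upwards [self_mem_nhdsWithin] with ε (hε : 0 < ε)
    rw [← Real.rpow_neg_one, ← Real.rpow_add hε]
    congr 1
    ring
  have hGi : ∀ (i : Option (Fin d)) (a b : ℝ),
      MemLp (fun p => ⟪G p, WithLp.toLp 2 (frame i)⟫) 2 (slabMeasure d α a b) := fun i a b =>
    (hG a b).inner_const _
  have h1 := (isBigO_integral_mul_dilate hv ha.dt.dt hη).trans hpow
  have h2 : ∀ i : Option (Fin d), (fun ε : ℝ => ∫ p, ⟪G p, WithLp.toLp 2 (frame i)⟫ *
      (fderiv ℝ a (p.1, p.2.1) (0, (frame i).1) * η (ε⁻¹ * p.2.2)) ∂bulkMeasure d α) =O[𝓝[>] 0]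
      fun ε => ε ^ (-α) := fun i =>
    (isBigO_integral_mul_dilate (hGi i) (ha.fderiv_apply _) hη).trans hpow
  have h3 : ∀ i : Option (Fin d), (fun ε : ℝ => ε⁻¹ * ∫ p, ⟪G p, WithLp.toLp 2 (frame i)⟫ *
      ((frame i).2 * a (p.1, p.2.1) * deriv η (ε⁻¹ * p.2.2)) ∂bulkMeasure d α) =O[𝓝[>] 0]
      fun ε => ε ^ (-α) := fun i =>
    hinv _ (isBigO_integral_mul_dilate (hGi i) (ha.const_mul _) hη')
  refine (h1.add (IsBigO.sum (s := Finset.univ) fun i _ => (h2 i).add (h3 i))).congr' ?_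
    EventuallyEq.rfl
  filter_upwards [self_mem_nhdsWithin] with ε (hε : 0 < ε)
  have hηε := hη.dilate_pos hε
  have hφ := ha.mul_normal hηε
  rw [integral_mul_waveOp_eq hv hG hw hφ]
  congr 1
  · refine integral_congr_ae (Eventually.of_forall fun p => ?_)
    simp only
    rw [funext (dt_tensor ha.1 hηε.1), dt_tensor (contDiff_dt ha.1) hηε.1]
  · have e : ∀ p, ⟪G p, sliceGrad (fun p : ℝ × Space d × ℝ => a (p.1, p.2.1) * η (ε⁻¹ * p.2.2)) p⟫ =
        ∑ i, (⟪G p, WithLp.toLp 2 (frame i)⟫ *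
          (fderiv ℝ a (p.1, p.2.1) (0, (frame i).1) * η (ε⁻¹ * p.2.2)) +
          ε⁻¹ * (⟪G p, WithLp.toLp 2 (frame i)⟫ *
          ((frame i).2 * a (p.1, p.2.1) * deriv η (ε⁻¹ * p.2.2)))) := fun p => by
      rw [sliceGrad_eq_sum (hφ.1.of_le (by simp)), inner_sum]
      refine Finset.sum_congr rfl fun i _ => ?_
      rw [real_inner_smul_right, fderiv_tensor ha.1 hηε.1, deriv_dilate]
      ring
    have i1 : ∀ i : Option (Fin d), Integrable (fun p => ⟪G p, WithLp.toLp 2 (frame i)⟫ *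
          (fderiv ℝ a (p.1, p.2.1) (0, (frame i).1) * η (ε⁻¹ * p.2.2))) (bulkMeasure d α) :=
      fun i => ((ha.fderiv_apply _).mul_normal hηε).integrable_mul_slab (hGi i)
    have i2 : ∀ i : Option (Fin d), Integrable (fun p => ε⁻¹ * (⟪G p, WithLp.toLp 2 (frame i)⟫ *
          ((frame i).2 * a (p.1, p.2.1) * deriv η (ε⁻¹ * p.2.2)))) (bulkMeasure d α) :=
      fun i => (((ha.const_mul _).mul_normal (hη'.dilate_pos hε)).integrable_mul_slab
        (hGi i)).const_mul _
    simp only [e]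
    rw [Finset.sum_apply]
    refine Eq.trans ?_ (integral_finsetSum _ fun i _ => (i1 i).add (i2 i)).symm
    refine Finset.sum_congr rfl fun i _ => ?_
    exact ((integral_add (i1 i) (i2 i)).trans (by rw [integral_const_mul])).symm

end Scaling

/-! ### The remaining coefficients and uniqueness -/

section HigherCoefficients

variable {d : ℕ} {α : ℝ} {k : ℕ} {χ : ℝ → ℝ}

/-- The moments of a normal profile. -/
noncomputable def moment (α : ℝ) (η : ℝ → ℝ) (n : ℕ) : ℝ := ∫ y, y ^ n * η y ∂normalMeasure α

theorem integral_pow_mul_dilate (η : ℝ → ℝ) (n : ℕ) {ε : ℝ} (hε : 0 < ε) :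
    ∫ y, y ^ n * η (ε⁻¹ * y) ∂normalMeasure α = ε ^ (2 - 2 * α) * (ε ^ n * moment α η n) := by
  have e : ∀ y, y ^ n * η (ε⁻¹ * y) = ε ^ n * ((ε⁻¹ * y) ^ n * η (ε⁻¹ * y)) := fun y => by
    rw [mul_pow, inv_pow]
    field_simp
  simp only [e]
  rw [integral_const_mul, integral_normalMeasure_dilate (fun y => y ^ n * η y) hε, moment]
  ring

theorem IsTestOn.pow_mul {U : Set ℝ} {η : ℝ → ℝ} (h : IsTestOn U η) (n : ℕ) :
    IsTestOn U fun y => y ^ n * η y :=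
  h.contDiff_mul (contDiff_id.pow n)

theorem moment_pos {η : ℝ → ℝ} (hη : IsTestOn (Ioo 1 2) η) (h0 : ∀ y, 0 ≤ η y) {y₀ : ℝ}
    (hy : η y₀ ≠ 0) (n : ℕ) : 0 < moment α η n := by
  have hy0 : 0 < y₀ := by
    by_contra h
    exact hy (hη.eq_zero fun h' => h (one_pos.trans h'.1))
  have h1 : IsTestOn (Ioi 0) fun y => y ^ n * η y :=
    (hη.pow_mul n).mono fun y hy => one_pos.trans hy.1
  have h2 : IsTestOn (Ioi 0) fun y : ℝ => y ^ (1 - 2 * α) * (y ^ n * η y) :=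
    h1.contDiffOn_mul isOpen_Ioi fun y hy =>
      (Real.contDiffAt_rpow_const_of_ne (ne_of_gt hy)).contDiffWithinAt
  have hz : ∀ y : ℝ, y ∉ Ioi (0 : ℝ) → y ^ (1 - 2 * α) * (y ^ n * η y) = 0 := fun y hy =>
    h2.eq_zero hy
  rw [moment, integral_normalMeasure, setIntegral_eq_integral_of_forall_compl_eq_zero hz]
  refine h2.1.continuous.integral_pos_of_hasCompactSupport_nonneg_nonzero h2.2.1 (fun y => ?_)
    (x := y₀) ?_
  · by_cases h : y ∈ Ioi (0 : ℝ)
    · have hy' : 0 < y := h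
      exact mul_nonneg (Real.rpow_nonneg hy'.le _) (mul_nonneg (pow_nonneg hy'.le _) (h0 y))
    · exact (hz y h).ge
  · exact mul_ne_zero (Real.rpow_pos_of_pos hy0 _).ne' (mul_ne_zero (pow_pos hy0 _).ne' hy)

/-- The wave operator applied to a term of the expansion, tested at the distance `ε` from the
boundary. -/
theorem integral_tensor_mul_waveOp_dilate (hχ : ContDiff ℝ ∞ χ) (h1 : ∀ y < 1, χ y = 1)
    {a b : ℝ × Space d → ℝ} (ha : IsTestOn univ a) (hb : IsTestOn univ b) {η : ℝ → ℝ}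
    (hη : IsTestOn (Ioo 1 2) η) (m : ℕ) {ε : ℝ} (hε : ε ∈ Ioo (0 : ℝ) (1 / 2)) :
    ∫ p, (b (p.1, p.2.1) * powerCutoff χ (m + 1) p.2.2) *
        waveOp α (fun p : ℝ × Space d × ℝ => a (p.1, p.2.1) * η (ε⁻¹ * p.2.2)) p
        ∂bulkMeasure d α =
      ε ^ (2 - 2 * α) * ((∫ q, box b q * a q) * (ε ^ (2 * m + 2) * moment α η (2 * m + 2)) -
        4 * (m + 1) * (m + 1 - α) * (∫ q, b q * a q) * (ε ^ (2 * m) * moment α η (2 * m))) := by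
  have hηε := hη.dilate_pos hε.1
  rw [integral_mul_waveOp_comm (contDiff_tensor hb.1 (contDiff_powerCutoff hχ (m + 1)))
    (ha.mul_normal hηε)]
  have e : ∀ p : ℝ × Space d × ℝ,
      waveOp α (fun p => b (p.1, p.2.1) * powerCutoff χ (m + 1) p.2.2) p *
        (a (p.1, p.2.1) * η (ε⁻¹ * p.2.2)) =
      (box b (p.1, p.2.1) * a (p.1, p.2.1)) * (p.2.2 ^ (2 * m + 2) * η (ε⁻¹ * p.2.2)) -
        4 * (m + 1) * (m + 1 - α) *
          ((b (p.1, p.2.1) * a (p.1, p.2.1)) * (p.2.2 ^ (2 * m) * η (ε⁻¹ * p.2.2))) := fun p => by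
    rw [waveOp_mul hb.1]
    by_cases hy : p.2.2 ∈ Ioo ε (2 * ε)
    · have hy0 : 0 < p.2.2 := hε.1.trans hy.1
      have hy1 : p.2.2 < 1 := by linarith [hy.2, hε.2]
      have hE := powerCutoff_eventuallyEq h1 (m + 1) hy1
      rw [normalOp_congr hE, normalOp_pow m hy0.ne', hE.eq_of_nhds]
      ring
    · have h0 : η (ε⁻¹ * p.2.2) = 0 := (hη.dilate hε.1).eq_zero hy
      simp [h0]
  simp only [e]
  have i1 : ∀ {g : ℝ × Space d → ℝ} (_ : IsTestOn univ g) (n : ℕ), Integrable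
      (fun p : ℝ × Space d × ℝ => g (p.1, p.2.1) * (p.2.2 ^ n * η (ε⁻¹ * p.2.2)))
      (bulkMeasure d α) := fun hg n => (hg.mul_normal (hηε.pow_mul n)).integrable_bulkMeasure
  have t1 : IsTestOn univ fun q => box b q * a q := ha.contDiff_mul hb.box.1
  have t2 : IsTestOn univ fun q => b q * a q := ha.contDiff_mul hb.1
  rw [integral_sub (i1 t1 _) ((i1 t2 _).const_mul _), integral_const_mul,
    integral_tensor (fun q => box b q * a q) fun y => y ^ (2 * m + 2) * η (ε⁻¹ * y),
    integral_tensor (fun q => b q * a q) fun y => y ^ (2 * m) * η (ε⁻¹ * y),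
    integral_pow_mul_dilate η _ hε.1, integral_pow_mul_dilate η _ hε.1]
  ring

theorem tendsto_integral_tensor_mul_waveOp_dilate (hχ : ContDiff ℝ ∞ χ) (h1 : ∀ y < 1, χ y = 1)
    {a b : ℝ × Space d → ℝ} (ha : IsTestOn univ a) (hb : IsTestOn univ b) {η : ℝ → ℝ}
    (hη : IsTestOn (Ioo 1 2) η) {l m : ℕ} (hlm : l ≤ m) :
    Tendsto (fun ε : ℝ => ε ^ (2 * α - 2 * (l + 1)) *
      ∫ p, (b (p.1, p.2.1) * powerCutoff χ (m + 1) p.2.2) *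
        waveOp α (fun p : ℝ × Space d × ℝ => a (p.1, p.2.1) * η (ε⁻¹ * p.2.2)) p
        ∂bulkMeasure d α) (𝓝[>] 0)
      (𝓝 (if m = l then -(4 * (l + 1) * (l + 1 - α) * (∫ q, b q * a q) * moment α η (2 * l))
        else 0)) := by
  have hc : Continuous fun ε : ℝ =>
      (∫ q, box b q * a q) * (ε ^ (2 * (m - l) + 2) * moment α η (2 * m + 2)) -
        4 * (m + 1) * (m + 1 - α) * (∫ q, b q * a q) *
          (ε ^ (2 * (m - l)) * moment α η (2 * m)) := by fun_prop
  have hl := (hc.tendsto 0).mono_left (nhdsWithin_le_nhds (s := Ioi 0))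
  refine (hl.congr' ?_).trans (le_of_eq ?_)
  · filter_upwards [Ioo_mem_nhdsGT (show (0 : ℝ) < 1 / 2 by norm_num)] with ε hε
    rw [integral_tensor_mul_waveOp_dilate hχ h1 ha hb hη m hε,
      ← mul_assoc (ε ^ (2 * α - _)), ← Real.rpow_add hε.1,
      show 2 * α - 2 * (l + 1) + (2 - 2 * α) = -((2 * l : ℕ) : ℝ) by push_cast; ring,
      Real.rpow_neg hε.1.le, Real.rpow_natCast]
    obtain ⟨i, rfl⟩ := Nat.exists_eq_add_of_le hlm
    have h0 : ε ^ (2 * l) ≠ 0 := (pow_pos hε.1 _).ne'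
    rw [show l + i - l = i by omega, show 2 * (l + i) + 2 = 2 * l + (2 * i + 2) by ring,
      show 2 * (l + i) = 2 * l + 2 * i by ring, pow_add ε (2 * l), pow_add ε (2 * l)]
    field_simp
  · congr 1
    split_ifs with h
    · subst h
      simp
    · have h2 : 2 * (m - l) ≠ 0 := by omega
      simp [zero_pow h2]

/-- The leading coefficient of positive index of an admissible solution vanishes as long as the
corresponding term of the expansion has infinite energy. -/
theorem coeff_succ_eq_zero (hχ : ContDiff ℝ ∞ χ) (h1 : ∀ y < 1, χ y = 1)
    {b : ℕ → ℝ × Space d → ℝ} (hb : ∀ j, ContDiff ℝ ∞ (b j) ∧ HasCompactSupport (b j))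
    {z : ℝ × Space d × ℝ → ℝ} (hw1 : MemL2LocHom α fun p => z p - expansion k χ b p)
    (hw2 : MemH1LocL2 α fun p => z p - expansion k χ b p) (heq : IsWeakSol α z) {l : ℕ}
    (hl : l + 1 < k) (hlα : 2 * ((l : ℝ) + 1) < α) (h0 : ∀ i ≤ l, b i = 0) : b (l + 1) = 0 := by
  obtain ⟨-, G, hG, hGs⟩ := hw1
  obtain ⟨g, hg, hgs⟩ := hw2
  have ht : ∀ j, IsTestOn univ (b j) := fun j => ⟨(hb j).1, (hb j).2, subset_univ _⟩
  let β : ContDiffBump (3 / 2 : ℝ) := ⟨1 / 8, 1 / 4, by norm_num, by norm_num⟩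
  have hη : IsTestOn (Ioo 1 2) β := by
    refine ⟨β.contDiff, β.hasCompactSupport, ?_⟩
    rw [β.tsupport_eq, Real.closedBall_eq_Icc]
    intro y hy
    exact ⟨by linarith [hy.1], by linarith [hy.2]⟩
  have hβ : β (3 / 2) ≠ 0 := by
    rw [β.one_of_mem_closedBall (Metric.mem_closedBall_self β.rIn_pos.le)]
    exact one_ne_zero
  have hM : 0 < moment α β (2 * l) := moment_pos hη (fun y => β.nonneg) hβ _
  -- the test function is built from the coefficient itself, so that the leading term is `∫ a²` up
  -- to a nonzero factor
  set a := b (l + 1) with ha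
  have hat : IsTestOn univ a := ht (l + 1)
  set φ : ℝ → ℝ × Space d × ℝ → ℝ := fun ε p => a (p.1, p.2.1) * β (ε⁻¹ * p.2.2) with hφ
  set s : ℝ := 2 * α - 2 * (l + 1) with hs
  -- the expansion contributes the leading term
  have hA : Tendsto (fun ε : ℝ => ∑ i ∈ Finset.range k, ε ^ s *
      ∫ p, (b i (p.1, p.2.1) * powerCutoff χ i p.2.2) * waveOp α (φ ε) p ∂bulkMeasure d α)
      (𝓝[>] 0) (𝓝 (∑ i ∈ Finset.range k, if i = l + 1 then
        -(4 * (l + 1) * (l + 1 - α) * (∫ q, a q * a q) * moment α β (2 * l)) else 0)) := by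
    refine tendsto_finsetSum _ fun i _ => ?_
    rcases le_or_gt i l with hi | hi
    · rw [if_neg (by omega)]
      simp [h0 i hi]
    · obtain ⟨m, rfl⟩ := Nat.exists_eq_succ_of_ne_zero (show i ≠ 0 by omega)
      have := tendsto_integral_tensor_mul_waveOp_dilate (α := α) hχ h1 hat (ht (m + 1)) hη
        (show l ≤ m by omega)
      refine this.trans (le_of_eq ?_)
      congr 1
      by_cases h : m = l
      · subst h
        simp [ha]
      · rw [if_neg h, if_neg (by omega)]
  rw [Finset.sum_ite_eq' _ _ _, if_pos (Finset.mem_range.2 hl)] at hA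
  -- the remainder is of lower order
  have hB := isBigO_integral_mul_waveOp_dilate (fun a b => (hgs a b).1) hGs
    (hG.mono fun t h => h.isWeakGrad) hat hη
  have hB' : Tendsto (fun ε : ℝ => ε ^ s * ∫ p, (z p - expansion k χ b p) * waveOp α (φ ε) p
      ∂bulkMeasure d α) (𝓝[>] 0) (𝓝 0) := by
    refine ((Asymptotics.isBigO_refl (fun ε : ℝ => ε ^ s) _).mul hB).trans_tendsto ?_
    have hp : 0 < α - 2 * (l + 1) := by linarith
    have h3 : Tendsto (fun ε : ℝ => ε ^ (α - 2 * (l + 1))) (𝓝[>] 0) (𝓝 0) := by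
      have := (Real.continuousAt_rpow_const 0 (α - 2 * (l + 1)) (Or.inr hp.le)).tendsto
      rw [Real.zero_rpow hp.ne'] at this
      exact this.mono_left nhdsWithin_le_nhds
    refine h3.congr' ?_
    filter_upwards [self_mem_nhdsWithin] with ε (hε : 0 < ε)
    rw [← Real.rpow_add hε, hs]
    congr 1
    ring
  have hE : (fun ε : ℝ => ∑ i ∈ Finset.range k, ε ^ s *
      ∫ p, (b i (p.1, p.2.1) * powerCutoff χ i p.2.2) * waveOp α (φ ε) p ∂bulkMeasure d α)
      =ᶠ[𝓝[>] 0] fun ε => -(ε ^ s * ∫ p, (z p - expansion k χ b p) * waveOp α (φ ε) p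
      ∂bulkMeasure d α) := by
    filter_upwards [self_mem_nhdsWithin] with ε (hε : 0 < ε)
    have hφt : IsTestOn (bulk d) (φ ε) := hat.mul_normal (hη.dilate_pos hε)
    have i1 : Integrable (fun p => z p * waveOp α (φ ε) p) (bulkMeasure d α) :=
      hφt.waveOp.integrable_mul_locallyIntegrableOn heq.1
    have i2 : ∀ i, Integrable (fun p => (b i (p.1, p.2.1) * powerCutoff χ i p.2.2) *
        waveOp α (φ ε) p) (bulkMeasure d α) := fun i =>
      (hφt.waveOp.contDiff_mul (contDiff_tensor (hb i).1
        (contDiff_powerCutoff hχ i))).integrable_bulkMeasure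
    have i3 : Integrable (fun p => expansion k χ b p * waveOp α (φ ε) p) (bulkMeasure d α) :=
      (hφt.waveOp.contDiff_mul
        (contDiff_expansion hχ fun j => (hb j).1)).integrable_bulkMeasure
    simp only [sub_mul]
    rw [integral_sub i1 i3, heq.2 _ hφt, zero_sub, mul_neg, neg_neg, ← Finset.mul_sum]
    simp only [expansion_eq, Finset.sum_mul]
    rw [integral_finsetSum _ fun i _ => i2 i]
  have hlim := tendsto_nhds_unique (hA.congr' hE) hB'.neg
  have hl1 : ((l : ℝ) + 1) ≠ 0 := by positivity
  have hl2 : (l : ℝ) + 1 - α ≠ 0 := by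
    have : (0 : ℝ) ≤ l := l.cast_nonneg
    linarith
  by_contra hne
  obtain ⟨q, hq⟩ : ∃ q, a q ≠ 0 := by
    by_contra! h
    exact hne (funext h)
  have hI : 0 < ∫ q, a q * a q :=
    (hat.1.continuous.mul hat.1.continuous).integral_pos_of_hasCompactSupport_nonneg_nonzero
      hat.2.1.mul_left (fun q => mul_self_nonneg _) (mul_ne_zero hq hq)
  rw [neg_zero, neg_eq_zero] at hlim
  simp [hl1, hl2, hI.ne', hM.ne'] at hlim

/-- All coefficients of terms of infinite energy vanish. -/
theorem coeff_eq_zero (hα : 1 < α) (hχ : ContDiff ℝ ∞ χ) (h1 : ∀ y < 1, χ y = 1)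
    {b : ℕ → ℝ × Space d → ℝ} (hb : ∀ j, ContDiff ℝ ∞ (b j) ∧ HasCompactSupport (b j))
    {z : ℝ × Space d × ℝ → ℝ} (hw1 : MemL2LocHom α fun p => z p - expansion k χ b p)
    (hw2 : MemH1LocL2 α fun p => z p - expansion k χ b p) (heq : IsWeakSol α z)
    (hbv : HasBoundaryValue z 0) (j : ℕ) : j < k → 2 * (j : ℝ) < α → b j = 0 := by
  induction j using Nat.strong_induction_on with
  | _ j ih =>
    intro hj hjα
    cases j with
    | zero => exact coeff_zero_eq_zero hα (by omega) h1 hχ hb hw2 heq.1 hbv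
    | succ l =>
      push_cast at hjα
      refine coeff_succ_eq_zero hχ h1 hb hw1 hw2 heq hj hjα fun i hi => ih i (by omega) (by omega) ?_
      have : (i : ℝ) ≤ l := by exact_mod_cast hi
      linarith

/-- Two solutions with the same boundary value agree. -/
theorem IsSolution.unique (hα : 0 < α) (hα' : ∀ m : ℕ, α ≠ m) (hχ : ContDiff ℝ ∞ χ)
    (h1 : ∀ y < 1, χ y = 1) (h2 : ∀ y > 2, χ y = 0) {f : ℝ × Space d → ℝ} (hf : Continuous f)
    {u u' : ℝ × Space d × ℝ → ℝ} (h : IsSolution α k χ f u) (h' : IsSolution α k χ f u') :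
    u =ᵐ[volume.restrict (bulk d)] u' := by
  obtain ⟨b, hb, hw1, hw2⟩ := h.admissible
  obtain ⟨b', hb', hw1', hw2'⟩ := h'.admissible
  have hbb : ∀ j, ContDiff ℝ ∞ (fun q => b j q - b' j q) ∧
      HasCompactSupport fun q => b j q - b' j q :=
    fun j => ⟨(hb j).1.sub (hb' j).1, (hb j).2.sub (hb' j).2⟩
  have e : (fun p => u p - u' p - expansion k χ (fun j q => b j q - b' j q) p) =
      fun p => (u p - expansion k χ b p) - (u' p - expansion k χ b' p) := by
    ext p
    simp only [expansion_eq, sub_mul, Finset.sum_sub_distrib]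
    ring
  have hz1 := hw1.sub hw1'
  have hz2 := hw2.sub hw2'
  rw [← e] at hz1 hz2
  have heq := h.equation.sub h'.equation
  have hbv := h.boundary.sub h.equation.1 hf h'.boundary
  have h0 : (fun p => u p - u' p) =ᵐ[volume.restrict (bulk d)] 0 := by
    refine ae_eq_zero_of_expansion hα hχ h1 h2 hbb (fun j hj => ?_) hz1 hz2 heq hbv
      (h.initial.sub h'.initial)
    -- terms with `2j > α` have finite energy, and those with `2j < α` vanish, except the term `j
    -- = 0` for `α < 1`, which again has finite energy; `2j = α` and `α = 1` are excluded
    rcases lt_trichotomy α (2 * j) with hj' | hj' | hj'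
    · exact Or.inr (Or.inl hj')
    · exact absurd hj' (by exact_mod_cast hα' (2 * j))
    · rcases lt_trichotomy α 1 with ha | ha | ha
      · refine Or.inr (Or.inr ⟨?_, ha⟩)
        by_contra hj0
        have : (1 : ℝ) ≤ j := by exact_mod_cast Nat.one_le_iff_ne_zero.2 hj0
        linarith
      · exact absurd ha (by exact_mod_cast hα' 1)
      · exact Or.inl (coeff_eq_zero ha hχ h1 hbb hz1 hz2 heq hbv j hj hj')
  filter_upwards [h0] with p hp
  exact sub_eq_zero.1 hp

end HigherCoefficients

end AdSWave

theorem lemma3p1 (α : ℝ) (hα : 0 < α) (hα_int : ∀ m : ℕ, α ≠ m)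
    (k : ℕ) (hk : IsLeast {m : ℕ | (1 + α) / 2 < m} k) :
    ∃ c : ℕ → ℝ, ∀ (d : ℕ) (χ : ℝ → ℝ), ContDiff ℝ ∞ χ →
      (∀ y < 1, χ y = 1) → (∀ y > 2, χ y = 0) →
      ∀ f : ℝ × AdSWave.Space d → ℝ, ContDiff ℝ ∞ f → HasCompactSupport f →
      ∃ u v : ℝ × AdSWave.Space d × ℝ → ℝ,
        (∀ t x y, u (t, x, y) =
          ∑ j ∈ Finset.range k, c j * (y ^ (2 * j) * χ y * (AdSWave.box^[j] f) (t, x)) +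
            v (t, x, y)) ∧
        AdSWave.MemLInftyHom α v ∧
        AdSWave.IsSolution α k χ f u ∧
        (∀ t₀ : ℝ, (∀ t x, t < t₀ → f (t, x) = 0) →
          ∀ᵐ p ∂(volume.restrict (AdSWave.bulk d)), p.1 < t₀ → u p = 0) ∧
        (∀ u' : ℝ × AdSWave.Space d × ℝ → ℝ, AdSWave.IsSolution α k χ f u' →
          u' =ᵐ[volume.restrict (AdSWave.bulk d)] u) := by
  refine ⟨AdSWave.coeff α, fun d χ hχ h1 h2 f hf hfc => ?_⟩
  obtain ⟨v, hv, hu, hsupp⟩ := AdSWave.exists_solution hα hα_int hk.1 hχ h1 h2 hf hfc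
  refine ⟨_, v, fun t x y => ?_, hv, hu, hsupp,
    fun u' hu' => hu'.unique hα hα_int hχ h1 h2 hf.continuous hu⟩
  rw [AdSWave.expansion]
  congr 1
  exact Finset.sum_congr rfl fun j _ => by ring
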